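/- Let $d\ge 1$, $M\in\mathbb N$ and $R>0$. Let $\chi_R$ be the indicator function of the ball $B(0,R)\subset\mathbb R^d$. For $f=(f_1,\dots,f_M)$ and $1\le m\le M$ put $$Q^R_m(f,f)(v)=\sum_{n=1}^{m-1}\chi_R(v)\int_{\mathbb R^d} f_n\Big(\tfrac{mv-(m-n)w}{n}\Big)f_{m-n}(w)\,|v-w|\,\big(\tfrac mn\big)^2\chi_R(w)\,dw-2\sum_{n=1}^M\chi_R(v)\int_{\mathbb R^d} f_m(v)f_n(w)|v-w|\chi_R(w)\,dw ,$$ and consider the truncated system $\partial_t f_m=\operatorname{div}(vf_m)+\Delta f_m+Q^R_m(f,f)$, $f_m|_{t=0}=f^0_m$, $m=1,\dots,M$. Let $(P_t)_{t\ge0}$ be the semigroup on $L^2(\mathbb R^d)$ generated by $\Delta+v\cdot\nabla$, that is, $P_0=I$ and, for $t>0$, $$P_tu(v)=\int_{\mathbb R^d}\big(2\pi(e^{2t}-1)\big)^{-d/2}e^{-|w|^2/(2(e^{2t}-1))}\,u(e^tv-w)\,dw .$$ For an interval $J\subseteq[0,\infty)$ containing $0$, an $L^2$-mild solution on $J$ is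 an $f\in C(J;L^2(\mathbb R^d)^M)$ such that for all $t\in J$ and all $m$ $$f_m(t)=P_tf^0_m+\int_0^tP_{t-s}\big(d\,f_m(s)+Q^R_m(f(s),f(s))\big)\,ds ,$$ and it is maximal if no mild solution on a strictly larger such interval extends it. **Theorem.** For all $f^0_1,\dots,f^0_M\in L^2(\mathbb R^d)$ (of any sign) the truncated system has a unique maximal $L^2$-mild solution $f$. Its interval of existence is of the form $[0,T(f^0))$ with $0<T(f^0)\le\infty$, hence open in $[0,\infty)$, and every mild solution on any interval $J$ as above satisfies $J\subseteq[0,T(f^0))$ and is the restriction of $f$ to $J$. Moreover $$f\in L^\infty_{loc}\big([0,T(f^0));L^2(\mathbb R^d)^{M}\big)\cap C\big((0,T(f^0));H^2(\mathbb R^d)^{M}\big)\cap W^{1,2}_{loc}\big((0,T(f^0));H^2_{loc}(\mathbb R^d)^{M}\big),$$ where the last membership means that for every $r>0$ the restriction of $f$ to $B(0,r)$ belongs to $W^{1,2}_{loc}((0,T(f^0));H^2(B(0,r))^{M})$. If $T(f^0)<\infty$, then $$\sup_{T(f^0)/2<t<T(f^0)}\ \sum_{m=1}^M\|f_m(t)\|_{L^2}=\infty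 .$$ -/

import Mathlib

open MeasureTheory Set Filter Topology
open scoped ENNReal ContDiff

noncomputable section

namespace Smoluchowski

/-! ### Spaces -/

/-- Velocity space `ℝ^d` with its Euclidean norm. -/
abbrev Vel (d : ℕ) := EuclideanSpace ℝ (Fin d)

/-- The real Hilbert space `L²(U)`, for `U ⊆ ℝ^d`. -/
abbrev L2 {d : ℕ} (U : Set (Vel d)) := Lp ℝ 2 ((volume : Measure (Vel d)).restrict U)

/-- The real Hilbert space `L²(ℝ^d)`. -/
abbrev L2V (d : ℕ) := Lp ℝ 2 (volume : Measure (Vel d))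

/-! ### The Ornstein-Uhlenbeck type semigroup `P_t` generated by `Δ + v · ∇` -/

/-- The centred Gaussian density with covariance `(e^{2t} - 1) I`, for `t > 0`. -/
def ouKernel (d : ℕ) (t : ℝ) (w : Vel d) : ℝ :=
  (2 * Real.pi * (Real.exp (2 * t) - 1)) ^ (-(d : ℝ) / 2) *
    Real.exp (-(‖w‖ ^ 2 / (2 * (Real.exp (2 * t) - 1))))

/-- Kolmogorov's formula `(P_t u)(v) = ∫ K(t, w) u(e^t v - w) dw`. -/
def ouFun {d : ℕ} (t : ℝ) (u : Vel d → ℝ) (v : Vel d) : ℝ :=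
  ∫ w, ouKernel d t w * u (Real.exp t • v - w)

lemma continuous_ouKernel (d : ℕ) (t : ℝ) : Continuous (ouKernel d t) := by
  unfold ouKernel
  fun_prop

lemma integrable_ouKernel (d : ℕ) {t : ℝ} (ht : 0 < t) :
    Integrable (ouKernel d t) := by
  have hs : 0 < Real.exp (2 * t) - 1 := by
    have := Real.add_one_lt_exp (x := 2 * t) (by positivity)
    linarith
  have h := GaussianFourier.integrable_cexp_neg_mul_sq_norm_add (V := Vel d)
    (b := (((2 * (Real.exp (2 * t) - 1))⁻¹ : ℝ) : ℂ))
    (by rw [Complex.ofReal_re]; positivity) 0 0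
  have h2 := h.norm.const_mul ((2 * Real.pi * (Real.exp (2 * t) - 1)) ^ (-(d : ℝ) / 2))
  refine h2.congr (Eventually.of_forall fun w => ?_)
  simp only [ouKernel, Complex.norm_exp]
  congr 2
  rw [zero_mul, add_zero, ← Complex.ofReal_neg, ← Complex.ofReal_pow, ← Complex.ofReal_mul,
    Complex.ofReal_re]
  ring

lemma lintegral_comp_affine {d : ℕ} {a : ℝ} (ha : a ≠ 0) (b : Vel d) {h : Vel d → ℝ≥0∞}
    (hh : Measurable h) :
    ∫⁻ v, h (a • v - b) = ENNReal.ofReal |(a ^ d)⁻¹| * ∫⁻ v, h v := by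
  have h1 : ∫⁻ v, h (a • v - b) = ∫⁻ y, h (y - b) ∂(Measure.map (a • ·) volume) := by
    rw [lintegral_map (by fun_prop) (measurable_const_smul a)]
  rw [h1, Measure.map_addHaar_smul volume ha, lintegral_smul_measure,
    lintegral_sub_right_eq_self]
  simp

/-- `P_t` maps `L²` functions to `L²` functions. -/
lemma memLp_ouFun {d : ℕ} {t : ℝ} (ht : 0 < t) {u : Vel d → ℝ} (hu : StronglyMeasurable u)
    (hu2 : MemLp u 2 volume) : MemLp (ouFun t u) 2 volume := by
  have hKm : Measurable fun w => ‖ouKernel d t w‖ₑ :=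
    (continuous_ouKernel d t).measurable.enorm
  have hum : Measurable fun w => ‖u w‖ₑ := hu.measurable.enorm
  have hmeas : StronglyMeasurable (ouFun t u) := by
    refine StronglyMeasurable.integral_prod_right
      (f := fun v w => ouKernel d t w * u (Real.exp t • v - w)) ?_
    exact ((continuous_ouKernel d t).comp continuous_snd).stronglyMeasurable.mul
      (hu.comp_measurable (g := fun p : Vel d × Vel d => Real.exp t • p.1 - p.2) (by fun_prop))
  refine ⟨hmeas.aestronglyMeasurable, ?_⟩
  rw [eLpNorm_lt_top_iff_lintegral_rpow_enorm_lt_top two_ne_zero ENNReal.ofNat_ne_top]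
  simp only [ENNReal.toReal_ofNat]
  set A : ℝ≥0∞ := ∫⁻ w, ‖ouKernel d t w‖ₑ with hA
  have hAtop : A < ⊤ := (integrable_ouKernel d ht).2
  have hU : ∫⁻ w, ‖u w‖ₑ ^ (2 : ℝ) < ⊤ := by
    have := hu2.2
    rw [eLpNorm_lt_top_iff_lintegral_rpow_enorm_lt_top two_ne_zero ENNReal.ofNat_ne_top] at this
    simpa using this
  have hpt : ∀ v, ‖ouFun t u v‖ₑ ^ (2 : ℝ) ≤
      A * ∫⁻ w, ‖ouKernel d t w‖ₑ * ‖u (Real.exp t • v - w)‖ₑ ^ (2 : ℝ) := by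
    intro v
    have hum' : Measurable fun w => ‖u (Real.exp t • v - w)‖ₑ :=
      hum.comp (by fun_prop)
    have h1 : ‖ouFun t u v‖ₑ ≤ ∫⁻ w, ‖ouKernel d t w‖ₑ * ‖u (Real.exp t • v - w)‖ₑ := by
      refine (enorm_integral_le_lintegral_enorm _).trans (le_of_eq ?_)
      simp [enorm_mul]
    have h2 := ENNReal.lintegral_mul_le_Lp_mul_Lq (volume : Measure (Vel d))
      Real.HolderConjugate.two_two
      (f := fun w => ‖ouKernel d t w‖ₑ ^ (1 / 2 : ℝ))
      (g := fun w => ‖ouKernel d t w‖ₑ ^ (1 / 2 : ℝ) * ‖u (Real.exp t • v - w)‖ₑ)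
      (hKm.pow_const _).aemeasurable ((hKm.pow_const _).mul hum').aemeasurable
    have h3 : ∀ x : ℝ≥0∞, x ^ (1 / 2 : ℝ) * x ^ (1 / 2 : ℝ) = x := by
      intro x
      rw [← ENNReal.rpow_add_of_nonneg _ _ (by norm_num) (by norm_num)]
      norm_num
    have h4 : ∀ x : ℝ≥0∞, (x ^ (1 / 2 : ℝ)) ^ (2 : ℝ) = x := by
      intro x
      rw [← ENNReal.rpow_mul]
      norm_num
    simp only [Pi.mul_apply, ← mul_assoc, h3, h4,
      ENNReal.mul_rpow_of_nonneg _ _ (by norm_num : (0 : ℝ) ≤ 2)] at h2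
    calc ‖ouFun t u v‖ₑ ^ (2 : ℝ)
        ≤ (∫⁻ w, ‖ouKernel d t w‖ₑ * ‖u (Real.exp t • v - w)‖ₑ) ^ (2 : ℝ) := by gcongr
      _ ≤ _ := by
          refine (ENNReal.rpow_le_rpow h2 (by norm_num)).trans (le_of_eq ?_)
          rw [ENNReal.mul_rpow_of_nonneg _ _ (by norm_num), h4, h4]
  calc ∫⁻ v, ‖ouFun t u v‖ₑ ^ (2 : ℝ)
      ≤ ∫⁻ v, A * ∫⁻ w, ‖ouKernel d t w‖ₑ * ‖u (Real.exp t • v - w)‖ₑ ^ (2 : ℝ) :=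
        lintegral_mono hpt
    _ = A * ∫⁻ v, ∫⁻ w, ‖ouKernel d t w‖ₑ * ‖u (Real.exp t • v - w)‖ₑ ^ (2 : ℝ) :=
        lintegral_const_mul' _ _ hAtop.ne
    _ = A * ∫⁻ w, ∫⁻ v, ‖ouKernel d t w‖ₑ * ‖u (Real.exp t • v - w)‖ₑ ^ (2 : ℝ) := by
        rw [lintegral_lintegral_swap]
        exact ((hKm.comp measurable_snd).mul ((hum.comp
          (g := fun w => ‖u w‖ₑ)
          (f := fun p : Vel d × Vel d => Real.exp t • p.1 - p.2) (by fun_prop)).pow_const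
            _)).aemeasurable
    _ = A * (A * (ENNReal.ofReal |(Real.exp t ^ d)⁻¹| * ∫⁻ v, ‖u v‖ₑ ^ (2 : ℝ))) := by
        congr 1
        rw [hA, ← lintegral_mul_const _ hKm]
        refine lintegral_congr fun w => ?_
        rw [lintegral_const_mul' _ _ enorm_ne_top,
          lintegral_comp_affine (Real.exp_ne_zero t) w (hum.pow_const _)]
    _ < ⊤ := by
        exact ENNReal.mul_lt_top hAtop (ENNReal.mul_lt_top hAtop
          (ENNReal.mul_lt_top ENNReal.ofReal_lt_top hU))

/-- The semigroup `(P_t)_{t ≥ 0}` on `L²(ℝ^d)` generated by `Δ + v · ∇`; `P_0` is the identity.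
(Negative times are irrelevant and are sent to the identity.) -/
def ouSemigroup {d : ℕ} (t : ℝ) (u : L2V d) : L2V d :=
  if ht : 0 < t then
    (memLp_ouFun ht (Lp.stronglyMeasurable u) (Lp.memLp u)).toLp (ouFun t u)
  else u

/-! ### The truncated coagulation operator -/

/-- The indicator function of the ball `B(0, R)`. -/
def cutoff {d : ℕ} (R : ℝ) : Vel d → ℝ := (Metric.ball (0 : Vel d) R).indicator 1

/-- Truncated gain term for the collision of masses `n` and `k`, producing mass `m = n + k`:
`χ_R(v) ∫ f(φ(v,w)) g(w) |v - w| (m/n)² χ_R(w) dw`, with `φ(v,w) = (m v - (m - n) w) / n`. -/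
def gain {d : ℕ} (R : ℝ) (n k : ℕ) (f g : Vel d → ℝ) (v : Vel d) : ℝ :=
  cutoff R v * ∫ w, f ((n : ℝ)⁻¹ • (((n : ℝ) + k) • v - (k : ℝ) • w)) * g w * ‖v - w‖ *
    (((n : ℝ) + k) / n) ^ 2 * cutoff R w

/-- Truncated loss term `χ_R(v) ∫ f(v) g(w) |v - w| χ_R(w) dw`. -/
def loss {d : ℕ} (R : ℝ) (f g : Vel d → ℝ) (v : Vel d) : ℝ :=
  cutoff R v * ∫ w, f v * g w * ‖v - w‖ * cutoff R w

/-- The mass of the `i`-th component: the components carry the masses `1, …, M`. -/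
def mass {M : ℕ} (i : Fin M) : ℕ := i + 1

/-- `Q^R_m(f, f)`: the first sum runs over the pairs of masses `(n, m - n)`, `1 ≤ n ≤ m - 1`. -/
def collision {d M : ℕ} (R : ℝ) (f : Fin M → Vel d → ℝ) (m : Fin M) (v : Vel d) : ℝ :=
  (∑ p : Fin M × Fin M with mass p.1 + mass p.2 = mass m,
      gain R (mass p.1) (mass p.2) (f p.1) (f p.2) v)
    - 2 * ∑ n : Fin M, loss R (f m) (f n) v

lemma stronglyMeasurable_cutoff {d : ℕ} (R : ℝ) :
    StronglyMeasurable (cutoff R : Vel d → ℝ) :=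
  stronglyMeasurable_one.indicator Metric.isOpen_ball.measurableSet

lemma cutoff_nonneg {d : ℕ} (R : ℝ) (v : Vel d) : 0 ≤ cutoff R v :=
  indicator_nonneg (fun _ _ => zero_le_one) v

lemma cutoff_le_one {d : ℕ} (R : ℝ) (v : Vel d) : cutoff R v ≤ 1 :=
  indicator_le_self' (fun _ _ => zero_le_one) v

lemma cutoff_mul_norm_sub_mul_cutoff_le {d : ℕ} (R : ℝ) (v w : Vel d) :
    cutoff R v * (‖v - w‖ * cutoff R w) ≤ 2 * |R| := by
  by_cases hv : v ∈ Metric.ball (0 : Vel d) R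
  · by_cases hw : w ∈ Metric.ball (0 : Vel d) R
    · simp only [cutoff, indicator_of_mem hv, indicator_of_mem hw, Pi.one_apply, one_mul, mul_one]
      rw [mem_ball_zero_iff] at hv hw
      have := norm_sub_le v w
      have := le_abs_self R
      linarith
    · simp [cutoff, indicator_of_notMem hw]
  · simp [cutoff, indicator_of_notMem hv]

lemma memLp_cutoff {d : ℕ} (R : ℝ) : MemLp (cutoff R : Vel d → ℝ) 2 volume :=
  memLp_indicator_const 2 Metric.isOpen_ball.measurableSet 1 (Or.inr measure_ball_lt_top.ne)

lemma memLp_gain {d : ℕ} (R : ℝ) {n k : ℕ} (hn : n ≠ 0) (hk : k ≠ 0) {f g : Vel d → ℝ}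
    (hf : StronglyMeasurable f) (hf2 : MemLp f 2 volume)
    (hg : StronglyMeasurable g) (hg2 : MemLp g 2 volume) :
    MemLp (gain R n k f g) 2 volume := by
  have hmeas : StronglyMeasurable (gain R n k f g) := by
    refine (stronglyMeasurable_cutoff R).mul ?_
    refine StronglyMeasurable.integral_prod_right
      (f := fun v w => f ((n : ℝ)⁻¹ • (((n : ℝ) + k) • v - (k : ℝ) • w)) * g w * ‖v - w‖ *
        (((n : ℝ) + k) / n) ^ 2 * cutoff R w) ?_
    have h1 : StronglyMeasurable fun p : Vel d × Vel d =>
        f ((n : ℝ)⁻¹ • (((n : ℝ) + k) • p.1 - (k : ℝ) • p.2)) :=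
      hf.comp_measurable (by fun_prop)
    have h2 : StronglyMeasurable fun p : Vel d × Vel d => g p.2 :=
      hg.comp_measurable measurable_snd
    have h3 : StronglyMeasurable fun p : Vel d × Vel d => ‖p.1 - p.2‖ :=
      Continuous.stronglyMeasurable (by fun_prop)
    have h4 : StronglyMeasurable fun p : Vel d × Vel d => cutoff R p.2 :=
      (stronglyMeasurable_cutoff R).comp_measurable measurable_snd
    exact (((h1.mul h2).mul h3).mul stronglyMeasurable_const).mul h4
  have hn' : (n : ℝ) ≠ 0 := Nat.cast_ne_zero.mpr hn
  have hk' : (k : ℝ) ≠ 0 := Nat.cast_ne_zero.mpr hk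
  have hfi : Integrable fun w => f w ^ 2 := hf2.integrable_sq
  have hgi : Integrable fun w => g w ^ 2 := hg2.integrable_sq
  set c : ℝ := (((n : ℝ) + k) / n) ^ 2 with hc
  have hc0 : 0 ≤ c := by positivity
  set a : ℝ := -((n : ℝ)⁻¹ * k) with ha
  have ha0 : a ≠ 0 := by simp [ha, hn', hk']
  obtain ⟨C, hC⟩ : ∃ C : ℝ, ∀ v, ‖gain R n k f g v‖ ≤ C := by
    refine ⟨2 * |R| * c * (|(a ^ d)⁻¹| * (∫ w, f w ^ 2) + ∫ w, g w ^ 2), fun v => ?_⟩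
    have harg : ∀ w : Vel d, (n : ℝ)⁻¹ • (((n : ℝ) + k) • v - (k : ℝ) • w) =
        a • w + (n : ℝ)⁻¹ • ((n : ℝ) + k) • v := by
      intro w
      rw [smul_sub, smul_smul (n : ℝ)⁻¹ (k : ℝ) w, ha, neg_smul]
      abel
    set b : Vel d := (n : ℝ)⁻¹ • ((n : ℝ) + k) • v with hb
    have hfi' : Integrable fun w => f (a • w + b) ^ 2 :=
      (hfi.comp_add_right b).comp_smul ha0
    have hfe : ∫ w, f (a • w + b) ^ 2 = |(a ^ d)⁻¹| * ∫ w, f w ^ 2 := by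
      rw [Measure.integral_comp_smul volume (fun y => f (y + b) ^ 2) a,
        integral_add_right_eq_self (fun y => f y ^ 2) b]
      simp
    rw [gain, ← integral_const_mul]
    simp only [harg]
    refine (norm_integral_le_of_norm_le
      (g := fun w => 2 * |R| * c * (f (a • w + b) ^ 2 + g w ^ 2))
      ((hfi'.add hgi).const_mul _) (Eventually.of_forall fun w => ?_)).trans (le_of_eq ?_)
    · have h1 := cutoff_mul_norm_sub_mul_cutoff_le R v w
      have h2 : ‖cutoff R v * (f (a • w + b) * g w * ‖v - w‖ * c * cutoff R w)‖ =
          (cutoff R v * (‖v - w‖ * cutoff R w)) * c * |f (a • w + b) * g w| := by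
        simp only [norm_mul, Real.norm_eq_abs, abs_mul, abs_of_nonneg hc0,
          abs_of_nonneg (cutoff_nonneg R _), abs_norm]
        ring
      have h3 : |f (a • w + b) * g w| ≤ f (a • w + b) ^ 2 + g w ^ 2 := by
        rw [abs_mul]
        nlinarith [sq_nonneg (|f (a • w + b)| - |g w|), sq_abs (f (a • w + b)), sq_abs (g w),
          sq_nonneg (f (a • w + b)), sq_nonneg (g w)]
      rw [h2]
      gcongr
    · rw [integral_const_mul, integral_add hfi' hgi, hfe]
  refine (memLp_cutoff R).of_le_mul (c := C) hmeas.aestronglyMeasurable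
    (Eventually.of_forall fun v => ?_)
  by_cases hv : v ∈ Metric.ball (0 : Vel d) R
  · simpa [cutoff, indicator_of_mem hv] using hC v
  · simp [gain, cutoff, indicator_of_notMem hv]

lemma memLp_loss {d : ℕ} (R : ℝ) {f g : Vel d → ℝ}
    (hf : StronglyMeasurable f) (hf2 : MemLp f 2 volume)
    (hg : StronglyMeasurable g) (hg2 : MemLp g 2 volume) :
    MemLp (loss R f g) 2 volume := by
  have hmeas : StronglyMeasurable (loss R f g) := by
    refine (stronglyMeasurable_cutoff R).mul ?_
    refine StronglyMeasurable.integral_prod_right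
      (f := fun v w => f v * g w * ‖v - w‖ * cutoff R w) ?_
    have h1 : StronglyMeasurable fun p : Vel d × Vel d => f p.1 :=
      hf.comp_measurable measurable_fst
    have h2 : StronglyMeasurable fun p : Vel d × Vel d => g p.2 :=
      hg.comp_measurable measurable_snd
    have h3 : StronglyMeasurable fun p : Vel d × Vel d => ‖p.1 - p.2‖ :=
      Continuous.stronglyMeasurable (by fun_prop)
    have h4 : StronglyMeasurable fun p : Vel d × Vel d => cutoff R p.2 :=
      (stronglyMeasurable_cutoff R).comp_measurable measurable_snd
    exact ((h1.mul h2).mul h3).mul h4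
  have hi : Integrable fun w => |g w| * cutoff R w := by
    have := (hg2.integrable_mul (memLp_cutoff R)).norm
    refine this.congr (Eventually.of_forall fun w => ?_)
    simp [abs_of_nonneg (cutoff_nonneg R w)]
  refine hf2.of_le_mul (c := 2 * |R| * ∫ w, |g w| * cutoff R w) hmeas.aestronglyMeasurable
    (Eventually.of_forall fun v => ?_)
  rw [loss, ← integral_const_mul]
  refine (norm_integral_le_of_norm_le
    (g := fun w => 2 * |R| * ‖f v‖ * (|g w| * cutoff R w))
    (hi.const_mul _) (Eventually.of_forall fun w => ?_)).trans (le_of_eq ?_)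
  · have h1 := cutoff_mul_norm_sub_mul_cutoff_le R v w
    have h2 : ‖cutoff R v * (f v * g w * ‖v - w‖ * cutoff R w)‖ =
        (cutoff R v * (‖v - w‖ * cutoff R w)) * ‖f v‖ * (|g w| * cutoff R w) := by
      have h5 : cutoff R w * cutoff R w = cutoff R w := by
        by_cases hw : w ∈ Metric.ball (0 : Vel d) R
        · simp [cutoff, indicator_of_mem hw]
        · simp [cutoff, indicator_of_notMem hw]
      simp only [norm_mul, Real.norm_eq_abs, abs_of_nonneg (cutoff_nonneg R _), abs_norm]
      linear_combination (-(cutoff R v * |f v| * |g w| * ‖v - w‖)) * h5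
    rw [h2]
    have := cutoff_nonneg R w
    gcongr
  · rw [integral_const_mul]
    ring

/-- `Q^R_m` maps `L²` to `L²`. -/
lemma memLp_collision {d M : ℕ} (R : ℝ) (f : Fin M → L2V d) (m : Fin M) :
    MemLp (collision R (fun n => (f n : Vel d → ℝ)) m) 2 volume := by
  have h1 : MemLp (fun v => ∑ p : Fin M × Fin M with mass p.1 + mass p.2 = mass m,
      gain R (mass p.1) (mass p.2) (f p.1 : Vel d → ℝ) (f p.2) v) 2 volume :=
    memLp_finsetSum _ fun p _ => memLp_gain R (Nat.succ_ne_zero _) (Nat.succ_ne_zero _)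
      (Lp.stronglyMeasurable _) (Lp.memLp _) (Lp.stronglyMeasurable _) (Lp.memLp _)
  have h2 : MemLp (fun v => ∑ n : Fin M, loss R (f m : Vel d → ℝ) (f n) v) 2 volume :=
    memLp_finsetSum _ fun n _ => memLp_loss R
      (Lp.stronglyMeasurable _) (Lp.memLp _) (Lp.stronglyMeasurable _) (Lp.memLp _)
  exact h1.sub (h2.const_mul 2)

/-- `Q^R_m(f, f)` as an element of `L²(ℝ^d)`, for `f ∈ L²(ℝ^d)^M`. -/
def collisionL2 {d M : ℕ} (R : ℝ) (f : Fin M → L2V d) (m : Fin M) : L2V d :=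
  (memLp_collision R f m).toLp _

/-! ### Mild solutions -/

/-- An interval in `[0, ∞)` that contains `0`. -/
def IsTimeInterval (J : Set ℝ) : Prop :=
  J.OrdConnected ∧ 0 ∈ J ∧ J ⊆ Ici 0

/-- `f ∈ C(J; L²(ℝ^d)^M)` is an `L²`-mild solution of the truncated system on `J` with initial
value `f0`: `f_m(t) = P_t f0_m + ∫_0^t P_{t-s} (d f_m(s) + Q^R_m(f(s), f(s))) ds` for `t ∈ J`,
the integral being a Bochner integral in `L²(ℝ^d)`. -/
def IsMildSolution {d M : ℕ} (R : ℝ) (f0 : Fin M → L2V d) (J : Set ℝ)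
    (f : ℝ → Fin M → L2V d) : Prop :=
  ContinuousOn f J ∧ ∀ t ∈ J, ∀ m, f t m = ouSemigroup t (f0 m) +
    ∫ s in (0 : ℝ)..t, ouSemigroup (t - s) ((d : ℝ) • f s m + collisionL2 R (f s) m)

/-- A mild solution on the time interval `J` that no mild solution on a larger time interval
extends. -/
def IsMaximalMildSolution {d M : ℕ} (R : ℝ) (f0 : Fin M → L2V d) (J : Set ℝ)
    (f : ℝ → Fin M → L2V d) : Prop :=
  IsTimeInterval J ∧ IsMildSolution R f0 J f ∧
    ∀ (J' : Set ℝ) (g : ℝ → Fin M → L2V d), IsTimeInterval J' → IsMildSolution R f0 J' g →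
      J ⊆ J' → EqOn g f J → J' = J

/-! ### Sobolev spaces -/

/-- `g` is the weak partial derivative `∂_i u` on `U`. -/
def IsWeakPartial {d : ℕ} (U : Set (Vel d)) (i : Fin d) (u g : L2 U) : Prop :=
  ∀ φ : Vel d → ℝ, ContDiff ℝ ∞ φ → HasCompactSupport φ → tsupport φ ⊆ U →
    ∫ v in U, u v * fderiv ℝ φ v (EuclideanSpace.single i 1) = - ∫ v in U, g v * φ v

/-- Labels of a function, its first and its second partial derivatives. -/
abbrev JetIndex (d : ℕ) := Unit ⊕ (Fin d ⊕ (Fin d × Fin d))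

/-- `2`-jets with entries in `L²(U)`, with the Hilbert norm. -/
abbrev Jet {d : ℕ} (U : Set (Vel d)) := PiLp 2 (fun _ : JetIndex d => L2 U)

lemma isWeakPartial_iff_zero {d : ℕ} {U : Set (Vel d)} {i : Fin d} {u g : L2 U} :
    IsWeakPartial U i u g ↔ ∀ φ : Vel d → ℝ, ContDiff ℝ ∞ φ → HasCompactSupport φ →
      tsupport φ ⊆ U →
      (∫ v in U, u v * fderiv ℝ φ v (EuclideanSpace.single i 1)) + ∫ v in U, g v * φ v = 0 := by
  simp only [IsWeakPartial, eq_neg_iff_add_eq_zero]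

lemma exists_inner_eq {d : ℕ} (U : Set (Vel d)) {ψ : Vel d → ℝ} (hψ : Continuous ψ)
    (hc : HasCompactSupport ψ) : ∃ Ψ : L2 U, ∀ u : L2 U, ∫ v in U, u v * ψ v = inner ℝ Ψ u := by
  have hm : MemLp ψ 2 (volume.restrict U) := (hψ.memLp_of_hasCompactSupport hc)
  refine ⟨hm.toLp ψ, fun u => ?_⟩
  rw [L2.inner_def]
  refine integral_congr_ae ?_
  filter_upwards [hm.coeFn_toLp] with v hv
  rw [hv]
  simp

lemma exists_isWeakPartial_functional {d : ℕ} (U : Set (Vel d)) (i : Fin d) {φ : Vel d → ℝ}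
    (hφ : ContDiff ℝ ∞ φ) (hc : HasCompactSupport φ) :
    ∃ A B : L2 U, ∀ u g : L2 U,
      (∫ v in U, u v * fderiv ℝ φ v (EuclideanSpace.single i 1)) + ∫ v in U, g v * φ v =
        inner ℝ A u + inner ℝ B g := by
  obtain ⟨B, hB⟩ := exists_inner_eq U hφ.continuous hc
  obtain ⟨A, hA⟩ := exists_inner_eq U
    (ψ := fun v => fderiv ℝ φ v (EuclideanSpace.single i 1))
    ((hφ.continuous_fderiv (by simp)).clm_apply continuous_const) (hc.fderiv_apply ℝ _)
  exact ⟨A, B, fun u g => by rw [hA, hB]⟩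

/-- The Sobolev space `H²(U)`, realized as the space of `2`-jets `(u, ∇u, ∇²u)` with entries in
`L²(U)`, so that it carries the usual Hilbert norm
`(‖u‖² + ∑ ‖∂_i u‖² + ∑ ‖∂_i ∂_j u‖²)^{1/2}`. -/
def H2 {d : ℕ} (U : Set (Vel d)) : Submodule ℝ (Jet U) where
  carrier := {x | (∀ i, IsWeakPartial U i (x (.inl ())) (x (.inr (.inl i)))) ∧
    ∀ i j, IsWeakPartial U j (x (.inr (.inl i))) (x (.inr (.inr (i, j))))}
  add_mem' := by
    have key : ∀ (i : Fin d) (u g u' g' : L2 U), IsWeakPartial U i u g →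
        IsWeakPartial U i u' g' → IsWeakPartial U i (u + u') (g + g') := by
      intro i u g u' g' h h'
      rw [isWeakPartial_iff_zero] at *
      intro φ hφ hc hs
      obtain ⟨A, B, hAB⟩ := exists_isWeakPartial_functional U i hφ hc
      have e := h φ hφ hc hs
      have e' := h' φ hφ hc hs
      rw [hAB] at e e' ⊢
      rw [inner_add_right, inner_add_right]
      linarith
    exact fun {x y} hx hy => ⟨fun i => key _ _ _ _ _ (hx.1 i) (hy.1 i),
      fun i j => key _ _ _ _ _ (hx.2 i j) (hy.2 i j)⟩
  zero_mem' := by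
    have key : ∀ i : Fin d, IsWeakPartial U i (0 : L2 U) 0 := by
      intro i
      rw [isWeakPartial_iff_zero]
      intro φ hφ hc hs
      obtain ⟨A, B, hAB⟩ := exists_isWeakPartial_functional U i hφ hc
      rw [hAB]
      simp
    exact ⟨fun i => key i, fun i j => key j⟩
  smul_mem' := by
    have key : ∀ (c : ℝ) (i : Fin d) (u g : L2 U), IsWeakPartial U i u g →
        IsWeakPartial U i (c • u) (c • g) := by
      intro c i u g h
      rw [isWeakPartial_iff_zero] at *
      intro φ hφ hc hs
      obtain ⟨A, B, hAB⟩ := exists_isWeakPartial_functional U i hφ hc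
      have e := h φ hφ hc hs
      rw [hAB] at e ⊢
      rw [inner_smul_right, inner_smul_right, ← mul_add, e, mul_zero]
    exact fun c {x} hx => ⟨fun i => key _ _ _ _ (hx.1 i), fun i j => key _ _ _ _ (hx.2 i j)⟩

/-- The function underlying an element of `H²(U)`. -/
def H2.fn {d : ℕ} {U : Set (Vel d)} (x : H2 U) : L2 U := (x : Jet U) (.inl ())

lemma isClosed_H2 {d : ℕ} (U : Set (Vel d)) : IsClosed (H2 U : Set (Jet U)) := by
  have key : ∀ (i : Fin d) (a b : JetIndex d),
      IsClosed {x : Jet U | IsWeakPartial U i (x a) (x b)} := by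
    intro i a b
    simp only [isWeakPartial_iff_zero, ofPred_forall]
    refine isClosed_iInter fun φ => isClosed_iInter fun hφ => isClosed_iInter fun hc =>
      isClosed_iInter fun _ => ?_
    obtain ⟨A, B, hAB⟩ := exists_isWeakPartial_functional U i hφ hc
    simp only [hAB]
    refine isClosed_eq ?_ continuous_const
    exact (continuous_const.inner (PiLp.continuous_apply 2 _ a)).add
      (continuous_const.inner (PiLp.continuous_apply 2 _ b))
  have h : (H2 U : Set (Jet U)) =
      (⋂ i, {x : Jet U | IsWeakPartial U i (x (.inl ())) (x (.inr (.inl i)))}) ∩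
      ⋂ i, ⋂ j, {x : Jet U | IsWeakPartial U j (x (.inr (.inl i))) (x (.inr (.inr (i, j))))} := by
    ext x
    simp only [mem_inter_iff, mem_iInter, mem_ofPred_eq]
    rfl
  rw [h]
  exact (isClosed_iInter fun i => key _ _ _).inter
    (isClosed_iInter fun i => isClosed_iInter fun j => key _ _ _)

instance {d : ℕ} (U : Set (Vel d)) : CompleteSpace (H2 U) :=
  (isClosed_H2 U).completeSpace_coe

/-- `F ∈ W^{1,2}_loc(I; V)` for an open set `I ⊆ ℝ` of times and a Banach space `V`: `F` and its
weak time derivative are square integrable on compact subsets of `I`. -/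
def MemW12loc {V : Type*} [NormedAddCommGroup V] [NormedSpace ℝ V] (I : Set ℝ) (F : ℝ → V) :
    Prop :=
  ∃ F' : ℝ → V,
    (∀ K : Set ℝ, IsCompact K → K ⊆ I →
      MemLp F 2 (volume.restrict K) ∧ MemLp F' 2 (volume.restrict K)) ∧
    ∀ ψ : ℝ → ℝ, ContDiff ℝ ∞ ψ → HasCompactSupport ψ → tsupport ψ ⊆ I →
      ∫ t, deriv ψ t • F t = - ∫ t, ψ t • F' t

end Smoluchowski

end

noncomputable section

namespace Smoluchowski

/-! ### Composition with affine maps on `L²` -/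

/-! Write S_t = e^{dt} P_t for the semigroup generated by Δ + div(v ·). The system is the semilinear
equation f(t) = S_t f⁰ + ∫ S_{t-s} Q(f(s)) ds. The truncation makes Q harmless in L²: with |v|, |w|
< R only the values of f on a fixed ball B(0, ρ) enter, the relative speed is at most 2R, and
Cauchy-Schwarz makes Q the diagonal of a bounded bilinear form (`exists_norm_collisionForm_le`).
Hence the source is Lipschitz on bounded sets. Banach's fixed point theorem, with an existence time
depending only on the size of the datum, together with Gronwall's inequality and concatenation,
gives the maximal solution, the half-open interval and the blow-up alternative (`exists_isMild`,
`exists_maximal_isMild`).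

Regularity in space is a bootstrap. P_t u is the average of u(e^t · - σ z) over a standard Gaussian
z, with σ² = e^{2t} - 1, so derivatives fall on the Gaussian and cost t^{-1/2} each. One derivative
of the Duhamel integral is therefore free, but two give the non-integrable rate 1/t. Moreover Q(f)
jumps across the sphere of radius R and is in general not in H¹. It is still Hölder continuous of
order 1/3 in L² when f is in H¹ (`norm_translate_speedMul_sub_le`): the shell between a ball and its
translate by h has, by convexity, disjoint translates along h, so an H¹ function has little mass
there. Second derivatives of the Gaussian have integral zero, hence second derivatives of S_t on
such functions cost only t^{-5/6} (`exists_norm_jetOp_two_le`), which is integrable. This gives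
continuity in H² for positive times (`IsDuhamel.exists_jet`).

Regularity in time meets the unbounded drift coefficient v: for u in H² the estimate S_η u - u =
O(η) is available on balls only (`exists_norm_rs_fpOp_sub_le`). Since Q sees f only on B(0, ρ),
Gronwall's inequality nevertheless closes for the norm localized to that ball
(`HasJets.exists_locNorm_sub_le`). Feeding this back into the smoothing estimates, applied to time
differences, yields local Lipschitz continuity with values in H² of every ball
(`HasJets.exists_norm_rs_sub_le`). A locally Lipschitz function with values in a Hilbert space has a
bounded weak derivative on compact intervals, a weak limit of difference quotients
(`memW12loc_of_locally_lipschitz`). -/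

/-- The map `v ↦ a v - w`; dilation factors below `1` are replaced by `1`. -/
def affMap {d : ℕ} (a : ℝ) (w v : Vel d) : Vel d := max a 1 • v - w

lemma affMap_of_one_le {d : ℕ} {a : ℝ} (ha : 1 ≤ a) (w v : Vel d) : affMap a w v = a • v - w := by
  rw [affMap, max_eq_left ha]

@[fun_prop]
lemma measurable_affMap {d : ℕ} (a : ℝ) (w : Vel d) : Measurable (affMap a w) := by
  unfold affMap; fun_prop

lemma map_affMap {d : ℕ} (a : ℝ) (w : Vel d) :
    Measure.map (affMap a w) volume =
      ENNReal.ofReal |((max a 1) ^ d)⁻¹| • (volume : Measure (Vel d)) := by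
  have h0 : max a 1 ≠ 0 := (lt_of_lt_of_le one_pos (le_max_right a 1)).ne'
  have h1 : affMap a w = (fun v : Vel d => v - w) ∘ fun v => max a 1 • v := rfl
  rw [h1, ← Measure.map_map (by fun_prop) (by fun_prop), Measure.map_addHaar_smul volume h0,
    Measure.map_smul, (measurePreserving_sub_right volume w).map_eq]
  simp

lemma affMap_factor_le_one (d : ℕ) (a : ℝ) : ENNReal.ofReal |((max a 1) ^ d)⁻¹| ≤ 1 := by
  rw [ENNReal.ofReal_le_one, abs_inv]
  refine inv_le_one_of_one_le₀ ?_
  rw [abs_of_nonneg (by positivity)]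
  exact one_le_pow₀ (le_max_right a 1)

lemma quasiMeasurePreserving_affMap {d : ℕ} (a : ℝ) (w : Vel d) :
    Measure.QuasiMeasurePreserving (affMap a w) volume volume := by
  refine ⟨measurable_affMap a w, ?_⟩
  rw [map_affMap]
  exact Measure.smul_absolutelyContinuous

lemma eLpNorm_comp_affMap_le {d : ℕ} (a : ℝ) (w : Vel d) {u : Vel d → ℝ}
    (hu : AEStronglyMeasurable u volume) :
    eLpNorm (fun v => u (affMap a w v)) 2 volume ≤ eLpNorm u 2 volume := by
  have h1 : AEStronglyMeasurable u (Measure.map (affMap a w) volume) :=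
    hu.mono_ac (quasiMeasurePreserving_affMap a w).2
  have h2 : eLpNorm (fun v => u (affMap a w v)) 2 volume =
      eLpNorm u 2 (Measure.map (affMap a w) volume) :=
    (eLpNorm_map_measure h1 (measurable_affMap a w).aemeasurable).symm
  rw [h2, map_affMap]
  refine (eLpNorm_mono_measure u ?_)
  intro s
  simp only [Measure.smul_apply, smul_eq_mul]
  exact mul_le_of_le_one_left zero_le (affMap_factor_le_one d a)

lemma memLp_comp_affMap {d : ℕ} (a : ℝ) (w : Vel d) {u : Vel d → ℝ} (hu : MemLp u 2 volume) :
    MemLp (fun v => u (affMap a w v)) 2 volume :=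
  ⟨hu.1.comp_quasiMeasurePreserving (quasiMeasurePreserving_affMap a w),
    (eLpNorm_comp_affMap_le a w hu.1).trans_lt hu.2⟩

/-- The contraction `u ↦ u(a · - w)` of `L²(ℝ^d)`. -/
def affComp {d : ℕ} (a : ℝ) (w : Vel d) : L2V d →L[ℝ] L2V d :=
  LinearMap.mkContinuous
    { toFun := fun u => (memLp_comp_affMap a w (Lp.memLp u)).toLp _
      map_add' := fun u u' => by
        rw [← MemLp.toLp_add, MemLp.toLp_eq_toLp_iff]
        exact (quasiMeasurePreserving_affMap a w).ae_eq_comp (Lp.coeFn_add u u')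
      map_smul' := fun c u => by
        rw [RingHom.id_apply, ← MemLp.toLp_const_smul, MemLp.toLp_eq_toLp_iff]
        exact (quasiMeasurePreserving_affMap a w).ae_eq_comp (Lp.coeFn_smul c u) } 1
    (fun u => by
      rw [one_mul, LinearMap.coe_mk, AddHom.coe_mk, Lp.norm_toLp, Lp.norm_def]
      exact ENNReal.toReal_mono (Lp.memLp u).2.ne
        (eLpNorm_comp_affMap_le a w (Lp.aestronglyMeasurable u)))

lemma coeFn_affComp {d : ℕ} (a : ℝ) (w : Vel d) (u : L2V d) :
    affComp a w u =ᵐ[volume] fun v => u (affMap a w v) :=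
  MemLp.coeFn_toLp (memLp_comp_affMap a w (Lp.memLp u))

lemma affComp_toLp {d : ℕ} (a : ℝ) (w : Vel d) {u : Vel d → ℝ} (hu : MemLp u 2 volume) :
    affComp a w (hu.toLp u) = (memLp_comp_affMap a w hu).toLp _ := by
  refine Lp.ext ((coeFn_affComp a w _).trans ?_)
  refine ((quasiMeasurePreserving_affMap a w).ae_eq_comp hu.coeFn_toLp).trans ?_
  exact (memLp_comp_affMap a w hu).coeFn_toLp.symm

lemma norm_affComp_le {d : ℕ} (a : ℝ) (w : Vel d) (u : L2V d) : ‖affComp a w u‖ ≤ ‖u‖ := by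
  have := (affComp a w).le_of_opNorm_le (c := 1) (LinearMap.mkContinuous_norm_le _ zero_le_one _) u
  rwa [one_mul] at this

lemma affComp_affComp {d : ℕ} {a b : ℝ} (ha : 1 ≤ a) (hb : 1 ≤ b) (w w' : Vel d) (u : L2V d) :
    affComp a w (affComp b w' u) = affComp (b * a) (b • w + w') u := by
  refine Lp.ext ((coeFn_affComp a w _).trans ?_)
  refine ((quasiMeasurePreserving_affMap a w).ae_eq_comp (coeFn_affComp b w' u)).trans ?_
  refine EventuallyEq.trans (Eventually.of_forall fun v => ?_) (coeFn_affComp _ _ u).symm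
  simp only [Function.comp_apply]
  rw [affMap_of_one_le ha, affMap_of_one_le hb, affMap_of_one_le (one_le_mul_of_one_le_of_one_le hb ha)]
  congr 1
  rw [smul_sub, smul_smul]; abel

/-- The default in `affMap` makes every factor `a ≤ 1` act as `a = 1`. It keeps `affComp` a
contraction for all parameters, so continuity in `a` needs no side condition. -/
lemma affComp_zero {d : ℕ} {a : ℝ} (ha : a ≤ 1) (u : L2V d) : affComp a 0 u = u := by
  refine Lp.ext ((coeFn_affComp a 0 _).trans (Eventually.of_forall fun v => ?_))
  simp [affMap, max_eq_right ha]

/-- Dominated convergence: dilation factors are at least `1`, so for parameters near `p₀` all the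
supports lie in one common ball. -/
lemma continuous_affComp_toLp {d : ℕ} {g : Vel d → ℝ} (hg : Continuous g)
    (hc : HasCompactSupport g) (hm : MemLp g 2 volume) :
    Continuous fun p : ℝ × Vel d => affComp p.1 p.2 (hm.toLp g) := by
  simp only [affComp_toLp]
  refine continuous_iff_continuousAt.2 fun p₀ => ?_
  rw [ContinuousAt, Lp.tendsto_Lp_iff_tendsto_eLpNorm'']
  obtain ⟨C, hC⟩ := hg.bounded_above_of_compact_support hc
  obtain ⟨r, hr⟩ := hc.isCompact.isBounded.subset_closedBall (0 : Vel d)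
  have hsupp : ∀ᶠ p : ℝ × Vel d in 𝓝 p₀, ∀ v, r + ‖p₀.2‖ + 1 < ‖v‖ → g (affMap p.1 p.2 v) = 0 := by
    have : ∀ᶠ p : ℝ × Vel d in 𝓝 p₀, ‖p.2‖ < ‖p₀.2‖ + 1 :=
      (continuous_snd.norm.tendsto p₀).eventually_lt_const (by simp)
    filter_upwards [this] with p hp v hv
    refine image_eq_zero_of_notMem_tsupport fun hmem => ?_
    have h1 := mem_closedBall_zero_iff.1 (hr hmem)
    have h2 : ‖v‖ ≤ ‖max p.1 1 • v‖ := by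
      rw [norm_smul]
      refine le_mul_of_one_le_left (norm_nonneg _) ?_
      rw [Real.norm_eq_abs]
      exact (le_max_right _ _).trans (le_abs_self _)
    have h3 := norm_sub_norm_le (max p.1 1 • v) p.2
    rw [affMap] at h1
    linarith
  set B := Metric.closedBall (0 : Vel d) (r + ‖p₀.2‖ + 1)
  have hrp : ∀ p : ℝ × Vel d, eLpNorm ((fun v => g (affMap p.1 p.2 v)) -
      fun v => g (affMap p₀.1 p₀.2 v)) 2 volume = (∫⁻ v, ‖g (affMap p.1 p.2 v) -
        g (affMap p₀.1 p₀.2 v)‖ₑ ^ (2 : ℝ)) ^ (1 / 2 : ℝ) := by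
    intro p
    rw [eLpNorm_eq_lintegral_rpow_enorm_toReal two_ne_zero ENNReal.ofNat_ne_top]
    simp
  simp only [hrp]
  have h0 : (0 : ℝ≥0∞) = (∫⁻ _ : Vel d, 0) ^ (1 / 2 : ℝ) := by simp
  rw [h0]
  refine (ENNReal.continuous_rpow_const.tendsto _).comp ?_
  have hcont : ∀ v, Continuous fun p : ℝ × Vel d => g (affMap p.1 p.2 v) := fun v => by
    unfold affMap; fun_prop
  refine tendsto_lintegral_filter_of_dominated_convergence
    (B.indicator fun _ => ENNReal.ofReal (2 * C) ^ (2 : ℝ)) ?_ ?_ ?_ ?_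
  · refine Eventually.of_forall fun p => ?_
    have h1 : Measurable fun v => g (affMap p.1 p.2 v) - g (affMap p₀.1 p₀.2 v) :=
      (hg.measurable.comp (measurable_affMap _ _)).sub (hg.measurable.comp (measurable_affMap _ _))
    exact h1.enorm.pow_const _
  · filter_upwards [hsupp] with p hp
    refine Eventually.of_forall fun v => ?_
    by_cases hv : v ∈ B
    · rw [indicator_of_mem hv]
      refine ENNReal.rpow_le_rpow ?_ (by norm_num)
      rw [← ofReal_norm]
      refine ENNReal.ofReal_le_ofReal ((norm_sub_le _ _).trans ?_)
      linarith [hC (affMap p.1 p.2 v), hC (affMap p₀.1 p₀.2 v)]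
    · have hv' : r + ‖p₀.2‖ + 1 < ‖v‖ := by simpa [B] using hv
      rw [hp v hv', hsupp.self_of_nhds v hv']
      simp
  · rw [lintegral_indicator Metric.isClosed_closedBall.measurableSet, setLIntegral_const]
    exact ENNReal.mul_ne_top (ENNReal.rpow_ne_top_of_nonneg (by norm_num) ENNReal.ofReal_ne_top) (isCompact_closedBall _ _).measure_lt_top.ne
  · refine Eventually.of_forall fun v => ?_
    have h1 : Tendsto (fun p : ℝ × Vel d => ‖g (affMap p.1 p.2 v) - g (affMap p₀.1 p₀.2 v)‖ₑ)
        (𝓝 p₀) (𝓝 ‖g (affMap p₀.1 p₀.2 v) - g (affMap p₀.1 p₀.2 v)‖ₑ) :=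
      (((hcont v).sub continuous_const).enorm).tendsto p₀
    have h2 := (ENNReal.continuous_rpow_const (y := 2)).continuousAt.tendsto.comp h1
    simpa [Function.comp_def] using h2

/-- `(a, w) ↦ u(a · - w)` is continuous with values in `L²`. -/
lemma continuous_affComp {d : ℕ} (u : L2V d) :
    Continuous fun p : ℝ × Vel d => affComp p.1 p.2 u := by
  -- Since every `affComp` is a contraction, replacing `u` by a compactly supported continuous `g`
  -- costs the same error for all parameters at once.
  refine continuous_of_uniform_approx_of_continuous fun V hV => ?_
  obtain ⟨ε, hε, hεV⟩ := Metric.mem_uniformity_dist.1 hV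
  obtain ⟨g, hgc, hgε, hg, hgm⟩ := (Lp.memLp u).exists_hasCompactSupport_eLpNorm_sub_le
    (by norm_num) (ε := ENNReal.ofReal (ε / 2)) (by simpa using hε)
  refine ⟨_, continuous_affComp_toLp hg hgc hgm, fun p => hεV ?_⟩
  rw [dist_eq_norm, ← map_sub]
  refine (norm_affComp_le _ _ _).trans_lt ?_
  have h1 : u - hgm.toLp g = ((Lp.memLp u).sub hgm).toLp _ := by
    rw [MemLp.toLp_sub (Lp.memLp u) hgm, Lp.toLp_coeFn]
  rw [h1, Lp.norm_toLp]
  have h2 := ENNReal.toReal_mono ENNReal.ofReal_ne_top hgε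
  rw [ENNReal.toReal_ofReal (by positivity)] at h2
  linarith

lemma tendsto_affComp {d : ℕ} {α : Type*} {l : Filter α} {a : α → ℝ} {w : α → Vel d}
    {u : α → L2V d} {a₀ : ℝ} {w₀ : Vel d} {u₀ : L2V d} (ha : Tendsto a l (𝓝 a₀))
    (hw : Tendsto w l (𝓝 w₀)) (hu : Tendsto u l (𝓝 u₀)) :
    Tendsto (fun x => affComp (a x) (w x) (u x)) l (𝓝 (affComp a₀ w₀ u₀)) := by
  have h0 := (continuous_affComp u₀).tendsto (a₀, w₀)
  have h1 : Tendsto (fun x => affComp (a x) (w x) u₀) l (𝓝 (affComp a₀ w₀ u₀)) :=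
    Tendsto.comp (f := fun x => (a x, w x)) h0 (ha.prodMk_nhds hw)
  have h2 : Tendsto (fun x => affComp (a x) (w x) (u x - u₀)) l (𝓝 0) := by
    refine squeeze_zero_norm (fun x => norm_affComp_le _ _ _) ?_
    have := (hu.sub (tendsto_const_nhds (x := u₀))).norm
    simpa using this
  have h3 := h1.add h2
  simp only [map_sub, add_sub_cancel, add_zero] at h3
  exact h3

/-! ### Averages of affine compositions against integrable kernels -/

lemma continuous_affComp_smul {d : ℕ} (a c : ℝ) (u : L2V d) :
    Continuous fun z : Vel d => affComp a (c • z) u :=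
  (continuous_affComp u).comp (f := fun z : Vel d => (a, c • z)) (by fun_prop)

lemma integrable_smul_affComp {d : ℕ} {k : Vel d → ℝ} (hk : Integrable k) (a c : ℝ) (u : L2V d) :
    Integrable fun z => k z • affComp a (c • z) u := by
  refine (hk.norm.mul_const ‖u‖).mono'
    (hk.1.smul (continuous_affComp_smul a c u).aestronglyMeasurable)
    (Eventually.of_forall fun z => ?_)
  rw [norm_smul]
  gcongr
  exact norm_affComp_le _ _ _

/-- The operator `u ↦ ∫ k(z) u(a · - c z) dz` on `L²(ℝ^d)`. -/
def kerOp {d : ℕ} {k : Vel d → ℝ} (hk : Integrable k) (a c : ℝ) : L2V d →L[ℝ] L2V d :=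
  LinearMap.mkContinuous
    { toFun := fun u => ∫ z, k z • affComp a (c • z) u
      map_add' := fun u u' => by
        simp only [map_add, smul_add]
        exact integral_add (integrable_smul_affComp hk a c u) (integrable_smul_affComp hk a c u')
      map_smul' := fun r u => by
        simp only [map_smul, smul_comm _ r, RingHom.id_apply]
        exact integral_smul r _ } (∫ z, ‖k z‖)
    (fun u => by
      rw [LinearMap.coe_mk, AddHom.coe_mk, ← integral_mul_const]
      refine norm_integral_le_of_norm_le (hk.norm.mul_const _) (Eventually.of_forall fun z => ?_)
      rw [norm_smul]
      gcongr
      exact norm_affComp_le _ _ _)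

lemma kerOp_apply {d : ℕ} {k : Vel d → ℝ} (hk : Integrable k) (a c : ℝ) (u : L2V d) :
    kerOp hk a c u = ∫ z, k z • affComp a (c • z) u := rfl

lemma norm_kerOp_le {d : ℕ} {k : Vel d → ℝ} (hk : Integrable k) (a c : ℝ) (u : L2V d) :
    ‖kerOp hk a c u‖ ≤ (∫ z, ‖k z‖) * ‖u‖ :=
  (kerOp hk a c).le_of_opNorm_le
    (LinearMap.mkContinuous_norm_le _ (integral_nonneg fun _ => norm_nonneg _) _) u

/-- The kernel `k` is fixed and only the affine maps vary, so `‖k z‖` times a constant dominates.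
This is the reason for writing the noise as `c • z`: continuity persists at `c = 0`, where a
rescaled density would degenerate. -/
lemma tendsto_kerOp {d : ℕ} {k : Vel d → ℝ} (hk : Integrable k) {α : Type*} {l : Filter α}
    [l.IsCountablyGenerated] {a c : α → ℝ} {u : α → L2V d} {a₀ c₀ : ℝ} {u₀ : L2V d}
    (ha : Tendsto a l (𝓝 a₀)) (hc : Tendsto c l (𝓝 c₀)) (hu : Tendsto u l (𝓝 u₀)) :
    Tendsto (fun x => kerOp hk (a x) (c x) (u x)) l (𝓝 (kerOp hk a₀ c₀ u₀)) := by
  simp only [kerOp_apply]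
  have hb : ∀ᶠ x in l, ‖u x‖ < ‖u₀‖ + 1 := hu.norm.eventually_lt_const (by simp)
  refine tendsto_integral_filter_of_dominated_convergence (fun z => ‖k z‖ * (‖u₀‖ + 1)) ?_ ?_
    (hk.norm.mul_const _) (Eventually.of_forall fun z => ?_)
  · exact Eventually.of_forall fun x =>
      hk.1.smul (continuous_affComp_smul (a x) (c x) (u x)).aestronglyMeasurable
  · filter_upwards [hb] with x hx
    refine Eventually.of_forall fun z => ?_
    rw [norm_smul]
    gcongr
    exact (norm_affComp_le _ _ _).trans hx.le
  · exact (tendsto_affComp ha (hc.smul_const z) hu).const_smul (k z)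

lemma integral_norm_mul_le {d : ℕ} (u v : L2V d) : ∫ x, ‖u x * v x‖ ≤ ‖u‖ * ‖v‖ := by
  have h : ∫ x, ‖u x * v x‖ = inner ℝ (|u|) (|v|) := by
    rw [L2.inner_def]
    refine integral_congr_ae ?_
    filter_upwards [Lp.coeFn_abs u, Lp.coeFn_abs v] with x h1 h2
    rw [h1, h2, norm_mul, Real.norm_eq_abs, Real.norm_eq_abs]
    simp [mul_comm]
  rw [h]
  refine (real_inner_le_norm _ _).trans (le_of_eq ?_)
  rw [norm_abs_eq_norm, norm_abs_eq_norm]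

lemma inner_eq_integral {d : ℕ} (u v : L2V d) : inner ℝ u v = ∫ x, u x * v x := by
  rw [L2.inner_def]
  refine integral_congr_ae (Eventually.of_forall fun x => ?_)
  simp [mul_comm]

lemma measurable_affMap_smul_prod {d : ℕ} (a c : ℝ) :
    Measurable fun p : Vel d × Vel d => affMap a (c • p.1) p.2 := by
  unfold affMap; fun_prop

/-- The pointwise formula for Bochner integrals in `L²(ℝ^d)`. -/
lemma integral_smul_eq_toLp {d : ℕ} {k : Vel d → ℝ} (hkm : StronglyMeasurable k)
    {Y : Vel d → L2V d} (hint : Integrable fun z => k z • Y z) {y : Vel d → Vel d → ℝ}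
    (hy : StronglyMeasurable (Function.uncurry y)) (hYy : ∀ z, Y z =ᵐ[volume] y z)
    {F : Vel d → ℝ} (hF : MemLp F 2 volume) (hFy : ∀ v, F v = ∫ z, k z * y z v) :
    ∫ z, k z • Y z = hF.toLp F := by
  -- Evaluation at a point does not commute with a Bochner integral, but pairing with `φ` does. The
  -- jointly measurable representative `y` then allows Fubini.
  refine ext_inner_left ℝ fun φ => ?_
  have hφm := Lp.stronglyMeasurable φ
  have hφy : ∀ z : Vel d, (fun v => φ v * y z v) =ᵐ[volume] fun v => φ v * (Y z) v := fun z => by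
    filter_upwards [hYy z] with v hv
    rw [hv]
  have hmul : ∀ φ' u' : L2V d, Integrable fun v => φ' v * u' v := fun φ' u' =>
    (Lp.memLp φ').integrable_mul (Lp.memLp u')
  have hprod : Integrable (Function.uncurry fun z v => k z * (φ v * y z v))
      ((volume : Measure (Vel d)).prod (volume : Measure (Vel d))) := by
    have hm : AEStronglyMeasurable (Function.uncurry fun z v => k z * (φ v * y z v))
        ((volume : Measure (Vel d)).prod (volume : Measure (Vel d))) :=
      ((hkm.comp_measurable measurable_fst).mul ((hφm.comp_measurable measurable_snd).mul
        hy)).aestronglyMeasurable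
    rw [integrable_prod_iff hm]
    refine ⟨Eventually.of_forall fun z =>
      Integrable.const_mul (c := k z) ((hmul φ _).congr (hφy z).symm), ?_⟩
    refine (hint.norm.const_mul ‖φ‖).mono' hm.norm.integral_prod_right'
      (Eventually.of_forall fun z => ?_)
    simp only [Function.uncurry_apply_pair]
    rw [Real.norm_of_nonneg (integral_nonneg fun _ => norm_nonneg _)]
    simp only [norm_mul (k z), integral_const_mul]
    rw [norm_smul, mul_left_comm]
    gcongr
    exact (integral_congr_ae ((hφy z).fun_comp (‖·‖))).trans_le (integral_norm_mul_le φ _)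
  calc inner ℝ φ (∫ z, k z • Y z)
      = ∫ z, inner ℝ φ (k z • Y z) := ((innerSL ℝ φ).integral_comp_comm hint).symm
    _ = ∫ z, ∫ v, k z * (φ v * y z v) := by
        congr 1; ext z
        rw [inner_smul_right, inner_eq_integral, integral_const_mul, integral_congr_ae (hφy z)]
    _ = ∫ v, ∫ z, k z * (φ v * y z v) := integral_integral_swap hprod
    _ = inner ℝ φ (hF.toLp F) := by
        rw [inner_eq_integral]
        refine integral_congr_ae ?_
        filter_upwards [hF.coeFn_toLp] with v hv
        rw [hv, hFy, ← integral_const_mul]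
        congr 1; ext z; ring

/-- The pointwise formula for `kerOp`. -/
lemma kerOp_eq_toLp {d : ℕ} {k : Vel d → ℝ} (hk : Integrable k) (hkm : StronglyMeasurable k)
    (a c : ℝ) (u : L2V d) {F : Vel d → ℝ} (hF : MemLp F 2 volume)
    (hFu : ∀ v, F v = ∫ z, k z * u (affMap a (c • z) v)) : kerOp hk a c u = hF.toLp F :=
  integral_smul_eq_toLp hkm (integrable_smul_affComp hk a c u)
    (y := fun z v => u (affMap a (c • z) v))
    ((Lp.stronglyMeasurable u).comp_measurable (measurable_affMap_smul_prod a c))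
    (fun z => coeFn_affComp a (c • z) u) hF hFu

/-! ### The standard Gaussian -/

/-- The standard Gaussian density. -/
def gauss {d : ℕ} (z : Vel d) : ℝ :=
  (2 * Real.pi) ^ (-(d : ℝ) / 2) * Real.exp (-(‖z‖ ^ 2 / 2))

lemma continuous_gauss {d : ℕ} : Continuous (gauss : Vel d → ℝ) := by
  unfold gauss; fun_prop

lemma gauss_nonneg {d : ℕ} (z : Vel d) : 0 ≤ gauss z := by
  unfold gauss; positivity

lemma integrable_exp_neg_mul_norm_sq {d : ℕ} {b : ℝ} (hb : 0 < b) :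
    Integrable fun z : Vel d => Real.exp (-b * ‖z‖ ^ 2) := by
  have h := (GaussianFourier.integrable_cexp_neg_mul_sq_norm_add (V := Vel d) (b := (b : ℂ))
    (by simpa using hb) 0 0).norm
  refine h.congr (Eventually.of_forall fun z => ?_)
  simp only [Complex.norm_exp]
  congr 1
  rw [zero_mul, add_zero, ← Complex.ofReal_neg, ← Complex.ofReal_pow, ← Complex.ofReal_mul,
    Complex.ofReal_re]

/-- Gaussian moments up to order four are finite. -/
lemma integrable_moment_gauss {d : ℕ} :
    Integrable fun z : Vel d => (1 + ‖z‖) ^ 4 * gauss z := by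
  have h := (integrable_exp_neg_mul_norm_sq (d := d) (b := 1 / 4) (by norm_num)).const_mul
    (264 * (2 * Real.pi) ^ (-(d : ℝ) / 2))
  refine h.mono' (Continuous.aestronglyMeasurable (by unfold gauss; fun_prop))
    (Eventually.of_forall fun z => ?_)
  have h1 : 0 ≤ ‖z‖ := norm_nonneg z
  have h2 := Real.quadratic_le_exp_of_nonneg (x := ‖z‖ ^ 2 / 4) (by positivity)
  -- With r = ‖z‖: (1 + r)⁴ ≤ 8 + 8r⁴, and exp x ≥ x²/2 at x = r²/4 gives r⁴ ≤ 32 exp(r²/4); 264 = 8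
  -- + 8 · 32.
  have h3 : (1 + ‖z‖) ^ 4 ≤ 264 * Real.exp (‖z‖ ^ 2 / 4) := by
    nlinarith [sq_nonneg (‖z‖ ^ 2 - 1), sq_nonneg (‖z‖ - 1), sq_nonneg (‖z‖ ^ 2 - ‖z‖)]
  rw [Real.norm_of_nonneg (mul_nonneg (by positivity) (gauss_nonneg z)), gauss]
  have h4 : Real.exp (-(‖z‖ ^ 2 / 2)) =
      Real.exp (-(‖z‖ ^ 2 / 4)) * Real.exp (-(1 / 4) * ‖z‖ ^ 2) := by
    rw [← Real.exp_add]; ring_nf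
  have h5 : Real.exp (‖z‖ ^ 2 / 4) * Real.exp (-(‖z‖ ^ 2 / 4)) = 1 := by
    rw [← Real.exp_add]; simp
  calc (1 + ‖z‖) ^ 4 * ((2 * Real.pi) ^ (-(d : ℝ) / 2) * Real.exp (-(‖z‖ ^ 2 / 2)))
      ≤ 264 * Real.exp (‖z‖ ^ 2 / 4) *
          ((2 * Real.pi) ^ (-(d : ℝ) / 2) * Real.exp (-(‖z‖ ^ 2 / 2))) := by gcongr
    _ = 264 * (2 * Real.pi) ^ (-(d : ℝ) / 2) *
          (Real.exp (‖z‖ ^ 2 / 4) * Real.exp (-(‖z‖ ^ 2 / 4))) *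
            Real.exp (-(1 / 4) * ‖z‖ ^ 2) := by rw [h4]; ring
    _ = _ := by rw [h5, mul_one]

lemma integrable_of_le_moment {d : ℕ} {k : Vel d → ℝ} (hk : Continuous k) {C : ℝ}
    (h : ∀ z, |k z| ≤ C * ((1 + ‖z‖) ^ 4 * gauss z)) : Integrable k :=
  (integrable_moment_gauss.const_mul C).mono' hk.aestronglyMeasurable (Eventually.of_forall h)

lemma integrable_gauss {d : ℕ} : Integrable (gauss : Vel d → ℝ) := by
  refine integrable_of_le_moment continuous_gauss (C := 1) fun z => ?_
  rw [abs_of_nonneg (gauss_nonneg z), one_mul]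
  refine le_mul_of_one_le_left (gauss_nonneg z) (one_le_pow₀ ?_)
  linarith [norm_nonneg z]

lemma integral_exp_gauss {d : ℕ} {s : ℝ} (hs : 0 < s) :
    ∫ z : Vel d, Real.exp (-(‖z‖ ^ 2 / (2 * s ^ 2))) = (2 * Real.pi) ^ ((d : ℝ) / 2) * s ^ d := by
  have h := GaussianFourier.integral_rexp_neg_mul_sq_norm (V := Vel d) (b := (2 * s ^ 2)⁻¹)
    (by positivity)
  have h2 : ∀ z : Vel d, -(2 * s ^ 2)⁻¹ * ‖z‖ ^ 2 = -(‖z‖ ^ 2 / (2 * s ^ 2)) := fun z => by ring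
  simp only [h2] at h
  rw [h, div_inv_eq_mul, finrank_euclideanSpace_fin,
    show Real.pi * (2 * s ^ 2) = (2 * Real.pi) * (s * s) by ring,
    Real.mul_rpow (by positivity) (by positivity), Real.mul_rpow hs.le hs.le,
    ← Real.rpow_add hs, add_halves, Real.rpow_natCast]

lemma integral_gauss {d : ℕ} : ∫ z : Vel d, gauss z = 1 := by
  have h := integral_exp_gauss (d := d) one_pos
  simp only [one_pow, mul_one] at h
  simp only [gauss]
  rw [integral_const_mul, h, ← Real.rpow_add (by positivity), neg_div, neg_add_cancel,
    Real.rpow_zero]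

lemma integral_norm_gauss {d : ℕ} : ∫ z : Vel d, ‖gauss z‖ = 1 := by
  rw [← integral_gauss (d := d)]
  congr 1; ext z
  exact Real.norm_of_nonneg (gauss_nonneg z)

lemma gauss_neg {d : ℕ} (z : Vel d) : gauss (-z) = gauss z := by
  simp [gauss]

/-- Completing the square in `z`: the product is again Gaussian in `z`, with centre `(β / γ ^ 2) •
y` and standard deviation `α / γ`. -/
lemma gauss_mul_gauss {d : ℕ} {α β γ : ℝ} (hα : 0 < α) (hγ : 0 < γ)
    (h : α ^ 2 + β ^ 2 = γ ^ 2) (y z : Vel d) :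
    gauss z * gauss (α⁻¹ • (y - β • z)) = gauss (γ⁻¹ • y) * ((2 * Real.pi) ^ (-(d : ℝ) / 2) *
      Real.exp (-(‖z - (β / γ ^ 2) • y‖ ^ 2 / (2 * (α / γ) ^ 2)))) := by
  have e : -(‖z‖ ^ 2 / 2) + -(‖α⁻¹ • (y - β • z)‖ ^ 2 / 2) =
      -(‖γ⁻¹ • y‖ ^ 2 / 2) + -(‖z - (β / γ ^ 2) • y‖ ^ 2 / (2 * (α / γ) ^ 2)) := by
    rw [norm_smul, norm_smul, mul_pow, mul_pow, norm_sub_sq_real, norm_sub_sq_real]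
    simp only [norm_smul, inner_smul_right, mul_pow, Real.norm_eq_abs, sq_abs]
    rw [real_inner_comm]
    field_simp
    rw [← h]
    ring
  calc _ = (2 * Real.pi) ^ (-(d : ℝ) / 2) * (2 * Real.pi) ^ (-(d : ℝ) / 2) *
        (Real.exp (-(‖z‖ ^ 2 / 2)) * Real.exp (-(‖α⁻¹ • (y - β • z)‖ ^ 2 / 2))) := by
        simp only [gauss]; ring
    _ = _ := by rw [← Real.exp_add, e, Real.exp_add, gauss]; ring

lemma integral_gauss_mul_gauss {d : ℕ} {α β γ : ℝ} (hα : 0 < α) (hγ : 0 < γ)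
    (h : α ^ 2 + β ^ 2 = γ ^ 2) (y : Vel d) :
    ∫ z, gauss z * gauss (α⁻¹ • (y - β • z)) = (α / γ) ^ d * gauss (γ⁻¹ • y) := by
  simp only [gauss_mul_gauss hα hγ h]
  rw [integral_const_mul, integral_const_mul,
    integral_sub_right_eq_self (fun z : Vel d => Real.exp (-(‖z‖ ^ 2 / (2 * (α / γ) ^ 2)))),
    integral_exp_gauss (by positivity), ← mul_assoc ((2 * Real.pi) ^ _),
    ← Real.rpow_add (by positivity), neg_div, neg_add_cancel, Real.rpow_zero]
  ring

lemma integral_comp_affine_vec {d : ℕ} {E : Type*} [NormedAddCommGroup E] [NormedSpace ℝ E]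
    (F : Vel d → E) {α : ℝ} (hα : 0 < α) (b : Vel d) :
    ∫ z, F (α • z + b) = (α ^ d)⁻¹ • ∫ y, F y := by
  rw [Measure.integral_comp_smul volume (fun y => F (y + b)) α,
    integral_add_right_eq_self (fun y => F y) b, finrank_euclideanSpace_fin,
    abs_of_nonneg (by positivity)]

/-- The sum of two independent centred Gaussians is Gaussian. -/
lemma integral_gauss_convolution {d : ℕ} {E : Type*} [NormedAddCommGroup E] [NormedSpace ℝ E]
    [CompleteSpace E]
    {Ψ : Vel d → E} (hΨ : Continuous Ψ) {C : ℝ} (hC : ∀ y, ‖Ψ y‖ ≤ C) {α β γ : ℝ} (hα : 0 < α)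
    (hγ : 0 < γ) (h : α ^ 2 + β ^ 2 = γ ^ 2) :
    ∫ z' : Vel d, ∫ z : Vel d, (gauss z' * gauss z) • Ψ (α • z + β • z') =
      ∫ z : Vel d, gauss z • Ψ (γ • z) := by
  -- Substitute y = α z + β z' in the inner integral. After Fubini the integral over z' is the
  -- convolution computed in `integral_gauss_mul_gauss`.
  have h1 : ∀ z' : Vel d, ∫ z : Vel d, (gauss z' * gauss z) • Ψ (α • z + β • z') =
      ∫ y, (α ^ d)⁻¹ • (gauss z' * gauss (α⁻¹ • (y - β • z'))) • Ψ y := by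
    intro z'
    have := integral_comp_affine_vec
      (fun y => (gauss z' * gauss (α⁻¹ • (y - β • z'))) • Ψ y) hα (β • z')
    rw [integral_smul, ← this]
    congr 1; ext z
    rw [add_sub_cancel_right, smul_smul, inv_mul_cancel₀ hα.ne', one_smul]
  simp only [h1]
  have hcomp : ∀ z' : Vel d, Integrable fun y : Vel d => gauss (α⁻¹ • (y - β • z')) := fun z' =>
    (integrable_gauss.comp_smul (inv_ne_zero hα.ne')).comp_sub_right (β • z')
  have hval : ∀ z' : Vel d, ∫ y : Vel d, gauss (α⁻¹ • (y - β • z')) = α ^ d := fun z' => by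
    rw [integral_sub_right_eq_self (fun y : Vel d => gauss (α⁻¹ • y)) (β • z'),
      Measure.integral_comp_smul volume gauss α⁻¹, integral_gauss, finrank_euclideanSpace_fin,
      abs_of_nonneg (by positivity)]
    simp
  have hprod : Integrable (Function.uncurry fun z' y : Vel d =>
      (α ^ d)⁻¹ • (gauss z' * gauss (α⁻¹ • (y - β • z'))) • Ψ y)
      ((volume : Measure (Vel d)).prod (volume : Measure (Vel d))) := by
    have hcont : Continuous (Function.uncurry fun z' y : Vel d =>
        (α ^ d)⁻¹ • (gauss z' * gauss (α⁻¹ • (y - β • z'))) • Ψ y) := by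
      have := continuous_gauss (d := d)
      unfold Function.uncurry
      fun_prop
    have hm := hcont.aestronglyMeasurable (μ := (volume : Measure (Vel d)).prod volume)
    have hpt : ∀ z' y : Vel d, ‖(α ^ d)⁻¹ • (gauss z' * gauss (α⁻¹ • (y - β • z'))) • Ψ y‖ ≤
        (α ^ d)⁻¹ * (gauss z' * gauss (α⁻¹ • (y - β • z'))) * C := fun z' y => by
      rw [norm_smul, norm_smul, ← mul_assoc, Real.norm_of_nonneg (by positivity),
        Real.norm_of_nonneg (mul_nonneg (gauss_nonneg _) (gauss_nonneg _))]
      exact mul_le_mul_of_nonneg_left (hC y)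
        (mul_nonneg (by positivity) (mul_nonneg (gauss_nonneg _) (gauss_nonneg _)))
    have hi : ∀ z' : Vel d, Integrable fun y : Vel d =>
        (α ^ d)⁻¹ * (gauss z' * gauss (α⁻¹ • (y - β • z'))) * C := fun z' =>
      (((hcomp z').const_mul _).const_mul _).mul_const _
    rw [integrable_prod_iff hm]
    refine ⟨Eventually.of_forall fun z' => (hi z').mono' ?_ (Eventually.of_forall (hpt z')), ?_⟩
    · exact (hcont.comp (Continuous.prodMk_right z')).aestronglyMeasurable
    · refine (integrable_gauss.mul_const C).mono' hm.norm.integral_prod_right'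
        (Eventually.of_forall fun z' => ?_)
      rw [Real.norm_of_nonneg (integral_nonneg fun _ => norm_nonneg _)]
      refine (integral_mono_of_nonneg (Eventually.of_forall fun _ => norm_nonneg _) (hi z')
        (Eventually.of_forall (hpt z'))).trans (le_of_eq ?_)
      rw [integral_mul_const, integral_const_mul, integral_const_mul, hval]
      field_simp
  rw [integral_integral_swap hprod]
  have h2 : ∀ y : Vel d, ∫ z', (α ^ d)⁻¹ • (gauss z' * gauss (α⁻¹ • (y - β • z'))) • Ψ y =
      (γ ^ d)⁻¹ • gauss (γ⁻¹ • y) • Ψ y := fun y => by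
    simp only [smul_smul]
    rw [integral_smul_const, integral_const_mul, integral_gauss_mul_gauss hα hγ h]
    rw [div_pow]
    congr 1
    have h3 : (α ^ d) ≠ 0 := by positivity
    field_simp
  simp only [h2]
  have h3 := integral_comp_affine_vec (fun y => gauss (γ⁻¹ • y) • Ψ y) hγ 0
  rw [integral_smul, ← h3]
  congr 1; ext z
  rw [add_zero, smul_smul, inv_mul_cancel₀ hγ.ne', one_smul]

/-! ### The semigroup as an average over affine compositions -/

/-- The standard deviation of the noise at time `t`. -/
def sig (t : ℝ) : ℝ := √(Real.exp (2 * t) - 1)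

lemma continuous_sig : Continuous sig := by unfold sig; fun_prop

lemma sig_nonneg (t : ℝ) : 0 ≤ sig t := Real.sqrt_nonneg _

lemma sig_pos {t : ℝ} (ht : 0 < t) : 0 < sig t :=
  Real.sqrt_pos.2 (by linarith [Real.add_one_lt_exp (x := 2 * t) (by positivity)])

lemma sig_of_nonpos {t : ℝ} (ht : t ≤ 0) : sig t = 0 :=
  Real.sqrt_eq_zero_of_nonpos (by linarith [Real.exp_le_one_iff.2 (by linarith : 2 * t ≤ 0)])

lemma sig_sq {t : ℝ} (ht : 0 ≤ t) : sig t ^ 2 = Real.exp (2 * t) - 1 :=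
  Real.sq_sqrt (by linarith [Real.one_le_exp (by linarith : 0 ≤ 2 * t)])

/-- The semigroup `P_t` as a bounded operator. -/
def ouOp {d : ℕ} (t : ℝ) : L2V d →L[ℝ] L2V d := kerOp integrable_gauss (Real.exp t) (sig t)

lemma norm_ouOp_le {d : ℕ} (t : ℝ) (u : L2V d) : ‖ouOp t u‖ ≤ ‖u‖ := by
  have := norm_kerOp_le integrable_gauss (Real.exp t) (sig t) u
  rwa [integral_norm_gauss, one_mul] at this

/-- For `t ≤ 0` two defaults meet: the factor `e^t` is replaced by `1`, and `sig t = 0` because the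
real square root vanishes on negative numbers. -/
lemma ouOp_of_nonpos {d : ℕ} {t : ℝ} (ht : t ≤ 0) (u : L2V d) : ouOp t u = u := by
  rw [ouOp, kerOp_apply]
  simp only [sig_of_nonpos ht, zero_smul, affComp_zero (Real.exp_le_one_iff.2 ht)]
  rw [integral_smul_const, integral_gauss, one_smul]

/-- The substitution `w = sig t • z` turns the kernel at time `t` into the standard Gaussian and
moves all dependence on time into the affine map. -/
lemma ouSemigroup_eq {d : ℕ} (t : ℝ) (u : L2V d) : ouSemigroup t u = ouOp t u := by
  by_cases ht : 0 < t
  · rw [ouSemigroup, dif_pos ht, ouOp]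
    refine (kerOp_eq_toLp integrable_gauss continuous_gauss.stronglyMeasurable _ _ u _
      fun v => ?_).symm
    have hs := sig_pos ht
    have h1 : ∀ z : Vel d, gauss z * u (affMap (Real.exp t) (sig t • z) v) =
        (fun w => (sig t) ^ d * (ouKernel d t w * u (Real.exp t • v - w))) (sig t • z + 0) := by
      intro z
      simp only [add_zero]
      rw [affMap_of_one_le (Real.one_le_exp ht.le), ← mul_assoc]
      congr 1
      rw [ouKernel, ← sig_sq ht.le, gauss, norm_smul, Real.norm_of_nonneg hs.le, mul_pow,
        Real.mul_rpow (x := 2 * Real.pi) (by positivity) (by positivity),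
        ← Real.rpow_natCast (sig t) 2,
        ← Real.rpow_mul hs.le, ← Real.rpow_natCast (sig t) d]
      have h2 : sig t ^ (d : ℝ) * sig t ^ (((2 : ℕ) : ℝ) * (-(d : ℝ) / 2)) = 1 := by
        rw [← Real.rpow_add hs]
        have : (d : ℝ) + ((2 : ℕ) : ℝ) * (-(d : ℝ) / 2) = 0 := by push_cast; ring
        rw [this, Real.rpow_zero]
      have h3 : sig t ^ ((2 : ℕ) : ℝ) * ‖z‖ ^ 2 / (2 * sig t ^ ((2 : ℕ) : ℝ)) = ‖z‖ ^ 2 / 2 := by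
        have : sig t ^ ((2 : ℕ) : ℝ) ≠ 0 := by positivity
        field_simp
      rw [h3]
      linear_combination (-(2 * Real.pi) ^ (-(d : ℝ) / 2) * Real.exp (-(‖z‖ ^ 2 / 2))) * h2
    rw [integral_congr_ae (Eventually.of_forall h1), integral_comp_affine_vec
      (fun w => (sig t) ^ d * (ouKernel d t w * u (Real.exp t • v - w))) hs, integral_const_mul, smul_eq_mul, ← mul_assoc,
      inv_mul_cancel₀ (by positivity), one_mul, ouFun]
  · rw [ouSemigroup, dif_neg ht, ouOp_of_nonpos (not_lt.1 ht)]

/-- Composing the affine maps gives the noise e^t σ_s z + σ_t z' with independent standard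
Gaussians. It is again Gaussian, with variance e^{2t}(e^{2s} - 1) + (e^{2t} - 1) = e^{2(s+t)} - 1.
-/
lemma ouOp_add {d : ℕ} {s t : ℝ} (hs : 0 ≤ s) (ht : 0 ≤ t) (u : L2V d) :
    ouOp (s + t) u = ouOp s (ouOp t u) := by
  rcases hs.eq_or_lt with rfl | hs'
  · rw [zero_add, ouOp_of_nonpos le_rfl]
  have hes := Real.one_le_exp hs
  have het := Real.one_le_exp ht
  have h1 : ∀ z : Vel d, affComp (Real.exp s) (sig s • z) (ouOp t u) =
      ∫ z' : Vel d, gauss z' • affComp (Real.exp (s + t))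
        ((Real.exp t * sig s) • z + sig t • z') u := fun z => by
    rw [ouOp, kerOp_apply,
      ← (affComp _ _).integral_comp_comm (integrable_smul_affComp integrable_gauss _ _ u)]
    congr 1; ext1 z'
    rw [map_smul, affComp_affComp hes het, ← Real.exp_add, add_comm t s, smul_smul]
  symm
  rw [ouOp, kerOp_apply]
  simp only [h1, ← integral_smul, smul_smul]
  have hcont : Continuous fun y : Vel d => affComp (Real.exp (s + t)) y u :=
    (continuous_affComp u).comp (f := fun y : Vel d => (Real.exp (s + t), y)) (by fun_prop)
  rcases ht.eq_or_lt with rfl | ht'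
  · simp only [sig_of_nonpos le_rfl, zero_smul, add_zero, Real.exp_zero, one_mul]
    rw [ouOp, kerOp_apply]
    congr 1; ext1 z
    rw [integral_smul_const, integral_const_mul, integral_gauss, mul_one]
  have := integral_gauss_convolution (α := sig t) (β := Real.exp t * sig s) (γ := sig (s + t))
    hcont (fun y => norm_affComp_le _ y u) (sig_pos ht')
    (sig_pos (by linarith)) (by
      rw [mul_pow, sig_sq hs, sig_sq ht, sig_sq (by linarith), ← Real.exp_nat_mul,
        show 2 * (s + t) = ((2 : ℕ) : ℝ) * t + 2 * s by push_cast; ring, Real.exp_add]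
      push_cast; ring)
  rw [ouOp, kerOp_apply, ← this]
  congr 1; ext1 z; congr 1; ext1 z'
  rw [add_comm (sig t • z')]

lemma tendsto_ouOp {d : ℕ} {α : Type*} {l : Filter α} [l.IsCountablyGenerated] {t : α → ℝ}
    {u : α → L2V d} {t₀ : ℝ} {u₀ : L2V d} (ht : Tendsto t l (𝓝 t₀)) (hu : Tendsto u l (𝓝 u₀)) :
    Tendsto (fun x => ouOp (t x) (u x)) l (𝓝 (ouOp t₀ u₀)) :=
  tendsto_kerOp _ ((Real.continuous_exp.tendsto _).comp ht) ((continuous_sig.tendsto _).comp ht) hu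

/-! ### Restriction and duality with test functions -/

/-- Restriction of `L²` functions to `V`. -/
def rs {d : ℕ} (V : Set (Vel d)) : L2V d →L[ℝ] L2 V := LpToLpRestrictCLM (Vel d) ℝ ℝ volume 2 V

lemma coeFn_rs {d : ℕ} (V : Set (Vel d)) (u : L2V d) : rs V u =ᵐ[volume.restrict V] u :=
  LpToLpRestrictCLM_coeFn ℝ V u

lemma norm_rs {d : ℕ} (V : Set (Vel d)) (u : L2V d) :
    ‖rs V u‖ = (eLpNorm u 2 (volume.restrict V)).toReal := by
  rw [Lp.norm_def, eLpNorm_congr_ae (coeFn_rs V u)]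

lemma norm_rs_mono {d : ℕ} {V W : Set (Vel d)} (h : V ⊆ W) (u : L2V d) :
    ‖rs V u‖ ≤ ‖rs W u‖ := by
  rw [norm_rs, norm_rs]
  exact ENNReal.toReal_mono ((Lp.memLp u).restrict W).2.ne
    (eLpNorm_mono_measure _ (Measure.restrict_mono h le_rfl))

lemma norm_rs_univ {d : ℕ} (u : L2V d) : ‖rs univ u‖ = ‖u‖ := by
  rw [norm_rs, Measure.restrict_univ, Lp.norm_def]

lemma norm_rs_le {d : ℕ} (V : Set (Vel d)) (u : L2V d) : ‖rs V u‖ ≤ ‖u‖ :=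
  (norm_rs_mono (subset_univ V) u).trans (norm_rs_univ u).le

lemma integral_mul_eq_inner {d : ℕ} {ψ : Vel d → ℝ} (hψ : MemLp ψ 2 volume) (u : L2V d) :
    ∫ v, u v * ψ v = inner ℝ (hψ.toLp ψ) u := by
  rw [inner_eq_integral]
  refine integral_congr_ae ?_
  filter_upwards [hψ.coeFn_toLp] with v hv
  rw [hv, mul_comm]

lemma abs_integral_mul_le {d : ℕ} {W : Set (Vel d)} {ψ : Vel d → ℝ}
    (hψ : MemLp ψ 2 volume) (hs : Function.support ψ ⊆ W) (u : L2V d) :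
    |∫ v, u v * ψ v| ≤ ‖rs W u‖ * ‖hψ.toLp ψ‖ := by
  have h1 : ∫ v, u v * ψ v = ∫ v in W, u v * ψ v := by
    refine (setIntegral_eq_integral_of_forall_compl_eq_zero fun v hv => ?_).symm
    rw [Function.notMem_support.1 fun h => hv (hs h), mul_zero]
  have hψ' : MemLp ψ 2 (volume.restrict W) := hψ.restrict W
  have h2 : ∫ v in W, u v * ψ v = inner ℝ (hψ'.toLp ψ) (rs W u) := by
    rw [L2.inner_def]
    refine integral_congr_ae ?_
    filter_upwards [hψ'.coeFn_toLp, coeFn_rs W u] with v h3 h4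
    rw [h3, h4]
    simp
  have h3 : ‖hψ'.toLp ψ‖ ≤ ‖hψ.toLp ψ‖ := by
    rw [Lp.norm_toLp, Lp.norm_toLp]
    exact ENNReal.toReal_mono hψ.2.ne (eLpNorm_mono_measure _ Measure.restrict_le_self)
  rw [h1, h2]
  refine (abs_real_inner_le_norm _ _).trans ?_
  rw [mul_comm]
  gcongr

/-- Smooth functions with compact support in `V`. -/
structure IsTest {d : ℕ} (V : Set (Vel d)) (φ : Vel d → ℝ) : Prop where
  smooth : ContDiff ℝ ∞ φ
  compact : HasCompactSupport φ
  subset : tsupport φ ⊆ V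

lemma IsTest.memLp {d : ℕ} {V : Set (Vel d)} {φ : Vel d → ℝ} (h : IsTest V φ)
    (μ : Measure (Vel d) := volume) [IsFiniteMeasureOnCompacts μ] : MemLp φ 2 μ :=
  h.smooth.continuous.memLp_of_hasCompactSupport h.compact

lemma IsTest.add {d : ℕ} {V : Set (Vel d)} {φ ψ : Vel d → ℝ} (hφ : IsTest V φ)
    (hψ : IsTest V ψ) : IsTest V (φ + ψ) :=
  ⟨hφ.smooth.add hψ.smooth, hφ.compact.add hψ.compact,
    (tsupport_add φ ψ).trans (union_subset hφ.subset hψ.subset)⟩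

/-- Test functions as a subspace of `L²(V)`. -/
def testSubmodule {d : ℕ} (V : Set (Vel d)) : Submodule ℝ (L2 V) where
  carrier := {x | ∃ φ : Vel d → ℝ, IsTest V φ ∧ x =ᵐ[volume.restrict V] φ}
  add_mem' := by
    rintro x y ⟨φ, hφ, hx⟩ ⟨ψ, hψ, hy⟩
    exact ⟨φ + ψ, hφ.add hψ, (Lp.coeFn_add x y).trans (hx.add hy)⟩
  zero_mem' := ⟨0, ⟨contDiff_const, HasCompactSupport.zero, by simp [tsupport]⟩,
    Lp.coeFn_zero _ _ _⟩
  smul_mem' := by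
    rintro c x ⟨φ, hφ, hx⟩
    refine ⟨c • φ, ⟨hφ.smooth.const_smul c, hφ.compact.smul_left (f := fun _ => c),
      (closure_mono (Function.support_const_smul_subset c φ)).trans hφ.subset⟩,
      (Lp.coeFn_smul c x).trans (hx.const_smul c)⟩

/-- An element orthogonal to all test functions vanishes almost everywhere on `V` by the fundamental
lemma of the calculus of variations. -/
lemma testSubmodule_closure_eq_top {d : ℕ} {V : Set (Vel d)} (hV : IsOpen V) :
    (testSubmodule V).topologicalClosure = ⊤ := by
  rw [Submodule.topologicalClosure_eq_top_iff, Submodule.eq_bot_iff]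
  intro x hx
  have hli : LocallyIntegrableOn x V (volume.restrict V) :=
    ((Lp.memLp x).locallyIntegrable (by norm_num)).locallyIntegrableOn V
  have h := hV.ae_eq_zero_of_integral_contDiff_smul_eq_zero hli fun g hg hgc hgs => by
    have hgm : MemLp g 2 (volume.restrict V) := (IsTest.mk hg hgc hgs).memLp _
    have h1 := (Submodule.mem_orthogonal _ _).1 hx (hgm.toLp g)
      ⟨g, ⟨hg, hgc, hgs⟩, hgm.coeFn_toLp⟩
    rw [L2.inner_def] at h1
    rw [← h1]
    refine integral_congr_ae ?_
    filter_upwards [hgm.coeFn_toLp] with v hv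
    rw [hv]
    simp [mul_comm]
  refine Lp.ext ?_
  refine EventuallyEq.trans ?_ (Lp.coeFn_zero _ _ _).symm
  filter_upwards [h, ae_restrict_mem hV.measurableSet] with v h1 h2
  simpa using h1 h2

/-- `‖w‖_{L²(V)}` is determined by duality with test functions in `V`. -/
lemma norm_rs_le_of_forall_test {d : ℕ} {V : Set (Vel d)} (hV : IsOpen V) {w : L2V d} {C : ℝ}
    (hC : 0 ≤ C) (h : ∀ φ, ∀ hφ : IsTest V φ, |∫ v, w v * φ v| ≤ C * ‖hφ.memLp.toLp φ‖) :
    ‖rs V w‖ ≤ C := by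
  have hK : ∀ x ∈ testSubmodule V, |inner ℝ (rs V w) x| ≤ C * ‖x‖ := by
    rintro x ⟨φ, hφ, hx⟩
    have h1 : inner ℝ (rs V w) x = ∫ v, w v * φ v := by
      rw [L2.inner_def, ← setIntegral_eq_integral_of_forall_compl_eq_zero (s := V)
        (f := fun v => w v * φ v) (fun v hv => by
        rw [image_eq_zero_of_notMem_tsupport fun h => hv (hφ.subset h), mul_zero])]
      refine integral_congr_ae ?_
      filter_upwards [hx, coeFn_rs V w] with v h1 h2
      rw [h1, h2]
      simp [mul_comm]
    have h2 : ‖x‖ = ‖hφ.memLp.toLp φ‖ := by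
      rw [Lp.norm_def, eLpNorm_congr_ae hx, Lp.norm_toLp,
        eLpNorm_restrict_eq_of_support_subset ((subset_tsupport φ).trans hφ.subset)]
    rw [h1, h2]
    exact h φ hφ
  have hd : Dense (testSubmodule V : Set (L2 V)) :=
    Submodule.dense_iff_topologicalClosure_eq_top.2 (testSubmodule_closure_eq_top hV)
  have hall : ∀ x : L2 V, |inner ℝ (rs V w) x| ≤ C * ‖x‖ := by
    intro x
    have hcl : IsClosed {x : L2 V | |inner ℝ (rs V w) x| ≤ C * ‖x‖} :=
      isClosed_le ((continuous_const.inner continuous_id).abs)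
        (continuous_const.mul continuous_norm)
    exact hcl.closure_subset_iff.2 hK (hd x)
  -- By density the bound holds on all of L²(V); at `w` itself it reads ‖w‖² ≤ C ‖w‖.
  have h1 := hall (rs V w)
  rw [real_inner_self_eq_norm_sq, abs_of_nonneg (by positivity), sq] at h1
  by_contra! hlt
  exact absurd h1 (not_le.2 (mul_lt_mul_of_pos_right hlt (hC.trans_lt hlt)))

/-! ### Weak partial derivatives on the whole space -/

/-- The `i`-th basis vector. -/
abbrev basisVec {d : ℕ} (i : Fin d) : Vel d := EuclideanSpace.single i 1

/-- `g` is the weak partial derivative `∂_i u` on `ℝ^d`. -/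
def HasWeakPartial {d : ℕ} (i : Fin d) (u g : L2V d) : Prop :=
  ∀ φ : Vel d → ℝ, IsTest univ φ →
    ∫ v, u v * fderiv ℝ φ v (basisVec i) = - ∫ v, g v * φ v

lemma IsTest.memLp_fderiv {d : ℕ} {V : Set (Vel d)} {φ : Vel d → ℝ} (h : IsTest V φ) (e : Vel d) :
    MemLp (fun v => fderiv ℝ φ v e) 2 volume :=
  ((h.smooth.continuous_fderiv (by simp)).clm_apply continuous_const).memLp_of_hasCompactSupport
    (h.compact.fderiv_apply ℝ e)

lemma HasWeakPartial.isWeakPartial {d : ℕ} {i : Fin d} {u g : L2V d} (h : HasWeakPartial i u g)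
    (V : Set (Vel d)) : IsWeakPartial V i (rs V u) (rs V g) := by
  intro φ hφ hc hs
  have key : ∀ (w : L2V d) (ψ : Vel d → ℝ), Function.support ψ ⊆ V →
      ∫ v in V, (rs V w) v * ψ v = ∫ v, w v * ψ v := by
    intro w ψ hψ
    rw [← setIntegral_eq_integral_of_forall_compl_eq_zero (s := V)
      (f := fun v => w v * ψ v) (fun v hv => by
        rw [Function.notMem_support.1 fun h => hv (hψ h), mul_zero])]
    refine integral_congr_ae ?_
    filter_upwards [coeFn_rs V w] with v hv
    rw [hv]
  rw [key u _ ?_, key g _ ((subset_tsupport φ).trans hs)]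
  · exact h φ ⟨hφ, hc, subset_univ _⟩
  · refine Subset.trans (fun v hv => support_fderiv_subset ℝ (f := φ) fun h0 => hv ?_) hs
    simp only
    rw [h0, zero_apply]

/-- Serves to identify derivatives obtained in two different ways, which replaces computations with
kernels and glues locally constructed jets. -/
lemma HasWeakPartial.unique {d : ℕ} {i : Fin d} {u g g' : L2V d} (h : HasWeakPartial i u g)
    (h' : HasWeakPartial i u g') : g = g' := by
  rw [← sub_eq_zero, ← norm_le_zero_iff, ← norm_rs_univ]
  refine norm_rs_le_of_forall_test isOpen_univ le_rfl fun φ hφ => ?_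
  rw [integral_mul_eq_inner hφ.memLp, inner_sub_right, ← integral_mul_eq_inner hφ.memLp,
    ← integral_mul_eq_inner hφ.memLp]
  have e := h φ hφ
  have e' := h' φ hφ
  rw [e, neg_inj] at e'
  simp [e']

/-- Both pairings are continuous linear functionals of `(u, g)`. Hence the relation survives linear
combinations and Bochner integrals. -/
lemma hasWeakPartial_iff_inner {d : ℕ} {i : Fin d} {u g : L2V d} : HasWeakPartial i u g ↔
    ∀ φ, ∀ hφ : IsTest univ φ, inner ℝ ((hφ.memLp_fderiv (basisVec i)).toLp _) u +
      inner ℝ (hφ.memLp.toLp φ) g = 0 := by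
  unfold HasWeakPartial
  refine forall_congr' fun φ => forall_congr' fun hφ => ?_
  rw [integral_mul_eq_inner (hφ.memLp_fderiv (basisVec i)), integral_mul_eq_inner hφ.memLp,
    eq_neg_iff_add_eq_zero]

lemma HasWeakPartial.add {d : ℕ} {i : Fin d} {u g u' g' : L2V d} (h : HasWeakPartial i u g)
    (h' : HasWeakPartial i u' g') : HasWeakPartial i (u + u') (g + g') := by
  rw [hasWeakPartial_iff_inner] at *
  intro φ hφ
  rw [inner_add_right, inner_add_right]
  linarith [h φ hφ, h' φ hφ]

lemma HasWeakPartial.const_smul {d : ℕ} {i : Fin d} {u g : L2V d} (h : HasWeakPartial i u g)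
    (c : ℝ) : HasWeakPartial i (c • u) (c • g) := by
  rw [hasWeakPartial_iff_inner] at *
  intro φ hφ
  rw [inner_smul_right, inner_smul_right, ← mul_add, h φ hφ, mul_zero]

lemma HasWeakPartial.sub {d : ℕ} {i : Fin d} {u g u' g' : L2V d} (h : HasWeakPartial i u g)
    (h' : HasWeakPartial i u' g') : HasWeakPartial i (u - u') (g - g') := by
  have := h.add (h'.const_smul (-1))
  simpa [sub_eq_add_neg] using this

lemma HasWeakPartial.integral {d : ℕ} {i : Fin d} {α : Type*} [MeasurableSpace α] {μ : Measure α}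
    {u g : α → L2V d} (hu : Integrable u μ) (hg : Integrable g μ)
    (h : ∀ᵐ s ∂μ, HasWeakPartial i (u s) (g s)) :
    HasWeakPartial i (∫ s, u s ∂μ) (∫ s, g s ∂μ) := by
  rw [hasWeakPartial_iff_inner]
  intro φ hφ
  have e1 := (innerSL ℝ ((hφ.memLp_fderiv (basisVec i)).toLp _)).integral_comp_comm hu
  have e2 := (innerSL ℝ (hφ.memLp.toLp φ)).integral_comp_comm hg
  simp only [innerSL_apply_apply] at e1 e2
  rw [← e1, ← e2, ← integral_add (hu.const_inner _) (hg.const_inner _)]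
  refine integral_eq_zero_of_ae ?_
  filter_upwards [h] with s hs
  exact hasWeakPartial_iff_inner.1 hs φ hφ

lemma integral_affComp_mul {d : ℕ} {a : ℝ} (ha : 1 ≤ a) (w : Vel d) (u : L2V d) (ψ : Vel d → ℝ) :
    ∫ v, (affComp a w u) v * ψ v = (a ^ d)⁻¹ * ∫ y, u y * ψ (a⁻¹ • (y + w)) := by
  have h0 : 0 < a := one_pos.trans_le ha
  rw [← smul_eq_mul, ← integral_comp_affine_vec (fun y => u y * ψ (a⁻¹ • (y + w))) h0 (-w)]
  refine integral_congr_ae ?_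
  filter_upwards [coeFn_affComp a w u] with v hv
  rw [hv, affMap_of_one_le ha, neg_add_cancel_right, smul_smul, inv_mul_cancel₀ h0.ne', one_smul,
    sub_eq_add_neg]

lemma integral_translate_mul {d : ℕ} (h : Vel d) (u : L2V d) (ψ : Vel d → ℝ) :
    ∫ v, (affComp 1 h u) v * ψ v = ∫ y, u y * ψ (y + h) := by
  rw [integral_affComp_mul le_rfl]
  simp

lemma IsTest.comp_affine {d : ℕ} {V W : Set (Vel d)} {φ : Vel d → ℝ} (hφ : IsTest V φ) {b : ℝ}
    (hb : b ≠ 0) (w : Vel d) (hW : ∀ y, b • (y + w) ∈ V → y ∈ W) :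
    IsTest W fun y => φ (b • (y + w)) := by
  have e : (fun y => φ (b • (y + w))) = φ ∘ ((Homeomorph.addRight w).trans
    (Homeomorph.smulOfNeZero b hb)) := rfl
  refine ⟨hφ.smooth.comp (by fun_prop), ?_, ?_⟩
  · rw [e]
    exact hφ.compact.comp_homeomorph _
  · rw [e, tsupport_comp_eq_preimage]
    exact fun y hy => hW y (hφ.subset hy)

lemma fderiv_comp_affine {d : ℕ} {φ : Vel d → ℝ} (hφ : ContDiff ℝ ∞ φ) (b : ℝ) (w y e : Vel d) :
    fderiv ℝ (fun y => φ (b • (y + w))) y e = b * fderiv ℝ φ (b • (y + w)) e := by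
  have h1 : HasFDerivAt (fun y : Vel d => b • (y + w)) (b • ContinuousLinearMap.id ℝ (Vel d)) y :=
    ((hasFDerivAt_id y).add_const w).const_smul b
  have h2 : HasFDerivAt φ (fderiv ℝ φ (b • (y + w))) (b • (y + w)) :=
    ((hφ.differentiable (by simp)) _).hasFDerivAt
  have h3 : HasFDerivAt (fun y => φ (b • (y + w))) _ y := h2.comp y h1
  rw [h3.fderiv]
  simp

lemma HasWeakPartial.affComp {d : ℕ} {i : Fin d} {u g : L2V d} (h : HasWeakPartial i u g) {a : ℝ}
    (ha : 1 ≤ a) (w : Vel d) : HasWeakPartial i (affComp a w u) (a • affComp a w g) := by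
  intro φ hφ
  have h0 : a ≠ 0 := (one_pos.trans_le ha).ne'
  have hφ' : IsTest univ fun y => φ (a⁻¹ • (y + w)) :=
    hφ.comp_affine (inv_ne_zero h0) w fun _ _ => mem_univ _
  have h1 := h _ hφ'
  simp only [fderiv_comp_affine hφ.smooth] at h1
  rw [integral_affComp_mul ha]
  have h2 : ∫ v, (a • Smoluchowski.affComp a w g) v * φ v =
      a * ∫ v, (Smoluchowski.affComp a w g) v * φ v := by
    rw [← integral_const_mul]
    refine integral_congr_ae ?_
    filter_upwards [Lp.coeFn_smul a (Smoluchowski.affComp a w g)] with v hv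
    rw [hv, Pi.smul_apply, smul_eq_mul, mul_assoc]
  rw [h2, integral_affComp_mul ha]
  have h3 : ∫ y, u y * (a⁻¹ * fderiv ℝ φ (a⁻¹ • (y + w)) (basisVec i)) =
      a⁻¹ * ∫ y, u y * fderiv ℝ φ (a⁻¹ • (y + w)) (basisVec i) := by
    rw [← integral_const_mul]; congr 1; ext y; ring
  rw [h3] at h1
  have h4 : ∫ y, u y * fderiv ℝ φ (a⁻¹ • (y + w)) (basisVec i) =
      -(a * ∫ y, g y * φ (a⁻¹ • (y + w))) := by
    rw [inv_mul_eq_iff_eq_mul₀ h0] at h1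
    linarith
  rw [h4]; ring

lemma HasWeakPartial.kerOp {d : ℕ} {i : Fin d} {u g : L2V d} (h : HasWeakPartial i u g)
    {k : Vel d → ℝ} (hk : Integrable k) {a : ℝ} (ha : 1 ≤ a) (c : ℝ) :
    HasWeakPartial i (kerOp hk a c u) (a • kerOp hk a c g) := by
  rw [kerOp_apply, kerOp_apply, ← integral_smul]
  refine HasWeakPartial.integral (integrable_smul_affComp hk a c u)
    ((integrable_smul_affComp hk a c g).smul a) (Eventually.of_forall fun z => ?_)
  have := (h.affComp ha (c • z)).const_smul (k z)
  rwa [smul_comm] at this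

/-- Differentiation under the integral against a smooth family of compactly supported functions. -/
lemma hasDerivAt_integral_mul {d : ℕ} (u : L2V d) {Φ Φ' : ℝ → Vel d → ℝ} {s₀ r : ℝ}
    (hΦ : ∀ s, Continuous (Φ s)) (hΦ' : Continuous (Function.uncurry Φ'))
    (hd : ∀ s x, HasDerivAt (fun s => Φ s x) (Φ' s x) s)
    (hs : ∀ s ∈ Metric.ball s₀ 1, ∀ x ∉ Metric.closedBall 0 r, Φ s x = 0 ∧ Φ' s x = 0) :
    HasDerivAt (fun s => ∫ x, u x * Φ s x) (∫ x, u x * Φ' s₀ x) s₀ := by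
  have hcomp : IsCompact (Metric.closedBall s₀ 1 ×ˢ Metric.closedBall (0 : Vel d) r) :=
    (isCompact_closedBall _ _).prod (isCompact_closedBall _ _)
  obtain ⟨C, hC⟩ := hcomp.exists_bound_of_continuousOn hΦ'.continuousOn
  have hind : MemLp ((Metric.closedBall (0 : Vel d) r).indicator fun _ => C) 2 volume :=
    memLp_indicator_const 2 Metric.isClosed_closedBall.measurableSet C
      (Or.inr (isCompact_closedBall _ _).measure_lt_top.ne)
  have hs₀ := Metric.mem_ball_self (x := s₀) one_pos
  have hcs : HasCompactSupport (Φ s₀) := HasCompactSupport.intro (isCompact_closedBall (0 : Vel d) r)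
    fun x hx => (hs s₀ hs₀ x hx).1
  refine (hasDerivAt_integral_of_dominated_loc_of_deriv_le (s := Metric.ball s₀ 1)
    (F := fun s x => u x * Φ s x) (F' := fun s x => u x * Φ' s x)
    (bound := fun x => ‖u x * (Metric.closedBall (0 : Vel d) r).indicator (fun _ => C) x‖)
    (Metric.ball_mem_nhds s₀ one_pos) ?_ ?_ ?_ ?_ ?_ ?_).2
  · exact Eventually.of_forall fun s =>
      (Lp.aestronglyMeasurable u).mul (hΦ s).aestronglyMeasurable
  · have : MemLp (Φ s₀) 2 volume := (hΦ s₀).memLp_of_hasCompactSupport hcs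
    exact (Lp.memLp u).integrable_mul this
  · exact (Lp.aestronglyMeasurable u).mul
      (hΦ'.comp (Continuous.prodMk_right s₀)).aestronglyMeasurable
  · refine Eventually.of_forall fun x s hs' => ?_
    rw [norm_mul, norm_mul]
    gcongr
    by_cases hx : x ∈ Metric.closedBall (0 : Vel d) r
    · rw [indicator_of_mem hx]
      exact (hC (s, x) ⟨Metric.ball_subset_closedBall hs', hx⟩).trans (Real.le_norm_self C)
    · rw [(hs s hs' x hx).2]
      simp
  · exact ((Lp.memLp u).integrable_mul hind).norm
  · exact Eventually.of_forall fun x s _ => (hd s x).const_mul (u x)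

lemma IsTest.exists_radius {d : ℕ} {V : Set (Vel d)} {φ : Vel d → ℝ} (hφ : IsTest V φ) :
    ∃ r, ∀ x ∉ Metric.closedBall 0 r, φ x = 0 ∧ fderiv ℝ φ x = 0 := by
  obtain ⟨r, hr⟩ := hφ.compact.isCompact.isBounded.subset_closedBall (0 : Vel d)
  refine ⟨r, fun x hx => ⟨image_eq_zero_of_notMem_tsupport fun h => hx (hr h), ?_⟩⟩
  by_contra h
  exact hx (hr (support_fderiv_subset ℝ h))

lemma hasDerivAt_integral_translate {d : ℕ} (u : L2V d) {V : Set (Vel d)} {φ : Vel d → ℝ}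
    (hφ : IsTest V φ) (h : Vel d) (s₀ : ℝ) :
    HasDerivAt (fun s : ℝ => ∫ x, u x * φ (x + s • h))
      (∫ x, u x * fderiv ℝ φ (x + s₀ • h) h) s₀ := by
  obtain ⟨r, hr⟩ := hφ.exists_radius
  have hc := hφ.smooth.continuous
  have hc' := hφ.smooth.continuous_fderiv (by simp)
  refine hasDerivAt_integral_mul u (Φ := fun s x => φ (x + s • h))
    (Φ' := fun s x => fderiv ℝ φ (x + s • h) h) (r := r + (|s₀| + 1) * ‖h‖) (fun s => by fun_prop)
    ?_ (fun s x => ?_) (fun s hs x hx => ?_)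
  · exact (hc'.comp (by fun_prop)).clm_apply continuous_const
  · have h1 : HasDerivAt (fun s : ℝ => x + s • h) h s := by
      simpa using ((hasDerivAt_id s).smul_const h).const_add x
    exact ((hφ.smooth.differentiable (by simp)) _).hasFDerivAt.comp_hasDerivAt s h1
  · have hx' : x + s • h ∉ Metric.closedBall (0 : Vel d) r := by
      rw [mem_closedBall_zero_iff, not_le] at hx ⊢
      have h1 : |s| ≤ |s₀| + 1 := by
        have := abs_sub_abs_le_abs_sub s s₀
        rw [Metric.mem_ball, Real.dist_eq] at hs
        linarith
      have h2 := norm_sub_norm_le x (-(s • h))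
      rw [norm_neg, sub_neg_eq_add, norm_smul, Real.norm_eq_abs] at h2
      have h3 := mul_le_mul_of_nonneg_right h1 (norm_nonneg h)
      linarith
    refine ⟨(hr _ hx').1, ?_⟩
    rw [(hr _ hx').2, zero_apply]

lemma integral_kerOp_mul {d : ℕ} {k : Vel d → ℝ} (hk : Integrable k) (a c : ℝ) (u : L2V d)
    {ψ : Vel d → ℝ} (hψ : MemLp ψ 2 volume) :
    ∫ v, (kerOp hk a c u) v * ψ v = ∫ z, k z * ∫ v, (affComp a (c • z) u) v * ψ v := by
  simp only [integral_mul_eq_inner hψ, kerOp_apply]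
  rw [← innerSL_apply_apply ℝ,
    ← (innerSL ℝ (hψ.toLp ψ)).integral_comp_comm (integrable_smul_affComp hk a c u)]
  simp

lemma integrable_mul_integral_affComp {d : ℕ} {k : Vel d → ℝ} (hk : Integrable k) (a c : ℝ)
    (u : L2V d) {ψ : Vel d → ℝ} (hψ : MemLp ψ 2 volume) :
    Integrable fun z => k z * ∫ v, (affComp a (c • z) u) v * ψ v := by
  have := (integrable_smul_affComp hk a c u).const_inner (𝕜 := ℝ) (hψ.toLp ψ)
  refine this.congr (Eventually.of_forall fun z => ?_)
  simp only
  rw [inner_smul_right, integral_mul_eq_inner hψ]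

/-- Shifting `z` by `s • e` translates `v ↦ u (a • v - c • z)` by `(s * c / a) • e`. The translation
can be moved to the smooth `φ`, so no derivative of `u` is needed. -/
lemma hasLineDerivAt_integral_affComp {d : ℕ} {a c : ℝ} (ha : 1 ≤ a) (u : L2V d) {V : Set (Vel d)}
    {φ : Vel d → ℝ} (hφ : IsTest V φ) (z e : Vel d) :
    HasLineDerivAt ℝ (fun z => ∫ v, (affComp a (c • z) u) v * φ v)
      ((c / a) * ∫ v, (affComp a (c • z) u) v * fderiv ℝ φ v e) z e := by
  have h0 : a ≠ 0 := (one_pos.trans_le ha).ne'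
  have h1 := hasDerivAt_integral_translate (affComp a (c • z) u) hφ ((c / a) • e) 0
  have e1 : ∀ s : ℝ, ∫ v, (affComp a (c • (z + s • e)) u) v * φ v =
      ∫ x, (affComp a (c • z) u) x * φ (x + s • (c / a) • e) := by
    intro s
    have e0 : affComp a (c • (z + s • e)) u =
        affComp 1 (s • (c / a) • e) (affComp a (c • z) u) := by
      rw [affComp_affComp le_rfl ha, mul_one]
      congr 2
      rw [smul_add, add_comm, smul_smul, smul_smul, smul_smul]
      congr 2
      field_simp
    rw [e0, integral_translate_mul]
  have e2 : (c / a) * ∫ v, (affComp a (c • z) u) v * fderiv ℝ φ v e =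
      ∫ x, (affComp a (c • z) u) x * fderiv ℝ φ (x + (0 : ℝ) • (c / a) • e) ((c / a) • e) := by
    rw [← integral_const_mul]
    congr 1; ext x
    rw [zero_smul, add_zero, map_smul, smul_eq_mul]; ring
  rw [HasLineDerivAt, e2]
  simp only [e1]
  exact h1

lemma integral_mul_lineDeriv {d : ℕ} {k k' m m' : Vel d → ℝ} {e : Vel d} {b : ℝ} (hb : b ≠ 0)
    (hk : ∀ z, HasLineDerivAt ℝ k (k' z) z e) (hm : ∀ z, HasLineDerivAt ℝ m (b * m' z) z e)
    (i1 : Integrable fun z => k' z * m z) (i2 : Integrable fun z => k z * m' z)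
    (i3 : Integrable fun z => k z * m z) :
    ∫ z, k z * m' z = -(b⁻¹ * ∫ z, k' z * m z) := by
  have i2' : Integrable fun z => k z * (b * m' z) :=
    (i2.const_mul b).congr (Eventually.of_forall fun z => by simp only; ring)
  have ibp := integral_bilinear_hasLineDerivAt_right_eq_neg_left_of_integrable
    (μ := (volume : Measure (Vel d))) (f := k) (f' := k') (g := m)
    (g' := fun z => b * m' z) (v := e) (B := ContinuousLinearMap.mul ℝ ℝ)
    i1 i2' i3 (fun z _ => hk z) (fun z _ => hm z)
  simp only [ContinuousLinearMap.mul_apply'] at ibp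
  have e4 : ∫ z, k z * (b * m' z) = b * ∫ z, k z * m' z := by
    rw [← integral_const_mul]; congr 1; ext z; ring
  rw [e4] at ibp
  rw [← mul_neg, ← ibp, inv_mul_cancel_left₀ hb]

/-- Averages against a differentiable kernel are weakly differentiable. -/
lemma hasWeakPartial_kerOp {d : ℕ} {i : Fin d} {k k' : Vel d → ℝ} (hk : Integrable k)
    (hk' : Integrable k') (hd : ∀ z, HasLineDerivAt ℝ k (k' z) z (basisVec i)) {a c : ℝ}
    (ha : 1 ≤ a) (hc : 0 < c) (u : L2V d) :
    HasWeakPartial i (kerOp hk a c u) ((a / c) • kerOp hk' a c u) := by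
  intro φ hφ
  have h0 : 0 < a := one_pos.trans_le ha
  have hDm := hφ.memLp_fderiv (basisVec i)
  have e3 : ∫ v, ((a / c) • kerOp hk' a c u) v * φ v = (a / c) * ∫ v, (kerOp hk' a c u) v * φ v := by
    rw [integral_mul_eq_inner hφ.memLp, integral_mul_eq_inner hφ.memLp, inner_smul_right]
  rw [e3, integral_kerOp_mul hk a c u hDm, integral_kerOp_mul hk' a c u hφ.memLp, ← inv_div c a]
  -- Differentiating `φ` in the velocity amounts, up to the factor `c / a`, to differentiating the
  -- pairing in `z`; integration by parts in `z` then puts the derivative on the kernel.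
  exact integral_mul_lineDeriv (div_pos hc h0).ne' hd
    (fun z => hasLineDerivAt_integral_affComp (c := c) ha u hφ z (basisVec i))
    (integrable_mul_integral_affComp hk' a c u hφ.memLp)
    (integrable_mul_integral_affComp hk a c u hDm)
    (integrable_mul_integral_affComp hk a c u hφ.memLp)

/-! ### Difference quotients -/

lemma sum_smul_basisVec {d : ℕ} (h : Vel d) : ∑ i, h i • basisVec i = h := by
  have := (EuclideanSpace.basisFun (Fin d) ℝ).sum_repr h
  simpa using this

lemma fderiv_apply_eq_sum {d : ℕ} (φ : Vel d → ℝ) (x h : Vel d) :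
    fderiv ℝ φ x h = ∑ i, h i * fderiv ℝ φ x (basisVec i) := by
  conv_lhs => rw [← sum_smul_basisVec h, map_sum]
  simp

lemma norm_toLp_translate {d : ℕ} {V W : Set (Vel d)} {φ : Vel d → ℝ} (hφ : IsTest V φ)
    (w : Vel d) (hφ' : IsTest W fun y => φ (y + w)) :
    ‖hφ'.memLp.toLp _‖ = ‖hφ.memLp.toLp φ‖ := by
  rw [Lp.norm_toLp, Lp.norm_toLp]
  congr 1
  exact eLpNorm_comp_measurePreserving hφ.smooth.continuous.aestronglyMeasurable
    (measurePreserving_add_right volume w)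

/-- Mean value inequality in weak form: the pairing of `φ` with the translate of `u` by `s • h` is
differentiable in `s`, with derivative the pairing of `-∑ h i • g i` with the shifted test function.
The set `W` contains the segments swept out by `V`. -/
lemma norm_rs_translate_sub_le {d : ℕ} {V W : Set (Vel d)} (hV : IsOpen V) {h : Vel d}
    (hVW : ∀ v ∈ V, ∀ s ∈ Icc (0 : ℝ) 1, v - s • h ∈ W) {u : L2V d} {g : Fin d → L2V d}
    (hg : ∀ i, HasWeakPartial i u (g i)) :
    ‖rs V (affComp 1 h u - u)‖ ≤ ∑ i, |h i| * ‖rs W (g i)‖ := by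
  refine norm_rs_le_of_forall_test hV (by positivity) fun φ hφ => ?_
  have hm : ∫ v, (affComp 1 h u - u) v * φ v =
      (∫ x, u x * φ (x + (1 : ℝ) • h)) - ∫ x, u x * φ (x + (0 : ℝ) • h) := by
    rw [integral_mul_eq_inner hφ.memLp, inner_sub_right, ← integral_mul_eq_inner hφ.memLp,
      ← integral_mul_eq_inner hφ.memLp, integral_translate_mul]
    simp
  rw [hm, ← Real.norm_eq_abs]
  refine norm_image_sub_le_of_norm_deriv_le_segment_01'
    (f := fun s : ℝ => ∫ x, u x * φ (x + s • h))
    (fun s _ => (hasDerivAt_integral_translate u hφ h s).hasDerivWithinAt) fun s hs => ?_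
  have hφs : ∀ W', (∀ y, y + s • h ∈ V → y ∈ W') → IsTest W' fun y => φ (y + s • h) := by
    intro W' hW'
    have := hφ.comp_affine (b := 1) one_ne_zero (s • h) (W := W') (by simpa using hW')
    simpa using this
  have hφu := hφs univ fun _ _ => mem_univ _
  have hφW := hφs W fun y hy => by
    have := hVW _ hy s ⟨hs.1, hs.2.le⟩
    simpa using this
  have e1 : ∫ x, u x * fderiv ℝ φ (x + s • h) h =
      ∑ i, h i * -∫ x, g i x * φ (x + s • h) := by
    simp only [fderiv_apply_eq_sum φ _ h, Finset.mul_sum]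
    have hfd : ∀ x e, fderiv ℝ φ (x + s • h) e = fderiv ℝ (fun y => φ (y + s • h)) x e := by
      intro x e
      have := fderiv_comp_affine hφ.smooth 1 (s • h) x e
      simpa using this.symm
    rw [integral_finsetSum]
    · refine Finset.sum_congr rfl fun i _ => ?_
      rw [← hg i _ hφu, ← integral_const_mul]
      congr 1; ext x
      rw [hfd]; ring
    · intro i _
      have := ((Lp.memLp u).integrable_mul (hφu.memLp_fderiv (basisVec i))).const_mul (h i)
      refine this.congr (Eventually.of_forall fun x => ?_)
      simp only [Pi.mul_apply]
      rw [hfd]; ring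
  rw [e1, Finset.sum_mul]
  refine (norm_sum_le _ _).trans (Finset.sum_le_sum fun i _ => ?_)
  rw [norm_mul, norm_neg, Real.norm_eq_abs, Real.norm_eq_abs, mul_assoc]
  gcongr
  refine (abs_integral_mul_le hφW.memLp ((subset_tsupport _).trans hφW.subset) (g i)).trans ?_
  rw [norm_toLp_translate hφ (s • h) hφW]

lemma norm_translate_sub_le {d : ℕ} {h : Vel d} {u : L2V d} {g : Fin d → L2V d}
    (hg : ∀ i, HasWeakPartial i u (g i)) :
    ‖affComp 1 h u - u‖ ≤ ‖h‖ * ∑ i, ‖g i‖ := by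
  rw [← norm_rs_univ]
  refine (norm_rs_translate_sub_le isOpen_univ (W := univ) (fun _ _ _ _ => mem_univ _) hg).trans ?_
  rw [Finset.mul_sum]
  refine Finset.sum_le_sum fun i _ => ?_
  rw [norm_rs_univ]
  gcongr
  simpa using PiLp.norm_apply_le h i

/-- The symmetric second difference is, up to sign, a first difference by `-h` of the first
difference by `h`, so the first order estimate applies twice. -/
lemma norm_second_difference_le {d : ℕ} {h : Vel d} {u : L2V d} {g : Fin d → L2V d}
    {g' : Fin d → Fin d → L2V d} (hg : ∀ i, HasWeakPartial i u (g i))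
    (hg' : ∀ i j, HasWeakPartial j (g i) (g' i j)) :
    ‖affComp 1 h u + affComp 1 (-h) u - (2 : ℝ) • u‖ ≤ ‖h‖ ^ 2 * ∑ i, ∑ j, ‖g' i j‖ := by
  have e : affComp 1 h u + affComp 1 (-h) u - (2 : ℝ) • u =
      -(affComp 1 (-h) (affComp 1 h u - u) - (affComp 1 h u - u)) := by
    rw [map_sub, affComp_affComp le_rfl le_rfl]
    simp only [one_smul, mul_one, neg_add_cancel, affComp_zero le_rfl, two_smul]
    abel
  have hw : ∀ i, HasWeakPartial i (affComp 1 h u - u) (affComp 1 h (g i) - g i) := fun i => by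
    have := ((hg i).affComp le_rfl h).sub (hg i)
    rwa [one_smul] at this
  rw [e, norm_neg]
  refine (norm_translate_sub_le hw).trans ?_
  rw [norm_neg, sq, mul_assoc, Finset.mul_sum _ (fun i => ∑ j, ‖g' i j‖) ‖h‖]
  exact mul_le_mul_of_nonneg_left
    (Finset.sum_le_sum fun i _ => norm_translate_sub_le (hg' i)) (norm_nonneg h)

/-! ### Dilations -/

/-- The derivative of u(e^s v) in s is the radial derivative e^s v · ∇u(e^s v), whose coefficient is
bounded on bounded sets only; hence the ball of radius `ρ`. -/
lemma norm_rs_dilate_sub_le {d : ℕ} {ρ η : ℝ} (hρ : 0 ≤ ρ) (hη : 0 ≤ η) {u : L2V d}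
    {g : Fin d → L2V d} (hg : ∀ i, HasWeakPartial i u (g i)) :
    ‖rs (Metric.ball 0 ρ) (affComp (Real.exp η) 0 u - u)‖ ≤
      η * (Real.exp η * ρ * ∑ i, ‖g i‖) := by
  refine norm_rs_le_of_forall_test Metric.isOpen_ball (by positivity) fun φ hφ => ?_
  -- `Φ s` is `φ` transported by the adjoint of the dilation, and its derivative in `s` is -div(x
  -- Φ_s).
  set Φ : ℝ → Vel d → ℝ := fun s x => Real.exp (-(d * s)) * φ (Real.exp (-s) • x) with hΦ
  set Φ' : ℝ → Vel d → ℝ := fun s x => -(Real.exp (-(d * s)) *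
    (d * φ (Real.exp (-s) • x) + fderiv ℝ φ (Real.exp (-s) • x) (Real.exp (-s) • x))) with hΦ'
  have hc := hφ.smooth.continuous
  have hc' := hφ.smooth.continuous_fderiv (by simp)
  obtain ⟨r, hr⟩ := hφ.exists_radius
  have hder : ∀ s₀, HasDerivAt (fun s => ∫ x, u x * Φ s x) (∫ x, u x * Φ' s₀ x) s₀ := by
    intro s₀
    refine hasDerivAt_integral_mul u (r := |r| * Real.exp (s₀ + 1)) (fun s => ?_) ?_
      (fun s x => ?_) (fun s hs x hx => ?_)
    · simp only [hΦ]; fun_prop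
    · have h1 : Continuous fun p : ℝ × Vel d => fderiv ℝ φ (Real.exp (-p.1) • p.2)
          (Real.exp (-p.1) • p.2) := (hc'.comp (by fun_prop)).clm_apply (by fun_prop)
      simp only [hΦ', Function.uncurry_def]
      fun_prop
    · have h1 : HasDerivAt (fun s : ℝ => Real.exp (-s)) (-Real.exp (-s)) s := by
        simpa using (hasDerivAt_neg s).exp
      have h2 : HasDerivAt (fun s : ℝ => Real.exp (-s) • x) (-Real.exp (-s) • x) s :=
        h1.smul_const x
      have h3 : HasDerivAt (fun s : ℝ => φ (Real.exp (-s) • x))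
          (fderiv ℝ φ (Real.exp (-s) • x) (-Real.exp (-s) • x)) s :=
        ((hφ.smooth.differentiable (by simp)) _).hasFDerivAt.comp_hasDerivAt s h2
      have h4 : HasDerivAt (fun s : ℝ => Real.exp (-(d * s))) (Real.exp (-(d * s)) * -d) s := by
        simpa using (((hasDerivAt_id s).const_mul (d : ℝ)).neg).exp
      refine (h4.mul h3).congr_deriv ?_
      simp only [hΦ', neg_smul, map_neg]
      ring
    · have hx' : Real.exp (-s) • x ∉ Metric.closedBall (0 : Vel d) r := by
        rw [mem_closedBall_zero_iff, not_le] at hx ⊢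
        rw [norm_smul, Real.norm_eq_abs, Real.abs_exp]
        rw [Metric.mem_ball, Real.dist_eq] at hs
        have h1 : s ≤ s₀ + 1 := by linarith [le_abs_self (s - s₀)]
        have h2 : Real.exp (-s) * (|r| * Real.exp (s₀ + 1)) < Real.exp (-s) * ‖x‖ := by gcongr
        have h3 : 1 ≤ Real.exp (-s) * Real.exp (s₀ + 1) := by
          rw [← Real.exp_add]
          exact Real.one_le_exp (by linarith)
        have h4 := mul_le_mul_of_nonneg_left h3 (abs_nonneg r)
        linarith [le_abs_self r]
      simp [hΦ, hΦ', hr _ hx']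
  have hm : ∫ v, (affComp (Real.exp η) 0 u - u) v * φ v =
      (∫ x, u x * Φ η x) - ∫ x, u x * Φ 0 x := by
    rw [integral_mul_eq_inner hφ.memLp, inner_sub_right, ← integral_mul_eq_inner hφ.memLp,
      ← integral_mul_eq_inner hφ.memLp, integral_affComp_mul (Real.one_le_exp hη),
      ← integral_const_mul]
    congr 1
    · congr 1; ext x
      simp only [hΦ, add_zero, Real.exp_neg, Real.exp_nat_mul]
      ring
    · simp [hΦ]
  rw [hm, ← Real.norm_eq_abs]
  have hbound : ∀ s ∈ Ico 0 η, ‖∫ x, u x * Φ' s x‖ ≤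
      Real.exp η * ρ * (∑ i, ‖g i‖) * ‖hφ.memLp.toLp φ‖ := by
    intro s hs
    have hes : 1 ≤ Real.exp s := Real.one_le_exp hs.1
    have hφs : IsTest univ fun y => φ (Real.exp (-s) • (y + 0)) :=
      hφ.comp_affine (Real.exp_ne_zero _) 0 fun _ _ => mem_univ _
    simp only [add_zero] at hφs
    have hcoord : ∀ i, ContDiff ℝ ∞ fun x : Vel d => x i := fun i =>
      (EuclideanSpace.proj (𝕜 := ℝ) i).contDiff
    have hψ : ∀ i, IsTest univ fun x : Vel d => x i * φ (Real.exp (-s) • x) := fun i =>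
      ⟨(hcoord i).mul hφs.smooth, hφs.compact.mul_left, subset_univ _⟩
    have hfd : ∀ i x, fderiv ℝ (fun x : Vel d => x i * φ (Real.exp (-s) • x)) x (basisVec i) =
        φ (Real.exp (-s) • x) +
          x i * (Real.exp (-s) * fderiv ℝ φ (Real.exp (-s) • x) (basisVec i)) := by
      intro i x
      have h1 : HasFDerivAt (fun x : Vel d => x i) (EuclideanSpace.proj (𝕜 := ℝ) i) x :=
        (EuclideanSpace.proj (𝕜 := ℝ) i).hasFDerivAt
      have h2 := ((hφs.smooth.differentiable (by simp)) x).hasFDerivAt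
      have h3 := fderiv_comp_affine hφ.smooth (Real.exp (-s)) 0 x (basisVec i)
      simp only [add_zero] at h3
      have h4 : HasFDerivAt (fun x : Vel d => x i * φ (Real.exp (-s) • x)) _ x := h1.mul h2
      rw [h4.fderiv]
      simp [h3]
      ring
    -- The divergence form: integrating by parts leaves the gradient of `u` against `x i * φ`, and
    -- this product is controlled because `φ` lives in the ball.
    have hsum : ∀ x, Φ' s x = ∑ i, -(Real.exp (-(d * s)) *
        fderiv ℝ (fun x : Vel d => x i * φ (Real.exp (-s) • x)) x (basisVec i)) := by
      intro x
      simp only [hfd, hΦ']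
      rw [Finset.sum_neg_distrib, ← Finset.mul_sum, Finset.sum_add_distrib, Finset.sum_const,
        Finset.card_univ, Fintype.card_fin, fderiv_apply_eq_sum φ _ (Real.exp (-s) • x)]
      simp only [PiLp.smul_apply, smul_eq_mul, nsmul_eq_mul]
      congr 3
      exact Finset.sum_congr rfl fun i _ => by ring
    have e1 : ∫ x, u x * Φ' s x =
        ∑ i, ∫ y, (affComp (Real.exp s) 0 (g i)) y * (Real.exp s * (y i * φ y)) := by
      simp only [hsum, Finset.mul_sum]
      rw [integral_finsetSum]
      · refine Finset.sum_congr rfl fun i _ => ?_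
        rw [integral_affComp_mul hes]
        have e2 : ∫ x, u x * -(Real.exp (-(d * s)) *
            fderiv ℝ (fun x : Vel d => x i * φ (Real.exp (-s) • x)) x (basisVec i)) =
            -(Real.exp (-(d * s)) * ∫ x, u x *
              fderiv ℝ (fun x : Vel d => x i * φ (Real.exp (-s) • x)) x (basisVec i)) := by
          rw [← integral_const_mul, ← integral_neg]
          congr 1; ext x; ring
        rw [e2, hg i _ (hψ i), Real.exp_neg, Real.exp_nat_mul, mul_neg, neg_neg]
        congr 2; ext x
        have h1 : Real.exp s * (Real.exp s)⁻¹ = 1 := mul_inv_cancel₀ (Real.exp_ne_zero s)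
        simp only [add_zero, PiLp.smul_apply, smul_eq_mul, Real.exp_neg]
        linear_combination (-(g i x * x i * φ ((Real.exp s)⁻¹ • x))) * h1
      · intro i _
        have := (((Lp.memLp u).integrable_mul
          ((hψ i).memLp_fderiv (basisVec i))).const_mul (-Real.exp (-(d * s))))
        refine this.congr (Eventually.of_forall fun x => ?_)
        simp only [Pi.mul_apply]
        ring
    rw [e1, mul_assoc, mul_assoc, Finset.sum_mul, Finset.mul_sum, Finset.mul_sum]
    refine (norm_sum_le _ _).trans (Finset.sum_le_sum fun i _ => ?_)
    have hχ : IsTest univ fun y : Vel d => Real.exp s * (y i * φ y) :=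
      ⟨contDiff_const.mul ((hcoord i).mul hφ.smooth), (hφ.compact.mul_left).mul_left,
        subset_univ _⟩
    have h1 := abs_integral_mul_le (W := univ) hχ.memLp (subset_univ _)
      (affComp (Real.exp s) 0 (g i))
    rw [norm_rs_univ] at h1
    have h2 : ‖hχ.memLp.toLp _‖ ≤ (Real.exp η * ρ) * ‖hφ.memLp.toLp φ‖ := by
      refine Lp.norm_le_mul_norm_of_ae_le_mul ?_
      filter_upwards [hχ.memLp.coeFn_toLp, hφ.memLp.coeFn_toLp] with y h3 h4
      rw [h3, h4, norm_mul, norm_mul, ← mul_assoc]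
      by_cases hy : φ y = 0
      · simp [hy]
      · have h5 : ‖y‖ < ρ := by
          have := hφ.subset (subset_tsupport φ hy)
          simpa using this
        gcongr
        · rw [Real.norm_eq_abs, Real.abs_exp]
          exact Real.exp_le_exp.2 hs.2.le
        · exact (PiLp.norm_apply_le y i).trans h5.le
    rw [Real.norm_eq_abs]
    calc _ ≤ ‖g i‖ * ((Real.exp η * ρ) * ‖hφ.memLp.toLp φ‖) :=
          h1.trans (mul_le_mul (norm_affComp_le _ _ _) h2 (norm_nonneg _) (norm_nonneg _))
      _ = _ := by ring
  have := norm_image_sub_le_of_norm_deriv_le_segment' (f := fun s => ∫ x, u x * Φ s x)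
    (fun s _ => (hder s).hasDerivWithinAt) hbound η (right_mem_Icc.2 hη)
  rw [sub_zero] at this
  refine this.trans (le_of_eq (by ring))

/-! ### The derivatives of the semigroup -/

/-- The order of a derivative in a `2`-jet. -/
def jetOrder {d : ℕ} : JetIndex d → ℕ
  | .inl _ => 0
  | .inr (.inl _) => 1
  | .inr (.inr _) => 2

/-- The derivatives of the standard Gaussian up to order two. -/
def jetKer {d : ℕ} : JetIndex d → Vel d → ℝ
  | .inl _ => gauss
  | .inr (.inl i) => fun z => -z i * gauss z
  | .inr (.inr (i, j)) => fun z => (z i * z j - if i = j then 1 else 0) * gauss z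

lemma continuous_jetKer {d : ℕ} (a : JetIndex d) : Continuous (jetKer a) := by
  have := continuous_gauss (d := d)
  rcases a with _ | i | ⟨i, j⟩ <;> simp only [jetKer] <;> fun_prop

lemma abs_jetKer_le {d : ℕ} (a : JetIndex d) (z : Vel d) :
    |jetKer a z| ≤ 2 * ((1 + ‖z‖) ^ 2 * gauss z) := by
  have h0 := norm_nonneg z
  have h1 := gauss_nonneg z
  have hz : ∀ i, |z i| ≤ ‖z‖ := fun i => PiLp.norm_apply_le z i
  rw [← mul_assoc]
  rcases a with _ | i | ⟨i, j⟩
  · rw [jetKer, abs_of_nonneg h1]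
    refine le_mul_of_one_le_left h1 ?_
    nlinarith
  · simp only [jetKer]
    rw [abs_mul, abs_of_nonneg h1, abs_neg]
    refine mul_le_mul_of_nonneg_right ((hz i).trans ?_) h1
    nlinarith
  · simp only [jetKer]
    rw [abs_mul, abs_of_nonneg h1]
    refine mul_le_mul_of_nonneg_right ((abs_sub _ _).trans ?_) h1
    rw [abs_mul]
    have h2 : |z i| * |z j| ≤ ‖z‖ * ‖z‖ := mul_le_mul (hz i) (hz j) (abs_nonneg _) h0
    have h3 : |if i = j then (1 : ℝ) else 0| ≤ 1 := by split_ifs <;> simp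
    nlinarith

lemma integrable_jetKer {d : ℕ} (a : JetIndex d) : Integrable (jetKer a) := by
  refine integrable_of_le_moment (continuous_jetKer a) (C := 2) fun z => ?_
  refine (abs_jetKer_le a z).trans ?_
  have h0 := norm_nonneg z
  have h1 := gauss_nonneg z
  gcongr
  · linarith
  · norm_num

lemma integrable_jetKer_mul {d : ℕ} (a : JetIndex d) :
    Integrable fun z => |jetKer a z| * (1 + ‖z‖) := by
  have hc := continuous_jetKer a
  refine integrable_of_le_moment (C := 2) (by fun_prop) fun z => ?_
  have h0 := norm_nonneg z
  have h1 := gauss_nonneg z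
  rw [abs_of_nonneg (by positivity)]
  calc |jetKer a z| * (1 + ‖z‖) ≤ 2 * ((1 + ‖z‖) ^ 2 * gauss z) * (1 + ‖z‖) := by
        gcongr
        exact abs_jetKer_le a z
    _ = 2 * ((1 + ‖z‖) ^ 3 * gauss z) := by ring
    _ ≤ _ := by
        gcongr
        · linarith
        · norm_num

lemma hasLineDerivAt_gauss {d : ℕ} (i : Fin d) (z : Vel d) :
    HasLineDerivAt ℝ gauss (-z i * gauss z) z (basisVec i) := by
  have h1 : ∀ s : ℝ, gauss (z + s • basisVec i) = (2 * Real.pi) ^ (-(d : ℝ) / 2) *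
      Real.exp (-((‖z‖ ^ 2 + 2 * (s * z i) + s ^ 2) / 2)) := fun s => by
    rw [gauss, norm_add_sq_real, inner_smul_right, norm_smul, PiLp.norm_single,
      EuclideanSpace.inner_single_right]
    simp
  have h2 : HasDerivAt (fun s : ℝ => -((‖z‖ ^ 2 + 2 * (s * z i) + s ^ 2) / 2)) (-z i) 0 := by
    have := ((((hasDerivAt_id (0 : ℝ)).mul_const (z i)).const_mul 2).const_add (‖z‖ ^ 2)).add
      ((hasDerivAt_id (0 : ℝ)).pow 2)
    refine ((this.div_const 2).neg).congr_deriv ?_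
    simp
  rw [HasLineDerivAt]
  simp only [h1]
  refine (h2.exp.const_mul _).congr_deriv ?_
  simp only [gauss, zero_mul, mul_zero, add_zero, ne_eq, OfNat.ofNat_ne_zero, not_false_eq_true,
    zero_pow]
  ring

lemma hasLineDerivAt_gauss_two {d : ℕ} (i j : Fin d) (z : Vel d) :
    HasLineDerivAt ℝ (fun z : Vel d => -z i * gauss z)
      ((z i * z j - if i = j then 1 else 0) * gauss z) z (basisVec j) := by
  have h1 : HasDerivAt (fun s : ℝ => -(z + s • basisVec j) i) (-if i = j then 1 else 0) 0 := by
    by_cases hij : i = j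
    · subst hij
      simpa using hasDerivAt_neg (0 : ℝ)
    · simpa [hij] using hasDerivAt_const (0 : ℝ) (-z i)
  have h2 := hasLineDerivAt_gauss j z
  rw [HasLineDerivAt] at h2 ⊢
  refine (h1.mul h2).congr_deriv ?_
  simp only [zero_smul, add_zero]
  ring

/-- The integral of a derivative vanishes. This cancellation is what allows constants to be
subtracted in `exists_norm_jetOp_two_le`. -/
lemma integral_jetKer_two {d : ℕ} (i j : Fin d) : ∫ z, jetKer (.inr (.inr (i, j))) z = 0 := by
  have h := integral_mul_lineDeriv (d := d) (k := fun z => -z i * gauss z)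
    (k' := jetKer (.inr (.inr (i, j)))) (m := fun _ => 1) (m' := fun _ => 0) (b := 1)
    (e := basisVec j) one_ne_zero (hasLineDerivAt_gauss_two i j)
    (fun z => by
      rw [HasLineDerivAt, mul_zero]
      exact hasDerivAt_const _ _)
    (by simpa using integrable_jetKer (.inr (.inr (i, j)))) (by simp)
    (by simpa [jetKer] using integrable_jetKer (.inr (.inl i)))
  simpa using h.symm

/-- The derivatives up to order two of the semigroup `S_t = e^{dt} P_t`. -/
def jetOp {d : ℕ} (a : JetIndex d) (t : ℝ) : L2V d →L[ℝ] L2V d :=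
  (Real.exp (d * t) * (Real.exp t / sig t) ^ jetOrder a) •
    kerOp (integrable_jetKer a) (Real.exp t) (sig t)

/-- The semigroup `S_t = e^{dt} P_t` generated by `Δ + div(v ·)`. -/
def fpOp {d : ℕ} (t : ℝ) : L2V d →L[ℝ] L2V d := Real.exp (d * t) • ouOp t

lemma jetOp_inl {d : ℕ} (t : ℝ) : jetOp (d := d) (.inl ()) t = fpOp t := by
  simp [jetOp, fpOp, jetOrder, ouOp, jetKer]

lemma fpOp_apply {d : ℕ} (t : ℝ) (u : L2V d) : fpOp t u = Real.exp (d * t) • ouOp t u := rfl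

lemma fpOp_zero {d : ℕ} (u : L2V d) : fpOp 0 u = u := by
  simp [fpOp_apply, ouOp_of_nonpos le_rfl]

lemma fpOp_add {d : ℕ} {s t : ℝ} (hs : 0 ≤ s) (ht : 0 ≤ t) (u : L2V d) :
    fpOp (s + t) u = fpOp s (fpOp t u) := by
  rw [fpOp_apply, fpOp_apply, fpOp_apply, ouOp_add hs ht, map_smul, smul_smul, ← Real.exp_add,
    mul_add]

lemma norm_fpOp_le {d : ℕ} (t : ℝ) (u : L2V d) : ‖fpOp t u‖ ≤ Real.exp (d * t) * ‖u‖ := by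
  rw [fpOp_apply, norm_smul, Real.norm_eq_abs, Real.abs_exp]
  gcongr
  exact norm_ouOp_le t u

lemma tendsto_fpOp {d : ℕ} {α : Type*} {l : Filter α} [l.IsCountablyGenerated] {t : α → ℝ}
    {u : α → L2V d} {t₀ : ℝ} {u₀ : L2V d} (ht : Tendsto t l (𝓝 t₀)) (hu : Tendsto u l (𝓝 u₀)) :
    Tendsto (fun x => fpOp (t x) (u x)) l (𝓝 (fpOp t₀ u₀)) :=
  ((Real.continuous_exp.tendsto _).comp (ht.const_mul (d : ℝ))).smul (tendsto_ouOp ht hu)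

lemma tendsto_jetOp {d : ℕ} (a : JetIndex d) {α : Type*} {l : Filter α} [l.IsCountablyGenerated]
    {t : α → ℝ} {u : α → L2V d} {t₀ : ℝ} {u₀ : L2V d} (ht₀ : 0 < t₀) (ht : Tendsto t l (𝓝 t₀))
    (hu : Tendsto u l (𝓝 u₀)) :
    Tendsto (fun x => jetOp a (t x) (u x)) l (𝓝 (jetOp a t₀ u₀)) := by
  have he : Tendsto (fun x => Real.exp (t x)) l (𝓝 (Real.exp t₀)) :=
    (Real.continuous_exp.tendsto _).comp ht
  have hs : Tendsto (fun x => sig (t x)) l (𝓝 (sig t₀)) := (continuous_sig.tendsto _).comp ht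
  exact (((Real.continuous_exp.tendsto _).comp (ht.const_mul (d : ℝ))).mul
    ((he.div hs (sig_pos ht₀).ne').pow _)).smul (tendsto_kerOp _ he hs hu)

lemma hasWeakPartial_fpOp {d : ℕ} {t : ℝ} (ht : 0 < t) (i : Fin d) (u : L2V d) :
    HasWeakPartial i (fpOp t u) (jetOp (.inr (.inl i)) t u) := by
  have h := (hasWeakPartial_kerOp (i := i) integrable_gauss (integrable_jetKer (.inr (.inl i)))
    (hasLineDerivAt_gauss i) (Real.one_le_exp ht.le) (sig_pos ht) u).const_smul (Real.exp (d * t))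
  rw [smul_smul] at h
  simpa [jetOp, jetOrder, fpOp_apply, ouOp] using h

lemma hasWeakPartial_jetOp {d : ℕ} {t : ℝ} (ht : 0 < t) (i j : Fin d) (u : L2V d) :
    HasWeakPartial j (jetOp (.inr (.inl i)) t u) (jetOp (.inr (.inr (i, j))) t u) := by
  have h := (hasWeakPartial_kerOp (i := j) (integrable_jetKer (.inr (.inl i)))
    (integrable_jetKer (.inr (.inr (i, j))))
    (hasLineDerivAt_gauss_two i j) (Real.one_le_exp ht.le) (sig_pos ht) u).const_smul
      (Real.exp (d * t) * (Real.exp t / sig t))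
  rw [smul_smul, mul_assoc, ← sq] at h
  simpa [jetOp, jetOrder] using h

lemma HasWeakPartial.fpOp {d : ℕ} {i : Fin d} {u g : L2V d} (h : HasWeakPartial i u g) {t : ℝ}
    (ht : 0 ≤ t) : HasWeakPartial i (fpOp t u) (Real.exp t • fpOp t g) := by
  have := (h.kerOp integrable_gauss (Real.one_le_exp ht) (sig t)).const_smul (Real.exp (d * t))
  rw [smul_comm] at this
  exact this

/-- No convolution of kernels is computed: both sides are weak derivatives of the same function,
since `fpOp` is a semigroup. -/
lemma jetOp_add {d : ℕ} (a : JetIndex d) {s t : ℝ} (hs : 0 < s) (ht : 0 ≤ t) (u : L2V d) :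
    jetOp a (s + t) u = jetOp a s (fpOp t u) := by
  have hst : 0 < s + t := by linarith
  have h1 : ∀ i, jetOp (.inr (.inl i)) (s + t) u = jetOp (.inr (.inl i)) s (fpOp t u) := by
    intro i
    have := hasWeakPartial_fpOp hst i u
    rw [fpOp_add hs.le ht] at this
    exact this.unique (hasWeakPartial_fpOp hs i (fpOp t u))
  rcases a with _ | i | ⟨i, j⟩
  · rw [jetOp_inl, jetOp_inl, fpOp_add hs.le ht]
  · exact h1 i
  · have := hasWeakPartial_jetOp hst i j u
    rw [h1] at this
    exact this.unique (hasWeakPartial_jetOp hs i j (fpOp t u))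

/-- A derivative passing through `fpOp s` picks up a factor `e^s`, because the semigroup dilates its
argument; again by uniqueness of weak derivatives. -/
lemma jetOp_add_comm {d : ℕ} (a : JetIndex d) {s t : ℝ} (hs : 0 ≤ s) (ht : 0 < t) (u : L2V d) :
    jetOp a (s + t) u = Real.exp (jetOrder a * s) • fpOp s (jetOp a t u) := by
  have hst : 0 < s + t := by linarith
  have h1 : ∀ i, jetOp (.inr (.inl i)) (s + t) u =
      Real.exp s • fpOp s (jetOp (.inr (.inl i)) t u) := by
    intro i
    have := hasWeakPartial_fpOp hst i u
    rw [fpOp_add hs ht.le] at this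
    exact this.unique ((hasWeakPartial_fpOp ht i u).fpOp hs)
  rcases a with _ | i | ⟨i, j⟩
  · rw [jetOp_inl, jetOp_inl, fpOp_add hs ht.le]
    simp [jetOrder]
  · rw [h1 i]
    simp [jetOrder]
  · have := hasWeakPartial_jetOp hst i j u
    rw [h1] at this
    rw [this.unique (((hasWeakPartial_jetOp ht i j u).fpOp hs).const_smul (Real.exp s)),
      smul_smul, ← Real.exp_add]
    simp [jetOrder, two_mul]

/-! ### Norm bounds -/

lemma inv_sig_le {t : ℝ} (ht : 0 < t) : (sig t)⁻¹ ≤ t ^ (-(1 / 2 : ℝ)) := by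
  rw [Real.rpow_neg ht.le, ← Real.sqrt_eq_rpow]
  refine inv_anti₀ (Real.sqrt_pos.2 ht) (Real.sqrt_le_sqrt ?_)
  linarith [Real.add_one_le_exp (2 * t)]

lemma sig_sq_le {t : ℝ} (ht : 0 ≤ t) : sig t ^ 2 ≤ 2 * t * Real.exp (2 * t) := by
  rw [sig_sq ht]
  have h1 := Real.add_one_le_exp (-(2 * t))
  have h2 : Real.exp (-(2 * t)) * Real.exp (2 * t) = 1 := by rw [← Real.exp_add]; simp
  nlinarith [Real.exp_pos (2 * t)]

/-- Each derivative contributes one factor `e^t / sig t`, and `sig t ≥ √t`. Summing over all labels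
gives one constant for the whole jet. -/
lemma exists_norm_jetOp_le {d : ℕ} (T : ℝ) : ∃ C, 0 ≤ C ∧ ∀ (a : JetIndex d) (t : ℝ), 0 < t →
    t ≤ T → ∀ u, ‖jetOp a t u‖ ≤ C * t ^ (-(jetOrder a / 2 : ℝ)) * ‖u‖ := by
  refine ⟨∑ a : JetIndex d, Real.exp (d * T) * Real.exp T ^ jetOrder a * ∫ z, ‖jetKer a z‖,
    Finset.sum_nonneg fun a _ => mul_nonneg (by positivity)
      (integral_nonneg fun _ => norm_nonneg _), fun a t ht htT u => ?_⟩
  have h1 : ‖jetOp a t u‖ ≤ (Real.exp (d * t) * (Real.exp t / sig t) ^ jetOrder a) *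
      ((∫ z, ‖jetKer a z‖) * ‖u‖) := by
    rw [jetOp, FunLike.coe_smul, Pi.smul_apply, norm_smul, Real.norm_of_nonneg
      (mul_nonneg (Real.exp_pos _).le (pow_nonneg (div_nonneg (Real.exp_pos _).le (sig_nonneg t)) _))]
    refine mul_le_mul_of_nonneg_left (norm_kerOp_le _ _ _ u)
      (mul_nonneg (Real.exp_pos _).le (pow_nonneg (div_nonneg (Real.exp_pos _).le (sig_nonneg t)) _))
  have hI : ∀ a : JetIndex d, 0 ≤ ∫ z, ‖jetKer a z‖ := fun a => integral_nonneg fun _ => norm_nonneg _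
  have h2 : (Real.exp t / sig t) ^ jetOrder a ≤
      Real.exp T ^ jetOrder a * t ^ (-(jetOrder a / 2 : ℝ)) := by
    have h3 : t ^ (-(jetOrder a / 2 : ℝ)) = (t ^ (-(1 / 2 : ℝ))) ^ jetOrder a := by
      rw [← Real.rpow_natCast, ← Real.rpow_mul ht.le]
      congr 1; ring
    rw [h3, ← mul_pow, div_eq_mul_inv]
    have := inv_sig_le ht
    have := sig_nonneg t
    gcongr
  have h4 : Real.exp (d * T) * Real.exp T ^ jetOrder a * ∫ z, ‖jetKer a z‖ ≤
      ∑ a : JetIndex d, Real.exp (d * T) * Real.exp T ^ jetOrder a * ∫ z, ‖jetKer a z‖ :=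
    Finset.single_le_sum (f := fun a : JetIndex d => Real.exp (d * T) * Real.exp T ^ jetOrder a *
      ∫ z, ‖jetKer a z‖) (fun a _ => mul_nonneg (by positivity) (hI a)) (Finset.mem_univ a)
  have h5 := hI a
  calc ‖jetOp a t u‖ ≤ _ := h1
    _ ≤ (Real.exp (d * T) * (Real.exp T ^ jetOrder a * t ^ (-(jetOrder a / 2 : ℝ)))) *
      ((∫ z, ‖jetKer a z‖) * ‖u‖) := by
        have := sig_nonneg t
        gcongr
    _ = (Real.exp (d * T) * Real.exp T ^ jetOrder a * ∫ z, ‖jetKer a z‖) *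
        t ^ (-(jetOrder a / 2 : ℝ)) * ‖u‖ := by ring
    _ ≤ _ := by gcongr

lemma rpow_third_le_one_add {x : ℝ} (hx : 0 ≤ x) : x ^ (1 / 3 : ℝ) ≤ 1 + x := by
  rcases le_total x 1 with h | h
  · exact (Real.rpow_le_one hx h (by norm_num)).trans (by linarith)
  · calc x ^ (1 / 3 : ℝ) ≤ x ^ (1 : ℝ) := Real.rpow_le_rpow_of_exponent_le h (by norm_num)
      _ ≤ _ := by rw [Real.rpow_one]; linarith

lemma affComp_sub_affComp_zero {d : ℕ} {a : ℝ} (ha : 1 ≤ a) (w : Vel d) (u : L2V d) :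
    affComp a w u - affComp a 0 u = affComp a 0 (affComp 1 w u - u) := by
  rw [map_sub, affComp_affComp ha le_rfl]
  simp

/-- Second derivatives of the semigroup are less singular on Hölder continuous (in `L²`)
functions. -/
lemma exists_norm_jetOp_two_le {d : ℕ} (T : ℝ) : ∃ C, 0 ≤ C ∧ ∀ (i j : Fin d) (t : ℝ), 0 < t →
    t ≤ T → ∀ (u : L2V d) (Λ : ℝ), 0 ≤ Λ → (∀ h, ‖affComp 1 h u - u‖ ≤ Λ * ‖h‖ ^ (1 / 3 : ℝ)) →
      ‖jetOp (.inr (.inr (i, j))) t u‖ ≤ C * t ^ (-(5 / 6 : ℝ)) * Λ := by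
  set I : Fin d × Fin d → ℝ := fun p => ∫ z, |jetKer (.inr (.inr p)) z| * (1 + ‖z‖) with hIdef
  have hI : ∀ p, 0 ≤ I p := fun p =>
    integral_nonneg fun z => mul_nonneg (abs_nonneg _) (by linarith [norm_nonneg z])
  refine ⟨Real.exp (d * T) * Real.exp T ^ 2 * ∑ p, I p,
    mul_nonneg (by positivity) (Finset.sum_nonneg fun p _ => hI p),
    fun i j t ht htT u Λ hΛ hu => ?_⟩
  have hs := sig_pos ht
  have hk := integrable_jetKer (d := d) (.inr (.inr (i, j)))
  -- The kernel has integral zero, so the term without noise may be subtracted; what remains is a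
  -- translation difference of `u` by `sig t • z`.
  have e1 : kerOp hk (Real.exp t) (sig t) u = ∫ z, jetKer (.inr (.inr (i, j))) z •
      affComp (Real.exp t) 0 (affComp 1 (sig t • z) u - u) := by
    have h0 : ∫ z, jetKer (.inr (.inr (i, j))) z • affComp (Real.exp t) (0 : Vel d) u = 0 := by
      rw [integral_smul_const, integral_jetKer_two, zero_smul]
    rw [kerOp_apply, ← sub_zero (∫ z, _), ← h0,
      ← integral_sub (integrable_smul_affComp hk _ _ u) (hk.smul_const _)]
    congr 1; ext1 z
    rw [← smul_sub, affComp_sub_affComp_zero (Real.one_le_exp ht.le)]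
  have h1 : ‖kerOp hk (Real.exp t) (sig t) u‖ ≤ I (i, j) * (Λ * sig t ^ (1 / 3 : ℝ)) := by
    rw [e1, hIdef, ← integral_mul_const]
    refine norm_integral_le_of_norm_le ((integrable_jetKer_mul _).mul_const _)
      (Eventually.of_forall fun z => ?_)
    rw [norm_smul, Real.norm_eq_abs, mul_assoc]
    refine mul_le_mul_of_nonneg_left ?_ (abs_nonneg _)
    refine (norm_affComp_le _ _ _).trans ((hu _).trans ?_)
    rw [norm_smul, Real.norm_of_nonneg hs.le, Real.mul_rpow hs.le (norm_nonneg _)]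
    have := rpow_third_le_one_add (norm_nonneg z)
    calc Λ * (sig t ^ (1 / 3 : ℝ) * ‖z‖ ^ (1 / 3 : ℝ))
        ≤ Λ * (sig t ^ (1 / 3 : ℝ) * (1 + ‖z‖)) := by gcongr
      _ = _ := by ring
  -- Two derivatives cost σ^{-2} and Hölder continuity returns σ^{1/3}: in total σ^{-5/3} ≤
  -- t^{-5/6}.
  have h2 : (sig t)⁻¹ ^ 2 * sig t ^ (1 / 3 : ℝ) ≤ t ^ (-(5 / 6 : ℝ)) := by
    have e2 : (sig t)⁻¹ ^ 2 * sig t ^ (1 / 3 : ℝ) = (sig t)⁻¹ ^ (5 / 3 : ℝ) := by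
      rw [← Real.rpow_natCast (sig t)⁻¹ 2, Real.inv_rpow hs.le, Real.inv_rpow hs.le,
        ← Real.rpow_neg hs.le, ← Real.rpow_neg hs.le, ← Real.rpow_add hs]
      norm_num
    have e3 : t ^ (-(5 / 6 : ℝ)) = (t ^ (-(1 / 2 : ℝ))) ^ (5 / 3 : ℝ) := by
      rw [← Real.rpow_mul ht.le]; norm_num
    rw [e2, e3]
    exact Real.rpow_le_rpow (inv_nonneg.2 hs.le) (inv_sig_le ht) (by norm_num)
  have h3 : I (i, j) ≤ ∑ p, I p :=
    Finset.single_le_sum (fun p _ => hI p) (Finset.mem_univ (i, j))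
  have h4 := hI (i, j)
  rw [jetOp, FunLike.coe_smul, Pi.smul_apply, norm_smul, Real.norm_of_nonneg
      (mul_nonneg (Real.exp_pos _).le (pow_nonneg (div_nonneg (Real.exp_pos _).le (sig_nonneg t)) _))]
  calc _ ≤ Real.exp (d * t) * (Real.exp t / sig t) ^ 2 * (I (i, j) * (Λ * sig t ^ (1 / 3 : ℝ))) :=
        mul_le_mul_of_nonneg_left h1
          (mul_nonneg (Real.exp_pos _).le (pow_nonneg (div_nonneg (Real.exp_pos _).le hs.le) _))
    _ = Real.exp (d * t) * Real.exp t ^ 2 * I (i, j) * ((sig t)⁻¹ ^ 2 * sig t ^ (1 / 3 : ℝ)) * Λ := by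
        rw [div_eq_mul_inv]; ring
    _ ≤ Real.exp (d * T) * Real.exp T ^ 2 * (∑ p, I p) * t ^ (-(5 / 6 : ℝ)) * Λ := by
        gcongr

lemma two_smul_integral_eq {d : ℕ} {E : Type*} [NormedAddCommGroup E] [NormedSpace ℝ E]
    {F : Vel d → E} (hF : Integrable F) : (2 : ℝ) • ∫ z, F z = ∫ z, (F z + F (-z)) := by
  rw [integral_add hF hF.comp_neg, integral_neg_eq_self F volume, two_smul]

lemma integrable_norm_gauss_mul_sq {d : ℕ} :
    Integrable fun z : Vel d => ‖gauss z‖ * ‖z‖ ^ 2 := by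
  have hc := continuous_gauss (d := d)
  refine integrable_of_le_moment (C := 1) (by fun_prop) fun z => ?_
  have h0 := norm_nonneg z
  have h1 := gauss_nonneg z
  rw [Real.norm_of_nonneg h1, abs_of_nonneg (by positivity), one_mul, mul_comm]
  gcongr
  nlinarith [sq_nonneg (‖z‖ ^ 2), sq_nonneg ‖z‖, pow_nonneg h0 3]

/-- The Gaussian is even: averaging over `z` and `-z` produces a symmetric second difference of size
`c ^ 2 * ‖z‖ ^ 2`. A first order estimate would give only `c`, that is, √η instead of η. -/
lemma norm_kerOp_gauss_sub_dilate_le {d : ℕ} {a c : ℝ} (ha : 1 ≤ a) {u : L2V d}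
    {g : Fin d → L2V d} {g' : Fin d → Fin d → L2V d} (hg : ∀ i, HasWeakPartial i u (g i))
    (hg' : ∀ i j, HasWeakPartial j (g i) (g' i j)) :
    ‖kerOp integrable_gauss a c u - affComp a 0 u‖ ≤
      2⁻¹ * ((∫ z : Vel d, ‖gauss z‖ * ‖z‖ ^ 2) * (c ^ 2 * ∑ i, ∑ j, ‖g' i j‖)) := by
  have hpt : ∀ z : Vel d, gauss z • affComp a (c • z) u - gauss z • affComp a 0 u =
      gauss z • affComp a 0 (affComp 1 (c • z) u - u) := fun z => by
    rw [← smul_sub, affComp_sub_affComp_zero ha]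
  have i1 := integrable_smul_affComp (d := d) integrable_gauss a c u
  have i2 : Integrable fun z : Vel d => gauss z • affComp a 0 u := integrable_gauss.smul_const _
  have hint : Integrable fun z : Vel d => gauss z • affComp a 0 (affComp 1 (c • z) u - u) :=
    (i1.sub i2).congr (Eventually.of_forall hpt)
  have e1 : kerOp integrable_gauss a c u - affComp a 0 u =
      ∫ z : Vel d, gauss z • affComp a 0 (affComp 1 (c • z) u - u) := by
    have h0 : ∫ z : Vel d, gauss z • affComp a (0 : Vel d) u = affComp a 0 u := by
      rw [integral_smul_const, integral_gauss, one_smul]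
    rw [kerOp_apply, ← h0, ← integral_sub i1 i2]
    exact integral_congr_ae (Eventually.of_forall hpt)
  have e2 := two_smul_integral_eq hint
  rw [← e1] at e2
  have h1 : ‖(2 : ℝ) • (kerOp integrable_gauss a c u - affComp a 0 u)‖ ≤
      (∫ z : Vel d, ‖gauss z‖ * ‖z‖ ^ 2) * (c ^ 2 * ∑ i, ∑ j, ‖g' i j‖) := by
    rw [e2, ← integral_mul_const]
    refine norm_integral_le_of_norm_le (integrable_norm_gauss_mul_sq.mul_const _)
      (Eventually.of_forall fun z => ?_)
    have e3 : gauss z • affComp a 0 (affComp 1 (c • z) u - u) +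
        gauss (-z) • affComp a 0 (affComp 1 (c • -z) u - u) = gauss z • affComp a 0
          (affComp 1 (c • z) u + affComp 1 (-(c • z)) u - (2 : ℝ) • u) := by
      rw [gauss_neg, ← smul_add, ← map_add, smul_neg, two_smul]
      congr 2
      abel
    rw [e3, norm_smul, mul_assoc]
    refine mul_le_mul_of_nonneg_left ?_ (norm_nonneg _)
    refine (norm_affComp_le _ _ _).trans ((norm_second_difference_le hg hg').trans ?_)
    rw [norm_smul, mul_pow, Real.norm_eq_abs, sq_abs]
    exact le_of_eq (by ring)
  rw [norm_smul, Real.norm_ofNat] at h1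
  linarith

lemma exp_sub_one_le_mul_exp (x : ℝ) : Real.exp x - 1 ≤ x * Real.exp x := by
  have h1 := Real.add_one_le_exp (-x)
  have h2 : Real.exp (-x) * Real.exp x = 1 := by rw [← Real.exp_add]; simp
  nlinarith [Real.exp_pos x]

lemma norm_rs_add_add_le {d : ℕ} (V : Set (Vel d)) (x y z : L2V d) :
    ‖rs V (x + y + z)‖ ≤ ‖x‖ + ‖y‖ + ‖rs V z‖ := by
  rw [map_add, map_add]
  exact norm_add₃_le.trans (add_le_add (add_le_add (norm_rs_le V x) (norm_rs_le V y)) le_rfl)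

/-- On bounded sets, `S_η u - u = O(η)` if `u` has two weak derivatives in `L²(ℝ^d)`. -/
lemma exists_norm_rs_fpOp_sub_le {d : ℕ} {ρ : ℝ} (hρ : 0 ≤ ρ) : ∃ C, 0 ≤ C ∧
    ∀ (u : L2V d) (g : Fin d → L2V d) (g' : Fin d → Fin d → L2V d),
      (∀ i, HasWeakPartial i u (g i)) → (∀ i j, HasWeakPartial j (g i) (g' i j)) →
      ∀ η ∈ Icc (0 : ℝ) 1, ‖rs (Metric.ball 0 ρ) (fpOp η u - u)‖ ≤
        C * η * (‖u‖ + ∑ i, ‖g i‖ + ∑ i, ∑ j, ‖g' i j‖) := by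
  obtain ⟨m, hm⟩ : ∃ m : ℝ, m = ∫ z : Vel d, ‖gauss z‖ * ‖z‖ ^ 2 := ⟨_, rfl⟩
  have hm0 : 0 ≤ m := hm ▸ integral_nonneg fun z => by positivity
  refine ⟨d * Real.exp d + Real.exp 1 * ρ + Real.exp 2 * m, by positivity,
    fun u g g' hg hg' η hη => ?_⟩
  set H : ℝ := ∑ i, ∑ j, ‖g' i j‖ with hH
  have hH0 : 0 ≤ H := by positivity
  set G : ℝ := ∑ i, ‖g i‖ with hG
  have hG0 : 0 ≤ G := by positivity
  have he1 := Real.one_le_exp hη.1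
  set D := affComp (Real.exp η) (0 : Vel d) u with hD
  -- The three terms are the growth factor e^{dη}, the diffusion at fixed dilation, and the drift.
  -- Only the drift requires localization.
  have e0 : fpOp η u - u = (Real.exp (d * η) - 1) • ouOp η u + (ouOp η u - D) + (D - u) := by
    rw [fpOp_apply, sub_smul, one_smul]; abel
  have hb1 : ‖(Real.exp (d * η) - 1) • ouOp η u‖ ≤ d * Real.exp d * η * ‖u‖ := by
    rw [norm_smul]
    have h3 : Real.exp (d * η) ≤ Real.exp d :=
      Real.exp_le_exp.2 (mul_le_of_le_one_right (Nat.cast_nonneg d) hη.2)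
    have h4 : 0 ≤ d * η := mul_nonneg (Nat.cast_nonneg d) hη.1
    have h5 : ‖Real.exp (d * η) - 1‖ ≤ d * Real.exp d * η := by
      rw [Real.norm_of_nonneg (by linarith [Real.one_le_exp h4])]
      refine (exp_sub_one_le_mul_exp _).trans ?_
      calc d * η * Real.exp (d * η) ≤ d * η * Real.exp d := by gcongr
        _ = _ := by ring
    exact mul_le_mul h5 (norm_ouOp_le η u) (norm_nonneg _) ((norm_nonneg _).trans h5)
  have hb2 : ‖ouOp η u - D‖ ≤ Real.exp 2 * m * η * H := by
    have h1 := norm_kerOp_gauss_sub_dilate_le (c := sig η) he1 hg hg'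
    rw [← hm, ← hH] at h1
    refine h1.trans ?_
    clear_value D G H
    have h2 : sig η ^ 2 ≤ 2 * η * Real.exp 2 := by
      refine (sig_sq_le hη.1).trans ?_
      have := Real.exp_le_exp.2 (by linarith [hη.2] : 2 * η ≤ 2)
      have := hη.1
      gcongr
    calc 2⁻¹ * (m * (sig η ^ 2 * H)) ≤ 2⁻¹ * (m * (2 * η * Real.exp 2 * H)) := by gcongr
      _ = _ := by ring
  have hb3 : ‖rs (Metric.ball 0 ρ) (D - u)‖ ≤ Real.exp 1 * ρ * η * G := by
    have h0 := norm_rs_dilate_sub_le hρ hη.1 hg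
    rw [← hD, ← hG] at h0
    refine h0.trans ?_
    clear_value D G H
    have h1 := Real.exp_le_exp.2 hη.2
    have h2 := hη.1
    calc η * (Real.exp η * ρ * G) ≤ η * (Real.exp 1 * ρ * G) := by gcongr
      _ = _ := by ring
  rw [e0]
  refine (norm_rs_add_add_le _ _ _ _).trans ((add_le_add (add_le_add hb1 hb2) hb3).trans ?_)
  clear_value D G H
  have h3 := hη.1
  have h4 := norm_nonneg u
  have p1 : 0 ≤ d * Real.exp d * η * (G + H) := by positivity
  have p2 : 0 ≤ Real.exp 1 * ρ * η * (‖u‖ + H) := by positivity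
  have p3 : 0 ≤ Real.exp 2 * m * η * (‖u‖ + G) := by positivity
  linarith

/-! ### Localized norms -/

lemma norm_rs_sq {d : ℕ} (V : Set (Vel d)) (u : L2V d) : ‖rs V u‖ ^ 2 = ∫ v in V, u v ^ 2 := by
  rw [← real_inner_self_eq_norm_sq, L2.inner_def]
  refine integral_congr_ae ?_
  filter_upwards [coeFn_rs V u] with v hv
  rw [hv, real_inner_self_eq_norm_sq, Real.norm_eq_abs, sq_abs]

lemma norm_rs_affComp_le {d : ℕ} {V W : Set (Vel d)} {a : ℝ} (ha : 1 ≤ a) {w : Vel d}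
    (hV : MeasurableSet V) (hW : MeasurableSet W) (h : ∀ v ∈ V, a • v - w ∈ W) (u : L2V d) :
    ‖rs V (affComp a w u)‖ ≤ ‖rs W u‖ := by
  rw [norm_rs, norm_rs]
  refine ENNReal.toReal_mono ((Lp.memLp u).restrict W).2.ne ?_
  rw [← eLpNorm_indicator_eq_eLpNorm_restrict hV, ← eLpNorm_indicator_eq_eLpNorm_restrict hW]
  refine le_trans (eLpNorm_mono_ae ?_)
    (eLpNorm_comp_affMap_le a w ((Lp.aestronglyMeasurable u).indicator hW))
  filter_upwards [coeFn_affComp a w u] with v hv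
  by_cases hvV : v ∈ V
  · have : affMap a w v ∈ W := by
      rw [affMap_of_one_le ha]
      exact h v hvV
    simp [hvV, hv, this]
  · simp [hvV]

lemma norm_toLp_indicator {d : ℕ} {V : Set (Vel d)} (hV : MeasurableSet V) (u : L2V d) :
    ‖((Lp.memLp u).indicator hV).toLp _‖ = ‖rs V u‖ := by
  rw [Lp.norm_toLp, eLpNorm_indicator_eq_eLpNorm_restrict hV, norm_rs]

/-- Minkowski's inequality for pointwise bounds by localized functions. -/
lemma norm_le_sum_norm_rs {d : ℕ} {ι : Type*} (s : Finset ι) (c : ι → ℝ) (V : ι → Set (Vel d))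
    (hV : ∀ i, MeasurableSet (V i)) (u : ι → L2V d) {F : L2V d} (hc : ∀ i ∈ s, 0 ≤ c i)
    (h : ∀ᵐ v, |F v| ≤ ∑ i ∈ s, c i * |(V i).indicator (u i) v|) :
    ‖F‖ ≤ ∑ i ∈ s, c i * ‖rs (V i) (u i)‖ := by
  set G : L2V d := ∑ i ∈ s, c i • |((Lp.memLp (u i)).indicator (hV i)).toLp _| with hG
  have h1 : G =ᵐ[volume] fun v => ∑ i ∈ s, c i * |(V i).indicator (u i) v| := by
    have h2 : ∀ i, (c i • |((Lp.memLp (u i)).indicator (hV i)).toLp _| : L2V d) =ᵐ[volume]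
        fun v => c i * |(V i).indicator (u i) v| := by
      intro i
      filter_upwards [Lp.coeFn_smul (c i) (|((Lp.memLp (u i)).indicator (hV i)).toLp _| : L2V d),
        Lp.coeFn_abs (((Lp.memLp (u i)).indicator (hV i)).toLp _),
        ((Lp.memLp (u i)).indicator (hV i)).coeFn_toLp] with v e1 e2 e3
      rw [e1, Pi.smul_apply, e2, e3, smul_eq_mul]
    have h3 : ∀ t : Finset ι, (∑ i ∈ t, c i • |((Lp.memLp (u i)).indicator (hV i)).toLp _| : L2V d)
        =ᵐ[volume] fun v => ∑ i ∈ t, c i * |(V i).indicator (u i) v| := by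
      classical
      intro t
      induction t using Finset.induction_on with
      | empty =>
        simp only [Finset.sum_empty]
        exact Lp.coeFn_zero ℝ 2 volume
      | insert i t hi ih =>
        simp only [Finset.sum_insert hi]
        exact (Lp.coeFn_add _ _).trans ((h2 i).add ih)
    exact h3 s
  have h2 : ‖F‖ ≤ ‖G‖ := by
    refine Lp.norm_le_norm_of_ae_le ?_
    filter_upwards [h, h1] with v e1 e2
    rw [e2, Real.norm_eq_abs, Real.norm_eq_abs]
    exact e1.trans (le_abs_self _)
  refine h2.trans ((norm_sum_le _ _).trans (Finset.sum_le_sum fun i hi => ?_))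
  rw [norm_smul, Real.norm_of_nonneg (hc i hi), norm_abs_eq_norm, norm_toLp_indicator (hV i)]

/-! ### Restrictions to small sets -/

lemma setIntegral_preimage_add {d : ℕ} (A : Set (Vel d)) (hA : MeasurableSet A) (w : Vel d)
    (F : Vel d → ℝ) : ∫ v in A, F (v - w) = ∫ v in (fun x => x + w) ⁻¹' A, F v := by
  rw [← integral_indicator hA, ← integral_indicator (by measurability),
    ← integral_add_right_eq_self _ w]
  congr 1; ext v
  simp only [indicator, add_sub_cancel_right]
  rfl

lemma norm_rs_translate_sq {d : ℕ} {A : Set (Vel d)} (hA : MeasurableSet A) (w : Vel d)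
    (u : L2V d) : ‖rs A (affComp 1 w u)‖ ^ 2 = ‖rs ((fun x => x + w) ⁻¹' A) u‖ ^ 2 := by
  rw [norm_rs_sq, norm_rs_sq, ← setIntegral_preimage_add A hA w (fun v => u v ^ 2)]
  refine integral_congr_ae (ae_restrict_of_ae ?_)
  filter_upwards [coeFn_affComp 1 w u] with v hv
  rw [hv, affMap_of_one_le le_rfl, one_smul]

lemma sum_norm_rs_sq_le {d : ℕ} {V : Set (Vel d)} {A : ℕ → Set (Vel d)}
    (hA : ∀ j, MeasurableSet (A j)) (hd : Pairwise (Function.onFun Disjoint A)) {N : ℕ}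
    (hV : ∀ j < N, A j ⊆ V) (u : L2V d) :
    ∑ j ∈ Finset.range N, ‖rs (A j) u‖ ^ 2 ≤ ‖rs V u‖ ^ 2 := by
  have hi : Integrable fun v => u v ^ 2 := (Lp.memLp u).integrable_sq
  simp only [norm_rs_sq]
  rw [← integral_biUnion_finset (μ := volume) (f := fun v => u v ^ 2) (Finset.range N)
    (fun j _ => hA j) (fun i _ j _ hij => hd hij) (fun j _ => hi.integrableOn)]
  refine setIntegral_mono_set hi.integrableOn (Eventually.of_forall fun v => sq_nonneg _)
    (LE.le.eventuallyLE ?_)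
  refine iUnion₂_subset fun j hj => hV j (Finset.mem_range.1 hj)

/-- A set that has many disjoint translates carries little mass of a weakly differentiable
function. -/
lemma norm_rs_le_of_disjoint_translates {d : ℕ} {ρ : ℝ} {A : Set (Vel d)} (hA : MeasurableSet A)
    (hAρ : A ⊆ Metric.ball 0 (ρ + 1)) {h : Vel d} (h0 : h ≠ 0) (h1 : ‖h‖ ≤ 1)
    (hd : Pairwise (Function.onFun Disjoint fun j : ℕ => (fun x => x + (j : ℝ) • h) ⁻¹' A))
    {u : L2V d} {g : Fin d → L2V d} (hg : ∀ i, HasWeakPartial i u (g i)) :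
    ‖rs A u‖ ≤ 2 * ‖h‖ ^ (1 / 3 : ℝ) * (‖rs (Metric.ball 0 (ρ + 2)) u‖ +
      ∑ i, ‖rs (Metric.ball 0 (ρ + 2)) (g i)‖) := by
  obtain ⟨U, hU⟩ : ∃ U, U = ‖rs (Metric.ball 0 (ρ + 2)) u‖ := ⟨_, rfl⟩
  obtain ⟨G, hG⟩ : ∃ G, G = ∑ i, ‖rs (Metric.ball 0 (ρ + 2)) (g i)‖ := ⟨_, rfl⟩
  have hU0 : 0 ≤ U := hU ▸ norm_nonneg _
  have hG0 : 0 ≤ G := hG ▸ Finset.sum_nonneg fun i _ => norm_nonneg _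
  rw [← hU, ← hG]
  have hh : 0 < ‖h‖ := norm_pos_iff.2 h0
  obtain ⟨ε, hε⟩ : ∃ ε, ε = ‖h‖ ^ (1 / 3 : ℝ) := ⟨_, rfl⟩
  have hε0 : 0 < ε := hε ▸ Real.rpow_pos_of_pos hh _
  have hε1 : ε ≤ 1 := hε ▸ Real.rpow_le_one hh.le h1 (by norm_num)
  have hε3 : ε ^ 3 = ‖h‖ := by
    rw [hε, ← Real.rpow_natCast, ← Real.rpow_mul hh.le]; norm_num
  rw [← hε]
  -- With ε³ = ‖h‖, about ε^{-2} translates are used: N ε² is comparable to 1, while the total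
  -- displacement N ‖h‖ is at most ε. This balance produces the exponent 1/3.
  obtain ⟨N, hN⟩ : ∃ N, N = ⌊(ε ^ 2)⁻¹⌋₊ := ⟨_, rfl⟩
  have hinv : 1 ≤ (ε ^ 2)⁻¹ := (one_le_inv₀ (by positivity)).2 (pow_le_one₀ hε0.le hε1)
  have hN1 : 1 ≤ N := hN ▸ Nat.one_le_floor_iff _ |>.2 hinv
  have hN1' : (1 : ℝ) ≤ N := by exact_mod_cast hN1
  have hNle : (N : ℝ) ≤ (ε ^ 2)⁻¹ := hN ▸ Nat.floor_le (by positivity)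
  have hNε : (N : ℝ) * ε ^ 2 ≤ 1 := by
    have := mul_le_mul_of_nonneg_right hNle (sq_nonneg ε)
    rwa [inv_mul_cancel₀ (by positivity)] at this
  have hNge : 1 ≤ 2 * (N : ℝ) * ε ^ 2 := by
    have h2 : (ε ^ 2)⁻¹ < N + 1 := hN ▸ Nat.lt_floor_add_one _
    have h3 : (ε ^ 2)⁻¹ ≤ 2 * N := by linarith
    have := mul_le_mul_of_nonneg_right h3 (sq_nonneg ε)
    rwa [inv_mul_cancel₀ (by positivity)] at this
  have hNh : (N : ℝ) * ‖h‖ ≤ ε := by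
    rw [← hε3]
    nlinarith
  -- The mass on `A` equals that on a translate up to the error made by translating `u`, which its
  -- gradient controls. Summing over the disjoint translates bounds `N` copies of the mass on `A` by
  -- a single mass on the large ball.
  have hj : ∀ j ∈ Finset.range N, ‖rs A u‖ ^ 2 ≤
      2 * ‖rs ((fun x => x + (j : ℝ) • h) ⁻¹' A) u‖ ^ 2 + 2 * (ε * G) ^ 2 := by
    intro j hj
    have hjN : (j : ℝ) ≤ N := by exact_mod_cast (Finset.mem_range.1 hj).le
    have hjh : ‖(j : ℝ) • h‖ ≤ ε := by
      rw [norm_smul, Real.norm_natCast]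
      exact (mul_le_mul_of_nonneg_right hjN hh.le).trans hNh
    have e1 : ‖rs A u‖ ≤ ‖rs A (affComp 1 ((j : ℝ) • h) u)‖ +
        ‖rs A (affComp 1 ((j : ℝ) • h) u - u)‖ := by
      rw [map_sub]
      have := norm_sub_norm_le (rs A u) (rs A (affComp 1 ((j : ℝ) • h) u))
      rw [norm_sub_rev] at this
      linarith
    have e2 : ‖rs A (affComp 1 ((j : ℝ) • h) u - u)‖ ≤ ε * G := by
      refine (norm_rs_mono hAρ _).trans ((norm_rs_translate_sub_le Metric.isOpen_ball
        (W := Metric.ball 0 (ρ + 2)) (fun v hv s hs => ?_) hg).trans ?_)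
      · rw [mem_ball_zero_iff] at hv ⊢
        have h2 : ‖s • (j : ℝ) • h‖ ≤ 1 := by
          rw [norm_smul, Real.norm_of_nonneg hs.1]
          exact (mul_le_of_le_one_left (norm_nonneg _) hs.2).trans (hjh.trans hε1)
        linarith [norm_sub_le v (s • (j : ℝ) • h)]
      · rw [hG, Finset.mul_sum]
        refine Finset.sum_le_sum fun i _ => ?_
        refine mul_le_mul_of_nonneg_right ?_ (norm_nonneg _)
        exact (PiLp.norm_apply_le ((j : ℝ) • h) i).trans hjh
    rw [← norm_rs_translate_sq hA]
    have h3 := norm_nonneg (rs A u)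
    have h4 := norm_nonneg (rs A (affComp 1 ((j : ℝ) • h) u))
    nlinarith [sq_nonneg (‖rs A (affComp 1 ((j : ℝ) • h) u)‖ - ε * G), mul_nonneg hε0.le hG0]
  have hsum := Finset.sum_le_sum hj
  rw [Finset.sum_add_distrib, Finset.sum_const, Finset.sum_const, Finset.card_range,
    ← Finset.mul_sum, nsmul_eq_mul, nsmul_eq_mul] at hsum
  have hsq := sum_norm_rs_sq_le (V := Metric.ball 0 (ρ + 2)) (N := N)
    (fun j : ℕ => (measurable_add_const ((j : ℝ) • h)) hA) hd (fun j hj x hx => by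
      have h2 := hAρ hx
      have hjN : (j : ℝ) ≤ N := by exact_mod_cast hj.le
      rw [mem_ball_zero_iff] at h2 ⊢
      have h3 : ‖(j : ℝ) • h‖ ≤ 1 := by
        rw [norm_smul, Real.norm_natCast]
        exact ((mul_le_mul_of_nonneg_right hjN hh.le).trans hNh).trans hε1
      have h4 := norm_sub_le (x + (j : ℝ) • h) ((j : ℝ) • h)
      rw [add_sub_cancel_right] at h4
      linarith) u
  rw [← hU] at hsq
  have h5 : (N : ℝ) * ‖rs A u‖ ^ 2 ≤ N * (2 * ε * (U + G)) ^ 2 := by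
    have h6 : U ^ 2 ≤ 2 * (N : ℝ) * ε ^ 2 * U ^ 2 := le_mul_of_one_le_left (sq_nonneg U) hNge
    have h7 : 0 ≤ (N : ℝ) * ε ^ 2 * (U * G) := by positivity
    have h8 : 0 ≤ (N : ℝ) * ε ^ 2 * G ^ 2 := by positivity
    nlinarith
  have h6 := le_of_mul_le_mul_left h5 (by linarith)
  exact le_of_sq_le_sq h6 (by positivity)

/-- A line meets a convex set in an interval, so the walk x, x + h, x + 2h, ... leaves `K` at most
once; lying in the j-th translate means leaving at step j. -/
lemma disjoint_exit_translates {d : ℕ} {K : Set (Vel d)} (hK : Convex ℝ K) (h : Vel d) :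
    Pairwise (Function.onFun Disjoint fun j : ℕ =>
      (fun x => x + (j : ℝ) • h) ⁻¹' {v | v - h ∈ K ∧ v ∉ K}) := by
  have key : ∀ i j : ℕ, i < j → ∀ x : Vel d, x + (i : ℝ) • h - h ∈ K → x + (i : ℝ) • h ∉ K →
      x + (j : ℝ) • h - h ∈ K → False := by
    intro i j hij x h1 h2 h3
    refine h2 ?_
    have hlt : (i : ℝ) + 1 ≤ j := by exact_mod_cast hij
    rcases hlt.eq_or_lt with he | hlt'
    · have : x + (j : ℝ) • h - h = x + (i : ℝ) • h := by rw [← he, add_smul, one_smul]; abel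
      rwa [this] at h3
    have hpos : 0 < (j : ℝ) - i := by linarith
    have hc := hK h1 h3 (a := 1 - ((j : ℝ) - i)⁻¹) (b := ((j : ℝ) - i)⁻¹)
      (by rw [sub_nonneg]; exact inv_le_one_of_one_le₀ (by linarith)) (by positivity) (by ring)
    have e : (1 - ((j : ℝ) - i)⁻¹) • (x + (i : ℝ) • h - h) +
        ((j : ℝ) - i)⁻¹ • (x + (j : ℝ) • h - h) = x + (i : ℝ) • h := by
      have e2 : x + (j : ℝ) • h - h = (x + (i : ℝ) • h - h) + ((j : ℝ) - i) • h := by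
        rw [sub_smul]; abel
      rw [e2, smul_add, smul_smul, inv_mul_cancel₀ hpos.ne', one_smul, sub_smul, one_smul]
      abel
    rwa [e] at hc
  intro i j hij
  rw [Function.onFun, Set.disjoint_left]
  rintro x ⟨h1, h2⟩ ⟨h3, h4⟩
  rcases lt_or_gt_of_ne hij with hlt | hlt
  · exact key i j hlt x h1 h2 h3
  · exact key j i hlt x h3 h4 h1

/-- Likewise, such a walk enters a convex set at most once. -/
lemma disjoint_entry_translates {d : ℕ} {K : Set (Vel d)} (hK : Convex ℝ K) (h : Vel d) :
    Pairwise (Function.onFun Disjoint fun j : ℕ =>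
      (fun x => x + (j : ℝ) • h) ⁻¹' {v | v - h ∉ K ∧ v ∈ K}) := by
  have key : ∀ i j : ℕ, i < j → ∀ x : Vel d, x + (i : ℝ) • h ∈ K → x + (j : ℝ) • h - h ∉ K →
      x + (j : ℝ) • h ∈ K → False := by
    intro i j hij x h1 h2 h3
    refine h2 ?_
    have hlt : (i : ℝ) + 1 ≤ j := by exact_mod_cast hij
    have hpos : 0 < (j : ℝ) - i := by linarith
    have hc := hK h3 h1 (a := 1 - ((j : ℝ) - i)⁻¹) (b := ((j : ℝ) - i)⁻¹)
      (by rw [sub_nonneg]; exact inv_le_one_of_one_le₀ (by linarith)) (by positivity) (by ring)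
    have e : (1 - ((j : ℝ) - i)⁻¹) • (x + (j : ℝ) • h) +
        ((j : ℝ) - i)⁻¹ • (x + (i : ℝ) • h) = x + (j : ℝ) • h - h := by
      have e2 : x + (i : ℝ) • h = (x + (j : ℝ) • h) - ((j : ℝ) - i) • h := by
        rw [sub_smul]; abel
      rw [e2, smul_sub, smul_smul, inv_mul_cancel₀ hpos.ne', one_smul, sub_smul, one_smul]
      abel
    rwa [e] at hc
  intro i j hij
  rw [Function.onFun, Set.disjoint_left]
  rintro x ⟨h1, h2⟩ ⟨h3, h4⟩
  rcases lt_or_gt_of_ne hij with hlt | hlt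
  · exact key i j hlt x h2 h3 h4
  · exact key j i hlt x h4 h1 h2

/-! ### Multiplication by `χ_R |· - w|` -/

lemma abs_cutoff_mul_norm_sub_le {d : ℕ} (R : ℝ) (w v : Vel d) :
    |cutoff R v * ‖v - w‖| ≤ |R| + ‖w‖ := by
  by_cases hv : v ∈ Metric.ball (0 : Vel d) R
  · rw [cutoff, indicator_of_mem hv, Pi.one_apply, one_mul, abs_norm]
    have := mem_ball_zero_iff.1 hv
    linarith [norm_sub_le v w, le_abs_self R]
  · rw [cutoff, indicator_of_notMem hv, zero_mul, abs_zero]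
    positivity

lemma memLp_speedMul {d : ℕ} (R : ℝ) (w : Vel d) {u : Vel d → ℝ} (hu : MemLp u 2 volume) :
    MemLp (fun v => cutoff R v * ‖v - w‖ * u v) 2 volume := by
  refine hu.of_le_mul (c := |R| + ‖w‖) ?_ (Eventually.of_forall fun v => ?_)
  · exact ((stronglyMeasurable_cutoff R).aestronglyMeasurable.mul
      (Continuous.aestronglyMeasurable (by fun_prop))).mul hu.1
  · rw [norm_mul, Real.norm_eq_abs]
    exact mul_le_mul_of_nonneg_right (abs_cutoff_mul_norm_sub_le R w v) (norm_nonneg _)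

/-- The operator of multiplication by `χ_R |· - w|` on `L²(ℝ^d)`. -/
def speedMul {d : ℕ} (R : ℝ) (w : Vel d) : L2V d →L[ℝ] L2V d :=
  LinearMap.mkContinuous
    { toFun := fun u => (memLp_speedMul R w (Lp.memLp u)).toLp _
      map_add' := fun u u' => by
        rw [← MemLp.toLp_add, MemLp.toLp_eq_toLp_iff]
        filter_upwards [Lp.coeFn_add u u'] with v hv
        simp only [hv, Pi.add_apply]; ring
      map_smul' := fun c u => by
        rw [RingHom.id_apply, ← MemLp.toLp_const_smul, MemLp.toLp_eq_toLp_iff]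
        filter_upwards [Lp.coeFn_smul c u] with v hv
        simp only [hv, Pi.smul_apply, smul_eq_mul]; ring } (|R| + ‖w‖)
    (fun u => by
      refine Lp.norm_le_mul_norm_of_ae_le_mul ?_
      rw [LinearMap.coe_mk, AddHom.coe_mk]
      filter_upwards [(memLp_speedMul R w (Lp.memLp u)).coeFn_toLp] with v hv
      rw [hv, norm_mul, Real.norm_eq_abs]
      exact mul_le_mul_of_nonneg_right (abs_cutoff_mul_norm_sub_le R w v) (norm_nonneg _))

lemma coeFn_speedMul {d : ℕ} (R : ℝ) (w : Vel d) (u : L2V d) :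
    speedMul R w u =ᵐ[volume] fun v => cutoff R v * ‖v - w‖ * u v :=
  (memLp_speedMul R w (Lp.memLp u)).coeFn_toLp

lemma norm_speedMul_le' {d : ℕ} (R : ℝ) (w : Vel d) (u : L2V d) :
    ‖speedMul R w u‖ ≤ (|R| + ‖w‖) * ‖u‖ :=
  (speedMul R w).le_of_opNorm_le (LinearMap.mkContinuous_norm_le _ (by positivity) _) u

lemma norm_speedMul_sub_le {d : ℕ} (R : ℝ) (w w' : Vel d) (u : L2V d) :
    ‖speedMul R w u - speedMul R w' u‖ ≤ ‖w - w'‖ * ‖u‖ := by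
  refine Lp.norm_le_mul_norm_of_ae_le_mul ?_
  filter_upwards [Lp.coeFn_sub (speedMul R w u) (speedMul R w' u), coeFn_speedMul R w u,
    coeFn_speedMul R w' u] with v h1 h2 h3
  rw [h1, Pi.sub_apply, h2, h3, ← sub_mul, ← mul_sub, norm_mul, norm_mul]
  refine mul_le_mul_of_nonneg_right ?_ (norm_nonneg _)
  have h4 : ‖cutoff R v‖ ≤ 1 := by
    rw [Real.norm_of_nonneg (cutoff_nonneg R v)]
    exact cutoff_le_one R v
  have h5 : ‖‖v - w‖ - ‖v - w'‖‖ ≤ ‖w - w'‖ := by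
    have := abs_norm_sub_norm_le (v - w) (v - w')
    rwa [sub_sub_sub_cancel_left, norm_sub_rev w'] at this
  calc _ ≤ 1 * ‖w - w'‖ := mul_le_mul h4 h5 (norm_nonneg _) zero_le_one
    _ = _ := one_mul _

/-- The cutoff is discontinuous in `v`, but the multiplier is Lipschitz in `w` uniformly in `v`.
This makes the integrand of `gainOp` strongly measurable. -/
lemma continuous_speedMul_comp {d : ℕ} (R : ℝ) {Y : Vel d → L2V d} (hY : Continuous Y) :
    Continuous fun w => speedMul R w (Y w) := by
  refine continuous_iff_continuousAt.2 fun w₀ => ?_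
  rw [ContinuousAt, tendsto_iff_norm_sub_tendsto_zero]
  have h1 : ∀ w, ‖speedMul R w (Y w) - speedMul R w₀ (Y w₀)‖ ≤
      ‖w - w₀‖ * ‖Y w‖ + (|R| + ‖w₀‖) * ‖Y w - Y w₀‖ := fun w => by
    have e : speedMul R w (Y w) - speedMul R w₀ (Y w₀) =
        (speedMul R w (Y w) - speedMul R w₀ (Y w)) + speedMul R w₀ (Y w - Y w₀) := by
      rw [map_sub]; abel
    rw [e]
    exact (norm_add_le _ _).trans
      (add_le_add (norm_speedMul_sub_le R w w₀ _) (norm_speedMul_le' R w₀ _))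
  refine squeeze_zero (fun _ => norm_nonneg _) h1 ?_
  have h2 : Continuous fun w => ‖w - w₀‖ * ‖Y w‖ + (|R| + ‖w₀‖) * ‖Y w - Y w₀‖ := by fun_prop
  have h3 := h2.tendsto w₀
  simpa using h3

lemma norm_speedMul_le {d : ℕ} {R : ℝ} (hR : 0 ≤ R) {w : Vel d} (hw : ‖w‖ ≤ R) (u : L2V d) :
    ‖speedMul R w u‖ ≤ 2 * R * ‖rs (Metric.ball 0 R) u‖ := by
  have := norm_le_sum_norm_rs (Finset.univ : Finset Unit) (fun _ => 2 * R)
    (fun _ => Metric.ball 0 R) (fun _ => Metric.isOpen_ball.measurableSet) (fun _ => u)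
    (F := speedMul R w u) (fun _ _ => by positivity) (by
      filter_upwards [coeFn_speedMul R w u] with v hv
      rw [hv, Finset.univ_unique, Finset.sum_singleton]
      by_cases hvR : v ∈ Metric.ball (0 : Vel d) R
      · rw [indicator_of_mem hvR, abs_mul]
        refine mul_le_mul_of_nonneg_right ((abs_cutoff_mul_norm_sub_le R w v).trans ?_)
          (abs_nonneg _)
        rw [abs_of_nonneg hR]; linarith
      · simp [cutoff, hvR])
  simpa using this

/-- For use with `a = u (v - h)` and `b = u v`. The terms account in order for the change of the
speed, the change of `u`, the points leaving the ball under translation by `h`, and the points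
entering it. -/
lemma abs_truncated_speed_sub_le {d : ℕ} {R : ℝ} {w h : Vel d} (hw : ‖w‖ ≤ R)
    (hh : ‖h‖ ≤ 1) (v : Vel d) (a b : ℝ) :
    |cutoff R (v - h) * ‖v - h - w‖ * a - cutoff R v * ‖v - w‖ * b| ≤
      ‖h‖ * |{x | x - h ∈ Metric.ball 0 R}.indicator (fun _ => a) v| +
      (2 * R + 1) * |{x | x - h ∈ Metric.ball 0 R}.indicator (fun _ => a - b) v| +
      (2 * R + 1) * |{x | x - h ∈ Metric.ball 0 R ∧ x ∉ Metric.ball 0 R}.indicator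
        (fun _ => b) v| +
      (2 * R + 1) * |{x | x - h ∉ Metric.ball 0 R ∧ x ∈ Metric.ball 0 R}.indicator
        (fun _ => b) v| := by
  have hdiff : |‖v - h - w‖ - ‖v - w‖| ≤ ‖h‖ := by
    have := abs_norm_sub_norm_le (v - h - w) (v - w)
    rwa [show v - h - w - (v - w) = -h by abel, norm_neg] at this
  have hn : ∀ x : Vel d, x ∈ Metric.ball (0 : Vel d) R → ‖x - w‖ ≤ 2 * R := fun x hx => by
    have := mem_ball_zero_iff.1 hx
    linarith [norm_sub_le x w]
  have hsplit : |‖v - h - w‖ * a - ‖v - w‖ * b| ≤ ‖h‖ * |a| + ‖v - w‖ * |a - b| := by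
    have e : ‖v - h - w‖ * a - ‖v - w‖ * b =
        (‖v - h - w‖ - ‖v - w‖) * a + ‖v - w‖ * (a - b) := by ring
    rw [e]
    refine (abs_add_le _ _).trans ?_
    rw [abs_mul, abs_mul, abs_norm]
    exact add_le_add (mul_le_mul_of_nonneg_right hdiff (abs_nonneg _)) le_rfl
  by_cases hv1 : v - h ∈ Metric.ball (0 : Vel d) R
  · have hvw : ‖v - w‖ ≤ 2 * R + 1 := by
      have h1 := hn _ hv1
      have h2 := (abs_le.1 hdiff).1
      linarith
    have h3 := mul_le_mul_of_nonneg_right hvw (abs_nonneg (a - b))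
    by_cases hv2 : v ∈ Metric.ball (0 : Vel d) R
    · simp only [cutoff, indicator, mem_ofPred_eq, hv1, hv2, if_true, not_true_eq_false, and_false,
        false_and, if_false, Pi.one_apply, one_mul, abs_zero, mul_zero, add_zero]
      linarith
    · simp only [cutoff, indicator, mem_ofPred_eq, hv1, hv2, if_true, not_true_eq_false, and_false,
        not_false_eq_true, and_true, if_false, Pi.one_apply, one_mul, abs_zero, mul_zero,
        add_zero, zero_mul, sub_zero]
      have h4 := mul_le_mul_of_nonneg_right hvw (abs_nonneg b)
      have h5 := abs_sub_abs_le_abs_sub (‖v - h - w‖ * a) (‖v - w‖ * b)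
      rw [abs_mul (‖v - w‖), abs_norm] at h5
      linarith
  · by_cases hv2 : v ∈ Metric.ball (0 : Vel d) R
    · simp only [cutoff, indicator, mem_ofPred_eq, hv1, hv2, if_true, not_true_eq_false,
        and_false, not_false_eq_true, true_and, if_false, Pi.one_apply, one_mul,
        abs_zero, mul_zero, add_zero, zero_add, zero_mul, zero_sub, abs_neg, abs_mul, abs_norm]
      have h4 := mul_le_mul_of_nonneg_right (hn v hv2) (abs_nonneg b)
      linarith [abs_nonneg b]
    · simp only [cutoff, indicator, mem_ofPred_eq, hv1, hv2, if_false, zero_mul, sub_zero, abs_zero,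
        and_false, false_and, mul_zero, add_zero, le_refl]

lemma norm_translate_speedMul_sub_le_sum {d : ℕ} {R : ℝ} (hR : 0 ≤ R) {w h : Vel d}
    (hw : ‖w‖ ≤ R) (hh : ‖h‖ ≤ 1) (u : L2V d) :
    ‖affComp 1 h (speedMul R w u) - speedMul R w u‖ ≤
      ‖h‖ * ‖rs {x | x - h ∈ Metric.ball 0 R} (affComp 1 h u)‖ +
      (2 * R + 1) * ‖rs {x | x - h ∈ Metric.ball 0 R} (affComp 1 h u - u)‖ +
      (2 * R + 1) * ‖rs {x | x - h ∈ Metric.ball 0 R ∧ x ∉ Metric.ball 0 R} u‖ +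
      (2 * R + 1) * ‖rs {x | x - h ∉ Metric.ball 0 R ∧ x ∈ Metric.ball 0 R} u‖ := by
  have hKm : MeasurableSet (Metric.ball (0 : Vel d) R) := Metric.isOpen_ball.measurableSet
  have hVm : MeasurableSet {x : Vel d | x - h ∈ Metric.ball 0 R} := (measurable_sub_const h) hKm
  have hmain := norm_le_sum_norm_rs (Finset.univ : Finset (Fin 4))
    ![‖h‖, 2 * R + 1, 2 * R + 1, 2 * R + 1]
    ![{x | x - h ∈ Metric.ball 0 R}, {x | x - h ∈ Metric.ball 0 R},
      {x | x - h ∈ Metric.ball 0 R ∧ x ∉ Metric.ball 0 R},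
      {x | x - h ∉ Metric.ball 0 R ∧ x ∈ Metric.ball 0 R}]
    (fun i => by
      fin_cases i
      exacts [hVm, hVm, hVm.inter hKm.compl, hVm.compl.inter hKm])
    ![affComp 1 h u, affComp 1 h u - u, u, u]
    (F := affComp 1 h (speedMul R w u) - speedMul R w u)
    (fun i _ => by
      have : 0 ≤ 2 * R + 1 := by linarith
      fin_cases i
      exacts [norm_nonneg _, this, this, this]) (by
      filter_upwards [Lp.coeFn_sub (affComp 1 h (speedMul R w u)) (speedMul R w u),
        coeFn_affComp 1 h (speedMul R w u),
        (quasiMeasurePreserving_affMap 1 h).ae_eq_comp (coeFn_speedMul R w u),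
        coeFn_speedMul R w u, coeFn_affComp 1 h u, Lp.coeFn_sub (affComp 1 h u) u]
        with v e1 e2 e3 e4 e5 e6
      simp only [Function.comp_apply, affMap_of_one_le le_rfl, one_smul] at e2 e3 e5
      have key := abs_truncated_speed_sub_le hw hh v (u (v - h)) (u v)
      rw [Fin.sum_univ_four, e1, Pi.sub_apply, e2, e3, e4]
      refine key.trans (le_of_eq ?_)
      rw [Pi.sub_apply, e5] at e6
      rw [← e6, ← e5]
      rfl)
  rw [Fin.sum_univ_four] at hmain
  exact hmain

lemma norm_le_rpow_third {d : ℕ} {h : Vel d} (h0 : h ≠ 0) (hle : ‖h‖ ≤ 1) :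
    ‖h‖ ≤ ‖h‖ ^ (1 / 3 : ℝ) := by
  calc ‖h‖ = ‖h‖ ^ (1 : ℝ) := (Real.rpow_one _).symm
    _ ≤ _ := Real.rpow_le_rpow_of_exponent_ge (norm_pos_iff.2 h0) hle (by norm_num)

/-- Truncating and multiplying by `|· - w|` turns weak differentiability into Hölder continuity
in `L²`. -/
lemma norm_translate_speedMul_sub_le {d : ℕ} {R : ℝ} (hR : 0 ≤ R) {w : Vel d} (hw : ‖w‖ ≤ R)
    {u : L2V d} {g : Fin d → L2V d} (hg : ∀ i, HasWeakPartial i u (g i)) (h : Vel d) :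
    ‖affComp 1 h (speedMul R w u) - speedMul R w u‖ ≤ (10 * R + 6) * ‖h‖ ^ (1 / 3 : ℝ) *
      (‖rs (Metric.ball 0 (R + 2)) u‖ + ∑ i, ‖rs (Metric.ball 0 (R + 2)) (g i)‖) := by
  obtain ⟨U, hU⟩ : ∃ U, U = ‖rs (Metric.ball 0 (R + 2)) u‖ := ⟨_, rfl⟩
  obtain ⟨G, hG⟩ : ∃ G, G = ∑ i, ‖rs (Metric.ball 0 (R + 2)) (g i)‖ := ⟨_, rfl⟩
  obtain ⟨ε, hε⟩ : ∃ ε, ε = ‖h‖ ^ (1 / 3 : ℝ) := ⟨_, rfl⟩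
  have hU0 : 0 ≤ U := hU ▸ norm_nonneg _
  have hG0 : 0 ≤ G := hG ▸ Finset.sum_nonneg fun i _ => norm_nonneg _
  have hε0 : 0 ≤ ε := hε ▸ Real.rpow_nonneg (norm_nonneg _) _
  have hmono : ‖rs (Metric.ball 0 R) u‖ ≤ U :=
    hU ▸ norm_rs_mono (Metric.ball_subset_ball (by linarith)) u
  rw [← hU, ← hG, ← hε]
  rcases eq_or_ne h 0 with rfl | h0
  · rw [affComp_zero le_rfl, sub_self, norm_zero]
    exact mul_nonneg (mul_nonneg (by linarith) hε0) (by linarith)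
  rcases lt_or_ge 1 ‖h‖ with hgt | hle
  -- Large translations need no cancellation: the difference is at most twice the norm.
  · have h1 : 1 ≤ ε := hε ▸ Real.one_le_rpow hgt.le (by norm_num)
    have h2 := norm_speedMul_le hR hw u
    calc _ ≤ ‖speedMul R w u‖ + ‖speedMul R w u‖ :=
          (norm_sub_le _ _).trans (add_le_add (norm_affComp_le _ _ _) le_rfl)
      _ ≤ 4 * R * U := by
          have := mul_le_mul_of_nonneg_left hmono hR
          linarith
      _ ≤ (10 * R + 6) * 1 * (U + G) := by
          have p1 : 0 ≤ R * U := mul_nonneg hR hU0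
          have p2 : 0 ≤ R * G := mul_nonneg hR hG0
          linarith
      _ ≤ _ := mul_le_mul_of_nonneg_right (mul_le_mul_of_nonneg_left h1 (by linarith))
          (by linarith)
  have hle' : ‖h‖ ≤ ε := hε ▸ norm_le_rpow_third h0 hle
  have hKc : Convex ℝ (Metric.ball (0 : Vel d) R) := convex_ball _ _
  have hKm : MeasurableSet (Metric.ball (0 : Vel d) R) := Metric.isOpen_ball.measurableSet
  have hVm : MeasurableSet {x : Vel d | x - h ∈ Metric.ball 0 R} := (measurable_sub_const h) hKm
  have hVR : {x : Vel d | x - h ∈ Metric.ball 0 R} ⊆ Metric.ball 0 (R + 1) := fun v hv => by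
    have h1 : ‖v - h‖ < R := mem_ball_zero_iff.1 hv
    rw [mem_ball_zero_iff]
    have := norm_add_le (v - h) h
    rw [sub_add_cancel] at this
    linarith
  have hb1 := norm_rs_le_of_disjoint_translates (ρ := R) (hVm.inter hKm.compl)
    (fun v hv => hVR hv.1) h0 hle (disjoint_exit_translates hKc h) hg
  have hb2 := norm_rs_le_of_disjoint_translates (ρ := R) (hVm.compl.inter hKm)
    (fun v hv => Metric.ball_subset_ball (by linarith) hv.2) h0 hle
    (disjoint_entry_translates hKc h) hg
  have hb3 : ‖rs {x : Vel d | x - h ∈ Metric.ball 0 R} (affComp 1 h u - u)‖ ≤ ε * G := by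
    refine (norm_rs_mono hVR _).trans ((norm_rs_translate_sub_le Metric.isOpen_ball
        (W := Metric.ball 0 (R + 2)) (fun v hv s hs => ?_) hg).trans ?_)
    · rw [mem_ball_zero_iff] at hv ⊢
      have h2 : ‖s • h‖ ≤ 1 := by
        rw [norm_smul, Real.norm_of_nonneg hs.1]
        exact (mul_le_of_le_one_left (norm_nonneg _) hs.2).trans hle
      linarith [norm_sub_le v (s • h)]
    · rw [hG, Finset.mul_sum]
      exact Finset.sum_le_sum fun i _ =>
        mul_le_mul_of_nonneg_right ((PiLp.norm_apply_le h i).trans hle') (norm_nonneg _)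
  have hb4 : ‖rs {x : Vel d | x - h ∈ Metric.ball 0 R} (affComp 1 h u)‖ ≤ U :=
    (norm_rs_affComp_le le_rfl hVm hKm (fun v hv => by rw [one_smul]; exact hv) u).trans hmono
  have hmain := norm_translate_speedMul_sub_le_sum hR hw hle u
  rw [← hU, ← hG, ← hε] at hb1 hb2
  have hR1 : 0 ≤ 2 * R + 1 := by linarith
  have q1 := mul_le_mul hle' hb4 (norm_nonneg _) hε0
  have q2 := mul_le_mul_of_nonneg_left hb3 hR1
  have q3 := mul_le_mul_of_nonneg_left hb1 hR1
  have q4 := mul_le_mul_of_nonneg_left hb2 hR1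
  -- The constant is 1 + 5(2R + 1) = 10R + 6: one from the speed, 2R + 1 from the difference of `u`,
  -- and 2(2R + 1) from each of the two boundary sets.
  have hfin : ε * U + (2 * R + 1) * (ε * G) + (2 * R + 1) * (2 * ε * (U + G)) +
      (2 * R + 1) * (2 * ε * (U + G)) ≤ (10 * R + 6) * ε * (U + G) := by
    have p1 : 0 ≤ ε * U := mul_nonneg hε0 hU0
    have p2 : 0 ≤ ε * G := mul_nonneg hε0 hG0
    have p3 : 0 ≤ R * (ε * U) := mul_nonneg hR p1
    linear_combination p1 + 2 * p3 + p2
  refine (hmain.trans (add_le_add (add_le_add (add_le_add q1 q2) q3) q4)).trans hfin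

/-! ### The collision operator as a bilinear form -/

lemma norm_rs_abs {d : ℕ} (V : Set (Vel d)) (u : L2V d) : ‖rs V |u|‖ = ‖rs V u‖ := by
  rw [norm_rs, norm_rs, ← eLpNorm_norm (u : Vel d → ℝ)]
  exact congrArg _ (eLpNorm_congr_ae (ae_restrict_of_ae (Lp.coeFn_abs u)))

/-- The `L²` norm of the cutoff. -/
def cutoffNorm (d : ℕ) (R : ℝ) : ℝ := ‖(memLp_cutoff (d := d) R).toLp (cutoff R)‖

lemma cutoffNorm_nonneg (d : ℕ) (R : ℝ) : 0 ≤ cutoffNorm d R := norm_nonneg _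

lemma integrable_mul_cutoff {d : ℕ} (R : ℝ) (g : L2V d) :
    Integrable fun w => g w * cutoff R w :=
  (Lp.memLp g).integrable_mul (memLp_cutoff R)

lemma integral_abs_mul_cutoff_le {d : ℕ} (R : ℝ) (g : L2V d) :
    ∫ w, |g w * cutoff R w| ≤ ‖rs (Metric.ball 0 R) g‖ * cutoffNorm d R := by
  have h := abs_integral_mul_le (memLp_cutoff (d := d) R) (W := Metric.ball 0 R)
    Set.support_indicator_subset |g|
  rw [norm_rs_abs] at h
  refine (le_of_eq ?_).trans ((le_abs_self _).trans h)
  refine integral_congr_ae ?_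
  filter_upwards [Lp.coeFn_abs g] with w hw
  rw [hw, abs_mul, abs_of_nonneg (cutoff_nonneg R w)]

lemma continuous_speedMul_affComp {d : ℕ} (R α β : ℝ) (f : L2V d) :
    Continuous fun w => speedMul R w (affComp α (β • w) f) :=
  continuous_speedMul_comp R (continuous_affComp_smul α β f)

lemma norm_smul_le_of_cutoff {d : ℕ} {E : Type*} [NormedAddCommGroup E] [NormedSpace ℝ E]
    {R C : ℝ} {Y : Vel d → E} (hY : ∀ w, ‖w‖ ≤ R → ‖Y w‖ ≤ C) (α : ℝ) (g : L2V d) (w : Vel d) :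
    ‖(α ^ 2 * (g w * cutoff R w)) • Y w‖ ≤ α ^ 2 * C * |g w * cutoff R w| := by
  rw [norm_smul, norm_mul, Real.norm_of_nonneg (sq_nonneg α), Real.norm_eq_abs]
  by_cases hw : w ∈ Metric.ball (0 : Vel d) R
  · have := mul_le_mul_of_nonneg_left (hY w (mem_ball_zero_iff.1 hw).le)
      (mul_nonneg (sq_nonneg α) (abs_nonneg (g w * cutoff R w)))
    linarith
  · simp [cutoff, hw]

lemma integrable_cutoff_smul {d : ℕ} {R C : ℝ} {Y : Vel d → L2V d} (hYc : Continuous Y)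
    (hY : ∀ w, ‖w‖ ≤ R → ‖Y w‖ ≤ C) (α : ℝ) (g : L2V d) :
    Integrable fun w => (α ^ 2 * (g w * cutoff R w)) • Y w := by
  refine ((integrable_mul_cutoff R g).abs.const_mul (α ^ 2 * C)).mono' ?_
    (Eventually.of_forall fun w => norm_smul_le_of_cutoff hY α g w)
  exact ((integrable_mul_cutoff R g).const_mul _).1.smul hYc.aestronglyMeasurable

lemma norm_integral_cutoff_smul_le {d : ℕ} {R C : ℝ} (hC : 0 ≤ C) {Y : Vel d → L2V d}
    (hY : ∀ w, ‖w‖ ≤ R → ‖Y w‖ ≤ C) (α : ℝ) (g : L2V d) :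
    ‖∫ w, (α ^ 2 * (g w * cutoff R w)) • Y w‖ ≤
      α ^ 2 * C * (‖rs (Metric.ball 0 R) g‖ * cutoffNorm d R) := by
  refine (norm_integral_le_of_norm_le ((integrable_mul_cutoff R g).abs.const_mul (α ^ 2 * C))
    (Eventually.of_forall fun w => norm_smul_le_of_cutoff hY α g w)).trans ?_
  rw [integral_const_mul]
  exact mul_le_mul_of_nonneg_left (integral_abs_mul_cutoff_le R g)
    (mul_nonneg (sq_nonneg α) hC)

/-- The bilinear form `χ_R(v) ∫ f(α v - β w) g(w) |v - w| α² χ_R(w) dw`. -/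
def gainOp {d : ℕ} (R α β : ℝ) (f g : L2V d) : L2V d :=
  ∫ w, (α ^ 2 * (g w * cutoff R w)) • speedMul R w (affComp α (β • w) f)

/-- Finite range: for |v| < R and |w| ≤ R the argument α v - β w stays in the ball of radius αR +
βR, so `f` outside `B(0, ρ)` is irrelevant. -/
lemma norm_speedMul_affComp_le {d : ℕ} {R α β ρ : ℝ} (hR : 0 ≤ R) (hα : 1 ≤ α) (hβ : 0 ≤ β)
    (hρ : α * R + β * R ≤ ρ) (f : L2V d) {w : Vel d} (hw : ‖w‖ ≤ R) :
    ‖speedMul R w (affComp α (β • w) f)‖ ≤ 2 * R * ‖rs (Metric.ball 0 ρ) f‖ := by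
  refine (norm_speedMul_le hR hw _).trans (mul_le_mul_of_nonneg_left ?_ (by linarith))
  refine norm_rs_affComp_le hα Metric.isOpen_ball.measurableSet Metric.isOpen_ball.measurableSet
    (fun v hv => ?_) f
  rw [mem_ball_zero_iff] at hv ⊢
  have h1 : ‖α • v‖ < α * R := by
    rw [norm_smul, Real.norm_of_nonneg (by linarith)]
    exact mul_lt_mul_of_pos_left hv (by linarith)
  have h2 : ‖β • w‖ ≤ β * R := by
    rw [norm_smul, Real.norm_of_nonneg hβ]
    exact mul_le_mul_of_nonneg_left hw hβ
  linarith [norm_sub_le (α • v) (β • w)]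

lemma integrable_gainOp {d : ℕ} {R α β : ℝ} (hR : 0 ≤ R) (hα : 1 ≤ α) (hβ : 0 ≤ β)
    (f g : L2V d) :
    Integrable fun w => (α ^ 2 * (g w * cutoff R w)) • speedMul R w (affComp α (β • w) f) :=
  integrable_cutoff_smul (continuous_speedMul_affComp R α β f)
    (fun _ hw => norm_speedMul_affComp_le hR hα hβ le_rfl f hw) α g

lemma norm_gainOp_le {d : ℕ} {R α β ρ : ℝ} (hR : 0 ≤ R) (hα : 1 ≤ α) (hβ : 0 ≤ β)
    (hρ : α * R + β * R ≤ ρ) (hρR : R ≤ ρ) (f g : L2V d) :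
    ‖gainOp R α β f g‖ ≤ α ^ 2 * (2 * R) * cutoffNorm d R *
      (‖rs (Metric.ball 0 ρ) f‖ * ‖rs (Metric.ball 0 ρ) g‖) := by
  refine (norm_integral_cutoff_smul_le (by positivity)
    (fun w hw => norm_speedMul_affComp_le hR hα hβ hρ f hw) α g).trans ?_
  have h1 := norm_rs_mono (Metric.ball_subset_ball (x := (0 : Vel d)) hρR) g
  have h2 : 0 ≤ α ^ 2 * (2 * R) * cutoffNorm d R * ‖rs (Metric.ball 0 ρ) f‖ := by
    have := cutoffNorm_nonneg d R
    positivity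
  have := mul_le_mul_of_nonneg_left h1 h2
  linarith

lemma gainOp_sub_left {d : ℕ} {R α β : ℝ} (hR : 0 ≤ R) (hα : 1 ≤ α) (hβ : 0 ≤ β)
    (f f' g : L2V d) : gainOp R α β (f - f') g = gainOp R α β f g - gainOp R α β f' g := by
  rw [gainOp, gainOp, gainOp, ← integral_sub (integrable_gainOp hR hα hβ f g)
    (integrable_gainOp hR hα hβ f' g)]
  simp only [map_sub, smul_sub]

lemma gainOp_sub_right {d : ℕ} {R α β : ℝ} (hR : 0 ≤ R) (hα : 1 ≤ α) (hβ : 0 ≤ β)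
    (f g g' : L2V d) : gainOp R α β f (g - g') = gainOp R α β f g - gainOp R α β f g' := by
  rw [gainOp, gainOp, gainOp, ← integral_sub (integrable_gainOp hR hα hβ f g)
    (integrable_gainOp hR hα hβ f g')]
  refine integral_congr_ae ?_
  filter_upwards [Lp.coeFn_sub g g'] with w hw
  rw [hw, Pi.sub_apply, ← sub_smul]
  congr 1
  ring

/-- Translation in `v` acts on `f` and on the truncated speed only; `g` is evaluated at the
integration variable, so it needs no derivative. In `α ^ 3`, two powers are the prefactor and one is
the chain rule. -/
lemma norm_translate_gainOp_sub_le {d : ℕ} {R α β ρ : ℝ} (hR : 0 ≤ R) (hα : 1 ≤ α)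
    (hβ : 0 ≤ β) (hρ : α * (R + 2) + β * R ≤ ρ) (hρR : R ≤ ρ) {f : L2V d} {f' : Fin d → L2V d}
    (hf : ∀ i, HasWeakPartial i f (f' i)) (g : L2V d) (h : Vel d) :
    ‖affComp 1 h (gainOp R α β f g) - gainOp R α β f g‖ ≤
      α ^ 3 * (10 * R + 6) * cutoffNorm d R * (‖rs (Metric.ball 0 ρ) f‖ +
        ∑ i, ‖rs (Metric.ball 0 ρ) (f' i)‖) * ‖rs (Metric.ball 0 ρ) g‖ * ‖h‖ ^ (1 / 3 : ℝ) := by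
  have hint := integrable_gainOp hR hα hβ f g
  have hα0 : 0 ≤ α := by linarith
  have e : affComp 1 h (gainOp R α β f g) - gainOp R α β f g =
      ∫ w, (α ^ 2 * (g w * cutoff R w)) • (affComp 1 h (speedMul R w (affComp α (β • w) f)) -
        speedMul R w (affComp α (β • w) f)) := by
    rw [gainOp, ← (affComp 1 h).integral_comp_comm hint, ← integral_sub
      ((affComp 1 h).integrable_comp hint) hint]
    simp only [map_smul, smul_sub]
  obtain ⟨N, hN⟩ : ∃ N, N = ‖rs (Metric.ball 0 ρ) f‖ + ∑ i, ‖rs (Metric.ball 0 ρ) (f' i)‖ :=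
    ⟨_, rfl⟩
  obtain ⟨ε, hε⟩ : ∃ ε, ε = ‖h‖ ^ (1 / 3 : ℝ) := ⟨_, rfl⟩
  have hε0 : 0 ≤ ε := hε ▸ Real.rpow_nonneg (norm_nonneg _) _
  have hN0 : 0 ≤ N := hN ▸ add_nonneg (norm_nonneg _) (Finset.sum_nonneg fun i _ => norm_nonneg _)
  rw [← hN, ← hε, e]
  have hY : ∀ w : Vel d, ‖w‖ ≤ R → ‖affComp 1 h (speedMul R w (affComp α (β • w) f)) -
        speedMul R w (affComp α (β • w) f)‖ ≤ (10 * R + 6) * ε * (α * N) := by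
    intro w hw
    have hb : ∀ u : L2V d, ‖rs (Metric.ball 0 (R + 2)) (affComp α (β • w) u)‖ ≤
        ‖rs (Metric.ball 0 ρ) u‖ := by
      refine norm_rs_affComp_le hα Metric.isOpen_ball.measurableSet
        Metric.isOpen_ball.measurableSet (fun v hv => ?_)
      rw [mem_ball_zero_iff] at hv ⊢
      have h1 : ‖α • v‖ < α * (R + 2) := by
        rw [norm_smul, Real.norm_of_nonneg hα0]
        exact mul_lt_mul_of_pos_left hv (by linarith)
      have h2 : ‖β • w‖ ≤ β * R := by
        rw [norm_smul, Real.norm_of_nonneg hβ]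
        exact mul_le_mul_of_nonneg_left hw hβ
      linarith [norm_sub_le (α • v) (β • w)]
    refine (norm_translate_speedMul_sub_le hR hw
      (fun i => (hf i).affComp hα (β • w)) h).trans ?_
    rw [← hε]
    refine mul_le_mul_of_nonneg_left ?_ (mul_nonneg (by linarith) hε0)
    rw [hN, mul_add, Finset.mul_sum]
    refine add_le_add ((hb f).trans (le_mul_of_one_le_left (norm_nonneg _) hα))
      (Finset.sum_le_sum fun i _ => ?_)
    rw [map_smul, norm_smul, Real.norm_of_nonneg hα0]
    exact mul_le_mul_of_nonneg_left (hb _) hα0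
  refine (norm_integral_cutoff_smul_le
    (mul_nonneg (mul_nonneg (by linarith) hε0) (mul_nonneg hα0 hN0)) hY α g).trans ?_
  have h1 := norm_rs_mono (Metric.ball_subset_ball (x := (0 : Vel d)) hρR) g
  have h2 : 0 ≤ α ^ 2 * ((10 * R + 6) * ε * (α * N)) * cutoffNorm d R := by
    have := cutoffNorm_nonneg d R
    positivity
  have := mul_le_mul_of_nonneg_left h1 h2
  linarith

lemma gainOp_eq_toLp {d : ℕ} {R α β : ℝ} (hR : 0 ≤ R) (hα : 1 ≤ α) (hβ : 0 ≤ β) (f g : L2V d)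
    {F : Vel d → ℝ} (hF : MemLp F 2 volume) (hFy : ∀ v, F v =
      ∫ w, α ^ 2 * (g w * cutoff R w) * (cutoff R v * ‖v - w‖ * f (α • v - β • w))) :
    gainOp R α β f g = hF.toLp F := by
  refine integral_smul_eq_toLp (y := fun w v => cutoff R v * ‖v - w‖ * f (α • v - β • w))
    (((Lp.stronglyMeasurable g).mul (stronglyMeasurable_cutoff R)).const_mul _)
    (integrable_gainOp hR hα hβ f g) ?_ (fun w => ?_) hF hFy
  · refine (((stronglyMeasurable_cutoff R).comp_measurable measurable_snd).mul
      (Continuous.stronglyMeasurable (by fun_prop))).mul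
      ((Lp.stronglyMeasurable f).comp_measurable (by fun_prop))
  · filter_upwards [coeFn_speedMul R w (affComp α (β • w) f), coeFn_affComp α (β • w) f]
      with v h1 h2
    rw [h1, h2, affMap_of_one_le hα]

lemma mass_ne_zero {M : ℕ} (i : Fin M) : mass i ≠ 0 := Nat.succ_ne_zero _

/-- The velocity ratio `(n + k) / n` of a collision of masses `n` and `k`. -/
def massRatio (n k : ℕ) : ℝ := ((n : ℝ) + k) / n

/-- The bilinear form that induces `Q^R_m`. -/
def collisionForm {d M : ℕ} (R : ℝ) (f g : Fin M → L2V d) (m : Fin M) : L2V d :=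
  (∑ p : Fin M × Fin M with mass p.1 + mass p.2 = mass m,
      gainOp R (massRatio (mass p.1) (mass p.2)) ((mass p.2 : ℝ) / mass p.1) (f p.1) (g p.2))
    - (2 : ℝ) • ∑ n : Fin M, gainOp R 1 0 (f m) (g n)

lemma one_le_massRatio {n k : ℕ} (hn : n ≠ 0) : 1 ≤ massRatio n k := by
  have : (0 : ℝ) < n := by exact_mod_cast Nat.pos_of_ne_zero hn
  rw [massRatio, one_le_div this]
  have : (0 : ℝ) ≤ k := by positivity
  linarith

lemma massRatio_le {M : ℕ} (p : Fin M × Fin M) {m : Fin M} (h : mass p.1 + mass p.2 = mass m) :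
    massRatio (mass p.1) (mass p.2) ≤ M ∧ (mass p.2 : ℝ) / mass p.1 ≤ M := by
  have h1 : (1 : ℝ) ≤ mass p.1 := by exact_mod_cast Nat.succ_le_succ (Nat.zero_le _)
  have h2 : ((mass p.1 : ℝ) + mass p.2) ≤ M := by
    have : mass m ≤ M := m.2
    exact_mod_cast h ▸ this
  have h3 : (0 : ℝ) ≤ mass p.2 := by positivity
  exact ⟨(div_le_self (by positivity) h1).trans h2, (div_le_self h3 h1).trans (by linarith)⟩

/-- A loss term is a gain term with α = 1 and β = 0, while a gain term for masses n and k has α = (n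
+ k)/n and β = k/n. One family of bilinear forms thus covers the whole operator. -/
lemma collisionL2_eq {d M : ℕ} {R : ℝ} (hR : 0 ≤ R) (f : Fin M → L2V d) (m : Fin M) :
    collisionL2 R f m = collisionForm R f f m := by
  have hg : ∀ p : Fin M × Fin M, gainOp R (massRatio (mass p.1) (mass p.2))
      ((mass p.2 : ℝ) / mass p.1) (f p.1) (f p.2) =ᵐ[volume]
      gain R (mass p.1) (mass p.2) (f p.1 : Vel d → ℝ) (f p.2) := by
    intro p
    have hn : mass p.1 ≠ 0 := mass_ne_zero _
    have hm := memLp_gain R hn (mass_ne_zero p.2)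
      (Lp.stronglyMeasurable (f p.1)) (Lp.memLp (f p.1)) (Lp.stronglyMeasurable (f p.2))
      (Lp.memLp (f p.2))
    rw [gainOp_eq_toLp hR (one_le_massRatio hn) (by positivity) (f p.1) (f p.2) hm fun v => ?_]
    · exact hm.coeFn_toLp
    · rw [gain, ← integral_const_mul]
      refine integral_congr_ae (Eventually.of_forall fun w => ?_)
      have hn' : (mass p.1 : ℝ) ≠ 0 := by exact_mod_cast hn
      have e : (mass p.1 : ℝ)⁻¹ • (((mass p.1 : ℝ) + mass p.2) • v - (mass p.2 : ℝ) • w) =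
          massRatio (mass p.1) (mass p.2) • v - ((mass p.2 : ℝ) / mass p.1) • w := by
        rw [smul_sub, smul_smul, smul_smul, massRatio, div_eq_inv_mul, div_eq_inv_mul]
      change _ * (f p.1 ((mass p.1 : ℝ)⁻¹ • (((mass p.1 : ℝ) + mass p.2) • v -
        (mass p.2 : ℝ) • w)) * _ * _ * massRatio _ _ ^ 2 * _) = _
      rw [e]
      ring
  have hl : ∀ n : Fin M, gainOp R 1 0 (f m) (f n) =ᵐ[volume]
      loss R (f m : Vel d → ℝ) (f n) := by
    intro n
    have hm := memLp_loss R (Lp.stronglyMeasurable (f m)) (Lp.memLp (f m))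
      (Lp.stronglyMeasurable (f n)) (Lp.memLp (f n))
    rw [gainOp_eq_toLp hR le_rfl le_rfl (f m) (f n) hm fun v => ?_]
    · exact hm.coeFn_toLp
    · rw [loss, ← integral_const_mul]
      refine integral_congr_ae (Eventually.of_forall fun w => ?_)
      simp only [one_smul, zero_smul, sub_zero]
      ring
  have hsum : ∀ {ι : Type} (s : Finset ι) (F : ι → L2V d) (G : ι → Vel d → ℝ),
      (∀ i, F i =ᵐ[volume] G i) → (∑ i ∈ s, F i : L2V d) =ᵐ[volume] fun v => ∑ i ∈ s, G i v := by
    classical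
    intro ι s F G h
    induction s using Finset.induction_on with
    | empty => simp only [Finset.sum_empty]; exact Lp.coeFn_zero ℝ 2 volume
    | insert i t hi ih =>
      simp only [Finset.sum_insert hi]
      exact (Lp.coeFn_add _ _).trans ((h i).add ih)
  refine Lp.ext ?_
  have h1 := hsum ({p : Fin M × Fin M | mass p.1 + mass p.2 = mass m} : Finset _) _ _ hg
  have h2 := hsum Finset.univ _ _ hl
  filter_upwards [(memLp_collision R f m).coeFn_toLp, h1, h2,
    Lp.coeFn_sub (∑ p : Fin M × Fin M with mass p.1 + mass p.2 = mass m,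
      gainOp R (massRatio (mass p.1) (mass p.2)) ((mass p.2 : ℝ) / mass p.1) (f p.1) (f p.2))
      ((2 : ℝ) • ∑ n : Fin M, gainOp R 1 0 (f m) (f n)),
    Lp.coeFn_smul (2 : ℝ) (∑ n : Fin M, gainOp R 1 0 (f m) (f n))] with v e1 e2 e3 e4 e5
  rw [collisionL2, e1, collisionForm, e4, Pi.sub_apply, e5, Pi.smul_apply, e2, e3, collision,
    smul_eq_mul]

lemma collisionForm_sub_left {d M : ℕ} {R : ℝ} (hR : 0 ≤ R) (f f' g : Fin M → L2V d)
    (m : Fin M) : collisionForm R (f - f') g m = collisionForm R f g m - collisionForm R f' g m := by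
  have h1 : ∀ p : Fin M × Fin M, _ := fun p => gainOp_sub_left hR
    (one_le_massRatio (k := mass p.2) (mass_ne_zero p.1))
    (β := (mass p.2 : ℝ) / mass p.1) (by positivity) (f p.1) (f' p.1) (g p.2)
  have h2 : ∀ n : Fin M, _ := fun n => gainOp_sub_left hR le_rfl le_rfl (f m) (f' m) (g n)
  simp only [collisionForm, Pi.sub_apply, h2, Finset.sum_sub_distrib, smul_sub]
  rw [Finset.sum_congr rfl fun p _ => h1 p, Finset.sum_sub_distrib]
  abel

lemma collisionForm_sub_right {d M : ℕ} {R : ℝ} (hR : 0 ≤ R) (f g g' : Fin M → L2V d)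
    (m : Fin M) : collisionForm R f (g - g') m = collisionForm R f g m - collisionForm R f g' m := by
  have h1 : ∀ p : Fin M × Fin M, _ := fun p => gainOp_sub_right hR
    (one_le_massRatio (k := mass p.2) (mass_ne_zero p.1))
    (β := (mass p.2 : ℝ) / mass p.1) (by positivity) (f p.1) (g p.2) (g' p.2)
  have h2 : ∀ n : Fin M, _ := fun n => gainOp_sub_right hR le_rfl le_rfl (f m) (g n) (g' n)
  simp only [collisionForm, Pi.sub_apply, h2, Finset.sum_sub_distrib, smul_sub]
  rw [Finset.sum_congr rfl fun p _ => h1 p, Finset.sum_sub_distrib]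
  abel

lemma collisionL2_sub {d M : ℕ} {R : ℝ} (hR : 0 ≤ R) (f g : Fin M → L2V d) (m : Fin M) :
    collisionL2 R f m - collisionL2 R g m =
      collisionForm R (f - g) f m + collisionForm R g (f - g) m := by
  rw [collisionL2_eq hR, collisionL2_eq hR, collisionForm_sub_left hR,
    collisionForm_sub_right hR]
  abel

/-- The sum of the norms of the components on the ball `B(0, ρ)`. -/
def locNorm {d : ℕ} {ι : Type*} [Fintype ι] (ρ : ℝ) (f : ι → L2V d) : ℝ :=
  ∑ i, ‖rs (Metric.ball 0 ρ) (f i)‖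

lemma locNorm_nonneg {d : ℕ} {ι : Type*} [Fintype ι] (ρ : ℝ) (f : ι → L2V d) :
    0 ≤ locNorm ρ f :=
  Finset.sum_nonneg fun _ _ => norm_nonneg _

lemma norm_rs_le_locNorm {d : ℕ} {ι : Type*} [Fintype ι] (ρ : ℝ) (f : ι → L2V d) (i : ι) :
    ‖rs (Metric.ball 0 ρ) (f i)‖ ≤ locNorm ρ f :=
  Finset.single_le_sum (f := fun i => ‖rs (Metric.ball 0 ρ) (f i)‖) (fun _ _ => norm_nonneg _)
    (Finset.mem_univ i)

/-- Bounds for the form from bounds for its constituents. -/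
lemma norm_collisionForm_map_le {d M : ℕ} {E : Type*} [NormedAddCommGroup E] [NormedSpace ℝ E]
    (L : L2V d →L[ℝ] E) {R B : ℝ} {f g : Fin M → L2V d} {m : Fin M}
    (hB : ∀ α β : ℝ, 1 ≤ α → 0 ≤ β → α ≤ M + 1 → β ≤ M → ∀ i j,
      ‖L (gainOp R α β (f i) (g j))‖ ≤ B) :
    ‖L (collisionForm R f g m)‖ ≤ ((M : ℝ) ^ 2 + 2 * M) * B := by
  rcases Nat.eq_zero_or_pos M with rfl | hM
  · exact m.elim0
  have hM0 : (0 : ℝ) ≤ M := by positivity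
  have hB0 : 0 ≤ B := (norm_nonneg _).trans (hB 1 0 le_rfl le_rfl (by linarith) hM0 m m)
  rw [collisionForm, map_sub, map_smul, map_sum, map_sum]
  refine (norm_sub_le _ _).trans ?_
  rw [add_mul]
  refine add_le_add ?_ ?_
  · refine (norm_sum_le _ _).trans ((Finset.sum_le_sum (g := fun _ => B) fun p hp => ?_).trans ?_)
    · have h := massRatio_le p (Finset.mem_filter.1 hp).2
      exact hB _ _ (one_le_massRatio (mass_ne_zero _)) (by positivity)
        (h.1.trans (by linarith)) h.2 _ _
    · rw [Finset.sum_const, nsmul_eq_mul]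
      refine mul_le_mul_of_nonneg_right ?_ hB0
      have : Finset.card ({p : Fin M × Fin M | mass p.1 + mass p.2 = mass m} : Finset _) ≤ M ^ 2 := by
        refine (Finset.card_le_univ _).trans (le_of_eq ?_)
        rw [Fintype.card_prod, Fintype.card_fin, sq]
      exact_mod_cast this
  · rw [norm_smul, Real.norm_of_nonneg zero_le_two, mul_assoc]
    refine mul_le_mul_of_nonneg_left ((norm_sum_le _ _).trans
      ((Finset.sum_le_sum (g := fun _ => B) fun n _ =>
        hB 1 0 le_rfl le_rfl (by linarith) hM0 m n).trans (le_of_eq ?_))) zero_le_two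
    rw [Finset.sum_const, Finset.card_univ, Fintype.card_fin, nsmul_eq_mul]

/-- The radius works for all masses at once: α ≤ M + 1 and β ≤ M give α(R + 2) + βR ≤ (2M + 1)(R +
2). The extra 2 is room for the translations in the Hölder estimate. -/
lemma exists_norm_collisionForm_le (d M : ℕ) {R : ℝ} (hR : 0 ≤ R) :
    ∃ C, 0 ≤ C ∧ ∀ ρ, (2 * M + 1) * (R + 2) ≤ ρ → ∀ (f g : Fin M → L2V d) (m : Fin M),
      ‖collisionForm R f g m‖ ≤ C * (locNorm ρ f * locNorm ρ g) := by
  have hc := cutoffNorm_nonneg d R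
  refine ⟨((M : ℝ) ^ 2 + 2 * M) * (((M : ℝ) + 1) ^ 2 * (2 * R) * cutoffNorm d R), by positivity,
    fun ρ hρ f g m => ?_⟩
  rw [mul_assoc]
  refine norm_collisionForm_map_le (ContinuousLinearMap.id ℝ (L2V d))
    fun α β hα hβ hαM hβM i j => ?_
  have hM0 : (0 : ℝ) ≤ M := by positivity
  have h1 : α * R + β * R ≤ ρ := by
    have := mul_le_mul_of_nonneg_right (add_le_add hαM hβM) hR
    nlinarith
  refine (norm_gainOp_le hR hα hβ h1 (by nlinarith) (f i) (g j)).trans ?_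
  refine mul_le_mul ?_ (mul_le_mul (norm_rs_le_locNorm ρ f i) (norm_rs_le_locNorm ρ g j)
    (norm_nonneg _) (locNorm_nonneg ρ f)) (by positivity) (by positivity)
  gcongr

lemma exists_norm_translate_collisionForm_sub_le (d M : ℕ) {R : ℝ} (hR : 0 ≤ R) :
    ∃ C, 0 ≤ C ∧ ∀ ρ, (2 * M + 1) * (R + 2) ≤ ρ → ∀ (f g : Fin M → L2V d)
      (f' : Fin M → Fin d → L2V d), (∀ n i, HasWeakPartial i (f n) (f' n i)) →
      ∀ (m : Fin M) (h : Vel d),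
      ‖affComp 1 h (collisionForm R f g m) - collisionForm R f g m‖ ≤
        C * ((locNorm ρ f + ∑ n, locNorm ρ (f' n)) * locNorm ρ g) * ‖h‖ ^ (1 / 3 : ℝ) := by
  have hc := cutoffNorm_nonneg d R
  refine ⟨((M : ℝ) ^ 2 + 2 * M) * (((M : ℝ) + 1) ^ 3 * (10 * R + 6) * cutoffNorm d R),
    by positivity, fun ρ hρ f g f' hf m h => ?_⟩
  rw [mul_assoc, mul_assoc]
  refine norm_collisionForm_map_le (affComp 1 h - ContinuousLinearMap.id ℝ (L2V d))
    fun α β hα hβ hαM hβM i j => ?_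
  have hM0 : (0 : ℝ) ≤ M := by positivity
  have h1 : α * (R + 2) + β * R ≤ ρ := by
    have e1 := mul_le_mul_of_nonneg_right hαM (by linarith : 0 ≤ R + 2)
    have e2 := mul_le_mul_of_nonneg_right hβM hR
    nlinarith
  refine (norm_translate_gainOp_sub_le hR hα hβ h1 (by nlinarith) (hf i) (g j) h).trans ?_
  have e1 : ‖rs (Metric.ball 0 ρ) (f i)‖ + ∑ k, ‖rs (Metric.ball 0 ρ) (f' i k)‖ ≤
      locNorm ρ f + ∑ n, locNorm ρ (f' n) :=
    add_le_add (norm_rs_le_locNorm ρ f i)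
      (Finset.single_le_sum (f := fun n => locNorm ρ (f' n)) (fun n _ => locNorm_nonneg ρ _)
        (Finset.mem_univ i))
  have e0 : 0 ≤ ‖rs (Metric.ball 0 ρ) (f i)‖ + ∑ k, ‖rs (Metric.ball 0 ρ) (f' i k)‖ :=
    add_nonneg (norm_nonneg _) (Finset.sum_nonneg fun _ _ => norm_nonneg _)
  have e2 := mul_le_mul e1 (norm_rs_le_locNorm ρ g j) (norm_nonneg _) (e0.trans e1)
  have e3 : α ^ 3 * (10 * R + 6) * cutoffNorm d R ≤
      ((M : ℝ) + 1) ^ 3 * (10 * R + 6) * cutoffNorm d R := by gcongr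
  have e4 := mul_le_mul e3 e2 (mul_nonneg e0 (norm_nonneg _)) (by positivity)
  have e5 := mul_le_mul_of_nonneg_right e4 (Real.rpow_nonneg (norm_nonneg h) (1 / 3))
  refine (le_of_eq ?_).trans (e5.trans (le_of_eq ?_)) <;> ring

/-! ### Semilinear equations for a semigroup of operators -/

/-- Lipschitz continuity on bounded sets. -/
def LipschitzOnBalls {Y : Type*} [NormedAddCommGroup Y] (N : Y → Y) : Prop :=
  ∀ r : ℝ, ∃ L : ℝ, 0 ≤ L ∧ ∀ x y, ‖x‖ ≤ r → ‖y‖ ≤ r → ‖N x - N y‖ ≤ L * ‖x - y‖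

lemma LipschitzOnBalls.continuous {Y : Type*} [NormedAddCommGroup Y] {N : Y → Y} (hN : LipschitzOnBalls N) : Continuous N := by
  refine continuous_iff_continuousAt.2 fun x => ?_
  obtain ⟨L, hL, h⟩ := hN (‖x‖ + 1)
  rw [ContinuousAt, tendsto_iff_norm_sub_tendsto_zero]
  have h1 : ∀ᶠ y in 𝓝 x, ‖N y - N x‖ ≤ L * ‖y - x‖ := by
    filter_upwards [Metric.ball_mem_nhds x one_pos] with y hy
    refine h y x ?_ (by linarith)
    have := norm_sub_norm_le y x
    rw [mem_ball_iff_norm] at hy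
    linarith
  refine squeeze_zero' (Eventually.of_forall fun _ => norm_nonneg _) h1 ?_
  have h2 : Continuous fun y => L * ‖y - x‖ := by fun_prop
  simpa using h2.tendsto x

section Abstract

variable {X : Type*} [NormedAddCommGroup X] [NormedSpace ℝ X]

/-- A strongly continuous semigroup, arbitrarily but continuously extended to negative times. -/
structure IsOpSemigroup (S : ℝ → X →L[ℝ] X) : Prop where
  zero : ∀ x, S 0 x = x
  add : ∀ s t, 0 ≤ s → 0 ≤ t → ∀ x, S (s + t) x = S s (S t x)
  continuous : Continuous fun p : ℝ × X => S p.1 p.2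

/-- The exponential bound is locally uniform in time, which upgrades strong continuity to joint
continuity. -/
lemma IsOpSemigroup.of_strong {S : ℝ → X →L[ℝ] X} (h0 : ∀ x, S 0 x = x)
    (hadd : ∀ s t, 0 ≤ s → 0 ≤ t → ∀ x, S (s + t) x = S s (S t x))
    (hc : ∀ x, Continuous fun t => S t x) {c : ℝ}
    (hn : ∀ t x, ‖S t x‖ ≤ Real.exp (c * t) * ‖x‖) : IsOpSemigroup S := by
  refine ⟨h0, hadd, continuous_iff_continuousAt.2 fun p₀ => ?_⟩
  rw [ContinuousAt, tendsto_iff_norm_sub_tendsto_zero]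
  have h1 : ∀ p : ℝ × X, ‖S p.1 p.2 - S p₀.1 p₀.2‖ ≤
      Real.exp (c * p.1) * ‖p.2 - p₀.2‖ + ‖S p.1 p₀.2 - S p₀.1 p₀.2‖ := fun p => by
    have e : S p.1 p.2 - S p₀.1 p₀.2 = S p.1 (p.2 - p₀.2) + (S p.1 p₀.2 - S p₀.1 p₀.2) := by
      rw [map_sub]; abel
    rw [e]
    exact (norm_add_le _ _).trans (add_le_add (hn _ _) le_rfl)
  refine squeeze_zero (fun _ => norm_nonneg _) h1 ?_
  have h2 : Continuous fun p : ℝ × X =>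
      Real.exp (c * p.1) * ‖p.2 - p₀.2‖ + ‖S p.1 p₀.2 - S p₀.1 p₀.2‖ := by
    have := (hc p₀.2).comp (continuous_fst (X := ℝ) (Y := X))
    simp only [Function.comp_def] at this
    fun_prop
  simpa using h2.tendsto p₀

/-- Gronwall's inequality in integral form. -/
lemma le_mul_exp_of_le_add_integral {φ : ℝ → ℝ} {a b A L : ℝ} (hφ : ContinuousOn φ (Icc a b))
    (h0 : ∀ t ∈ Icc a b, 0 ≤ φ t) (hL : 0 ≤ L)
    (h : ∀ t ∈ Icc a b, φ t ≤ A + L * ∫ s in a..t, φ s) :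
    ∀ t ∈ Icc a b, φ t ≤ A * Real.exp (L * (t - a)) := by
  intro t ht
  have hab : a ≤ b := ht.1.trans ht.2
  -- Extending `φ` by constants makes its primitive differentiable everywhere; the differential form
  -- of Gronwall's inequality is applied to that primitive.
  obtain ⟨ψ, hψ⟩ : ∃ ψ, ψ = IccExtend hab ((Icc a b).domRestrict φ) := ⟨_, rfl⟩
  have hψc : Continuous ψ := hψ ▸ (continuousOn_iff_continuous_domRestrict.1 hφ).Icc_extend'
  have hψe : ∀ s ∈ Icc a b, ψ s = φ s := fun s hs => by
    rw [hψ, IccExtend_of_mem hab _ hs]; rfl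
  have hint : ∀ s ∈ Icc a b, ∫ r in a..s, ψ r = ∫ r in a..s, φ r := fun s hs => by
    refine intervalIntegral.integral_congr fun r hr => ?_
    rw [uIcc_of_le hs.1] at hr
    exact hψe r ⟨hr.1, hr.2.trans hs.2⟩
  have hint0 : ∀ s ∈ Icc a b, 0 ≤ ∫ r in a..s, ψ r := fun s hs =>
    intervalIntegral.integral_nonneg hs.1 fun r hr => by
      rw [hψe r ⟨hr.1, hr.2.trans hs.2⟩]
      exact h0 r ⟨hr.1, hr.2.trans hs.2⟩
  have hd : ∀ s, HasDerivAt (fun t => ∫ r in a..t, ψ r) (ψ s) s := fun s =>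
    intervalIntegral.integral_hasDerivAt_right (hψc.intervalIntegrable _ _)
      (hψc.stronglyMeasurableAtFilter _ _) hψc.continuousAt
  have hG := norm_le_gronwallBound_of_norm_deriv_right_le (f := fun t => ∫ r in a..t, ψ r)
    (f' := ψ) (δ := 0) (K := L) (ε := A) (a := a) (b := b)
    (fun s _ => (hd s).continuousAt.continuousWithinAt)
    (fun s _ => (hd s).hasDerivWithinAt) (by simp) (fun s hs => by
      have hs' : s ∈ Icc a b := ⟨hs.1, hs.2.le⟩
      rw [hψe s hs', Real.norm_of_nonneg (h0 s hs'), Real.norm_of_nonneg (hint0 s hs'),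
        hint s hs', add_comm]
      exact h s hs') t ht
  rw [Real.norm_of_nonneg (hint0 t ht), hint t ht] at hG
  have h1 := h t ht
  rcases hL.eq_or_lt with rfl | hL'
  · simpa using h1
  rw [gronwallBound_of_K_ne_0 hL'.ne'] at hG
  have h2 := mul_le_mul_of_nonneg_left hG hL
  have e : L * (0 * Real.exp (L * (t - a)) + A / L * (Real.exp (L * (t - a)) - 1)) =
      A * Real.exp (L * (t - a)) - A := by field_simp; ring
  linarith

lemma IsOpSemigroup.continuousOn_apply {S : ℝ → X →L[ℝ] X} (hS : IsOpSemigroup S) (t : ℝ)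
    {g : ℝ → X} {K : Set ℝ} (hg : ContinuousOn g K) :
    ContinuousOn (fun s => S (t - s) (g s)) K :=
  hS.continuous.comp_continuousOn (f := fun s => (t - s, g s))
    ((continuous_const.sub continuous_id).continuousOn.prodMk hg)

lemma IsOpSemigroup.intervalIntegrable {S : ℝ → X →L[ℝ] X} (hS : IsOpSemigroup S) (t : ℝ)
    {g : ℝ → X} {a b : ℝ} (hab : a ≤ b) (hg : ContinuousOn g (Icc a b)) :
    IntervalIntegrable (fun s => S (t - s) (g s)) volume a b :=
  ((uIcc_of_le hab).symm ▸ hS.continuousOn_apply t hg).intervalIntegrable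

lemma IsOpSemigroup.continuousOn_duhamel {S : ℝ → X →L[ℝ] X} (hS : IsOpSemigroup S)
    {g : ℝ → X} {a b : ℝ} (hg : ContinuousOn g (Icc a b)) :
    ContinuousOn (fun t => ∫ s in a..t, S (t - s) (g s)) (Icc a b) := by
  rcases lt_or_ge b a with hba | hab
  · rw [Icc_eq_empty (not_le.2 hba)]
    exact continuousOn_empty _
  have hψc : Continuous (IccExtend hab ((Icc a b).domRestrict g)) :=
    (continuousOn_iff_continuous_domRestrict.1 hg).Icc_extend'
  have hc : Continuous fun t => ∫ s in a..t, S (t - s) (IccExtend hab ((Icc a b).domRestrict g) s) :=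
    intervalIntegral.continuous_parametric_intervalIntegral_of_continuous
      (f := fun t s => S (t - s) (IccExtend hab ((Icc a b).domRestrict g) s))
      (hS.continuous.comp (f := fun p : ℝ × ℝ => (p.1 - p.2, _))
        ((continuous_fst.sub continuous_snd).prodMk (hψc.comp continuous_snd))) continuous_id
  refine hc.continuousOn.congr fun t ht => ?_
  refine intervalIntegral.integral_congr fun r hr => ?_
  rw [uIcc_of_le ht.1] at hr
  simp only [IccExtend_of_mem hab _ (⟨hr.1, hr.2.trans ht.2⟩ : r ∈ Icc a b)]
  rfl

variable [CompleteSpace X]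

/-- Restarting Duhamel's formula at a later time. -/
lemma IsOpSemigroup.duhamel_restart {S : ℝ → X →L[ℝ] X} (hS : IsOpSemigroup S) {y g : ℝ → X}
    {y₀ : X} {t₀ t : ℝ} (h0 : 0 ≤ t₀) (ht : t₀ ≤ t) (hg : ContinuousOn g (Icc 0 t))
    (h1 : y t₀ = S t₀ y₀ + ∫ s in (0 : ℝ)..t₀, S (t₀ - s) (g s)) :
    S t y₀ + ∫ s in (0 : ℝ)..t, S (t - s) (g s) =
      S (t - t₀) (y t₀) + ∫ s in t₀..t, S (t - s) (g s) := by
  have i1 := hS.intervalIntegrable t h0 (hg.mono (Icc_subset_Icc_right ht))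
  have i2 := hS.intervalIntegrable t ht (hg.mono (Icc_subset_Icc_left h0))
  have i3 := hS.intervalIntegrable t₀ h0 (hg.mono (Icc_subset_Icc_right ht))
  rw [← intervalIntegral.integral_add_adjacent_intervals i1 i2, h1, map_add,
    ← hS.add (t - t₀) t₀ (by linarith) h0, sub_add_cancel,
    ← ContinuousLinearMap.intervalIntegral_comp_comm _ i3, ← add_assoc]
  congr 2
  refine intervalIntegral.integral_congr fun r hr => ?_
  rw [uIcc_of_le h0] at hr
  change _ = S (t - t₀) (S (t₀ - r) (g r))
  rw [← hS.add (t - t₀) (t₀ - r) (by linarith) (by linarith [hr.2])]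
  congr 2
  ring

/-- Absorbing a linear source term into the semigroup. -/
lemma IsOpSemigroup.duhamel_exp {S : ℝ → X →L[ℝ] X} (hS : IsOpSemigroup S) {y q : ℝ → X} {c b : ℝ}
    {y₀ : X} (hy : ContinuousOn y (Icc 0 b)) (hq : ContinuousOn q (Icc 0 b))
    (h : ∀ t ∈ Icc 0 b, y t = S t y₀ + ∫ s in (0 : ℝ)..t, S (t - s) (c • y s + q s)) :
    ∀ t ∈ Icc 0 b, y t = Real.exp (c * t) • S t y₀ +
      ∫ s in (0 : ℝ)..t, Real.exp (c * (t - s)) • S (t - s) (q s) := by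
  intro t ht
  have hg : ContinuousOn (fun s => c • y s + q s) (Icc 0 t) :=
    ((hy.const_smul c).add hq).mono (Icc_subset_Icc_right ht.2)
  have hFc : ContinuousOn (fun s => S (t - s) (c • y s + q s)) (Icc 0 t) :=
    hS.continuousOn_apply t hg
  have hyt : y 0 = y₀ := by
    have := h 0 ⟨le_rfl, ht.1.trans ht.2⟩
    rwa [intervalIntegral.integral_same, add_zero, hS.zero] at this
  -- By the semigroup law the right side depends on `s` only through the limit of integration. So `S
  -- (t - s) (y s)` is differentiable in `s` although neither factor need be, and no generator is
  -- required.
  have hpt : ∀ s ∈ Icc 0 t, S (t - s) (y s) =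
      S t y₀ + ∫ r in (0 : ℝ)..s, S (t - r) (c • y r + q r) := by
    intro s hs
    rw [h s ⟨hs.1, hs.2.trans ht.2⟩, map_add, ← hS.add (t - s) s (by linarith [hs.2]) hs.1,
      sub_add_cancel, ← ContinuousLinearMap.intervalIntegral_comp_comm _
        (hS.intervalIntegrable s hs.1 (hg.mono (Icc_subset_Icc_right hs.2)))]
    congr 1
    refine intervalIntegral.integral_congr fun r hr => ?_
    rw [uIcc_of_le hs.1] at hr
    change S (t - s) (S (s - r) _) = _
    rw [← hS.add (t - s) (s - r) (by linarith [hs.2]) (by linarith [hr.2])]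
    congr 2
    ring
  have hcont : ContinuousOn (fun s => Real.exp (-(c * s)) • S (t - s) (y s)) (Icc 0 t) :=
    (Continuous.continuousOn (by fun_prop)).smul
      (hS.continuousOn_apply t (hy.mono (Icc_subset_Icc_right ht.2)))
  -- The weight e^{-cs} cancels the linear source `c • y s`, leaving only `q`.
  have hder : ∀ s ∈ Ioo 0 t, HasDerivAt (fun s => Real.exp (-(c * s)) • S (t - s) (y s))
      (Real.exp (-(c * s)) • S (t - s) (q s)) s := by
    intro s hs
    have hnhds : Icc 0 t ∈ 𝓝 s := Icc_mem_nhds hs.1 hs.2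
    have h1 : HasDerivAt (fun s => S t y₀ + ∫ r in (0 : ℝ)..s, S (t - r) (c • y r + q r))
        (S (t - s) (c • y s + q s)) s := by
      refine (intervalIntegral.integral_hasDerivAt_right
        (hFc.mono (by rw [uIcc_of_le hs.1.le]; exact Icc_subset_Icc_right hs.2.le)).intervalIntegrable
        ?_ (hFc.continuousAt hnhds)).const_add _
      exact hFc.stronglyMeasurableAtFilter_nhdsWithin measurableSet_Icc s |>.filter_mono
        (by rw [nhdsWithin_eq_nhds.2 hnhds])
    have h2 : HasDerivAt (fun s => S (t - s) (y s)) (S (t - s) (c • y s + q s)) s :=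
      h1.congr_of_eventuallyEq (by filter_upwards [hnhds] with r hr using hpt r hr)
    have h3 : HasDerivAt (fun s => Real.exp (-(c * s))) (Real.exp (-(c * s)) * -(c * 1)) s :=
      (((hasDerivAt_id s).const_mul c).neg).exp
    refine (h3.smul h2).congr_deriv ?_
    rw [map_add, map_smul, smul_add, smul_smul, mul_one, mul_neg, neg_smul]
    abel
  have hqc : ContinuousOn (fun s => Real.exp (-(c * s)) • S (t - s) (q s)) (Icc 0 t) :=
    (Continuous.continuousOn (by fun_prop)).smul
      (hS.continuousOn_apply t (hq.mono (Icc_subset_Icc_right ht.2)))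
  have hftc := intervalIntegral.integral_eq_sub_of_hasDerivAt_of_le ht.1 hcont hder
    ((uIcc_of_le ht.1).symm ▸ hqc).intervalIntegrable
  rw [sub_self, sub_zero, hS.zero, mul_zero, neg_zero, Real.exp_zero, one_smul, hyt] at hftc
  have h5 : Real.exp (c * t) • (Real.exp (-(c * t)) • y t) = y t := by
    rw [smul_smul, ← Real.exp_add, add_neg_cancel, Real.exp_zero, one_smul]
  rw [← h5, eq_add_of_sub_eq hftc.symm, smul_add, add_comm]
  congr 1
  rw [← intervalIntegral.integral_smul]
  refine intervalIntegral.integral_congr fun r _ => ?_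
  rw [smul_smul, ← Real.exp_add]
  congr 2
  ring

/-- Mild solutions of `y' = A y + N y`, where `A` generates `S`. -/
def IsMild (S : ℝ → X →L[ℝ] X) (N : X → X) (x₀ : X) (J : Set ℝ) (f : ℝ → X) : Prop :=
  ContinuousOn f J ∧ ∀ t ∈ J, f t = S t x₀ + ∫ s in (0 : ℝ)..t, S (t - s) (N (f s))

end Abstract

/-! ### Uniqueness, local existence and continuation of mild solutions -/

section WellPosedness

variable {X : Type*} [NormedAddCommGroup X] [NormedSpace ℝ X]

lemma IsMild.mono {S : ℝ → X →L[ℝ] X} {N : X → X} {x₀ : X} {J J' : Set ℝ} {f : ℝ → X}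
    (hf : IsMild S N x₀ J f) (h : J' ⊆ J) : IsMild S N x₀ J' f :=
  ⟨hf.1.mono h, fun t ht => hf.2 t (h ht)⟩

lemma IsMild.exists_bound {S : ℝ → X →L[ℝ] X} {N : X → X} {x₀ : X} {b : ℝ} {f : ℝ → X}
    (hf : IsMild S N x₀ (Icc 0 b) f) : ∃ r, ∀ t ∈ Icc 0 b, ‖f t‖ ≤ r :=
  isCompact_Icc.exists_bound_of_continuousOn hf.1

lemma IsMild.apply_zero {S : ℝ → X →L[ℝ] X} (hS : IsOpSemigroup S) {N : X → X} {x₀ : X}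
    {J : Set ℝ} (hJ : 0 ∈ J) {f : ℝ → X} (hf : IsMild S N x₀ J f) : f 0 = x₀ := by
  rw [hf.2 0 hJ, intervalIntegral.integral_same, add_zero, hS.zero]

/-- Mild solutions are unique. -/
lemma IsMild.unique {S : ℝ → X →L[ℝ] X} (hS : IsOpSemigroup S) (hS1 : ∀ t x, ‖S t x‖ ≤ ‖x‖)
    {N : X → X} (hN : LipschitzOnBalls N) {x₀ : X} {b : ℝ} {f g : ℝ → X}
    (hf : IsMild S N x₀ (Icc 0 b) f) (hg : IsMild S N x₀ (Icc 0 b) g) :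
    ∀ t ∈ Icc 0 b, f t = g t := by
  obtain ⟨r, hr⟩ := hf.exists_bound
  obtain ⟨r', hr'⟩ := hg.exists_bound
  obtain ⟨L, hL, hLip⟩ := hN (max r r')
  have hNf : ContinuousOn (fun s => N (f s)) (Icc 0 b) := hN.continuous.comp_continuousOn hf.1
  have hNg : ContinuousOn (fun s => N (g s)) (Icc 0 b) := hN.continuous.comp_continuousOn hg.1
  have key := le_mul_exp_of_le_add_integral (φ := fun t => ‖f t - g t‖) (a := 0) (b := b) (A := 0)
    (hf.1.sub hg.1).norm (fun _ _ => norm_nonneg _) hL (fun t ht => by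
      rw [hf.2 t ht, hg.2 t ht, add_sub_add_left_eq_sub, ← intervalIntegral.integral_sub
        (hS.intervalIntegrable t ht.1 (hNf.mono (Icc_subset_Icc_right ht.2)))
        (hS.intervalIntegrable t ht.1 (hNg.mono (Icc_subset_Icc_right ht.2))), zero_add,
        ← intervalIntegral.integral_const_mul]
      refine intervalIntegral.norm_integral_le_of_norm_le ht.1 (ae_of_all _ fun s hs => ?_) ?_
      · have hs' : s ∈ Icc 0 b := ⟨hs.1.le, hs.2.trans ht.2⟩
        rw [← map_sub]
        exact (hS1 _ _).trans (hLip _ _ ((hr s hs').trans (le_max_left _ _))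
          ((hr' s hs').trans (le_max_right _ _)))
      · refine ContinuousOn.intervalIntegrable ?_
        rw [uIcc_of_le ht.1]
        exact ((hf.1.sub hg.1).norm.const_mul L).mono (Icc_subset_Icc_right ht.2))
  intro t ht
  have := key t ht
  rw [zero_mul] at this
  exact sub_eq_zero.1 (norm_le_zero_iff.1 this)

variable [CompleteSpace X]

/-- Local existence, with an existence time that depends on the size of the initial value only. -/
lemma exists_isMild {S : ℝ → X →L[ℝ] X} (hS : IsOpSemigroup S) (hS1 : ∀ t x, ‖S t x‖ ≤ ‖x‖)
    {N : X → X} (hN : LipschitzOnBalls N) (r : ℝ) :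
    ∃ δ > 0, ∀ x₀ : X, ‖x₀‖ ≤ r → ∃ f, IsMild S N x₀ (Icc 0 δ) f := by
  obtain ⟨L, hL, hLip⟩ := hN (|r| + 1)
  obtain ⟨K, hK⟩ : ∃ K, K = ‖N 0‖ + L * (|r| + 1) := ⟨_, rfl⟩
  have hK0 : 0 ≤ K := by rw [hK]; positivity
  have hNK : ∀ x, ‖x‖ ≤ |r| + 1 → ‖N x‖ ≤ K := fun x hx => by
    have h1 := hLip x 0 hx (by rw [norm_zero]; positivity)
    rw [sub_zero] at h1
    have h2 := norm_sub_norm_le (N x) (N 0)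
    have h3 := mul_le_mul_of_nonneg_left hx hL
    linarith
  -- `K` bounds `N` and `L` is its Lipschitz constant on the ball of radius `|r| + 1`. The choice
  -- gives `δ * K ≤ 1`, so the ball is preserved, and `δ * L ≤ 1 / 2`, so the map contracts.
  obtain ⟨δ, hδ⟩ : ∃ δ, δ = (2 * (K + L + 1))⁻¹ := ⟨_, rfl⟩
  have hδ0 : 0 < δ := by rw [hδ]; positivity
  have hδe : 2 * δ * K + 2 * δ * L + 2 * δ = 1 := by
    rw [hδ]; field_simp
  have hδK : δ * K ≤ 1 := by nlinarith [mul_nonneg hδ0.le hK0, mul_nonneg hδ0.le hL]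
  have hδL : δ * L ≤ 1 / 2 := by nlinarith [mul_nonneg hδ0.le hK0, mul_nonneg hδ0.le hL]
  refine ⟨δ, hδ0, fun x₀ hx₀ => ?_⟩
  have hx₀' : ‖x₀‖ ≤ |r| := hx₀.trans (le_abs_self r)
  have hcu : ∀ u : C(Icc 0 δ, X), Continuous fun s => N (IccExtend hδ0.le u s) := fun u =>
    hN.continuous.comp u.continuous.Icc_extend'
  have hcI : ∀ u : C(Icc 0 δ, X), ContinuousOn (fun t => S t x₀ +
      ∫ s in (0 : ℝ)..t, S (t - s) (N (IccExtend hδ0.le u s))) (Icc 0 δ) := fun u =>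
    (hS.continuous.comp (f := fun t : ℝ => (t, x₀)) (by fun_prop)).continuousOn.add
      (hS.continuousOn_duhamel (hcu u).continuousOn)
  let Φ : C(Icc 0 δ, X) → C(Icc 0 δ, X) := fun u =>
    ⟨_, continuousOn_iff_continuous_domRestrict.1 (hcI u)⟩
  have hΦ : ∀ u t, Φ u t = S t x₀ +
      ∫ s in (0 : ℝ)..t, S (t - s) (N (IccExtend hδ0.le u s)) := fun u t => rfl
  have hmaps : MapsTo Φ (Metric.closedBall 0 (|r| + 1)) (Metric.closedBall 0 (|r| + 1)) := by
    intro u hu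
    rw [mem_closedBall_zero_iff] at hu ⊢
    rw [ContinuousMap.norm_le _ (by positivity)]
    intro t
    rw [hΦ]
    refine (norm_add_le _ _).trans (add_le_add ((hS1 _ _).trans hx₀') ?_)
    have h1 := intervalIntegral.norm_integral_le_of_norm_le_const (a := (0 : ℝ)) (b := t) (C := K)
      (f := fun s => S (t - s) (N (IccExtend hδ0.le u s)))
      (fun s _ => (hS1 _ _).trans (hNK _ ((u.norm_coe_le_norm _).trans hu)))
    rw [sub_zero, abs_of_nonneg t.2.1] at h1
    refine h1.trans (le_trans ?_ hδK)
    rw [mul_comm δ K]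
    exact mul_le_mul_of_nonneg_left t.2.2 hK0
  have hcontr : ContractingWith (1 / 2) (hmaps.restrict Φ _ _) := by
    refine ⟨by norm_num, LipschitzWith.of_dist_le_mul fun u v => ?_⟩
    have hu := mem_closedBall_zero_iff.1 u.2
    have hv := mem_closedBall_zero_iff.1 v.2
    change dist (Φ u) (Φ v) ≤ _ * dist u.1 v.1
    rw [ContinuousMap.dist_le (by positivity)]
    intro t
    have hh : ∀ s, ‖S (t - s) (N (IccExtend hδ0.le u.1 s)) -
        S (t - s) (N (IccExtend hδ0.le v.1 s))‖ ≤ L * dist u.1 v.1 := fun s => by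
      rw [← map_sub]
      refine (hS1 _ _).trans ((hLip _ _ ((u.1.norm_coe_le_norm _).trans hu)
        ((v.1.norm_coe_le_norm _).trans hv)).trans ?_)
      refine mul_le_mul_of_nonneg_left ?_ hL
      rw [← dist_eq_norm]
      exact ContinuousMap.dist_apply_le_dist _
    rw [hΦ, hΦ, dist_eq_norm, add_sub_add_left_eq_sub, ← intervalIntegral.integral_sub
        (hS.intervalIntegrable t t.2.1 (hcu u.1).continuousOn)
        (hS.intervalIntegrable t t.2.1 (hcu v.1).continuousOn)]
    refine (intervalIntegral.norm_integral_le_of_norm_le_const fun s _ => hh s).trans ?_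
    rw [sub_zero, abs_of_nonneg t.2.1]
    have h3 : L * (t : ℝ) ≤ 1 / 2 := by
      refine le_trans ?_ hδL
      rw [mul_comm δ L]
      exact mul_le_mul_of_nonneg_left t.2.2 hL
    have h4 := mul_le_mul_of_nonneg_right h3 (dist_nonneg (x := u.1) (y := v.1))
    have e : (((1 / 2 : NNReal)) : ℝ) = 1 / 2 := by norm_num
    rw [e]
    linarith
  obtain ⟨u, hu, hfix, -⟩ := hcontr.exists_fixedPoint' Metric.isClosed_closedBall.isComplete hmaps
    (x := 0) (Metric.mem_closedBall_self (by positivity)) (edist_ne_top _ _)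
  refine ⟨IccExtend hδ0.le u, u.continuous.Icc_extend'.continuousOn, fun t ht => ?_⟩
  rw [IccExtend_of_mem hδ0.le _ ht]
  exact (ContinuousMap.congr_fun hfix (⟨t, ht⟩ : Icc (0 : ℝ) δ)).symm.trans (hΦ u (⟨t, ht⟩ : Icc (0 : ℝ) δ))

/-- Concatenation of mild solutions. -/
lemma IsMild.concat {S : ℝ → X →L[ℝ] X} (hS : IsOpSemigroup S)
    {N : X → X} (hN : Continuous N) {x₀ : X} {a b : ℝ} (ha : 0 ≤ a) (hb : 0 ≤ b) {f g : ℝ → X}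
    (hf : IsMild S N x₀ (Icc 0 a) f) (hg : IsMild S N (f a) (Icc 0 b) g) :
    IsMild S N x₀ (Icc 0 (a + b)) fun t => f (min t a) + g (max (t - a) 0) - f a := by
  -- This matching value makes the glued formula equal to `f` up to time `a` and to the shifted `g`
  -- afterwards; the form with `min` and `max` is continuous without a case distinction.
  have hg0 : g 0 = f a := hg.apply_zero hS (left_mem_Icc.2 hb)
  have hc : ContinuousOn (fun t => f (min t a) + g (max (t - a) 0) - f a) (Icc 0 (a + b)) := by
    refine ((hf.1.comp (Continuous.continuousOn (by fun_prop)) fun t ht => ?_).add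
      (hg.1.comp (Continuous.continuousOn (by fun_prop)) fun t ht => ?_)).sub continuousOn_const
    · exact ⟨le_min ht.1 ha, min_le_right _ _⟩
    · exact ⟨le_max_right _ _, max_le (by linarith [ht.2]) hb⟩
  have h1 : ∀ t, t ≤ a → f (min t a) + g (max (t - a) 0) - f a = f t := fun t ht => by
    rw [min_eq_left ht, max_eq_right (by linarith), hg0, add_sub_cancel_right]
  have h2 : ∀ t, a ≤ t → f (min t a) + g (max (t - a) 0) - f a = g (t - a) := fun t ht => by
    rw [min_eq_right ht, max_eq_left (by linarith), add_sub_cancel_left]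
  have h3 : ∀ t ≤ a, 0 ≤ t → f t = S t x₀ + ∫ s in (0 : ℝ)..t,
      S (t - s) (N (f (min s a) + g (max (s - a) 0) - f a)) := fun t ht ht0 => by
    rw [hf.2 t ⟨ht0, ht⟩]
    congr 1
    refine intervalIntegral.integral_congr fun s hs => ?_
    rw [uIcc_of_le ht0] at hs
    simp only [h1 s (hs.2.trans ht)]
  refine ⟨hc, fun t ht => ?_⟩
  rcases le_total t a with hta | hta
  · beta_reduce
    rw [h1 t hta]
    exact h3 t hta ht.1
  · beta_reduce
    rw [h2 t hta, hg.2 (t - a) ⟨by linarith, by linarith [ht.2]⟩]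
    have h4 := hS.duhamel_restart (y := f) (y₀ := x₀) ha hta
      ((hN.comp_continuousOn hc).mono (Icc_subset_Icc_right ht.2)) (h3 a le_rfl ha)
    simp only [Function.comp_apply] at h4
    rw [h4]
    congr 1
    have h5 := intervalIntegral.integral_comp_sub_right (a := a) (b := t)
      (fun s => S (t - a - s) (N (g s))) a
    rw [sub_self] at h5
    rw [← h5]
    refine intervalIntegral.integral_congr fun s hs => ?_
    rw [uIcc_of_le hta] at hs
    simp only [h2 s hs.1]
    congr 2
    ring

/-- The maximal mild solution of a semilinear equation. -/
theorem exists_maximal_isMild {S : ℝ → X →L[ℝ] X} (hS : IsOpSemigroup S)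
    (hS1 : ∀ t x, ‖S t x‖ ≤ ‖x‖) {N : X → X} (hN : LipschitzOnBalls N) (x₀ : X) :
    ∃ (T : EReal) (f : ℝ → X), 0 < T ∧ IsMild S N x₀ {t : ℝ | 0 ≤ t ∧ (t : EReal) < T} f ∧
      (∀ (J : Set ℝ) (g : ℝ → X), IsTimeInterval J → IsMild S N x₀ J g →
        J ⊆ {t : ℝ | 0 ≤ t ∧ (t : EReal) < T} ∧ EqOn g f J) ∧
      ∀ τ : ℝ, T = (τ : EReal) → ∀ r : ℝ, ∃ t ∈ Ioo (τ / 2) τ, r < ‖f t‖ := by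
  classical
  -- The lengths of closed intervals that carry a solution; `T` will be their supremum in the
  -- extended reals, which covers global existence.
  obtain ⟨A, hA⟩ : ∃ A : Set ℝ, A = {b | 0 ≤ b ∧ ∃ f, IsMild S N x₀ (Icc 0 b) f} := ⟨_, rfl⟩
  have hAdown : ∀ b ∈ A, ∀ a, 0 ≤ a → a ≤ b → a ∈ A := by
    rw [hA]
    rintro b ⟨-, f, hf⟩ a ha hab
    exact ⟨ha, f, hf.mono (Icc_subset_Icc_right hab)⟩
  have hextend : ∀ b ∈ A, ∀ f, IsMild S N x₀ (Icc 0 b) f → ∀ r, ‖f b‖ ≤ r → ∀ δ, 0 ≤ δ →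
      (∀ y : X, ‖y‖ ≤ r → ∃ f, IsMild S N y (Icc 0 δ) f) → b + δ ∈ A := by
    intro b hb f hf r hr δ hδ h
    have hb0 : 0 ≤ b := by rw [hA] at hb; exact hb.1
    obtain ⟨g, hg⟩ := h (f b) hr
    rw [hA]
    exact ⟨by linarith, _, hf.concat hS hN.continuous hb0 hδ hg⟩
  -- Every solution on a closed interval can be continued, so `A` has no largest element and the
  -- maximal interval is half-open.
  have hup : ∀ b ∈ A, ∃ c ∈ A, b < c := by
    intro b hb
    obtain ⟨hb0, f, hf⟩ := hA ▸ hb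
    obtain ⟨δ, hδ, h⟩ := exists_isMild hS hS1 hN ‖f b‖
    exact ⟨b + δ, hextend b hb f hf _ le_rfl δ hδ.le h, by linarith⟩
  have h0A : 0 ∈ A := by
    rw [hA]
    refine ⟨le_rfl, fun _ => x₀, continuousOn_const, fun t ht => ?_⟩
    rw [le_antisymm ht.2 ht.1, intervalIntegral.integral_same, add_zero, hS.zero]
  obtain ⟨T, hT⟩ : ∃ T : EReal, T = sSup ((fun b : ℝ => (b : EReal)) '' A) := ⟨_, rfl⟩
  have hmem : ∀ t : ℝ, t ∈ A ↔ 0 ≤ t ∧ (t : EReal) < T := by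
    intro t
    constructor
    · intro ht
      obtain ⟨c, hc, htc⟩ := hup t ht
      refine ⟨(hA ▸ ht).1, ?_⟩
      rw [hT]
      exact (EReal.coe_lt_coe_iff.2 htc).trans_le (le_sSup ⟨c, hc, rfl⟩)
    · rintro ⟨ht0, htT⟩
      rw [hT, lt_sSup_iff] at htT
      obtain ⟨_, ⟨c, hc, rfl⟩, htc⟩ := htT
      exact hAdown c hc t ht0 (EReal.coe_lt_coe_iff.1 htc).le
  have hsol : ∀ b, ∃ f : ℝ → X, b ∈ A → IsMild S N x₀ (Icc 0 b) f := fun b => by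
    by_cases hb : b ∈ A
    · obtain ⟨-, f, hf⟩ := hA ▸ hb
      exact ⟨f, fun _ => hf⟩
    · exact ⟨0, fun h => absurd h hb⟩
  choose sol hsol using hsol
  -- The maximal solution is the diagonal `sol t t`: the chosen solution on `[0, t]`, read at its
  -- endpoint. By uniqueness it agrees with every solution.
  have heq : ∀ b ∈ A, ∀ g, IsMild S N x₀ (Icc 0 b) g → ∀ t ∈ Icc 0 b, sol t t = g t := by
    intro b hb g hg t ht
    have htA : t ∈ A := hAdown b hb t ht.1 ht.2
    exact (hsol t htA).unique hS hS1 hN (hg.mono (Icc_subset_Icc_right ht.2)) t ⟨ht.1, le_rfl⟩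
  have hmild : ∀ b ∈ A, IsMild S N x₀ (Icc 0 b) fun t => sol t t := by
    intro b hb
    have h1 := heq b hb (sol b) (hsol b hb)
    refine ⟨(hsol b hb).1.congr h1, fun t ht => ?_⟩
    beta_reduce
    rw [h1 t ht, (hsol b hb).2 t ht]
    congr 1
    refine intervalIntegral.integral_congr fun s hs => ?_
    rw [uIcc_of_le ht.1] at hs
    simp only [h1 s ⟨hs.1, hs.2.trans ht.2⟩]
  have hset : {t : ℝ | 0 ≤ t ∧ (t : EReal) < T} = A := by
    ext t
    exact (hmem t).symm
  refine ⟨T, fun t => sol t t, ((hmem 0).1 h0A).2, ?_, ?_, ?_⟩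
  · rw [hset]
    refine ⟨fun t ht => ?_, fun t ht => (hmild t ht).2 t ⟨(hA ▸ ht).1, le_rfl⟩⟩
    obtain ⟨c, hc, htc⟩ := hup t ht
    have h1 := (hmild c hc).1 t ⟨(hA ▸ ht).1, htc.le⟩
    refine h1.mono_of_mem_nhdsWithin ?_
    filter_upwards [self_mem_nhdsWithin, mem_nhdsWithin_of_mem_nhds (Iio_mem_nhds htc)] with s h2 h3
    exact ⟨(hA ▸ h2).1, h3.le⟩
  · intro J g hJ hg
    rw [hset]
    have hIcc : ∀ t ∈ J, Icc 0 t ⊆ J := fun t ht => hJ.1.out hJ.2.1 ht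
    have hJA : J ⊆ A := fun t ht => by
      rw [hA]
      exact ⟨hJ.2.2 ht, g, hg.mono (hIcc t ht)⟩
    exact ⟨hJA, fun t ht => (heq t (hJA ht) g (hg.mono (hIcc t ht)) t
      ⟨hJ.2.2 ht, le_rfl⟩).symm⟩
  · intro τ hτ r
    -- If the norm stayed below `r` on the second half of the interval, a single `δ` would serve for
    -- restarting at every such time; a restart later than `τ - δ` would pass `τ`.
    by_contra! hcon
    obtain ⟨δ, hδ, h⟩ := exists_isMild hS hS1 hN r
    have hτ0 : 0 < τ := by
      have := ((hmem 0).1 h0A).2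
      rw [hτ] at this
      exact EReal.coe_lt_coe_iff.1 this
    obtain ⟨t, ht1, ht2⟩ : ∃ t, max (τ / 2) (τ - δ) < t ∧ t < τ :=
      exists_between (max_lt (by linarith) (by linarith))
    have htt : τ / 2 < t := (le_max_left _ _).trans_lt ht1
    have htA : t ∈ A := (hmem t).2 ⟨by linarith, by rw [hτ]; exact EReal.coe_lt_coe_iff.2 ht2⟩
    have h1 := hextend t htA _ (hmild t htA) r (hcon t ⟨htt, ht2⟩) δ hδ.le h
    have h2 := ((hmem _).1 h1).2
    rw [hτ, EReal.coe_lt_coe_iff] at h2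
    have := (le_max_right _ _).trans_lt ht1
    linarith

end WellPosedness

/-! ### The truncated system as a semilinear equation -/

lemma isOpSemigroup_ouOp (d : ℕ) : IsOpSemigroup (ouOp (d := d)) :=
  .of_strong (c := 0) (fun u => ouOp_of_nonpos le_rfl u) (fun _ _ hs ht _ => ouOp_add hs ht _)
    (fun _ => continuous_iff_continuousAt.2 fun _ => tendsto_ouOp tendsto_id tendsto_const_nhds)
    (fun t u => by simpa using norm_ouOp_le t u)

lemma isOpSemigroup_fpOp (d : ℕ) : IsOpSemigroup (fpOp (d := d)) :=
  .of_strong (c := d) fpOp_zero (fun _ _ hs ht _ => fpOp_add hs ht _)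
    (fun _ => continuous_iff_continuousAt.2 fun _ => tendsto_fpOp tendsto_id tendsto_const_nhds)
    norm_fpOp_le

/-- The semigroup `P_t`, acting on all components. -/
def ouOpPi (d M : ℕ) (t : ℝ) : (Fin M → L2V d) →L[ℝ] (Fin M → L2V d) :=
  ContinuousLinearMap.pi fun m => (ouOp t).comp (ContinuousLinearMap.proj m)

lemma ouOpPi_apply {d M : ℕ} (t : ℝ) (f : Fin M → L2V d) (m : Fin M) :
    ouOpPi d M t f m = ouOp t (f m) := rfl

lemma norm_ouOpPi_le {d M : ℕ} (t : ℝ) (f : Fin M → L2V d) : ‖ouOpPi d M t f‖ ≤ ‖f‖ :=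
  (pi_norm_le_iff_of_nonneg (norm_nonneg _)).2 fun m =>
    (norm_ouOp_le t (f m)).trans (norm_le_pi_norm f m)

lemma isOpSemigroup_ouOpPi (d M : ℕ) : IsOpSemigroup (ouOpPi d M) :=
  .of_strong (c := 0) (fun f => funext fun m => (isOpSemigroup_ouOp d).zero (f m))
    (fun s t hs ht f => funext fun m => ouOp_add hs ht (f m))
    (fun f => continuous_pi fun m => (isOpSemigroup_ouOp d).continuous.comp
      (f := fun t : ℝ => (t, f m)) (by fun_prop))
    (fun t f => by simpa using norm_ouOpPi_le t f)

/-- The source term `d f + Q^R(f, f)`. -/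
def source {d M : ℕ} (R : ℝ) (f : Fin M → L2V d) : Fin M → L2V d :=
  fun m => (d : ℝ) • f m + collisionL2 R f m

lemma locNorm_le {d : ℕ} {ι : Type*} [Fintype ι] (ρ : ℝ) (f : ι → L2V d) :
    locNorm ρ f ≤ Fintype.card ι * ‖f‖ := by
  refine (Finset.sum_le_sum (g := fun _ => ‖f‖) fun i _ =>
    (norm_rs_le _ _).trans (norm_le_pi_norm f i)).trans (le_of_eq ?_)
  rw [Finset.sum_const, Finset.card_univ, nsmul_eq_mul]

/-- The left side is a norm over all of ℝ^d, yet differences enter only through values on a ball.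
This is what lets a Gronwall argument close in `locNorm`. -/
lemma exists_norm_collisionL2_sub_le (d M : ℕ) {R : ℝ} (hR : 0 ≤ R) :
    ∃ C, 0 ≤ C ∧ ∀ ρ, (2 * M + 1) * (R + 2) ≤ ρ → ∀ (f g : Fin M → L2V d) (m : Fin M),
      ‖collisionL2 R f m - collisionL2 R g m‖ ≤
        C * (locNorm ρ f + locNorm ρ g) * locNorm ρ (f - g) := by
  obtain ⟨C, hC, h⟩ := exists_norm_collisionForm_le d M hR
  refine ⟨C, hC, fun ρ hρ f g m => ?_⟩
  rw [collisionL2_sub hR]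
  refine (norm_add_le _ _).trans ((add_le_add (h ρ hρ _ _ m) (h ρ hρ _ _ m)).trans (le_of_eq ?_))
  ring

lemma lipschitzOnBalls_collisionL2 (d M : ℕ) {R : ℝ} (hR : 0 ≤ R) :
    LipschitzOnBalls (fun f : Fin M → L2V d => collisionL2 R f) := by
  obtain ⟨C, hC, h⟩ := exists_norm_collisionL2_sub_le d M hR
  intro r
  refine ⟨C * (M * |r| + M * |r|) * M, by positivity, fun f g hf hg => ?_⟩
  refine (pi_norm_le_iff_of_nonneg (by positivity)).2 fun m => ?_
  refine (h _ le_rfl f g m).trans ?_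
  have h1 : ∀ f : Fin M → L2V d, ‖f‖ ≤ r → locNorm ((2 * M + 1) * (R + 2)) f ≤ M * |r| :=
    fun f hf => (locNorm_le _ f).trans (by
      rw [Fintype.card_fin]
      exact mul_le_mul_of_nonneg_left (hf.trans (le_abs_self r)) (by positivity))
  have h2 := locNorm_le ((2 * M + 1) * (R + 2)) (f - g)
  rw [Fintype.card_fin] at h2
  have h3 := mul_le_mul (mul_le_mul_of_nonneg_left (add_le_add (h1 f hf) (h1 g hg)) hC) h2
    (locNorm_nonneg _ _) (by positivity)
  linarith

lemma continuous_collisionL2 (d M : ℕ) {R : ℝ} (hR : 0 ≤ R) :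
    Continuous (fun f : Fin M → L2V d => collisionL2 R f) :=
  (lipschitzOnBalls_collisionL2 d M hR).continuous

lemma lipschitzOnBalls_source (d M : ℕ) {R : ℝ} (hR : 0 ≤ R) :
    LipschitzOnBalls (source (d := d) (M := M) R) := by
  intro r
  obtain ⟨L, hL, h⟩ := lipschitzOnBalls_collisionL2 d M hR r
  refine ⟨d + L, by positivity, fun f g hf hg => ?_⟩
  have e : source R f - source R g = (d : ℝ) • (f - g) + (collisionL2 R f - collisionL2 R g) := by
    funext m
    simp only [source, Pi.sub_apply, Pi.add_apply, Pi.smul_apply, smul_sub]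
    abel
  rw [e, add_mul]
  refine (norm_add_le _ _).trans (add_le_add ?_ (h f g hf hg))
  rw [norm_smul, Real.norm_natCast]

lemma isMildSolution_iff {d M : ℕ} {R : ℝ} (hR : 0 ≤ R) {f0 : Fin M → L2V d} {J : Set ℝ}
    (hJ : IsTimeInterval J) {f : ℝ → Fin M → L2V d} :
    IsMildSolution R f0 J f ↔ IsMild (ouOpPi d M) (source R) f0 J f := by
  rw [IsMildSolution, IsMild]
  refine and_congr_right fun hf => forall₂_congr fun t ht => ?_
  have hsub : Icc 0 t ⊆ J := hJ.1.out hJ.2.1 ht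
  have hint := (isOpSemigroup_ouOpPi d M).intervalIntegrable t (hJ.2.2 ht)
    ((lipschitzOnBalls_source d M hR).continuous.comp_continuousOn (hf.mono hsub))
  have e : ∀ m, (∫ s in (0 : ℝ)..t, ouOpPi d M (t - s) (source R (f s))) m =
      ∫ s in (0 : ℝ)..t, ouSemigroup (t - s) ((d : ℝ) • f s m + collisionL2 R (f s) m) := fun m => by
    have := (ContinuousLinearMap.proj (R := ℝ) (φ := fun _ : Fin M => L2V d)
      m).intervalIntegral_comp_comm hint
    refine this.symm.trans ?_
    simp only [ouSemigroup_eq]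
    rfl
  rw [funext_iff]
  refine forall_congr' fun m => ?_
  rw [Pi.add_apply, e, ouOpPi_apply, ouSemigroup_eq]

/-- Duhamel's formula for the semigroup `S_t = e^{dt} P_t`, on the time interval `[0, b]`. -/
def IsDuhamel {d M : ℕ} (R b : ℝ) (f : ℝ → Fin M → L2V d) : Prop :=
  ContinuousOn f (Icc 0 b) ∧ ∀ t₀ t, 0 ≤ t₀ → t₀ ≤ t → t ≤ b → ∀ m,
    f t m = fpOp (t - t₀) (f t₀ m) + ∫ s in t₀..t, fpOp (t - s) (collisionL2 R (f s) m)

lemma IsDuhamel.continuousOn_collision {d M : ℕ} {R b : ℝ} (hR : 0 ≤ R)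
    {f : ℝ → Fin M → L2V d} (hf : IsDuhamel R b f) (m : Fin M) :
    ContinuousOn (fun s => collisionL2 R (f s) m) (Icc 0 b) :=
  ((continuous_apply m).comp (continuous_collisionL2 d M hR)).comp_continuousOn hf.1

/-- The linear source `d f` is absorbed into the semigroup, P_t becoming e^{dt} P_t. Arbitrary
starting times are recorded because all later estimates restart at a positive time. -/
lemma IsMildSolution.isDuhamel {d M : ℕ} {R b : ℝ} (hR : 0 ≤ R) {f0 : Fin M → L2V d}
    {f : ℝ → Fin M → L2V d} (hf : IsMildSolution R f0 (Icc 0 b) f) : IsDuhamel R b f := by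
  have hq : ∀ m, ContinuousOn (fun s => collisionL2 R (f s) m) (Icc 0 b) := fun m =>
    ((continuous_apply m).comp (continuous_collisionL2 d M hR)).comp_continuousOn hf.1
  have h1 : ∀ m, ∀ t ∈ Icc 0 b, f t m = fpOp t (f0 m) +
      ∫ s in (0 : ℝ)..t, fpOp (t - s) (collisionL2 R (f s) m) := fun m =>
    (isOpSemigroup_ouOp d).duhamel_exp (c := d) (y := fun t => f t m)
      ((continuous_apply m).comp_continuousOn hf.1) (hq m) fun t ht => by
        have := hf.2 t ht m
        simp only [ouSemigroup_eq] at this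
        exact this
  refine ⟨hf.1, fun t₀ t h0 ht hb m => ?_⟩
  rw [h1 m t ⟨h0.trans ht, hb⟩]
  exact (isOpSemigroup_fpOp d).duhamel_restart (y := fun t => f t m) h0 ht
    ((hq m).mono (Icc_subset_Icc_right hb)) (h1 m t₀ ⟨h0, ht.trans hb⟩)

/-! ### Duhamel integrals with singular kernels -/

lemma norm_singular_duhamel_le {E : Type*} [NormedAddCommGroup E] [NormedSpace ℝ E]
    {J : ℝ → E → E} {q : ℝ → E} {t₀ t L C θ : ℝ} (ht : t₀ ≤ t) (hL : t - t₀ ≤ L) (hC : 0 ≤ C)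
    (hθ : θ < 1)
    (hb : ∀ τ, 0 < τ → τ ≤ L → ∀ s ∈ Icc t₀ t, ‖J τ (q s)‖ ≤ C * τ ^ (-θ)) :
    ‖∫ s in t₀..t, J (t - s) (q s)‖ ≤ C * ∫ τ in (0 : ℝ)..L, τ ^ (-θ) := by
  have h1 := intervalIntegral.integral_comp_sub_left (a := t₀) (b := t)
    (fun τ => J τ (q (t - τ))) t
  simp only [sub_sub_cancel, sub_self] at h1
  rw [h1]
  have hI : ∀ a b : ℝ, IntervalIntegrable (fun τ : ℝ => C * τ ^ (-θ)) volume a b := fun a b =>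
    (intervalIntegral.intervalIntegrable_rpow' (by linarith)).const_mul C
  rw [← intervalIntegral.integral_const_mul]
  refine (intervalIntegral.norm_integral_le_of_norm_le (by linarith) (ae_of_all _ fun τ hτ =>
    hb τ hτ.1 (hτ.2.trans hL) (t - τ) ⟨by linarith [hτ.2], by linarith [hτ.1]⟩) (hI _ _)).trans ?_
  refine intervalIntegral.integral_mono_interval le_rfl (by linarith) hL ?_ (hI _ _)
  refine (ae_restrict_iff' measurableSet_Ioc).2 (ae_of_all _ fun τ hτ => ?_)
  exact mul_nonneg hC (Real.rpow_nonneg hτ.1.le _)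

/-- After the substitution τ = t - s the singularity sits at τ = 0 independently of `t`, and `C * τ
^ (-θ)` is an integrable majorant on a fixed interval. -/
lemma continuousOn_singular_duhamel {E : Type*} [NormedAddCommGroup E] [NormedSpace ℝ E]
    {J : ℝ → E → E} (hJ : ∀ τ, 0 < τ → ∀ x, ContinuousAt (fun p : ℝ × E => J p.1 p.2) (τ, x))
    {q : ℝ → E} {t₀ t₁ C θ : ℝ} (hq : ContinuousOn q (Icc t₀ t₁)) (hC : 0 ≤ C) (hθ : θ < 1)
    (hb : ∀ τ, 0 < τ → τ ≤ t₁ - t₀ → ∀ s ∈ Icc t₀ t₁, ‖J τ (q s)‖ ≤ C * τ ^ (-θ)) :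
    (∀ t ∈ Icc t₀ t₁, IntervalIntegrable (fun s => J (t - s) (q s)) volume t₀ t) ∧
      ContinuousOn (fun t => ∫ s in t₀..t, J (t - s) (q s)) (Icc t₀ t₁) := by
  rcases lt_or_ge t₁ t₀ with hlt | hle
  · rw [Icc_eq_empty (not_le.2 hlt)]
    exact ⟨fun t ht => absurd ht (notMem_empty t), continuousOn_empty _⟩
  obtain ⟨p, hp⟩ : ∃ p, p = IccExtend hle ((Icc t₀ t₁).domRestrict q) := ⟨_, rfl⟩
  have hpc : Continuous p := hp ▸ (continuousOn_iff_continuous_domRestrict.1 hq).Icc_extend'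
  have hpe : ∀ s ∈ Icc t₀ t₁, p s = q s := fun s hs => by
    rw [hp, IccExtend_of_mem hle _ hs]; rfl
  have hcont : ∀ t, ContinuousOn (fun τ => J τ (p (t - τ))) (Ioi 0) := fun t τ hτ =>
    (ContinuousAt.comp (f := fun τ => (τ, p (t - τ))) (hJ τ hτ _)
      (continuous_id.prodMk (hpc.comp (continuous_const.sub continuous_id))).continuousAt
      ).continuousWithinAt
  have hbd : ∀ t ∈ Icc t₀ t₁, ∀ τ, 0 < τ → τ ≤ t - t₀ → ‖J τ (p (t - τ))‖ ≤ C * τ ^ (-θ) := by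
    intro t ht τ h0 h1
    have hmem : t - τ ∈ Icc t₀ t₁ := ⟨by linarith, by linarith [ht.2]⟩
    rw [hpe _ hmem]
    exact hb τ h0 (by linarith [ht.2]) _ hmem
  have hI : IntervalIntegrable (fun τ : ℝ => C * τ ^ (-θ)) volume 0 (t₁ - t₀) :=
    (intervalIntegral.intervalIntegrable_rpow' (by linarith)).const_mul C
  have hI' := (intervalIntegrable_iff_integrableOn_Ioc_of_le (by linarith)).1 hI
  have hmeas : ∀ t, AEStronglyMeasurable (fun τ => J τ (p (t - τ)))
      (volume.restrict (Ioc 0 (t₁ - t₀))) := fun t =>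
    ((hcont t).mono fun τ hτ => hτ.1).aestronglyMeasurable measurableSet_Ioc
  have hint : ∀ t ∈ Icc t₀ t₁,
      IntervalIntegrable (fun τ => J τ (p (t - τ))) volume 0 (t - t₀) := by
    intro t ht
    have hsub : Ioc 0 (t - t₀) ⊆ Ioc 0 (t₁ - t₀) := Ioc_subset_Ioc_right (by linarith [ht.2])
    rw [intervalIntegrable_iff_integrableOn_Ioc_of_le (by linarith [ht.1])]
    refine (hI'.mono_set hsub).mono' ((hmeas t).mono_measure (Measure.restrict_mono hsub le_rfl)) ?_
    refine (ae_restrict_iff' measurableSet_Ioc).2 (ae_of_all _ fun τ hτ => ?_)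
    exact hbd t ht τ hτ.1 hτ.2
  constructor
  · intro t ht
    have h1 := (hint t ht).comp_sub_left t
    rw [sub_zero, sub_sub_cancel] at h1
    refine (h1.symm).congr fun s hs => ?_
    rw [uIoc_of_le ht.1] at hs
    simp only [sub_sub_cancel]
    rw [hpe s ⟨hs.1.le, hs.2.trans ht.2⟩]
  · have heq : ∀ t ∈ Icc t₀ t₁, ∫ s in t₀..t, J (t - s) (q s) =
        ∫ τ in Ioc 0 (t₁ - t₀), (Ioo 0 (t - t₀)).indicator (fun τ => J τ (p (t - τ))) τ := by
      intro t ht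
      have h1 := intervalIntegral.integral_comp_sub_left (a := t₀) (b := t)
        (fun τ => J τ (p (t - τ))) t
      simp only [sub_sub_cancel, sub_self] at h1
      have h2 : ∫ s in t₀..t, J (t - s) (q s) = ∫ s in t₀..t, J (t - s) (p s) := by
        refine intervalIntegral.integral_congr fun s hs => ?_
        rw [uIcc_of_le ht.1] at hs
        simp only [hpe s ⟨hs.1, hs.2.trans ht.2⟩]
      rw [h2, h1, intervalIntegral.integral_of_le (by linarith [ht.1]),
        setIntegral_indicator measurableSet_Ioo, integral_Ioc_eq_integral_Ioo]
      congr 2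
      ext τ
      simp only [mem_inter_iff, mem_Ioc, mem_Ioo]
      constructor
      · rintro ⟨h3, h4⟩
        exact ⟨⟨h3, by linarith [ht.2]⟩, h3, h4⟩
      · rintro ⟨-, h3⟩
        exact h3
    refine ContinuousOn.congr (fun t ht => ?_) heq
    refine continuousWithinAt_of_dominated (bound := fun τ => C * τ ^ (-θ)) ?_ ?_ hI' ?_
    · exact Eventually.of_forall fun t => (hmeas t).indicator measurableSet_Ioo
    · filter_upwards [self_mem_nhdsWithin] with t ht
      refine (ae_restrict_iff' measurableSet_Ioc).2 (ae_of_all _ fun τ hτ => ?_)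
      by_cases h : τ ∈ Ioo 0 (t - t₀)
      · rw [indicator_of_mem h]
        exact hbd t ht τ h.1 h.2.le
      · rw [indicator_of_notMem h, norm_zero]
        exact mul_nonneg hC (Real.rpow_nonneg hτ.1.le _)
    -- The variable limit of integration has become an indicator, which as a function of `t` is
    -- discontinuous only when τ = t - t₀, a single point.
    · have hne : ∀ᵐ τ ∂(volume.restrict (Ioc 0 (t₁ - t₀))), τ ≠ t - t₀ :=
        ae_restrict_of_ae (Measure.ae_ne volume _)
      filter_upwards [hne, ae_restrict_mem measurableSet_Ioc] with τ h1 h2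
      rcases lt_or_gt_of_ne h1 with h3 | h3
      · have hc : ContinuousAt (fun t => J τ (p (t - τ))) t :=
          ContinuousAt.comp (f := fun t => (τ, p (t - τ))) (hJ τ h2.1 _)
            (continuous_const.prodMk (hpc.comp (continuous_id.sub continuous_const))).continuousAt
        refine (hc.congr ?_).continuousWithinAt
        filter_upwards [Ioi_mem_nhds (show t₀ + τ < t by linarith)] with t' ht'
        rw [indicator_of_mem (show τ ∈ Ioo 0 (t' - t₀) from ⟨h2.1, by linarith [mem_Ioi.1 ht']⟩)]
      · refine ((continuousAt_const (y := (0 : E))).congr ?_).continuousWithinAt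
        filter_upwards [Iio_mem_nhds (show t < t₀ + τ by linarith)] with t' ht'
        rw [indicator_of_notMem]
        rintro ⟨-, h4⟩
        linarith [mem_Iio.1 ht']

/-! ### Spatial regularity -/

/-- The derivatives of `S_{t-t₀} u₀ + ∫_{t₀}^t S_{t-s} q(s) ds`. -/
def duhamelJet {d : ℕ} (a : JetIndex d) (t₀ : ℝ) (q : ℝ → L2V d) (u₀ : L2V d) (t : ℝ) : L2V d :=
  jetOp a (t - t₀) u₀ + ∫ s in t₀..t, jetOp a (t - s) (q s)

lemma continuousAt_jetOp {d : ℕ} (a : JetIndex d) {t : ℝ} (ht : 0 < t) (u : L2V d) :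
    ContinuousAt (fun p : ℝ × L2V d => jetOp a p.1 p.2) (t, u) :=
  tendsto_jetOp a ht continuous_fst.continuousAt continuous_snd.continuousAt

/-- Smallness of `jetOp a τ (q s)` for small `τ`, at an integrable rate. -/
def JetBound {d : ℕ} (a : JetIndex d) (q : ℝ → L2V d) (t₀ t₁ C θ : ℝ) : Prop :=
  ∀ τ, 0 < τ → τ ≤ t₁ - t₀ → ∀ s ∈ Icc t₀ t₁, ‖jetOp a τ (q s)‖ ≤ C * τ ^ (-θ)

lemma continuousOn_duhamelJet {d : ℕ} {a : JetIndex d} {t₀ t₁ C θ : ℝ} {q : ℝ → L2V d}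
    (hq : ContinuousOn q (Icc t₀ t₁)) (hC : 0 ≤ C) (hθ : θ < 1) (hb : JetBound a q t₀ t₁ C θ)
    (u₀ : L2V d) : ContinuousOn (duhamelJet a t₀ q u₀) (Ioc t₀ t₁) := by
  refine ContinuousOn.add (fun t ht => ContinuousAt.continuousWithinAt ?_)
    ((continuousOn_singular_duhamel (J := fun τ u => jetOp a τ u)
      (fun τ hτ u => continuousAt_jetOp a hτ u) hq hC hθ hb).2.mono Ioc_subset_Icc_self)
  exact tendsto_jetOp a (by linarith [ht.1])
    ((continuous_id.sub continuous_const).tendsto t) tendsto_const_nhds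

lemma intervalIntegrable_duhamelJet {d : ℕ} {a : JetIndex d} {t₀ t₁ C θ : ℝ} {q : ℝ → L2V d}
    (hq : ContinuousOn q (Icc t₀ t₁)) (hC : 0 ≤ C) (hθ : θ < 1) (hb : JetBound a q t₀ t₁ C θ)
    {t : ℝ} (ht : t ∈ Icc t₀ t₁) :
    IntervalIntegrable (fun s => jetOp a (t - s) (q s)) volume t₀ t :=
  (continuousOn_singular_duhamel (J := fun τ u => jetOp a τ u)
    (fun _ hτ u => continuousAt_jetOp a hτ u) hq hC hθ hb).1 t ht

/-- First order difference quotients of order `1/3`. -/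
def HolderBound {d : ℕ} (Λ : ℝ) (u : L2V d) : Prop :=
  ∀ h, ‖affComp 1 h u - u‖ ≤ Λ * ‖h‖ ^ (1 / 3 : ℝ)

lemma exists_jetBound_of_norm_le (d : ℕ) (L : ℝ) : ∃ C, 0 ≤ C ∧ ∀ (a : JetIndex d) (t₀ t₁ K : ℝ)
    (q : ℝ → L2V d), t₁ - t₀ ≤ L → 0 ≤ K → (∀ s ∈ Icc t₀ t₁, ‖q s‖ ≤ K) →
      JetBound a q t₀ t₁ (C * K) (jetOrder a / 2) := by
  obtain ⟨C, hC, h⟩ := exists_norm_jetOp_le (d := d) L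
  refine ⟨C, hC, fun a t₀ t₁ K q hL _ hq τ hτ hτ' s hs => ?_⟩
  refine (h a τ hτ (hτ'.trans hL) (q s)).trans ?_
  have := mul_le_mul_of_nonneg_left (hq s hs)
    (mul_nonneg hC (Real.rpow_nonneg hτ.le (-(jetOrder a / 2 : ℝ))))
  linarith

lemma exists_jetBound_of_holderBound (d : ℕ) (L : ℝ) : ∃ C, 0 ≤ C ∧ ∀ (i j : Fin d)
    (t₀ t₁ Λ : ℝ) (q : ℝ → L2V d), t₁ - t₀ ≤ L → 0 ≤ Λ → (∀ s ∈ Icc t₀ t₁, HolderBound Λ (q s)) →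
      JetBound (.inr (.inr (i, j))) q t₀ t₁ (C * Λ) (5 / 6) := by
  obtain ⟨C, hC, h⟩ := exists_norm_jetOp_two_le (d := d) L
  refine ⟨C, hC, fun i j t₀ t₁ Λ q hL hΛ hq τ hτ hτ' s hs => ?_⟩
  refine (h i j τ hτ (hτ'.trans hL) (q s) Λ hΛ (hq s hs)).trans (le_of_eq ?_)
  ring

lemma hasWeakPartial_duhamelJet {d : ℕ} {t₀ t₁ C θ C' θ' : ℝ} {q : ℝ → L2V d} {i : Fin d}
    {a b : JetIndex d} (hab : ∀ t, 0 < t → ∀ u, HasWeakPartial i (jetOp a t u) (jetOp b t u))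
    (hq : ContinuousOn q (Icc t₀ t₁)) (hC : 0 ≤ C) (hθ : θ < 1) (hb : JetBound a q t₀ t₁ C θ)
    (hC' : 0 ≤ C') (hθ' : θ' < 1) (hb' : JetBound b q t₀ t₁ C' θ') (u₀ : L2V d)
    {t : ℝ} (ht : t ∈ Ioc t₀ t₁) :
    HasWeakPartial i (duhamelJet a t₀ q u₀ t) (duhamelJet b t₀ q u₀ t) := by
  refine (hab _ (by linarith [ht.1]) u₀).add ?_
  have ht' : t ∈ Icc t₀ t₁ := ⟨ht.1.le, ht.2⟩
  -- Passing to the open interval excludes s = t, where the time argument is zero and the derivative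
  -- relation is not available.
  rw [intervalIntegral.integral_of_le ht.1.le, intervalIntegral.integral_of_le ht.1.le,
    integral_Ioc_eq_integral_Ioo, integral_Ioc_eq_integral_Ioo]
  refine HasWeakPartial.integral ?_ ?_ ?_
  · exact (intervalIntegrable_duhamelJet hq hC hθ hb ht').1.mono_set Ioo_subset_Ioc_self
  · exact (intervalIntegrable_duhamelJet hq hC' hθ' hb' ht').1.mono_set Ioo_subset_Ioc_self
  · refine (ae_restrict_iff' measurableSet_Ioo).2 (ae_of_all _ fun s hs => ?_)
    exact hab _ (by linarith [hs.2]) (q s)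

/-- `x` consists of a function and its first and second weak derivatives. -/
def IsJet {d : ℕ} (x : JetIndex d → L2V d) : Prop :=
  (∀ i, HasWeakPartial i (x (.inl ())) (x (.inr (.inl i)))) ∧
    ∀ i j, HasWeakPartial j (x (.inr (.inl i))) (x (.inr (.inr (i, j))))

/-- Jets constructed from different starting times, or on different intervals, therefore agree
wherever both are defined. -/
lemma IsJet.unique {d : ℕ} {x y : JetIndex d → L2V d} (hx : IsJet x) (hy : IsJet y)
    (h : x (.inl ()) = y (.inl ())) : x = y := by
  have h1 : ∀ i, x (.inr (.inl i)) = y (.inr (.inl i)) := fun i =>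
    (hx.1 i).unique (h ▸ hy.1 i)
  have h2 : ∀ i j, x (.inr (.inr (i, j))) = y (.inr (.inr (i, j))) := fun i j =>
    (hx.2 i j).unique (h1 i ▸ hy.2 i j)
  funext a
  rcases a with ⟨⟩ | i | ⟨i, j⟩
  exacts [h, h1 i, h2 i j]

lemma IsJet.sub {d : ℕ} {x y : JetIndex d → L2V d} (hx : IsJet x) (hy : IsJet y) :
    IsJet (x - y) :=
  ⟨fun i => (hx.1 i).sub (hy.1 i), fun i j => (hx.2 i j).sub (hy.2 i j)⟩

lemma isJet_jetOp {d : ℕ} {t : ℝ} (ht : 0 < t) (u : L2V d) : IsJet fun a => jetOp a t u := by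
  refine ⟨fun i => ?_, fun i j => hasWeakPartial_jetOp ht i j u⟩
  beta_reduce
  rw [jetOp_inl]
  exact hasWeakPartial_fpOp ht i u

lemma IsJet.fpOp {d : ℕ} {x : JetIndex d → L2V d} (hx : IsJet x) {t : ℝ} (ht : 0 ≤ t) :
    IsJet fun a => Real.exp (jetOrder a * t) • fpOp t (x a) := by
  refine ⟨fun i => ?_, fun i j => ?_⟩
  · simpa [jetOrder] using (hx.1 i).fpOp ht
  · have := ((hx.2 i j).fpOp ht).const_smul (Real.exp t)
    rw [smul_smul, ← Real.exp_add, ← two_mul] at this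
    simpa [jetOrder] using this

/-- From mere continuity of `q` the exponent for second derivatives is 1, which is not integrable;
only the entries of order zero and one are usable here. -/
lemma exists_jetBound_one {d : ℕ} {q : ℝ → L2V d} {t₀ t₁ : ℝ} (hq : ContinuousOn q (Icc t₀ t₁)) :
    ∃ C, 0 ≤ C ∧ ∀ a : JetIndex d, JetBound a q t₀ t₁ C (jetOrder a / 2) := by
  obtain ⟨K, hK⟩ := isCompact_Icc.exists_bound_of_continuousOn hq
  obtain ⟨C, hC, h⟩ := exists_jetBound_of_norm_le d (t₁ - t₀)
  exact ⟨C * |K|, by positivity, fun a => h a t₀ t₁ |K| q le_rfl (abs_nonneg K)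
    fun s hs => (hK s hs).trans (le_abs_self K)⟩

lemma duhamelJet_inl {d : ℕ} (t₀ : ℝ) (q : ℝ → L2V d) (u₀ : L2V d) (t : ℝ) :
    duhamelJet (.inl ()) t₀ q u₀ t = fpOp (t - t₀) u₀ + ∫ s in t₀..t, fpOp (t - s) (q s) := by
  simp only [duhamelJet, jetOp_inl]

lemma hasWeakPartial_duhamelJet_one {d : ℕ} {q : ℝ → L2V d} {t₀ t₁ : ℝ}
    (hq : ContinuousOn q (Icc t₀ t₁)) (u₀ : L2V d) (i : Fin d) :
    ContinuousOn (duhamelJet (.inr (.inl i)) t₀ q u₀) (Ioc t₀ t₁) ∧ ∀ t ∈ Ioc t₀ t₁,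
      HasWeakPartial i (duhamelJet (.inl ()) t₀ q u₀ t) (duhamelJet (.inr (.inl i)) t₀ q u₀ t) := by
  obtain ⟨C, hC, h⟩ := exists_jetBound_one hq
  have h0 := h (.inl ())
  have h1 := h (.inr (.inl i))
  simp only [jetOrder] at h0 h1
  exact ⟨continuousOn_duhamelJet hq hC (by norm_num) h1 u₀, fun t ht =>
    hasWeakPartial_duhamelJet (fun t ht u => (isJet_jetOp ht u).1 i) hq hC (by norm_num) h0
      hC (by norm_num) h1 u₀ ht⟩

/-- The Hölder bound lowers the exponent of second derivatives from 1 to 5/6, so these too may be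
taken under the Duhamel integral. -/
lemma isJet_duhamelJet {d : ℕ} {q : ℝ → L2V d} {t₀ t₁ Λ : ℝ} (hΛ : 0 ≤ Λ)
    (hq : ContinuousOn q (Icc t₀ t₁)) (hN : ∀ s ∈ Icc t₀ t₁, HolderBound Λ (q s)) (u₀ : L2V d) :
    (∀ a, ContinuousOn (duhamelJet a t₀ q u₀) (Ioc t₀ t₁)) ∧
      ∀ t ∈ Ioc t₀ t₁, IsJet fun a => duhamelJet a t₀ q u₀ t := by
  obtain ⟨C, hC, h⟩ := exists_jetBound_one hq
  obtain ⟨C', hC', h'⟩ := exists_jetBound_of_holderBound d (t₁ - t₀)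
  have h0 := h (.inl ())
  have h1 := fun i => h (.inr (.inl i))
  have h2 := fun i j => h' i j t₀ t₁ Λ q le_rfl hΛ hN
  simp only [jetOrder] at h0 h1
  refine ⟨fun a => ?_, fun t ht => ⟨fun i => (hasWeakPartial_duhamelJet_one hq u₀ i).2 t ht,
    fun i j => ?_⟩⟩
  · rcases a with ⟨⟩ | i | ⟨i, j⟩
    · exact continuousOn_duhamelJet hq hC (by norm_num) h0 u₀
    · exact (hasWeakPartial_duhamelJet_one hq u₀ i).1
    · exact continuousOn_duhamelJet hq (by positivity) (by norm_num) (h2 i j) u₀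
  · exact hasWeakPartial_duhamelJet (fun t ht u => (isJet_jetOp ht u).2 i j) hq hC (by norm_num)
      (h1 i) (by positivity) (by norm_num) (h2 i j) u₀ ht

lemma IsDuhamel.eq_duhamelJet {d M : ℕ} {R b : ℝ} {f : ℝ → Fin M → L2V d}
    (hf : IsDuhamel R b f) {t₀ t : ℝ} (h0 : 0 ≤ t₀) (ht : t₀ ≤ t) (hb : t ≤ b) (m : Fin M) :
    f t m = duhamelJet (.inl ()) t₀ (fun s => collisionL2 R (f s) m) (f t₀ m) t := by
  rw [duhamelJet_inl, ← hf.2 t₀ t h0 ht hb m]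

lemma exists_sum_bound {ι : Type*} [Fintype ι] {E : Type*} [NormedAddCommGroup E] {K : Set ℝ}
    (hK : IsCompact K) {F : ι → ℝ → E} (hF : ∀ i, ContinuousOn (F i) K) :
    ∃ C, 0 ≤ C ∧ ∀ i, ∀ t ∈ K, ‖F i t‖ ≤ C := by
  choose c hc using fun i => hK.exists_bound_of_continuousOn (hF i)
  refine ⟨∑ i, |c i|, Finset.sum_nonneg fun i _ => abs_nonneg _, fun i t ht => ?_⟩
  exact (hc i t ht).trans ((le_abs_self _).trans
    (Finset.single_le_sum (f := fun i => |c i|) (fun i _ => abs_nonneg _) (Finset.mem_univ i)))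

lemma locNorm_le_of_forall_le {d : ℕ} {ι : Type*} [Fintype ι] {ρ K : ℝ} {f : ι → L2V d}
    (h : ∀ i, ‖f i‖ ≤ K) : locNorm ρ f ≤ Fintype.card ι * K := by
  refine (Finset.sum_le_sum (g := fun _ => K) fun i _ => (norm_rs_le _ _).trans (h i)).trans
    (le_of_eq ?_)
  rw [Finset.sum_const, Finset.card_univ, nsmul_eq_mul]

/-- Away from the initial time the collision term is Hölder continuous in `L²`. -/
lemma IsDuhamel.exists_holderBound {d M : ℕ} {R b : ℝ} (hR : 0 ≤ R) {f : ℝ → Fin M → L2V d}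
    (hf : IsDuhamel R b f) {t₀ : ℝ} (h0 : 0 < t₀) :
    ∃ Λ, 0 ≤ Λ ∧ ∀ m, ∀ s ∈ Icc t₀ b, HolderBound Λ (collisionL2 R (f s) m) := by
  have hq := fun m => hf.continuousOn_collision hR m
  have hsub : Icc t₀ b ⊆ Ioc 0 b := fun s hs => ⟨h0.trans_le hs.1, hs.2⟩
  obtain ⟨K, hK, hfK⟩ := exists_sum_bound (isCompact_Icc (a := t₀) (b := b))
    (F := fun m t => f t m) fun m =>
      ((continuous_apply m).comp_continuousOn hf.1).mono (Icc_subset_Icc_left h0.le)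
  -- First stage of the bootstrap: Duhamel's formula started at time zero already gives continuous
  -- first derivatives on `(0, b]`, hence bounded ones on `[t₀, b]`.
  obtain ⟨K', hK', hgK⟩ := exists_sum_bound (isCompact_Icc (a := t₀) (b := b))
    (F := fun (p : Fin M × Fin d) t => duhamelJet (.inr (.inl p.2)) 0
      (fun s => collisionL2 R (f s) p.1) (f 0 p.1) t)
    fun p => ((hasWeakPartial_duhamelJet_one (hq p.1) (f 0 p.1) p.2).1).mono hsub
  obtain ⟨C, hC, h⟩ := exists_norm_translate_collisionForm_sub_le d M hR
  refine ⟨C * ((M * K + ∑ _n : Fin M, d * K') * (M * K)), by positivity, fun m s hs h' => ?_⟩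
  rw [collisionL2_eq hR]
  refine (h _ le_rfl (f s) (f s) (fun n i => duhamelJet (.inr (.inl i)) 0
    (fun s => collisionL2 R (f s) n) (f 0 n) s) (fun n i => ?_) m h').trans ?_
  · have := (hasWeakPartial_duhamelJet_one (hq n) (f 0 n) i).2 s (hsub hs)
    rwa [← hf.eq_duhamelJet le_rfl (h0.le.trans hs.1) hs.2 n] at this
  · refine mul_le_mul_of_nonneg_right (mul_le_mul_of_nonneg_left ?_ hC)
      (Real.rpow_nonneg (norm_nonneg _) _)
    have e1 : locNorm ((2 * M + 1) * (R + 2)) (f s) ≤ M * K := by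
      have := locNorm_le_of_forall_le (ρ := (2 * M + 1) * (R + 2)) fun m => hfK m s hs
      rwa [Fintype.card_fin] at this
    have e2 : ∀ n : Fin M, locNorm ((2 * M + 1) * (R + 2)) (fun i => duhamelJet (.inr (.inl i)) 0
        (fun s => collisionL2 R (f s) n) (f 0 n) s) ≤ d * K' := fun n => by
      have := locNorm_le_of_forall_le (ρ := (2 * M + 1) * (R + 2)) fun i => hgK (n, i) s hs
      rwa [Fintype.card_fin] at this
    exact mul_le_mul (add_le_add e1 (Finset.sum_le_sum fun n _ => e2 n)) e1 (locNorm_nonneg _ _)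
      (by positivity)

/-- A solution on `[0, b]` has continuous jets on `(0, b]`. -/
lemma IsDuhamel.exists_jet {d M : ℕ} {R b : ℝ} (hR : 0 ≤ R) {f : ℝ → Fin M → L2V d}
    (hf : IsDuhamel R b f) (m : Fin M) :
    ∃ D : JetIndex d → ℝ → L2V d, (∀ a, ContinuousOn (D a) (Ioc 0 b)) ∧
      ∀ t ∈ Ioc 0 b, (IsJet fun a => D a t) ∧ D (.inl ()) t = f t m := by
  -- Second stage: the Hölder bound is available only on intervals starting at a positive time, so
  -- Duhamel's formula is restarted at `t₀`.
  have hloc : ∀ t₀, 0 < t₀ → ∃ E : JetIndex d → ℝ → L2V d, (∀ a, ContinuousOn (E a) (Ioc t₀ b)) ∧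
      ∀ t ∈ Ioc t₀ b, (IsJet fun a => E a t) ∧ E (.inl ()) t = f t m := by
    intro t₀ h0
    obtain ⟨Λ, hΛ, hN⟩ := hf.exists_holderBound hR h0
    have h1 := isJet_duhamelJet hΛ ((hf.continuousOn_collision hR m).mono
      (Icc_subset_Icc_left h0.le)) (hN m) (f t₀ m)
    exact ⟨_, h1.1, fun t ht => ⟨h1.2 t ht,
      (hf.eq_duhamelJet h0.le ht.1.le ht.2 m).symm⟩⟩
  have hpt : ∀ t, ∃ x : JetIndex d → L2V d, t ∈ Ioc 0 b → IsJet x ∧ x (.inl ()) = f t m := by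
    intro t
    by_cases ht : t ∈ Ioc 0 b
    · obtain ⟨E, -, hE⟩ := hloc (t / 2) (by linarith [ht.1])
      exact ⟨fun a => E a t, fun _ => hE t ⟨by linarith [ht.1], ht.2⟩⟩
    · exact ⟨0, fun h => absurd h ht⟩
  choose x hx using hpt
  refine ⟨fun a t => x t a, fun a t ht => ?_, fun t ht => hx t ht⟩
  obtain ⟨E, hEc, hE⟩ := hloc (t / 2) (by linarith [ht.1])
  have hmem : t ∈ Ioc (t / 2) b := ⟨by linarith [ht.1], ht.2⟩
  -- The jets were chosen pointwise; near `t` they coincide, by uniqueness, with the continuous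
  -- family started at `t / 2`.
  have heq : ∀ s ∈ Ioc (t / 2) b, x s a = E a s := fun s hs => by
    have hs' : s ∈ Ioc 0 b := ⟨by linarith [ht.1, hs.1], hs.2⟩
    exact congrFun ((hx s hs').1.unique (hE s hs).1 ((hx s hs').2.trans (hE s hs).2.symm)) a
  refine (((hEc a) t hmem).congr heq (heq t hmem)).mono_of_mem_nhdsWithin ?_
  filter_upwards [self_mem_nhdsWithin,
    mem_nhdsWithin_of_mem_nhds (Ioi_mem_nhds hmem.1)] with s h1 h2
  exact ⟨h2, h1.2⟩

/-! ### Regularity in time -/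

lemma sum_jetIndex {d : ℕ} (F : JetIndex d → ℝ) : ∑ a, F a =
    F (.inl ()) + ∑ i, F (.inr (.inl i)) + ∑ i, ∑ j, F (.inr (.inr (i, j))) := by
  rw [Fintype.sum_sum_type, Fintype.sum_sum_type, Fintype.sum_prod_type, Fintype.sum_unique,
    add_assoc]

/-- `D m a t` are the jets of `f t m`, for `0 < t ≤ b`. -/
structure HasJets {d M : ℕ} (b : ℝ) (f : ℝ → Fin M → L2V d)
    (D : Fin M → JetIndex d → ℝ → L2V d) : Prop where
  cont : ∀ m a, ContinuousOn (D m a) (Ioc 0 b)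
  jet : ∀ m, ∀ t ∈ Ioc 0 b, IsJet fun a => D m a t
  fn : ∀ m, ∀ t ∈ Ioc 0 b, D m (.inl ()) t = f t m

lemma HolderBound.sub {d : ℕ} {Λ Λ' : ℝ} {u u' : L2V d} (h : HolderBound Λ u)
    (h' : HolderBound Λ' u') : HolderBound (Λ + Λ') (u - u') := by
  intro z
  have e : affComp 1 z (u - u') - (u - u') = (affComp 1 z u - u) - (affComp 1 z u' - u') := by
    rw [map_sub]; abel
  rw [e, add_mul]
  exact (norm_sub_le _ _).trans (add_le_add (h z) (h' z))

/-- Since the equation is autonomous, the time shift satisfies Duhamel's formula with the shifted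
collision term; the two formulas are subtracted. -/
lemma IsDuhamel.sub_shift {d M : ℕ} {R b : ℝ} (hR : 0 ≤ R) {f : ℝ → Fin M → L2V d}
    (hf : IsDuhamel R b f) {t₀ t η : ℝ} (h0 : 0 ≤ t₀) (ht : t₀ ≤ t) (hη : 0 ≤ η) (hb : t + η ≤ b)
    (m : Fin M) :
    f (t + η) m - f t m = fpOp (t - t₀) (f (t₀ + η) m - f t₀ m) +
      ∫ s in t₀..t, fpOp (t - s) (collisionL2 R (f (s + η)) m - collisionL2 R (f s) m) := by
  have hq := hf.continuousOn_collision hR m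
  have h1 := hf.2 (t₀ + η) (t + η) (by linarith) (by linarith) hb m
  rw [← intervalIntegral.integral_comp_add_right (fun s => fpOp (t + η - s)
    (collisionL2 R (f s) m)) η, add_sub_add_right_eq_sub] at h1
  simp only [add_sub_add_right_eq_sub] at h1
  rw [h1, hf.2 t₀ t h0 ht (by linarith) m]
  have i1 := (isOpSemigroup_fpOp d).intervalIntegrable t (a := t₀) (b := t) ht
    (g := fun s => collisionL2 R (f (s + η)) m)
    (hq.comp (f := fun s => s + η) (by fun_prop) fun s hs =>
      ⟨by linarith [hs.1], by linarith [hs.2]⟩)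
  have i2 := (isOpSemigroup_fpOp d).intervalIntegrable t (a := t₀) (b := t) ht
    (g := fun s => collisionL2 R (f s) m) (hq.mono (Icc_subset_Icc h0 (by linarith)))
  simp only [map_sub]
  rw [intervalIntegral.integral_sub i1 i2]
  abel

/-- The jets of the time differences of a solution. -/
lemma HasJets.sub_shift {d M : ℕ} {R b : ℝ} (hR : 0 ≤ R) {f : ℝ → Fin M → L2V d}
    (hf : IsDuhamel R b f) {D : Fin M → JetIndex d → ℝ → L2V d} (hD : HasJets b f D) {t₀ t η : ℝ}
    (h0 : 0 < t₀) (ht : t₀ < t) (hη : 0 ≤ η) (hb : t + η ≤ b) (m : Fin M) (a : JetIndex d) :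
    D m a (t + η) - D m a t = duhamelJet a t₀
      (fun s => collisionL2 R (f (s + η)) m - collisionL2 R (f s) m) (f (t₀ + η) m - f t₀ m) t := by
  have hq := hf.continuousOn_collision hR m
  obtain ⟨Λ, hΛ, hN⟩ := hf.exists_holderBound hR h0
  have m1 : t ∈ Ioc 0 b := ⟨h0.trans ht, by linarith⟩
  have m2 : t + η ∈ Ioc 0 b := ⟨by linarith, hb⟩
  have hqc : ContinuousOn (fun s => collisionL2 R (f (s + η)) m - collisionL2 R (f s) m)
      (Icc t₀ t) := by
    refine ContinuousOn.sub ?_ (hq.mono (Icc_subset_Icc h0.le (by linarith)))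
    exact hq.comp (f := fun s => s + η) (by fun_prop) fun s hs =>
      ⟨by linarith [hs.1], by linarith [hs.2]⟩
  -- The crude bound Λ + Λ does not decay with η, but here it only has to make the singular
  -- integrals converge.
  have hjet := (isJet_duhamelJet (add_nonneg hΛ hΛ) hqc (fun s hs =>
    (hN m (s + η) ⟨by linarith [hs.1], by linarith [hs.2]⟩).sub
      (hN m s ⟨hs.1, by linarith [hs.2]⟩)) (f (t₀ + η) m - f t₀ m)).2 t ⟨ht, le_rfl⟩
  refine congrFun (((hD.jet m _ m2).sub (hD.jet m _ m1)).unique hjet ?_) a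
  change D m (.inl ()) (t + η) - D m (.inl ()) t = _
  rw [hD.fn m _ m1, hD.fn m _ m2, duhamelJet_inl, ← hf.sub_shift hR h0.le ht.le hη hb]

lemma norm_fpOp_le_of_le {d : ℕ} {t L : ℝ} (ht : t ≤ L) (u : L2V d) :
    ‖fpOp t u‖ ≤ Real.exp (d * L) * ‖u‖ :=
  (norm_fpOp_le t u).trans (mul_le_mul_of_nonneg_right
    (Real.exp_le_exp.2 (mul_le_mul_of_nonneg_left ht (Nat.cast_nonneg d))) (norm_nonneg _))

/-- For short times a solution evolves by the semigroup, up to a small error. -/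
lemma IsDuhamel.exists_norm_sub_fpOp_le {d M : ℕ} {R b : ℝ} (hR : 0 ≤ R)
    {f : ℝ → Fin M → L2V d} (hf : IsDuhamel R b f) :
    ∃ C, 0 ≤ C ∧ ∀ t₀ η, 0 ≤ t₀ → η ∈ Icc (0 : ℝ) 1 → t₀ + η ≤ b → ∀ m,
      ‖f (t₀ + η) m - fpOp η (f t₀ m)‖ ≤ C * η := by
  obtain ⟨K, hK, hqK⟩ := exists_sum_bound (isCompact_Icc (a := 0) (b := b))
    (F := fun m t => collisionL2 R (f t) m) fun m => hf.continuousOn_collision hR m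
  refine ⟨Real.exp (d * 1) * K, by positivity, fun t₀ η h0 hη hb m => ?_⟩
  rw [hf.2 t₀ (t₀ + η) h0 (by linarith [hη.1]) hb m, add_sub_cancel_left, add_sub_cancel_left]
  refine (intervalIntegral.norm_integral_le_of_norm_le_const (C := Real.exp (d * 1) * K)
    fun s hs => ?_).trans (le_of_eq ?_)
  · rw [uIoc_of_le (by linarith [hη.1])] at hs
    refine (norm_fpOp_le_of_le (L := 1) (by linarith [hs.1, hη.2]) _).trans ?_
    exact mul_le_mul_of_nonneg_left (hqK m s ⟨by linarith [hs.1], by linarith [hs.2]⟩)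
      (Real.exp_pos _).le
  · rw [add_sub_cancel_left, abs_of_nonneg hη.1]

/-- Solutions are Lipschitz continuous in time with respect to localized norms. -/
lemma HasJets.exists_locNorm_sub_le {d M : ℕ} {R b : ℝ} (hR : 0 ≤ R) {f : ℝ → Fin M → L2V d}
    (hf : IsDuhamel R b f) {D : Fin M → JetIndex d → ℝ → L2V d} (hD : HasJets b f D) {t₀ : ℝ}
    (h0 : 0 < t₀) {ρ : ℝ} (hρ : (2 * M + 1) * (R + 2) ≤ ρ) :
    ∃ C, 0 ≤ C ∧ ∀ η ∈ Icc (0 : ℝ) 1, ∀ t ∈ Icc t₀ (b - η),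
      locNorm ρ (f (t + η) - f t) ≤ C * η := by
  have hρ0 : 0 ≤ ρ := le_trans (by positivity) hρ
  obtain ⟨C₁, hC₁, h₁⟩ := hf.exists_norm_sub_fpOp_le hR
  obtain ⟨C₂, hC₂, h₂⟩ := exists_norm_rs_fpOp_sub_le (d := d) hρ0
  obtain ⟨C₃, hC₃, h₃⟩ := exists_norm_collisionL2_sub_le d M hR
  obtain ⟨K, hK, hfK⟩ := exists_sum_bound (isCompact_Icc (a := 0) (b := b))
    (F := fun m t => f t m) fun m => (continuous_apply m).comp_continuousOn hf.1
  obtain ⟨H, hH⟩ : ∃ H : ℝ, H = ∑ m, ∑ a, Real.exp (2 * b) * (Real.exp (d * b) * ‖D m a t₀‖) :=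
    ⟨_, rfl⟩
  have hH0 : 0 ≤ H := hH ▸ Finset.sum_nonneg fun m _ => Finset.sum_nonneg fun a _ => by positivity
  obtain ⟨A, hA⟩ : ∃ A, A = C₂ * H + Real.exp (d * b) * C₁ := ⟨_, rfl⟩
  have hA0 : 0 ≤ A := by rw [hA]; positivity
  obtain ⟨L, hL⟩ : ∃ L, L = Real.exp (d * b) * (C₃ * (M * K + M * K)) := ⟨_, rfl⟩
  have hL0 : 0 ≤ L := by rw [hL]; positivity
  have hlocK : ∀ s ∈ Icc 0 b, locNorm ρ (f s) ≤ M * K := fun s hs => by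
    have := locNorm_le_of_forall_le (ρ := ρ) fun m => hfK m s hs
    rwa [Fintype.card_fin] at this
  refine ⟨M * A * Real.exp (M * L * b), by positivity, fun η hη t ht => ?_⟩
  have hcs : ContinuousOn (fun s => f (s + η) - f s) (Icc t₀ (b - η)) := by
    refine (hf.1.comp (f := fun s => s + η) (by fun_prop) fun s hs => ?_).sub
      (hf.1.mono (Icc_subset_Icc h0.le (by linarith [hη.1])))
    exact ⟨by linarith [hs.1, hη.1], by linarith [hs.2]⟩
  have hφ : ContinuousOn (fun s => locNorm ρ (f (s + η) - f s)) (Icc t₀ (b - η)) :=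
    continuousOn_finsetSum _ fun m _ =>
      ((rs (Metric.ball 0 ρ)).continuous.comp_continuousOn
        ((continuous_apply m).comp_continuousOn hcs)).norm
  have hstep : ∀ t ∈ Icc t₀ (b - η), ∀ m, ‖rs (Metric.ball 0 ρ) ((f (t + η) - f t) m)‖ ≤
      A * η + L * ∫ s in t₀..t, locNorm ρ (f (s + η) - f s) := by
    intro t ht m
    have hb0 : t₀ ≤ b := by linarith [ht.1, ht.2, hη.1]
    have htt : 0 ≤ t - t₀ := by linarith [ht.1]
    have htb : t - t₀ ≤ b := by linarith [ht.2, hη.1]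
    -- The initial difference is not known to be O(η) in L². It is split through S_η f(t₀): the
    -- Duhamel error is O(η) in L², while S_η commutes with S_{t-t₀} and then acts on a function
    -- with two weak derivatives, giving O(η) on the ball.
    have e : (f (t + η) - f t) m = (fpOp η (fpOp (t - t₀) (f t₀ m)) - fpOp (t - t₀) (f t₀ m)) +
        fpOp (t - t₀) (f (t₀ + η) m - fpOp η (f t₀ m)) +
        ∫ s in t₀..t, fpOp (t - s) (collisionL2 R (f (s + η)) m - collisionL2 R (f s) m) := by
      rw [Pi.sub_apply, hf.sub_shift hR h0.le ht.1 hη.1 (by linarith [ht.2]), map_sub, map_sub,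
        ← fpOp_add hη.1 htt, add_comm η, fpOp_add htt hη.1]
      abel
    have b1 : ‖rs (Metric.ball 0 ρ)
        (fpOp η (fpOp (t - t₀) (f t₀ m)) - fpOp (t - t₀) (f t₀ m))‖ ≤ C₂ * η * H := by
      have hm0 : t₀ ∈ Ioc 0 b := ⟨h0, hb0⟩
      have hj := (hD.jet m t₀ hm0).fpOp htt
      have hj0 : Real.exp (jetOrder (.inl () : JetIndex d) * (t - t₀)) •
          fpOp (t - t₀) (D m (.inl ()) t₀) = fpOp (t - t₀) (f t₀ m) := by
        rw [hD.fn m t₀ hm0]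
        simp [jetOrder]
      have h4 := h₂ _ _ _ hj.1 hj.2 η hη
      beta_reduce at h4
      rw [hj0] at h4
      refine h4.trans (mul_le_mul_of_nonneg_left ?_ (mul_nonneg hC₂ hη.1))
      have h5 : ∀ a : JetIndex d, ‖Real.exp (jetOrder a * (t - t₀)) • fpOp (t - t₀) (D m a t₀)‖ ≤
          Real.exp (2 * b) * (Real.exp (d * b) * ‖D m a t₀‖) := fun a => by
        rw [norm_smul, Real.norm_of_nonneg (Real.exp_pos _).le]
        refine mul_le_mul (Real.exp_le_exp.2 ?_) (norm_fpOp_le_of_le htb _) (norm_nonneg _)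
          (Real.exp_pos _).le
        have : (jetOrder a : ℝ) ≤ 2 := by
          rcases a with ⟨⟩ | i | ⟨i, j⟩ <;> simp [jetOrder]
        exact mul_le_mul this htb htt zero_le_two
      have h6 := h5 (.inl ())
      rw [hj0] at h6
      refine (add_le_add (add_le_add h6 (Finset.sum_le_sum fun i _ => h5 (.inr (.inl i))))
        (Finset.sum_le_sum fun i _ => Finset.sum_le_sum fun j _ =>
          h5 (.inr (.inr (i, j))))).trans ?_
      rw [hH]
      refine le_trans (le_of_eq ?_) (Finset.single_le_sum
        (f := fun m => ∑ a, Real.exp (2 * b) * (Real.exp (d * b) * ‖D m a t₀‖))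
        (fun m _ => Finset.sum_nonneg fun a _ => by positivity) (Finset.mem_univ m))
      rw [sum_jetIndex]
    have b2 : ‖rs (Metric.ball 0 ρ) (fpOp (t - t₀) (f (t₀ + η) m - fpOp η (f t₀ m)))‖ ≤
        Real.exp (d * b) * (C₁ * η) :=
      (norm_rs_le _ _).trans ((norm_fpOp_le_of_le htb _).trans (mul_le_mul_of_nonneg_left
        (h₁ t₀ η h0.le hη (by linarith [ht.1, ht.2]) m) (Real.exp_pos _).le))
    -- Dropping the localization and applying the nonlocal semigroup does no harm, because the
    -- collision difference is controlled in the full L² norm by the localized norm of the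
    -- difference of `f`.
    have b3 : ‖rs (Metric.ball 0 ρ) (∫ s in t₀..t,
        fpOp (t - s) (collisionL2 R (f (s + η)) m - collisionL2 R (f s) m))‖ ≤
        L * ∫ s in t₀..t, locNorm ρ (f (s + η) - f s) := by
      refine (norm_rs_le _ _).trans ?_
      rw [← intervalIntegral.integral_const_mul]
      refine intervalIntegral.norm_integral_le_of_norm_le ht.1 (ae_of_all _ fun s hs => ?_) ?_
      · have m1 : s ∈ Icc 0 b := ⟨by linarith [hs.1], by linarith [hs.2, ht.2, hη.1]⟩
        have m2 : s + η ∈ Icc 0 b := ⟨by linarith [hs.1, hη.1], by linarith [hs.2, ht.2]⟩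
        refine (norm_fpOp_le_of_le (L := b) (by linarith [hs.1, ht.2, hη.1]) _).trans ?_
        rw [hL, mul_assoc]
        refine mul_le_mul_of_nonneg_left ((h₃ ρ hρ _ _ m).trans ?_) (Real.exp_pos _).le
        exact mul_le_mul_of_nonneg_right (mul_le_mul_of_nonneg_left
          (add_le_add (hlocK _ m2) (hlocK _ m1)) hC₃) (locNorm_nonneg _ _)
      · refine ContinuousOn.intervalIntegrable ?_
        rw [uIcc_of_le ht.1]
        exact (hφ.const_mul L).mono (Icc_subset_Icc_right ht.2)
    rw [e, map_add, map_add]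
    refine (norm_add₃_le).trans ((add_le_add (add_le_add b1 b2) b3).trans (le_of_eq ?_))
    rw [hA]
    ring
  have hG := le_mul_exp_of_le_add_integral hφ (fun s _ => locNorm_nonneg _ _)
    (L := M * L) (A := M * (A * η)) (by positivity) (fun t ht => by
      refine (Finset.sum_le_sum fun m _ => hstep t ht m).trans (le_of_eq ?_)
      rw [Finset.sum_const, Finset.card_univ, Fintype.card_fin, nsmul_eq_mul]
      ring) t ht
  refine hG.trans ?_
  have h7 : Real.exp (M * L * (t - t₀)) ≤ Real.exp (M * L * b) :=
    Real.exp_le_exp.2 (mul_le_mul_of_nonneg_left (by linarith [ht.2, hη.1]) (by positivity))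
  have h8 := mul_le_mul_of_nonneg_left h7 (show 0 ≤ M * (A * η) by have := hη.1; positivity)
  linarith

lemma exists_norm_jetOp_le_of_ge (d : ℕ) {c : ℝ} (hc : 0 < c) (L : ℝ) : ∃ C, 0 ≤ C ∧
    ∀ (a : JetIndex d) (τ : ℝ), c ≤ τ → τ ≤ L → ∀ u, ‖jetOp a τ u‖ ≤ C * ‖u‖ := by
  obtain ⟨C, hC, h⟩ := exists_norm_jetOp_le (d := d) L
  refine ⟨C * (1 + c ^ (-(1 / 2) : ℝ) + c ^ (-1 : ℝ)), by positivity, fun a τ hτ hL u => ?_⟩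
  refine (h a τ (hc.trans_le hτ) hL u).trans (mul_le_mul_of_nonneg_right
    (mul_le_mul_of_nonneg_left ?_ hC) (norm_nonneg _))
  have h1 : 0 ≤ c ^ (-(1 / 2) : ℝ) := Real.rpow_nonneg hc.le _
  have h2 : 0 ≤ c ^ (-1 : ℝ) := Real.rpow_nonneg hc.le _
  rcases a with ⟨⟩ | i | ⟨i, j⟩
  · simp only [jetOrder, Nat.cast_zero, zero_div, neg_zero, Real.rpow_zero]
    linarith
  · have := Real.rpow_le_rpow_of_nonpos hc hτ (show (-(1 / 2) : ℝ) ≤ 0 by norm_num)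
    simp only [jetOrder, Nat.cast_one]
    linarith
  · have := Real.rpow_le_rpow_of_nonpos hc hτ (show (-1 : ℝ) ≤ 0 by norm_num)
    simp only [jetOrder, Nat.cast_ofNat, div_self (two_ne_zero' ℝ)]
    linarith

lemma jetOrder_le_two {d : ℕ} (a : JetIndex d) : (jetOrder a : ℝ) ≤ 2 := by
  rcases a with ⟨⟩ | i | ⟨i, j⟩ <;> simp [jetOrder]

/-- Localized Lipschitz continuity in time of the derivatives of `S_t u`. -/
lemma exists_norm_rs_jetOp_fpOp_sub_le {d : ℕ} {ρ c : ℝ} (hρ : 0 ≤ ρ) (hc : 0 < c) (L : ℝ) :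
    ∃ C, 0 ≤ C ∧ ∀ (a : JetIndex d) (τ : ℝ), c ≤ τ → τ ≤ L → ∀ η ∈ Icc (0 : ℝ) 1, ∀ u,
      ‖rs (Metric.ball 0 ρ) (jetOp a τ (fpOp η u - u))‖ ≤ C * η * ‖u‖ := by
  obtain ⟨C₁, hC₁, h₁⟩ := exists_norm_jetOp_le_of_ge d (half_pos hc) |L|
  obtain ⟨C₂, hC₂, h₂⟩ := exists_norm_rs_fpOp_sub_le (d := d) hρ
  obtain ⟨N, hN⟩ : ∃ N : ℝ, N = ∑ _b : JetIndex d, Real.exp |L| * (C₁ * C₁) := ⟨_, rfl⟩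
  have hN0 : 0 ≤ N := hN ▸ Finset.sum_nonneg fun b _ => by positivity
  refine ⟨2 * Real.exp 2 * (Real.exp (d * 1) * C₁) + C₂ * N, by positivity,
    fun a τ hτ hL η hη u => ?_⟩
  have hτ0 : 0 < τ := hc.trans_le hτ
  have hτL : τ ≤ |L| := hL.trans (le_abs_self L)
  obtain ⟨w, hw⟩ : ∃ w, w = jetOp a τ u := ⟨_, rfl⟩
  have hwn : ‖w‖ ≤ C₁ * ‖u‖ := hw ▸ h₁ a τ (by linarith) hτL u
  -- Commuting the derivative past S_η reduces the claim to S_η w - w with w = `jetOp a τ u`, apart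
  -- from the harmless factor e^{kη} for a derivative of order k.
  have e : jetOp a τ (fpOp η u - u) =
      (Real.exp (jetOrder a * η) - 1) • fpOp η w + (fpOp η w - w) := by
    rw [map_sub, ← jetOp_add a hτ0 hη.1, add_comm, jetOp_add_comm a hη.1 hτ0, ← hw, sub_smul,
      one_smul]
    abel
  have b1 : ‖(Real.exp (jetOrder a * η) - 1) • fpOp η w‖ ≤
      2 * Real.exp 2 * (Real.exp (d * 1) * C₁) * η * ‖u‖ := by
    have hx : (jetOrder a : ℝ) * η ≤ 2 * η := mul_le_mul_of_nonneg_right (jetOrder_le_two a) hη.1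
    have hx0 : 0 ≤ (jetOrder a : ℝ) * η := mul_nonneg (Nat.cast_nonneg _) hη.1
    have h3 : Real.exp (jetOrder a * η) - 1 ≤ 2 * η * Real.exp 2 :=
      (exp_sub_one_le_mul_exp _).trans (mul_le_mul hx
        (Real.exp_le_exp.2 (by linarith [hη.2])) (Real.exp_pos _).le (by linarith [hη.1]))
    rw [norm_smul, Real.norm_of_nonneg (by linarith [Real.one_le_exp hx0])]
    refine (mul_le_mul h3 ((norm_fpOp_le_of_le hη.2 w).trans (mul_le_mul_of_nonneg_left hwn
      (Real.exp_pos _).le)) (norm_nonneg _) (by have := hη.1; positivity)).trans (le_of_eq ?_)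
    ring
  have b2 : ‖rs (Metric.ball 0 ρ) (fpOp η w - w)‖ ≤ C₂ * η * (N * ‖u‖) := by
    -- Two further derivatives of `w` are needed: half of the time τ is spent on the derivatives
    -- labelled `a`, the other half on these two.
    have hj := (isJet_jetOp (half_pos hτ0) (jetOp a (τ / 2) u))
    have hww : Real.exp (jetOrder a * (τ / 2)) • fpOp (τ / 2) (jetOp a (τ / 2) u) = w := by
      rw [hw, ← jetOp_add_comm a (half_pos hτ0).le (half_pos hτ0), add_halves]
    have hj1 : ∀ i, HasWeakPartial i w (Real.exp (jetOrder a * (τ / 2)) •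
        jetOp (.inr (.inl i)) (τ / 2) (jetOp a (τ / 2) u)) := fun i => by
      rw [← hww, ← jetOp_inl]
      exact (hj.1 i).const_smul _
    have h4 := h₂ w _ _ hj1 (fun i j => (hj.2 i j).const_smul _) η hη
    refine h4.trans (mul_le_mul_of_nonneg_left ?_ (mul_nonneg hC₂ hη.1))
    have h5 : ∀ b : JetIndex d, ‖Real.exp (jetOrder a * (τ / 2)) •
        jetOp b (τ / 2) (jetOp a (τ / 2) u)‖ ≤ Real.exp |L| * (C₁ * C₁) * ‖u‖ := fun b => by
      rw [norm_smul, Real.norm_of_nonneg (Real.exp_pos _).le, mul_assoc, mul_assoc]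
      refine mul_le_mul (Real.exp_le_exp.2 ?_) ((h₁ b _ (by linarith) (by linarith) _).trans
        (mul_le_mul_of_nonneg_left (h₁ a _ (by linarith) (by linarith) u) hC₁)) (norm_nonneg _)
        (Real.exp_pos _).le
      have := mul_le_mul_of_nonneg_right (jetOrder_le_two a) (half_pos hτ0).le
      linarith
    have h6 := h5 (.inl ())
    rw [jetOp_inl, hww] at h6
    refine (add_le_add (add_le_add h6 (Finset.sum_le_sum fun i _ => h5 (.inr (.inl i))))
      (Finset.sum_le_sum fun i _ => Finset.sum_le_sum fun j _ =>
        h5 (.inr (.inr (i, j))))).trans (le_of_eq ?_)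
    rw [hN, Finset.sum_mul, sum_jetIndex]
  rw [e, map_add]
  refine (norm_add_le _ _).trans ((add_le_add ((norm_rs_le _ _).trans b1) b2).trans (le_of_eq ?_))
  ring

/-- Lipschitz continuity in time of derivatives, given bounds for the differences of the
collision term. -/
lemma HasJets.exists_norm_rs_sub_le_of_jetBound {d M : ℕ} {R b : ℝ} (hR : 0 ≤ R)
    {f : ℝ → Fin M → L2V d} (hf : IsDuhamel R b f) {D : Fin M → JetIndex d → ℝ → L2V d}
    (hD : HasJets b f D) {t₀ t₁ : ℝ} (h0 : 0 < t₀) (h1 : t₀ < t₁) {ρ : ℝ} (hρ : 0 ≤ ρ)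
    {a : JetIndex d} {K θ : ℝ} (hK : 0 ≤ K) (hθ : θ < 1)
    (hb : ∀ m, ∀ η ∈ Icc (0 : ℝ) 1, JetBound a
      (fun s => collisionL2 R (f (s + η)) m - collisionL2 R (f s) m) t₀ (b - η) (K * η) θ) :
    ∃ C, 0 ≤ C ∧ ∀ m, ∀ η ∈ Icc (0 : ℝ) 1, ∀ t ∈ Icc t₁ (b - η),
      ‖rs (Metric.ball 0 ρ) (D m a (t + η) - D m a t)‖ ≤ C * η := by
  obtain ⟨C₁, hC₁, h₁⟩ := hf.exists_norm_sub_fpOp_le hR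
  obtain ⟨C₂, hC₂, h₂⟩ := exists_norm_rs_jetOp_fpOp_sub_le (d := d) hρ (sub_pos.2 h1) b
  obtain ⟨C₃, hC₃, h₃⟩ := exists_norm_jetOp_le_of_ge d (sub_pos.2 h1) b
  obtain ⟨I, hI⟩ : ∃ I, I = ∫ τ in (0 : ℝ)..|b|, τ ^ (-θ) := ⟨_, rfl⟩
  have hI0 : 0 ≤ I := hI ▸ intervalIntegral.integral_nonneg (abs_nonneg b)
    fun τ hτ => Real.rpow_nonneg hτ.1 _
  refine ⟨C₂ * ‖f t₀‖ + C₃ * C₁ + K * I, by positivity, fun m η hη t ht => ?_⟩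
  have htt : t₀ < t := h1.trans_le ht.1
  have htb : t - t₀ ≤ b := by linarith [ht.2, hη.1]
  rw [hD.sub_shift hR hf h0 htt hη.1 (by linarith [ht.2]) m a, duhamelJet]
  -- The splitting as before: the first part uses the localized estimate for derivatives of S_η - 1,
  -- the second is O(η) in L² and is smoothed for a time at least `t₁ - t₀`.
  have e : f (t₀ + η) m - f t₀ m = (fpOp η (f t₀ m) - f t₀ m) +
      (f (t₀ + η) m - fpOp η (f t₀ m)) := by abel
  rw [e, map_add, map_add, map_add]
  have b1 := (h₂ a (t - t₀) (by linarith [ht.1]) htb η hη (f t₀ m)).trans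
    (mul_le_mul_of_nonneg_left (norm_le_pi_norm (f t₀) m) (mul_nonneg hC₂ hη.1))
  have b2 : ‖rs (Metric.ball 0 ρ) (jetOp a (t - t₀) (f (t₀ + η) m - fpOp η (f t₀ m)))‖ ≤
      C₃ * (C₁ * η) :=
    (norm_rs_le _ _).trans ((h₃ a (t - t₀) (by linarith [ht.1]) htb _).trans
      (mul_le_mul_of_nonneg_left (h₁ t₀ η h0.le hη (by linarith [ht.2]) m) hC₃))
  have b3 := (norm_rs_le (Metric.ball 0 ρ) _).trans (norm_singular_duhamel_le (L := t - t₀)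
    (J := fun τ u => jetOp a τ u)
    (q := fun s => collisionL2 R (f (s + η)) m - collisionL2 R (f s) m) htt.le le_rfl
    (mul_nonneg hK hη.1) hθ fun τ hτ hτ' s hs => hb m η hη τ hτ (by linarith [ht.2]) s
      ⟨hs.1, by linarith [hs.2, ht.2]⟩)
  have b4 : ∫ τ in (0 : ℝ)..(t - t₀), τ ^ (-θ) ≤ I := by
    rw [hI]
    refine intervalIntegral.integral_mono_interval le_rfl (by linarith)
      (htb.trans (le_abs_self b)) ?_ (intervalIntegral.intervalIntegrable_rpow' (by linarith))
    exact (ae_restrict_iff' measurableSet_Ioc).2 (ae_of_all _ fun τ hτ =>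
      Real.rpow_nonneg hτ.1.le _)
  have b5 := mul_le_mul_of_nonneg_left b4 (mul_nonneg hK hη.1)
  refine norm_add₃_le.trans ((add_le_add (add_le_add b1 b2) (b3.trans b5)).trans (le_of_eq ?_))
  ring

/-- Solutions are locally Lipschitz continuous in time with values in `H²_loc`. -/
lemma HasJets.exists_norm_rs_sub_le {d M : ℕ} {R b : ℝ} (hR : 0 ≤ R)
    {f : ℝ → Fin M → L2V d} (hf : IsDuhamel R b f) {D : Fin M → JetIndex d → ℝ → L2V d}
    (hD : HasJets b f D) {t₂ : ℝ} (h2 : 0 < t₂) (r : ℝ) (a : JetIndex d) :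
    ∃ C, 0 ≤ C ∧ ∀ m, ∀ η ∈ Icc (0 : ℝ) 1, ∀ t ∈ Icc t₂ (b - η),
      ‖rs (Metric.ball 0 r) (D m a (t + η) - D m a t)‖ ≤ C * η := by
  obtain ⟨ρ, hρr, hρ⟩ : ∃ ρ, r ≤ ρ ∧ (2 * M + 1) * (R + 2) ≤ ρ :=
    ⟨max r ((2 * M + 1) * (R + 2)), le_max_left _ _, le_max_right _ _⟩
  have hρ0 : 0 ≤ ρ := le_trans (by positivity) hρ
  suffices h : ∃ C, 0 ≤ C ∧ ∀ m, ∀ η ∈ Icc (0 : ℝ) 1, ∀ t ∈ Icc t₂ (b - η),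
      ‖rs (Metric.ball 0 ρ) (D m a (t + η) - D m a t)‖ ≤ C * η by
    obtain ⟨C, hC, h⟩ := h
    exact ⟨C, hC, fun m η hη t ht => (norm_rs_mono (Metric.ball_subset_ball hρr) _).trans
      (h m η hη t ht)⟩
  -- A positive amount of time is spent on each stage: `f` itself is Lipschitz from `t₀` on, its
  -- derivatives of order at most one from `t₁` on, and the second derivatives from `t₂` on.
  obtain ⟨t₀, ht₀⟩ : ∃ t₀, t₀ = t₂ / 3 := ⟨_, rfl⟩
  obtain ⟨t₁, ht₁⟩ : ∃ t₁, t₁ = 2 * t₂ / 3 := ⟨_, rfl⟩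
  have h0 : 0 < t₀ := by rw [ht₀]; linarith
  have h01 : t₀ < t₁ := by rw [ht₀, ht₁]; linarith
  have h12 : t₁ < t₂ := by rw [ht₁]; linarith
  obtain ⟨C₁, hC₁, h₁⟩ := hD.exists_locNorm_sub_le hR hf h0 hρ
  obtain ⟨C₃, hC₃, h₃⟩ := exists_norm_collisionL2_sub_le d M hR
  obtain ⟨K, hK, hfK⟩ := exists_sum_bound (isCompact_Icc (a := 0) (b := b))
    (F := fun m t => f t m) fun m => (continuous_apply m).comp_continuousOn hf.1
  have hlocK : ∀ s ∈ Icc 0 b, locNorm ρ (f s) ≤ M * K := fun s hs => by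
    have := locNorm_le_of_forall_le (ρ := ρ) fun m => hfK m s hs
    rwa [Fintype.card_fin] at this
  have hqd : ∀ m, ∀ η ∈ Icc (0 : ℝ) 1, ∀ s ∈ Icc t₀ (b - η),
      ‖collisionL2 R (f (s + η)) m - collisionL2 R (f s) m‖ ≤
        C₃ * (M * K + M * K) * C₁ * η := fun m η hη s hs => by
    refine (h₃ ρ hρ _ _ m).trans ?_
    rw [mul_assoc _ C₁]
    exact mul_le_mul (mul_le_mul_of_nonneg_left (add_le_add
      (hlocK _ ⟨by linarith [hs.1, hη.1], by linarith [hs.2]⟩)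
      (hlocK _ ⟨by linarith [hs.1], by linarith [hs.2, hη.1]⟩)) hC₃) (h₁ η hη s hs)
      (locNorm_nonneg _ _) (by positivity)
  have hQ0 : 0 ≤ C₃ * (M * K + M * K) * C₁ := by positivity
  obtain ⟨C₄, hC₄, h₄⟩ := exists_jetBound_of_norm_le d |b|
  -- Orders zero and one have exponents 0 and 1/2, so the L² Lipschitz bound of the collision term
  -- suffices.
  have hlow : ∀ a : JetIndex d, (jetOrder a : ℝ) / 2 < 1 → ∃ C, 0 ≤ C ∧ ∀ m,
      ∀ η ∈ Icc (0 : ℝ) 1, ∀ t ∈ Icc t₁ (b - η),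
        ‖rs (Metric.ball 0 ρ) (D m a (t + η) - D m a t)‖ ≤ C * η := fun a ha =>
    hD.exists_norm_rs_sub_le_of_jetBound hR hf h0 h01 hρ0 (mul_nonneg hC₄ hQ0) ha
      fun m η hη => by
        rw [mul_assoc]
        exact h₄ a t₀ (b - η) _ _ (by linarith [hη.1, le_abs_self b])
          (mul_nonneg hQ0 hη.1) (hqd m η hη)
  by_cases ha : (jetOrder a : ℝ) / 2 < 1
  · obtain ⟨C, hC, h⟩ := hlow a ha
    exact ⟨C, hC, fun m η hη t ht => h m η hη t ⟨h12.le.trans ht.1, ht.2⟩⟩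
  obtain ⟨i, j, rfl⟩ : ∃ i j, a = .inr (.inr (i, j)) := by
    rcases a with ⟨⟩ | i | ⟨i, j⟩
    · simp [jetOrder] at ha
    · norm_num [jetOrder] at ha
    · exact ⟨i, j, rfl⟩
  choose G hG hGb using fun i : Fin d => hlow (.inr (.inl i)) (by norm_num [jetOrder])
  obtain ⟨K', hK', hgK⟩ := exists_sum_bound (isCompact_Icc (a := t₁) (b := b))
    (F := fun (p : Fin M × Fin d) => D p.1 (.inr (.inl p.2)))
    fun p => (hD.cont p.1 _).mono fun s hs => ⟨(h0.trans h01).trans_le hs.1, hs.2⟩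
  obtain ⟨C₅, hC₅, h₅⟩ := exists_norm_translate_collisionForm_sub_le d M hR
  -- For second derivatives the difference of collision terms must be Hölder with a constant
  -- proportional to η. By bilinearity the η comes from the first slot, using the Lipschitz bounds
  -- on first derivatives just proved, or from the second slot, using only that of `f`.
  obtain ⟨Λ, hΛ⟩ : ∃ Λ, Λ = C₅ * ((C₁ + ∑ _n : Fin M, ∑ i, G i) * (M * K)) +
    C₅ * ((M * K + ∑ _n : Fin M, d * K') * C₁) := ⟨_, rfl⟩
  have hG0 : 0 ≤ ∑ _n : Fin M, ∑ i, G i :=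
    Finset.sum_nonneg fun _ _ => Finset.sum_nonneg fun i _ => hG i
  have hΛ0 : 0 ≤ Λ := by rw [hΛ]; positivity
  obtain ⟨C₆, hC₆, h₆⟩ := exists_jetBound_of_holderBound d |b|
  refine hD.exists_norm_rs_sub_le_of_jetBound hR hf (h0.trans h01) h12 hρ0 (mul_nonneg hC₆ hΛ0)
    (θ := 5 / 6) (by norm_num) fun m η hη => ?_
  rw [mul_assoc]
  refine h₆ i j t₁ (b - η) _ _ (by linarith [hη.1, le_abs_self b]) (mul_nonneg hΛ0 hη.1)
    fun s hs z => ?_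
  have m1 : s ∈ Ioc 0 b := ⟨(h0.trans h01).trans_le hs.1, by linarith [hs.2, hη.1]⟩
  have m2 : s + η ∈ Ioc 0 b := ⟨by linarith [m1.1, hη.1], by linarith [hs.2]⟩
  have hw : ∀ t ∈ Ioc 0 b, ∀ n i, HasWeakPartial i (f t n) (D n (.inr (.inl i)) t) :=
    fun t ht n i => by
      have := (hD.jet n t ht).1 i
      beta_reduce at this
      rwa [hD.fn n t ht] at this
  have n1 := h₅ ρ hρ (f (s + η) - f s) (f (s + η))
    (fun n i => D n (.inr (.inl i)) (s + η) - D n (.inr (.inl i)) s)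
    (fun n i => (hw _ m2 n i).sub (hw _ m1 n i)) m z
  have n2 := h₅ ρ hρ (f s) (f (s + η) - f s) (fun n i => D n (.inr (.inl i)) s)
    (fun n i => hw _ m1 n i) m z
  have e1 := h₁ η hη s ⟨h01.le.trans hs.1, hs.2⟩
  have e2 : ∑ n, locNorm ρ (fun i => D n (.inr (.inl i)) (s + η) - D n (.inr (.inl i)) s) ≤
      (∑ _n : Fin M, ∑ i, G i) * η := by
    rw [Finset.sum_mul]
    refine Finset.sum_le_sum fun n _ => ?_
    rw [Finset.sum_mul]
    exact Finset.sum_le_sum fun i _ => hGb i n η hη s hs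
  have e3 : ∑ n, locNorm ρ (fun i => D n (.inr (.inl i)) s) ≤ ∑ _n : Fin M, d * K' :=
    Finset.sum_le_sum fun n _ => by
      have := locNorm_le_of_forall_le (ρ := ρ) fun i =>
        hgK (n, i) s ⟨hs.1, by linarith [hs.2, hη.1]⟩
      rwa [Fintype.card_fin] at this
  have e4 := hlocK _ (Ioc_subset_Icc_self m1)
  have e5 := hlocK _ (Ioc_subset_Icc_self m2)
  have hz := Real.rpow_nonneg (norm_nonneg z) (1 / 3)
  have p1 := mul_le_mul (add_le_add e1 e2) e5 (locNorm_nonneg _ _)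
    (add_nonneg (mul_nonneg hC₁ hη.1) (mul_nonneg hG0 hη.1))
  have p2 := mul_le_mul (add_le_add e4 e3) e1 (locNorm_nonneg _ _)
    (add_nonneg (by positivity) (Finset.sum_nonneg fun _ _ => by positivity))
  have p3 := mul_le_mul_of_nonneg_right (mul_le_mul_of_nonneg_left p1 hC₅) hz
  have p4 := mul_le_mul_of_nonneg_right (mul_le_mul_of_nonneg_left p2 hC₅) hz
  have e : affComp 1 z (collisionL2 R (f (s + η)) m - collisionL2 R (f s) m) -
      (collisionL2 R (f (s + η)) m - collisionL2 R (f s) m) =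
      (affComp 1 z (collisionForm R (f (s + η) - f s) (f (s + η)) m) -
        collisionForm R (f (s + η) - f s) (f (s + η)) m) +
      (affComp 1 z (collisionForm R (f s) (f (s + η) - f s) m) -
        collisionForm R (f s) (f (s + η) - f s) m) := by
    rw [collisionL2_sub hR, map_add]
    abel
  rw [e]
  refine (norm_add_le _ _).trans ((add_le_add (n1.trans p3) (n2.trans p4)).trans (le_of_eq ?_))
  rw [hΛ]
  ring

/-! ### Locally Lipschitz functions of time have weak derivatives -/

section WeakDerivative

/-- Along an ultrafilter every bounded real sequence converges, so all pairings converge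
simultaneously. Their limits form a bounded functional, represented by Riesz; no separability or
subsequence is involved. -/
lemma exists_ultrafilter_weak_limit {H : Type*} [NormedAddCommGroup H] [InnerProductSpace ℝ H]
    [CompleteSpace H] {g : ℕ → H} {C : ℝ} (hg : ∀ n, ‖g n‖ ≤ C) :
    ∃ G : H, ∀ φ : H, Tendsto (fun n => inner ℝ (g n) φ) (hyperfilter ℕ : Filter ℕ)
      (𝓝 (inner ℝ G φ)) := by
  have hlim : ∀ φ : H, ∃ l : ℝ, |l| ≤ C * ‖φ‖ ∧
      Tendsto (fun n => inner ℝ (g n) φ) (hyperfilter ℕ : Filter ℕ) (𝓝 l) := by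
    intro φ
    obtain ⟨l, hl, h⟩ := (isCompact_Icc (a := -(C * ‖φ‖)) (b := C * ‖φ‖)).ultrafilter_le_nhds
      ((hyperfilter ℕ).map fun n => inner ℝ (g n) φ) (by
        rw [le_principal_iff, Ultrafilter.mem_coe, Ultrafilter.mem_map]
        refine Filter.univ_mem' fun n => ?_
        exact abs_le.1 ((abs_real_inner_le_norm _ _).trans
          (mul_le_mul_of_nonneg_right (hg n) (norm_nonneg _))))
    exact ⟨l, abs_le.2 hl, h⟩
  choose l hlb hl using hlim
  let L : H →L[ℝ] ℝ := LinearMap.mkContinuous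
    { toFun := l
      map_add' := fun φ φ' => tendsto_nhds_unique (hl (φ + φ')) (by
        simpa only [inner_add_right] using (hl φ).add (hl φ'))
      map_smul' := fun c φ => tendsto_nhds_unique (hl (c • φ)) (by
        simpa only [inner_smul_right, smul_eq_mul, RingHom.id_apply] using (hl φ).const_mul c) }
    C hlb
  refine ⟨(InnerProductSpace.toDual ℝ H).symm L, fun φ => ?_⟩
  rw [InnerProductSpace.toDual_symm_apply]
  exact hl φ

variable {V : Type*} [NormedAddCommGroup V] [NormedSpace ℝ V]

/-- A change of variables moves the difference quotient from `F`, which is only continuous, to the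
smooth `ψ`. -/
lemma tendsto_integral_difference_quotient {F : ℝ → V} (hF : Continuous F) {ψ : ℝ → ℝ}
    (hψ : ContDiff ℝ ∞ ψ) (hc : HasCompactSupport ψ) {η : ℕ → ℝ} (hη0 : ∀ n, 0 < η n)
    (hη : Tendsto η atTop (𝓝 0)) (hη1 : ∀ n, η n ≤ 1) :
    Tendsto (fun n => ∫ t, ψ t • ((η n)⁻¹ • (F (t + η n) - F t))) atTop
      (𝓝 (-∫ t, deriv ψ t • F t)) := by
  have hψc := hψ.continuous
  have hint : ∀ {G : ℝ → V}, Continuous G → Integrable fun t => ψ t • G t := fun hG =>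
    (hψc.smul hG).integrable_of_hasCompactSupport hc.smul_right
  have e : ∀ n, ∫ t, ψ t • ((η n)⁻¹ • (F (t + η n) - F t)) =
      ∫ t, ((η n)⁻¹ * (ψ (t - η n) - ψ t)) • F t := by
    intro n
    have h1 : ∫ t, ψ t • F (t + η n) = ∫ t, ψ (t - η n) • F t := by
      rw [← integral_sub_right_eq_self (fun t => ψ t • F (t + η n)) (η n)]
      simp only [sub_add_cancel]
    have h2 : Integrable fun t => ψ (t - η n) • F t := by
      have := (hint (G := fun t => F (t + η n)) (by fun_prop)).comp_sub_right (η n)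
      simpa only [sub_add_cancel] using this
    have h3 : ∀ t, ψ t • ((η n)⁻¹ • (F (t + η n) - F t)) =
        (η n)⁻¹ • (ψ t • F (t + η n) - ψ t • F t) := fun t => by
      rw [smul_comm, smul_sub]
    simp only [h3, mul_smul, sub_smul]
    rw [integral_smul, integral_smul, integral_sub (hint (by fun_prop)) (hint hF), h1,
      integral_sub h2 (hint hF)]
  simp only [e]
  rw [← integral_neg]
  obtain ⟨K, hK⟩ := hψ.lipschitzWith_of_hasCompactSupport hc (by simp)
  obtain ⟨r, hr⟩ := hc.isCompact.isBounded.subset_closedBall 0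
  have hψr : ∀ t, r < |t| → ψ t = 0 := fun t ht => by
    by_contra h
    have := hr (subset_tsupport ψ h)
    rw [mem_closedBall_zero_iff, Real.norm_eq_abs] at this
    linarith
  refine tendsto_integral_of_dominated_convergence
    (fun t => (Icc (-(r + 1)) (r + 1)).indicator (fun t => K * ‖F t‖) t) (fun n => ?_) ?_
    (fun n => ae_of_all _ fun t => ?_) (ae_of_all _ fun t => ?_)
  · exact Continuous.aestronglyMeasurable (by fun_prop)
  · rw [integrable_indicator_iff measurableSet_Icc]
    exact (Continuous.continuousOn (by fun_prop)).integrableOn_Icc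
  · by_cases ht : t ∈ Icc (-(r + 1)) (r + 1)
    · rw [indicator_of_mem ht, norm_smul, norm_mul, norm_inv, Real.norm_of_nonneg (hη0 n).le]
      refine mul_le_mul_of_nonneg_right ?_ (norm_nonneg _)
      have h1 := hK.dist_le_mul (t - η n) t
      rw [dist_eq_norm, dist_eq_norm, sub_sub_cancel_left, norm_neg,
        Real.norm_of_nonneg (hη0 n).le] at h1
      rw [inv_mul_le_iff₀ (hη0 n), mul_comm]
      exact h1
    · have ht' : r + 1 < |t| := by
        rw [mem_Icc, ← abs_le] at ht
        exact not_le.1 ht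
      have h1 : r < |t - η n| := by
        have h2 := abs_sub_abs_le_abs_sub t (η n)
        rw [abs_of_pos (hη0 n)] at h2
        linarith [hη1 n]
      rw [indicator_of_notMem ht, hψr t (by linarith), hψr _ h1]
      simp
  · have hd : HasDerivAt ψ (deriv ψ t) t :=
      ((hψ.differentiable (by simp)) t).hasDerivAt
    have h1 := hd.tendsto_slope_zero
    have h2 : Tendsto (fun n => -η n) atTop (𝓝[≠] 0) := by
      refine tendsto_nhdsWithin_iff.2 ⟨by simpa using hη.neg, Eventually.of_forall fun n => ?_⟩
      exact neg_ne_zero.2 (hη0 n).ne'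
    have h3 := ((h1.comp h2).neg).smul_const (F t)
    rw [neg_smul] at h3
    refine h3.congr fun n => ?_
    simp only [Function.comp_apply, smul_eq_mul, inv_neg, neg_mul, neg_neg, sub_eq_add_neg]

/-- Weakly differentiable functions have at most one weak derivative. -/
lemma ae_eq_of_forall_integral_smul_eq [CompleteSpace V] {U : Set ℝ} (hU : IsOpen U)
    {g g' : ℝ → V} (hg : MemLp g 2 volume) (hg' : MemLp g' 2 volume)
    (h : ∀ ψ : ℝ → ℝ, ContDiff ℝ ∞ ψ → HasCompactSupport ψ → tsupport ψ ⊆ U →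
      ∫ t, ψ t • g t = ∫ t, ψ t • g' t) : ∀ᵐ t, t ∈ U → g t = g' t := by
  have hl := (hg.locallyIntegrable (by norm_num)).sub (hg'.locallyIntegrable (by norm_num))
  have := hU.ae_eq_zero_of_integral_contDiff_smul_eq_zero (hl.locallyIntegrableOn U)
    fun ψ hψ hc hs => by
      have hi : ∀ {g : ℝ → V}, MemLp g 2 volume → Integrable fun t => ψ t • g t := fun hg =>
        (hg.locallyIntegrable (by norm_num)).integrable_smul_left_of_hasCompactSupport
          hψ.continuous hc
      simp only [Pi.sub_apply, smul_sub]
      rw [integral_sub (hi hg) (hi hg'), h ψ hψ hc hs, sub_self]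
  filter_upwards [this] with t ht htU
  exact sub_eq_zero.1 (ht htU)

end WeakDerivative

variable {V : Type*} [NormedAddCommGroup V] [InnerProductSpace ℝ V] [CompleteSpace V]

/-- The Lipschitz bound keeps the difference quotients bounded in L²([a, c]; V). A weak limit is the
derivative, since tested against `ψ` the quotients also converge to the weak derivative pairing. -/
lemma exists_weak_deriv {F : ℝ → V} (hF : Continuous F) {a c δ L : ℝ} (hδ : 0 < δ) (hδ1 : δ ≤ 1)
    (hL : 0 ≤ L) (h : ∀ t ∈ Icc a c, ∀ η, 0 < η → η ≤ δ → ‖F (t + η) - F t‖ ≤ L * η) :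
    ∃ g : ℝ → V, MemLp g 2 volume ∧ ∀ ψ : ℝ → ℝ, ContDiff ℝ ∞ ψ → HasCompactSupport ψ →
      tsupport ψ ⊆ Ioo a c → ∫ t, deriv ψ t • F t = -∫ t, ψ t • g t := by
  obtain ⟨η, hη⟩ : ∃ η : ℕ → ℝ, η = fun n : ℕ => δ / ((n : ℝ) + 1) := ⟨_, rfl⟩
  have hη0 : ∀ n, 0 < η n := fun n => by rw [hη]; positivity
  have hηδ : ∀ n, η n ≤ δ := fun n => by
    rw [hη]
    exact div_le_self hδ.le (by linarith [(Nat.cast_nonneg n : (0 : ℝ) ≤ n)])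
  have hηt : Tendsto η atTop (𝓝 0) := by
    rw [hη]
    exact tendsto_const_nhds.div_atTop
      (tendsto_atTop_add_const_right _ _ tendsto_natCast_atTop_atTop)
  have hbd : ∀ n, ∀ t ∈ Icc a c, ‖(η n)⁻¹ • (F (t + η n) - F t)‖ ≤ L := fun n t ht => by
    rw [norm_smul, norm_inv, Real.norm_of_nonneg (hη0 n).le, inv_mul_le_iff₀ (hη0 n), mul_comm]
    exact h t ht _ (hη0 n) (hηδ n)
  have hae : ∀ n, ∀ᵐ t ∂(volume.restrict (Icc a c)), ‖(η n)⁻¹ • (F (t + η n) - F t)‖ ≤ L :=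
    fun n => (ae_restrict_iff' measurableSet_Icc).2 (ae_of_all _ (hbd n))
  have hmem : ∀ n, MemLp (fun t => (η n)⁻¹ • (F (t + η n) - F t)) 2
      (volume.restrict (Icc a c)) := fun n =>
    MemLp.of_bound (Continuous.aestronglyMeasurable (by fun_prop)) L (hae n)
  obtain ⟨G, hG⟩ := exists_ultrafilter_weak_limit (g := fun n => (hmem n).toLp _)
    (C := measureUnivNNReal (volume.restrict (Icc a c)) ^ (2 : ℝ≥0∞).toReal⁻¹ * L)
    fun n => by
      refine Lp.norm_le_of_ae_bound hL ?_
      filter_upwards [(hmem n).coeFn_toLp, hae n] with t h1 h2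
      rwa [h1]
  refine ⟨(Icc a c).indicator G, (memLp_indicator_iff_restrict measurableSet_Icc).2 (Lp.memLp G),
    fun ψ hψ hc hs => ?_⟩
  have hψ0 : ∀ t ∉ Icc a c, ψ t = 0 := fun t ht =>
    image_eq_zero_of_notMem_tsupport fun h => ht (Ioo_subset_Icc_self (hs h))
  have hset : ∀ g : ℝ → V, ∫ t, ψ t • g t = ∫ t in Icc a c, ψ t • g t := fun g =>
    (setIntegral_eq_integral_of_forall_compl_eq_zero fun t ht => by
      rw [hψ0 t ht, zero_smul]).symm
  have hGi : ∫ t, ψ t • (Icc a c).indicator G t = ∫ t in Icc a c, ψ t • G t := by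
    rw [hset]
    refine setIntegral_congr_fun measurableSet_Icc fun t ht => ?_
    simp only [indicator_of_mem ht]
  rw [hGi, eq_comm, neg_eq_iff_eq_neg]
  -- Testing with ψ(t) v turns the vector-valued identity into inner products in L²([a, c]; V),
  -- where the weak limit is available.
  refine ext_inner_right ℝ fun v => ?_
  have hφ : MemLp (fun t => ψ t • v) 2 (volume.restrict (Icc a c)) :=
    (Continuous.memLp_of_hasCompactSupport (by have := hψ.continuous; fun_prop) hc.smul_right)
  have hinner : ∀ (G : Lp V 2 (volume.restrict (Icc a c))) (g : ℝ → V),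
      G =ᵐ[volume.restrict (Icc a c)] g →
      inner ℝ G (hφ.toLp _) = inner ℝ (∫ t in Icc a c, ψ t • g t) v := by
    intro G g hGg
    have hgm : MemLp g 2 (volume.restrict (Icc a c)) := (memLp_congr_ae hGg).1 (Lp.memLp G)
    have hi : Integrable (fun t => ψ t • g t) (volume.restrict (Icc a c)) := by
      have h2 : MemLp ψ 2 (volume.restrict (Icc a c)) :=
        hψ.continuous.memLp_of_hasCompactSupport hc
      exact memLp_one_iff_integrable.1 (hgm.smul h2)
    rw [L2.inner_def, real_inner_comm, ← integral_inner hi v]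
    refine integral_congr_ae ?_
    filter_upwards [hGg, hφ.coeFn_toLp] with t h1 h2
    rw [h1, h2, inner_smul_right, inner_smul_right, real_inner_comm]
  have h1 := hG (hφ.toLp _)
  rw [hinner G G EventuallyEq.rfl] at h1
  have h2 : Tendsto (fun n => inner ℝ (∫ t, ψ t • ((η n)⁻¹ • (F (t + η n) - F t))) v) atTop
      (𝓝 (inner ℝ (-∫ t, deriv ψ t • F t) v)) :=
    (tendsto_integral_difference_quotient hF hψ hc hη0 hηt
      fun n => (hηδ n).trans hδ1).inner tendsto_const_nhds
  refine tendsto_nhds_unique h1 ((h2.mono_left Nat.hyperfilter_le_atTop).congr fun n => ?_)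
  rw [hset]
  exact (hinner _ _ (hmem n).coeFn_toLp).symm

/-- Gluing of locally defined weak derivatives. -/
lemma exists_glued_weak_deriv {F : ℝ → V} {U : ℕ → Set ℝ} (hU : ∀ n, IsOpen (U n))
    {g : ℕ → ℝ → V} (hg : ∀ n, MemLp (g n) 2 volume)
    (h : ∀ n, ∀ ψ : ℝ → ℝ, ContDiff ℝ ∞ ψ → HasCompactSupport ψ → tsupport ψ ⊆ U n →
      ∫ t, deriv ψ t • F t = -∫ t, ψ t • g n t) :
    ∃ G : ℝ → V, ∀ n, ∀ᵐ t, t ∈ U n → G t = g n t := by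
  classical
  refine ⟨fun t => if ht : ∃ n, t ∈ U n then g (Nat.find ht) t else 0, fun n => ?_⟩
  have hcons : ∀ k, ∀ᵐ t, t ∈ U k ∩ U n → g k t = g n t := fun k =>
    ae_eq_of_forall_integral_smul_eq ((hU k).inter (hU n)) (hg k) (hg n) fun ψ hψ hc hs => by
      have h1 := h k ψ hψ hc (hs.trans inter_subset_left)
      rw [h n ψ hψ hc (hs.trans inter_subset_right)] at h1
      exact (neg_injective h1).symm
  filter_upwards [ae_all_iff.2 hcons] with t ht htn
  have hex : ∃ n, t ∈ U n := ⟨n, htn⟩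
  rw [dif_pos hex]
  exact ht _ ⟨Nat.find_spec hex, htn⟩

/-- A locally Lipschitz function with values in a Hilbert space belongs to `W^{1,2}_loc`. -/
lemma memW12loc_of_locally_lipschitz {I : Set ℝ} (hI : IsOpen I) (hI' : I.OrdConnected)
    {F : ℝ → V} (hF : ContinuousOn F I)
    (hL : ∀ a c, Icc a c ⊆ I → ∃ L, 0 ≤ L ∧ ∀ η ∈ Icc (0 : ℝ) 1, ∀ t ∈ Icc a (c - η),
      ‖F (t + η) - F t‖ ≤ L * η) : MemW12loc I F := by
  classical
  -- Rational endpoints give countably many intervals, so the almost everywhere identities between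
  -- local derivatives hold off one common null set.
  have hloc : ∀ p : ℚ × ℚ, ∃ g : ℝ → V, MemLp g 2 volume ∧
      (Icc (p.1 : ℝ) p.2 ⊆ I → ∀ ψ : ℝ → ℝ, ContDiff ℝ ∞ ψ → HasCompactSupport ψ →
        tsupport ψ ⊆ Ioo (p.1 : ℝ) p.2 → ∫ t, deriv ψ t • F t = -∫ t, ψ t • g t) := by
    rintro ⟨a, c⟩
    by_cases hp : Icc (a : ℝ) c ⊆ I
    swap
    · exact ⟨0, MemLp.zero, fun h => absurd h hp⟩
    rcases lt_or_ge (c : ℝ) a with hca | hac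
    · refine ⟨0, MemLp.zero, fun _ ψ hψ hc hs => ?_⟩
      have h0 : ψ = 0 := by
        rw [← tsupport_eq_empty_iff]
        exact subset_empty_iff.1 (hs.trans (by rw [Ioo_eq_empty (not_lt.2 hca.le)]))
      simp [h0]
    obtain ⟨δ, hδ, hball⟩ := Metric.isOpen_iff.1 hI c (hp ⟨hac, le_rfl⟩)
    -- Difference quotients at points up to `c` use values beyond `c`; openness of `I` leaves this
    -- margin.
    obtain ⟨ε, hε⟩ : ∃ ε, ε = min (δ / 2) 1 := ⟨_, rfl⟩
    have hε0 : 0 < ε := hε ▸ lt_min (half_pos hδ) one_pos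
    have hcε : (c : ℝ) + ε ∈ I := hball (by
      rw [Metric.mem_ball, Real.dist_eq, add_sub_cancel_left, abs_of_pos hε0]
      exact (hε ▸ min_le_left _ _ : ε ≤ δ / 2).trans_lt (half_lt_self hδ))
    have hsub : Icc (a : ℝ) (c + ε) ⊆ I := hI'.out (hp ⟨le_rfl, hac⟩) hcε
    obtain ⟨L, hL0, hLip⟩ := hL _ _ hsub
    have hle : (a : ℝ) ≤ c + ε := by linarith
    have hFe : ∀ t ∈ Icc (a : ℝ) (c + ε), IccExtend hle ((Icc (a : ℝ) (c + ε)).domRestrict F) t =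
        F t := fun t ht => by rw [IccExtend_of_mem hle _ ht]; rfl
    obtain ⟨g, hg, h⟩ := exists_weak_deriv
      (F := IccExtend hle ((Icc (a : ℝ) (c + ε)).domRestrict F)) (a := a) (c := c) (δ := ε) (L := L)
      (continuousOn_iff_continuous_domRestrict.1 (hF.mono hsub)).Icc_extend' hε0
      (hε ▸ min_le_right _ _) hL0 fun t ht η h0 h1 => by
        rw [hFe t ⟨ht.1, by linarith [ht.2]⟩, hFe (t + η) ⟨by linarith [ht.1], by linarith [ht.2]⟩]
        exact hLip η ⟨h0.le, h1.trans (hε ▸ min_le_right _ _)⟩ t ⟨ht.1, by linarith [ht.2]⟩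
    refine ⟨g, hg, fun _ ψ hψ hc hs => ?_⟩
    rw [← h ψ hψ hc hs]
    refine integral_congr_ae (ae_of_all _ fun t => ?_)
    by_cases ht : t ∈ Icc (a : ℝ) (c + ε)
    · simp only [hFe t ht]
    · have : deriv ψ t = 0 := by
        by_contra h0
        have := hs (support_deriv_subset h0)
        exact ht ⟨this.1.le, by linarith [this.2]⟩
      simp only [this, zero_smul]
  choose g hg hw using hloc
  obtain ⟨e, he⟩ := exists_surjective_nat (ℚ × ℚ)
  obtain ⟨U, hUdef⟩ : ∃ U : ℕ → Set ℝ, U = fun n =>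
    if Icc ((e n).1 : ℝ) (e n).2 ⊆ I then Ioo ((e n).1 : ℝ) (e n).2 else ∅ := ⟨_, rfl⟩
  have hU : ∀ n, IsOpen (U n) := fun n => by
    rw [hUdef]
    beta_reduce
    split_ifs
    exacts [isOpen_Ioo, isOpen_empty]
  have hwU : ∀ n, ∀ ψ : ℝ → ℝ, ContDiff ℝ ∞ ψ → HasCompactSupport ψ → tsupport ψ ⊆ U n →
      ∫ t, deriv ψ t • F t = -∫ t, ψ t • g (e n) t := fun n ψ hψ hc hs => by
    rw [hUdef] at hs
    beta_reduce at hs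
    split_ifs at hs with hn
    · exact hw (e n) hn ψ hψ hc hs
    · have h0 : ψ = 0 := tsupport_eq_empty_iff.1 (subset_empty_iff.1 hs)
      simp [h0]
  obtain ⟨G, hG⟩ := exists_glued_weak_deriv hU (fun n => hg (e n)) hwU
  -- A compact subset of an open interval lies in a single rational interval, so no partition of
  -- unity is needed.
  have hcov : ∀ K : Set ℝ, IsCompact K → K ⊆ I → ∃ n, K ⊆ U n := by
    intro K hK hKI
    rcases K.eq_empty_or_nonempty with rfl | hne
    · exact ⟨0, empty_subset _⟩
    obtain ⟨x, hx, hxm⟩ := hK.exists_isLeast hne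
    obtain ⟨y, hy, hym⟩ := hK.exists_isGreatest hne
    obtain ⟨δ, hδ, hb⟩ := Metric.isOpen_iff.1 hI x (hKI hx)
    obtain ⟨δ', hδ', hb'⟩ := Metric.isOpen_iff.1 hI y (hKI hy)
    obtain ⟨p, hp1, hp2⟩ := exists_rat_btwn (show x - δ < x by linarith)
    obtain ⟨q, hq1, hq2⟩ := exists_rat_btwn (show y < y + δ' by linarith)
    obtain ⟨n, hn⟩ := he (p, q)
    have hsub : Icc (p : ℝ) q ⊆ I := hI'.out
      (hb (by rw [Metric.mem_ball, Real.dist_eq, abs_lt]; constructor <;> linarith))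
      (hb' (by rw [Metric.mem_ball, Real.dist_eq, abs_lt]; constructor <;> linarith))
    refine ⟨n, fun t ht => ?_⟩
    rw [hUdef]
    beta_reduce
    rw [hn, if_pos hsub]
    exact ⟨hp2.trans_le (hxm ht), (hym ht).trans_lt hq1⟩
  refine ⟨G, fun K hK hKI => ⟨?_, ?_⟩, fun ψ hψ hc hs => ?_⟩
  · have hfin : IsFiniteMeasure (volume.restrict K) := ⟨by simpa using hK.measure_lt_top⟩
    obtain ⟨C, hC⟩ := hK.exists_bound_of_continuousOn (hF.mono hKI)
    exact MemLp.of_bound ((hF.mono hKI).aestronglyMeasurable hK.measurableSet) C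
      ((ae_restrict_iff' hK.measurableSet).2 (ae_of_all _ hC))
  · obtain ⟨n, hn⟩ := hcov K hK hKI
    refine (memLp_congr_ae ?_).2 ((hg (e n)).restrict K)
    refine (ae_restrict_iff' hK.measurableSet).2 ?_
    filter_upwards [hG n] with t ht htK using ht (hn htK)
  · obtain ⟨n, hn⟩ := hcov _ hc.isCompact hs
    rw [hwU n ψ hψ hc hn]
    congr 1
    refine integral_congr_ae ?_
    filter_upwards [hG n] with t ht
    by_cases h0 : t ∈ tsupport ψ
    · rw [ht (hn h0)]
    · rw [image_eq_zero_of_notMem_tsupport h0, zero_smul, zero_smul]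

/-! ### Jets as H²-valued functions on the whole interval of existence -/

/-- One family of jets serves for all `b`: at time `t` it is the family built on `[0, t]`, and by
uniqueness this agrees with the one built on any longer interval. -/
lemma exists_hasJets {d M : ℕ} {R : ℝ} (hR : 0 ≤ R) {f : ℝ → Fin M → L2V d} {P : ℝ → Prop}
    (hf : ∀ b, P b → IsDuhamel R b f) (hP : ∀ b c, P c → b ≤ c → P b) :
    ∃ D : Fin M → JetIndex d → ℝ → L2V d, ∀ b, P b → HasJets b f D := by
  have h : ∀ b m, ∃ D : JetIndex d → ℝ → L2V d, P b → (∀ a, ContinuousOn (D a) (Ioc 0 b)) ∧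
      ∀ t ∈ Ioc 0 b, (IsJet fun a => D a t) ∧ D (.inl ()) t = f t m := by
    intro b m
    by_cases hb : P b
    · obtain ⟨D, hD⟩ := (hf b hb).exists_jet hR m
      exact ⟨D, fun _ => hD⟩
    · exact ⟨0, fun h => absurd h hb⟩
  choose E hE using h
  have heq : ∀ b, P b → ∀ m, ∀ t ∈ Ioc 0 b, ∀ a, E t m a t = E b m a t := by
    intro b hb m t ht a
    have h1 := (hE t m (hP t b hb ht.2)).2 t ⟨ht.1, le_rfl⟩
    have h2 := (hE b m hb).2 t ht
    exact congrFun (h1.1.unique h2.1 (h1.2.trans h2.2.symm)) a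
  refine ⟨fun m a t => E t m a t, fun b hb => ⟨fun m a => ?_, fun m t ht => ?_, fun m t ht => ?_⟩⟩
  · exact ((hE b m hb).1 a).congr fun t ht => heq b hb m t ht a
  · exact ((hE t m (hP t b hb ht.2)).2 t ⟨ht.1, le_rfl⟩).1
  · exact ((hE t m (hP t b hb ht.2)).2 t ⟨ht.1, le_rfl⟩).2

/-- The restriction to `V` of a `2`-jet on `ℝ^d`, extended by `0` to families that are not jets. -/
def jetToH2 {d : ℕ} (V : Set (Vel d)) (x : JetIndex d → L2V d) : H2 V :=
  open scoped Classical in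
  if hx : IsJet x then
    ⟨WithLp.toLp 2 fun a => rs V (x a), fun i => (hx.1 i).isWeakPartial V,
      fun i j => (hx.2 i j).isWeakPartial V⟩
  else 0

lemma IsJet.coe_jetToH2 {d : ℕ} (V : Set (Vel d)) {x : JetIndex d → L2V d} (hx : IsJet x) :
    (jetToH2 V x : Jet V) = WithLp.toLp 2 fun a => rs V (x a) := by
  rw [jetToH2, dif_pos hx]

lemma IsJet.fn_jetToH2 {d : ℕ} (V : Set (Vel d)) {x : JetIndex d → L2V d} (hx : IsJet x) :
    H2.fn (jetToH2 V x) = rs V (x (.inl ())) := by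
  rw [H2.fn, hx.coe_jetToH2]

lemma IsJet.norm_jetToH2_sub_le {d : ℕ} (V : Set (Vel d)) {x y : JetIndex d → L2V d}
    (hx : IsJet x) (hy : IsJet y) :
    ‖jetToH2 V x - jetToH2 V y‖ ≤ ∑ a, ‖rs V (x a - y a)‖ := by
  change ‖((jetToH2 V x - jetToH2 V y : H2 V) : Jet V)‖ ≤ _
  rw [Submodule.coe_sub, hx.coe_jetToH2, hy.coe_jetToH2,
    ← WithLp.toLp_sub, PiLp.norm_eq_of_L2]
  refine Real.sqrt_le_iff.2 ⟨Finset.sum_nonneg fun a _ => norm_nonneg _, ?_⟩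
  refine le_of_eq_of_le (Finset.sum_congr rfl fun a _ => ?_)
    (Finset.sum_sq_le_sq_sum_of_nonneg fun a _ => norm_nonneg (rs V (x a - y a)))
  simp

lemma continuousOn_jetToH2 {d : ℕ} (V : Set (Vel d)) {I : Set ℝ} {x : JetIndex d → ℝ → L2V d}
    (hx : ∀ t ∈ I, IsJet fun a => x a t) (hc : ∀ a, ContinuousOn (x a) I) :
    ContinuousOn (fun t => jetToH2 V fun a => x a t) I := by
  refine Topology.IsInducing.subtypeVal.continuousOn_iff.2 ?_
  have h : ContinuousOn (fun t => (WithLp.toLp 2 fun a => rs V (x a t) : Jet V)) I :=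
    (PiLp.continuous_toLp 2 _).comp_continuousOn
      (continuousOn_pi.2 fun a => (rs V).continuous.comp_continuousOn (hc a))
  exact h.congr fun t ht => (hx t ht).coe_jetToH2 V

lemma isOpen_setOf_pos_lt (T : EReal) : IsOpen {t : ℝ | 0 < t ∧ (t : EReal) < T} :=
  (isOpen_lt continuous_const continuous_id).inter
    (isOpen_lt continuous_coe_real_ereal continuous_const)

lemma ordConnected_setOf_pos_lt (T : EReal) : {t : ℝ | 0 < t ∧ (t : EReal) < T}.OrdConnected :=
  ⟨fun _ hx _ hy _ hz => ⟨hx.1.trans_le hz.1, (EReal.coe_le_coe_iff.2 hz.2).trans_lt hy.2⟩⟩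

section Regularity

variable {d M : ℕ} {T : EReal} {f : ℝ → Fin M → L2V d} {D : Fin M → JetIndex d → ℝ → L2V d}

lemma isJet_of_hasJets (hD : ∀ b : ℝ, (b : EReal) < T → HasJets b f D) (m : Fin M) {t : ℝ}
    (ht : t ∈ {t : ℝ | 0 < t ∧ (t : EReal) < T}) : IsJet fun a => D m a t :=
  (hD t ht.2).jet m t ⟨ht.1, le_rfl⟩

lemma continuousOn_of_hasJets (hD : ∀ b : ℝ, (b : EReal) < T → HasJets b f D) (m : Fin M)
    (a : JetIndex d) : ContinuousOn (D m a) {t : ℝ | 0 < t ∧ (t : EReal) < T} := by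
  intro t ht
  obtain ⟨b, htb, hb⟩ := EReal.lt_iff_exists_real_btwn.1 ht.2
  have htb' : t < b := EReal.coe_lt_coe_iff.1 htb
  exact (((hD b hb).cont m a).continuousAt (Ioc_mem_nhds ht.1 htb')).continuousWithinAt

lemma fn_jetToH2_ae_eq (hD : ∀ b : ℝ, (b : EReal) < T → HasJets b f D) (V : Set (Vel d))
    (m : Fin M) {t : ℝ} (ht : t ∈ {t : ℝ | 0 < t ∧ (t : EReal) < T}) :
    (H2.fn (jetToH2 V fun a => D m a t) : Vel d → ℝ) =ᵐ[volume.restrict V] f t m := by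
  rw [(isJet_of_hasJets hD m ht).fn_jetToH2, (hD t ht.2).fn m t ⟨ht.1, le_rfl⟩]
  exact coeFn_rs V (f t m)

lemma memW12loc_jetToH2 {R : ℝ} (hR : 0 ≤ R)
    (hf : ∀ b : ℝ, (b : EReal) < T → IsDuhamel R b f)
    (hD : ∀ b : ℝ, (b : EReal) < T → HasJets b f D) (r : ℝ) (m : Fin M) :
    MemW12loc {t : ℝ | 0 < t ∧ (t : EReal) < T}
      fun t => jetToH2 (Metric.ball (0 : Vel d) r) fun a => D m a t := by
  refine memW12loc_of_locally_lipschitz (isOpen_setOf_pos_lt T) (ordConnected_setOf_pos_lt T)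
    (continuousOn_jetToH2 _ (fun t ht => isJet_of_hasJets hD m ht)
      fun a => continuousOn_of_hasJets hD m a) fun a c hac => ?_
  rcases lt_or_ge c a with hca | hca
  · exact ⟨0, le_rfl, fun η hη t ht => absurd (ht.1.trans ht.2) (by linarith [hη.1])⟩
  have ha := hac (left_mem_Icc.2 hca)
  have hc := hac (right_mem_Icc.2 hca)
  choose C hC h using fun i => (hD c hc.2).exists_norm_rs_sub_le hR (hf c hc.2) ha.1 r i
  refine ⟨∑ i, C i, Finset.sum_nonneg fun i _ => hC i, fun η hη t ht => ?_⟩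
  have m1 : t ∈ Icc a c := ⟨ht.1, by linarith [ht.2, hη.1]⟩
  have m2 : t + η ∈ Icc a c := ⟨by linarith [ht.1, hη.1], by linarith [ht.2]⟩
  refine ((isJet_of_hasJets hD m (hac m2)).norm_jetToH2_sub_le _
    (isJet_of_hasJets hD m (hac m1))).trans ?_
  rw [Finset.sum_mul]
  exact Finset.sum_le_sum fun i _ => h i m η hη t ht

end Regularity

lemma memLp_top_of_continuousOn_Icc {E : Type*} [NormedAddCommGroup E] {f : ℝ → E} {a b : ℝ}
    (hf : ContinuousOn f (Icc a b)) : MemLp f ⊤ (volume.restrict (Icc a b)) := by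
  obtain ⟨C, hC⟩ := isCompact_Icc.exists_bound_of_continuousOn hf
  exact memLp_top_of_bound (hf.aestronglyMeasurable measurableSet_Icc) C
    ((ae_restrict_iff' measurableSet_Icc).2 (ae_of_all _ hC))

lemma isTimeInterval_setOf_lt {T : EReal} (hT : 0 < T) :
    IsTimeInterval {t : ℝ | 0 ≤ t ∧ (t : EReal) < T} :=
  ⟨⟨fun _ hx _ hy _ hz => ⟨hx.1.trans hz.1, (EReal.coe_le_coe_iff.2 hz.2).trans_lt hy.2⟩⟩,
    ⟨le_rfl, hT⟩, fun _ h => h.1⟩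

end Smoluchowski

end

/-! ### Maximal solution, regularity and blow-up for the truncated system -/

open Smoluchowski in
theorem mainTheorem2 (d : ℕ) (hd : 1 ≤ d) (M : ℕ) (R : ℝ) (hR : 0 < R)
    (f0 : Fin M → L2V d) :
    ∃ (T : EReal) (f : ℝ → Fin M → L2V d), 0 < T ∧
      -- `f` is a maximal mild solution, and its interval of existence is `[0, T)`
      IsMaximalMildSolution R f0 {t : ℝ | 0 ≤ t ∧ (t : EReal) < T} f ∧
      -- every mild solution on a time interval is a restriction of `f`
      (∀ (J : Set ℝ) (g : ℝ → Fin M → L2V d), IsTimeInterval J → IsMildSolution R f0 J g →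
        J ⊆ {t : ℝ | 0 ≤ t ∧ (t : EReal) < T} ∧ EqOn g f J) ∧
      -- every maximal mild solution has the same interval of existence and coincides with `f`
      (∀ (J : Set ℝ) (g : ℝ → Fin M → L2V d), IsMaximalMildSolution R f0 J g →
        J = {t : ℝ | 0 ≤ t ∧ (t : EReal) < T} ∧ EqOn g f J) ∧
      -- `f ∈ L^∞_loc([0, T); L²(ℝ^d)^M)`
      (∀ b : ℝ, (b : EReal) < T → MemLp f ⊤ (volume.restrict (Icc 0 b))) ∧
      -- `f ∈ C((0, T); H²(ℝ^d)^M)`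
      (∀ m, ∃ F : ℝ → H2 (univ : Set (Vel d)),
        ContinuousOn F {t : ℝ | 0 < t ∧ (t : EReal) < T} ∧
        ∀ t : ℝ, 0 < t → (t : EReal) < T → (H2.fn (F t) : Vel d → ℝ) =ᵐ[volume] f t m) ∧
      -- `f ∈ W^{1,2}_loc((0, T); H²_loc(ℝ^d)^M)`
      (∀ m, ∀ r : ℝ, 0 < r → ∃ F : ℝ → H2 (Metric.ball (0 : Vel d) r),
        MemW12loc {t : ℝ | 0 < t ∧ (t : EReal) < T} F ∧
        ∀ t : ℝ, 0 < t → (t : EReal) < T →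
          (H2.fn (F t) : Vel d → ℝ) =ᵐ[volume.restrict (Metric.ball 0 r)] f t m) ∧
      -- blow-up of the `L²` norm if `T` is finite
      (∀ τ : ℝ, T = (τ : EReal) →
        ¬ BddAbove ((fun t : ℝ => ∑ m, ‖f t m‖) '' Ioo (τ / 2) τ)) := by
  obtain ⟨T, f, hT, hf, huniv, hblow⟩ := exists_maximal_isMild (isOpSemigroup_ouOpPi d M)
    norm_ouOpPi_le (lipschitzOnBalls_source d M hR.le) f0
  have hJT := isTimeInterval_setOf_lt hT
  have hf' : IsMildSolution R f0 {t : ℝ | 0 ≤ t ∧ (t : EReal) < T} f :=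
    (isMildSolution_iff hR.le hJT).2 hf
  have huniv' : ∀ (J : Set ℝ) (g : ℝ → Fin M → L2V d), IsTimeInterval J →
      IsMildSolution R f0 J g → J ⊆ {t : ℝ | 0 ≤ t ∧ (t : EReal) < T} ∧ EqOn g f J :=
    fun J g hJ hg => huniv J g hJ ((isMildSolution_iff hR.le hJ).1 hg)
  have hsub : ∀ b : ℝ, (b : EReal) < T → Icc 0 b ⊆ {t : ℝ | 0 ≤ t ∧ (t : EReal) < T} :=
    fun b hb t ht => ⟨ht.1, (EReal.coe_le_coe_iff.2 ht.2).trans_lt hb⟩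
  have hduh : ∀ b : ℝ, (b : EReal) < T → IsDuhamel R b f := fun b hb =>
    IsMildSolution.isDuhamel hR.le (f0 := f0)
      ⟨hf'.1.mono (hsub b hb), fun t ht => hf'.2 t (hsub b hb ht)⟩
  obtain ⟨D, hD⟩ := exists_hasJets hR.le hduh
    fun b c hc hbc => (EReal.coe_le_coe_iff.2 hbc).trans_lt hc
  refine ⟨T, f, hT, ⟨hJT, hf', fun J' g hJ' hg hJJ' _ =>
    ((huniv' J' g hJ' hg).1).antisymm hJJ'⟩, huniv', fun J g hg => ?_, fun b hb =>
    memLp_top_of_continuousOn_Icc (hf'.1.mono (hsub b hb)), fun m => ?_, fun m r _ => ?_,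
    fun τ hτ => ?_⟩
  -- Any mild solution is a restriction of `f`; if it is itself maximal, its own maximality applied
  -- to the extension `f` forces equality of the intervals.
  · obtain ⟨h1, h2⟩ := huniv' J g hg.1 hg.2.1
    exact ⟨(hg.2.2 _ f hJT hf' h1 h2.symm).symm, h2⟩
  · refine ⟨fun t => jetToH2 univ fun a => D m a t,
      continuousOn_jetToH2 _ (fun t ht => isJet_of_hasJets hD m ht)
        fun a => continuousOn_of_hasJets hD m a, fun t h0 ht => ?_⟩
    exact (ae_mono Measure.restrict_univ.ge : ae (volume : Measure (Vel d)) ≤ _)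
      (fn_jetToH2_ae_eq hD univ m (t := t) ⟨h0, ht⟩)
  · exact ⟨fun t => jetToH2 (Metric.ball 0 r) fun a => D m a t,
      memW12loc_jetToH2 hR.le hduh hD r m, fun t h0 ht => fn_jetToH2_ae_eq hD _ m ⟨h0, ht⟩⟩
  -- The abstract alternative concerns the maximum of the component norms, which their sum
  -- dominates.
  · rintro ⟨B, hB⟩
    obtain ⟨t, ht, hlt⟩ := hblow τ hτ B
    have h1 : ∑ m, ‖f t m‖ ≤ B := hB ⟨t, ht, rfl⟩
    have h2 : ‖f t‖ ≤ ∑ m, ‖f t m‖ :=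
      (pi_norm_le_iff_of_nonneg (Finset.sum_nonneg fun m _ => norm_nonneg _)).2 fun m =>
        Finset.single_le_sum (f := fun m => ‖f t m‖) (fun m _ => norm_nonneg _) (Finset.mem_univ m)
    linarith
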